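/- Let $k$ be a field, let $\mathfrak z$ and $\mathfrak z'$ be regular, commutative, finitely generated $k$-algebras, and let $\mathfrak z\to\mathfrak z'$ be a homomorphism of $k$-algebras. Let $A$ be a left and right Noetherian ring which is a flat algebra over $\mathfrak z$ (so that $\mathfrak z$ maps to the center of $A$; for instance $\mathfrak z\subset A$ is a central subalgebra over which $A$ is flat), and put $A'=A\otimes_{\mathfrak z}\mathfrak z'$. An object $\mathbf R\in D^b(A\otimes_{\mathfrak z}A^{o})$ is called a dualizing complex of $A$ if (1) it has finite injective dimension over $A$ and over $A^{o}$; (2) its cohomology bimodules are finitely generated on both sides; (3) the natural morphisms $A\to\mathrm{RHom}_A(\mathbf R,\mathbf R)$ and $A\to\mathrm{RHom}_{A^{o}}(\mathbf R,\mathbf R)$ are isomorphisms. It is called $\mathfrak z$-rigid if there is an isomorphism $\mathbf R\cong\mathrm{RHom}_{A\otimes_{\mathfrak z}A^{o}}(A,\mathbf R\otimes^{L}_{\mathfrak z}\mathbf R)$ in $D(A\otimes_{\mathfrak z}A^{o})$, where $\mathrm{RHom}$ is formed with respect to the outer bimodule structure of $\mathbf R\otimes^{L}_{\mathfrak z}\mathbf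 R$ and is a complex of bimodules through the inner one. The same definitions apply to $A'$ over $\mathfrak z'$. Let $\mathbf R\in D^b(A\otimes_{\mathfrak z}A^{o})$ be a dualizing complex of $A$. Then $\mathbf R\otimes^{L}_{\mathfrak z}\mathfrak z'\in D(A'\otimes_{\mathfrak z'}A'^{o})$ is a dualizing complex of $A'$. If moreover $A\otimes_{\mathfrak z}A^{o}$ is Noetherian and $\mathbf R$ is $\mathfrak z$-rigid, then $\mathbf R\otimes^{L}_{\mathfrak z}\mathfrak z'$ is $\mathfrak z'$-rigid; that is, the base change of a $\mathfrak z$-rigid dualizing complex of $A$ is a $\mathfrak z'$-rigid dualizing complex of $A'$. -/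

import Mathlib

open CategoryTheory TensorProduct

universe u

/- `DerivedCategory C` is Mathlib's localization of `CochainComplex C ℤ` at the quasi-isomorphisms;
this fixes the standard construction of it for all the module categories below. -/
attribute [local instance] HasDerivedCategory.standard

namespace DualizingComplex

noncomputable section

/-! ### Tensor products and Hom functors on module categories -/

section Functors

variable (z : Type u) [CommRing z] (S T : Type u) [Ring S] [Ring T] [Algebra z S] [Algebra z T]

section Tensor

/-- A module over the `z`-algebra `S`, viewed as a `z`-module. -/
abbrev baseModule {S : Type u} [Ring S] [Algebra z S] (M : ModuleCat.{u} S) : Module z M :=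
  Module.restrictScalars z S M

attribute [local instance] baseModule

theorem baseModule_isScalarTower {S : Type u} [Ring S] [Algebra z S] (M : ModuleCat.{u} S) :
    IsScalarTower z S M :=
  IsScalarTower.restrictScalars z S M

attribute [local instance] baseModule_isScalarTower

/-- The action of `S ⊗_z T` on `M ⊗_z N`: `(s ⊗ t) • (m ⊗ n) = (s • m) ⊗ (t • n)`. -/
def tensorAction (M : ModuleCat.{u} S) (N : ModuleCat.{u} T) :
    S ⊗[z] T →ₐ[z] Module.End z (M ⊗[z] N) :=
  (Module.endTensorEndAlgHom (R := z) (S := z) (A := z) (M := M) (N := N)).comp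
    (Algebra.TensorProduct.map (Algebra.lsmul z z M) (Algebra.lsmul z z N))

/-- The `S ⊗_z T`-module structure on `M ⊗_z N`. -/
abbrev tensorModule (M : ModuleCat.{u} S) (N : ModuleCat.{u} T) : Module (S ⊗[z] T) (M ⊗[z] N) :=
  Module.compHom _ (tensorAction z S T M N).toRingHom

attribute [local instance] tensorModule

variable {S T} in
theorem tensorModule_smul_tmul (M : ModuleCat.{u} S) (N : ModuleCat.{u} T)
    (s : S) (t : T) (m : M) (n : N) :
    (s ⊗ₜ[z] t) • (m ⊗ₜ[z] n) = (s • m) ⊗ₜ[z] (t • n) :=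
  rfl

variable {S T} in
/-- The `S ⊗_z T`-linear map `f ⊗ g : M ⊗_z N → M' ⊗_z N'`. -/
def tensorMap {M M' : ModuleCat.{u} S} {N N' : ModuleCat.{u} T} (f : M ⟶ M') (g : N ⟶ N') :
    (M ⊗[z] N) →ₗ[S ⊗[z] T] (M' ⊗[z] N') where
  toFun := TensorProduct.map (f.hom.restrictScalars z) (g.hom.restrictScalars z)
  map_add' := map_add _
  map_smul' r x := by
    induction r with
    | zero => simp
    | add r₁ r₂ h₁ h₂ => simp only [add_smul, map_add, h₁, h₂]
    | tmul s t =>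
      induction x with
      | zero => simp
      | add x₁ x₂ h₁ h₂ => simp only [smul_add, map_add, h₁, h₂]
      | tmul m n => simp [tensorModule_smul_tmul]

/-- The bifunctor `(M, N) ↦ M ⊗_z N` from `S`-modules and `T`-modules to `S ⊗_z T`-modules. -/
def tensorFunctor : ModuleCat.{u} S ⥤ ModuleCat.{u} T ⥤ ModuleCat.{u} (S ⊗[z] T) where
  obj M :=
    { obj := fun N => ModuleCat.of (S ⊗[z] T) (M ⊗[z] N)
      map := fun g => ModuleCat.ofHom (tensorMap z (𝟙 M) g)
      map_id := fun N => by
        ext x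
        induction x using TensorProduct.induction_on with
        | zero => simp
        | add x₁ x₂ h₁ h₂ => simp only [map_add, h₁, h₂]
        | tmul m n => rfl
      map_comp := fun g g' => by
        ext x
        induction x using TensorProduct.induction_on with
        | zero => simp
        | add x₁ x₂ h₁ h₂ => simp only [map_add, h₁, h₂]
        | tmul m n => rfl }
  map f :=
    { app := fun N => ModuleCat.ofHom (tensorMap z f (𝟙 N))
      naturality := fun N N' g => by
        ext x
        induction x using TensorProduct.induction_on with
        | zero => simp
        | add x₁ x₂ h₁ h₂ => simp only [map_add, h₁, h₂]
        | tmul m n => rfl }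
  map_id M := by
    ext N x
    induction x using TensorProduct.induction_on with
    | zero => simp
    | add x₁ x₂ h₁ h₂ => simp only [map_add, h₁, h₂]
    | tmul m n => rfl
  map_comp f f' := by
    ext N x
    induction x using TensorProduct.induction_on with
    | zero => simp
    | add x₁ x₂ h₁ h₂ => simp only [map_add, h₁, h₂]
    | tmul m n => rfl

instance tensorFunctor_additive : (tensorFunctor z S T).Additive where
  map_add {M M' f f'} := by
    ext N x
    induction x using TensorProduct.induction_on with
    | zero => exact (map_zero _).trans (map_zero _).symm
    | add x₁ x₂ h₁ h₂ => exact (map_add _ _ _).trans ((congrArg₂ _ h₁ h₂).trans (map_add _ _ _).symm)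
    | tmul m n => exact TensorProduct.add_tmul _ _ _

instance tensorFunctor_obj_additive (M : ModuleCat.{u} S) :
    ((tensorFunctor z S T).obj M).Additive where
  map_add {N N' g g'} := by
    ext x
    induction x using TensorProduct.induction_on with
    | zero => exact (map_zero _).trans (map_zero _).symm
    | add x₁ x₂ h₁ h₂ => exact (map_add _ _ _).trans ((congrArg₂ _ h₁ h₂).trans (map_add _ _ _).symm)
    | tmul m n => exact TensorProduct.tmul_add _ _ _

end Tensor

section Hom

variable {S T}

/-- An `S ⊗_z T`-module as an `S`-module, `s • m = (s ⊗ 1) • m`. -/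
abbrev leftFactorModule (M : ModuleCat.{u} (S ⊗[z] T)) : Module S M :=
  Module.compHom M (Algebra.TensorProduct.includeLeft (R := z) (S := z) (A := S) (B := T)).toRingHom

/-- An `S ⊗_z T`-module as a `T`-module, `t • m = (1 ⊗ t) • m`. -/
abbrev rightFactorModule (M : ModuleCat.{u} (S ⊗[z] T)) : Module T M :=
  Module.compHom M (Algebra.TensorProduct.includeRight (R := z) (A := S) (B := T)).toRingHom

attribute [local instance] leftFactorModule rightFactorModule

theorem smulCommClass_left_right (M : ModuleCat.{u} (S ⊗[z] T)) : SMulCommClass S T M where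
  smul_comm s t m := by
    change (s ⊗ₜ[z] (1 : T)) • ((1 : S) ⊗ₜ[z] t) • m = ((1 : S) ⊗ₜ[z] t) • (s ⊗ₜ[z] (1 : T)) • m
    simp [smul_smul]

attribute [local instance] smulCommClass_left_right

/-- An `S ⊗_z T`-linear map, as an `S`-linear map. -/
def toLeftLinear {M M' : ModuleCat.{u} (S ⊗[z] T)} (f : M ⟶ M') : M →ₗ[S] M' where
  toFun := f.hom
  map_add' := map_add _
  map_smul' s := map_smul f.hom (s ⊗ₜ[z] (1 : T))

variable (S T) in
/-- The functor `M ↦ Hom_S(N, M)` from `S ⊗_z T`-modules to `T`-modules, where `T` acts on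
`Hom_S(N, M)` through `M`. -/
def homFunctor (N : Type u) [AddCommGroup N] [Module S N] :
    ModuleCat.{u} (S ⊗[z] T) ⥤ ModuleCat.{u} T where
  obj M := ModuleCat.of T (N →ₗ[S] M)
  map {M M'} f := ModuleCat.ofHom
    { toFun := fun φ => (toLeftLinear z f).comp φ
      map_add' := fun φ ψ => LinearMap.comp_add _ _ _
      map_smul' := fun t φ => LinearMap.ext fun n =>
        map_smul f.hom ((1 : S) ⊗ₜ[z] t) (φ n) }

instance homFunctor_additive (N : Type u) [AddCommGroup N] [Module S N] :
    (homFunctor z S T N).Additive where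

end Hom

end Functors

/-! ### Derived functors, computed by resolutions -/

section Derived

variable {C D E : Type (u + 1)} [Category.{u} C] [Category.{u} D] [Category.{u} E]
  [Abelian C] [Abelian D] [Abelian E]

/-- `Y ≅ (LF)(X)`: the object `Y` is the value at `X` of the left derived functor of `F`,
i.e. `Y ≅ F(P)` for a K-projective resolution `P` of `X`. -/
def IsLeftDerived (F : C ⥤ D) [F.Additive] (X : DerivedCategory C) (Y : DerivedCategory D) :
    Prop :=
  ∃ P : CochainComplex C ℤ, P.IsKProjective ∧ Nonempty (DerivedCategory.Q.obj P ≅ X) ∧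
    Nonempty (DerivedCategory.Q.obj ((F.mapHomologicalComplex (ComplexShape.up ℤ)).obj P) ≅ Y)

/-- `Y ≅ (RF)(X)`: the object `Y` is the value at `X` of the right derived functor of `F`,
i.e. `Y ≅ F(I)` for a K-injective resolution `I` of `X`. -/
def IsRightDerived (F : C ⥤ D) [F.Additive] (X : DerivedCategory C) (Y : DerivedCategory D) :
    Prop :=
  ∃ I : CochainComplex C ℤ, I.IsKInjective ∧ Nonempty (DerivedCategory.Q.obj I ≅ X) ∧
    Nonempty (DerivedCategory.Q.obj ((F.mapHomologicalComplex (ComplexShape.up ℤ)).obj I) ≅ Y)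

end Derived

variable (z : Type u) [CommRing z]

/-- `W ≅ X ⊗^L_z Y` in `D(S ⊗_z T)`, for `X` in `D(S)` and `Y` in `D(T)`: the object `W` is
isomorphic to the total complex of `P ⊗_z P'` for K-projective resolutions `P` of `X` over `S` and
`P'` of `Y` over `T`. (This is the derived tensor product over `z` whenever `S` and `T` are flat
over `z`, since then `P` and `P'` are K-flat over `z`.) -/
def IsDerivedTensor {S T : Type u} [Ring S] [Ring T] [Algebra z S] [Algebra z T]
    (X : DerivedCategory (ModuleCat.{u} S)) (Y : DerivedCategory (ModuleCat.{u} T))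
    (W : DerivedCategory (ModuleCat.{u} (S ⊗[z] T))) : Prop :=
  ∃ (P : CochainComplex (ModuleCat.{u} S) ℤ) (P' : CochainComplex (ModuleCat.{u} T) ℤ),
    P.IsKProjective ∧ P'.IsKProjective ∧
    Nonempty (DerivedCategory.Q.obj P ≅ X) ∧ Nonempty (DerivedCategory.Q.obj P' ≅ Y) ∧
    Nonempty (DerivedCategory.Q.obj (CochainComplex.mapBifunctor P P' (tensorFunctor z S T)) ≅ W)

/-! ### Bimodules -/

section Bimodules

variable (A : Type u) [Ring A] [Algebra z A]

/-- The enveloping algebra `A ⊗_z A^o`; its modules are the `z`-central `A`-bimodules. -/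
abbrev Env : Type u := A ⊗[z] Aᵐᵒᵖ

/-- `A` as a bimodule over itself: `(a ⊗ b) • x = a * x * b`. -/
instance envModule : Module (Env z A) A := TensorProduct.Algebra.module

theorem envModule_smul (a x : A) (b : Aᵐᵒᵖ) :
    (a ⊗ₜ[z] b : Env z A) • x = a * x * b.unop := by
  change TensorProduct.Algebra.moduleAux _ _ = _
  simp [TensorProduct.Algebra.moduleAux, mul_assoc]

/-- Bimodules as left `A`-modules. -/
abbrev leftRes : ModuleCat.{u} (Env z A) ⥤ ModuleCat.{u} A :=
  ModuleCat.restrictScalars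
    (Algebra.TensorProduct.includeLeft (R := z) (S := z) (A := A) (B := Aᵐᵒᵖ)).toRingHom

/-- Bimodules as right `A`-modules, i.e. as `A^o`-modules. -/
abbrev rightRes : ModuleCat.{u} (Env z A) ⥤ ModuleCat.{u} Aᵐᵒᵖ :=
  ModuleCat.restrictScalars
    (Algebra.TensorProduct.includeRight (R := z) (A := A) (B := Aᵐᵒᵖ)).toRingHom

instance restrictScalars_preservesFiniteLimits {S T : Type u} [Ring S] [Ring T] (f : S →+* T) :
    Limits.PreservesFiniteLimits (ModuleCat.restrictScalars.{u} f) where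
  preservesFiniteLimits _ _ _ := { preservesLimit := inferInstance }

instance restrictScalars_preservesFiniteColimits {S T : Type u} [Ring S] [Ring T] (f : S →+* T) :
    Limits.PreservesFiniteColimits (ModuleCat.restrictScalars.{u} f) where
  preservesFiniteColimits _ _ _ := { preservesColimit := inferInstance }

theorem env_smul_comm (M : ModuleCat.{u} (Env z A)) (a : A) (b : Aᵐᵒᵖ) (m : M) :
    (a ⊗ₜ[z] (1 : Aᵐᵒᵖ) : Env z A) • ((1 : A) ⊗ₜ[z] b : Env z A) • m =
      ((1 : A) ⊗ₜ[z] b : Env z A) • (a ⊗ₜ[z] (1 : Aᵐᵒᵖ) : Env z A) • m := by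
  simp [smul_smul]

/-- Right multiplication by `a`, `m ↦ m a`, which is left `A`-linear. -/
def rightMul (a : A) : leftRes z A ⟶ leftRes z A where
  app M := ModuleCat.ofHom (X := (leftRes z A).obj M) (Y := (leftRes z A).obj M)
    { toFun := fun m : M => ((1 : A) ⊗ₜ[z] MulOpposite.op a : Env z A) • m
      map_add' := fun m m' : M => smul_add _ _ _
      map_smul' := fun b (m : M) => (env_smul_comm z A M b (MulOpposite.op a) m).symm }
  naturality M M' f := by
    ext m
    exact (map_smul f.hom ((1 : A) ⊗ₜ[z] MulOpposite.op a : Env z A) m).symm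

/-- Left multiplication by `a`, `m ↦ a m`, which is right `A`-linear. -/
def leftMul (a : A) : rightRes z A ⟶ rightRes z A where
  app M := ModuleCat.ofHom (X := (rightRes z A).obj M) (Y := (rightRes z A).obj M)
    { toFun := fun m : M => (a ⊗ₜ[z] (1 : Aᵐᵒᵖ) : Env z A) • m
      map_add' := fun m m' : M => smul_add _ _ _
      map_smul' := fun b (m : M) => env_smul_comm z A M a b m }
  naturality M M' f := by
    ext m
    exact (map_smul f.hom (a ⊗ₜ[z] (1 : Aᵐᵒᵖ) : Env z A) m).symm

end Bimodules

section Dualizing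

/-- The natural transformation between the functors on derived categories that is induced by a
natural transformation between exact functors. -/
def derivedNatTrans {C D : Type (u + 1)} [Category.{u} C] [Category.{u} D] [Abelian C] [Abelian D]
    {F G : C ⥤ D} [F.Additive] [G.Additive]
    [Limits.PreservesFiniteLimits F] [Limits.PreservesFiniteColimits F]
    [Limits.PreservesFiniteLimits G] [Limits.PreservesFiniteColimits G] (τ : F ⟶ G) :
    F.mapDerivedCategory ⟶ G.mapDerivedCategory :=
  Localization.liftNatTrans DerivedCategory.Q
    (HomologicalComplex.quasiIso C (ComplexShape.up ℤ))
    (F.mapHomologicalComplex _ ⋙ DerivedCategory.Q) (G.mapHomologicalComplex _ ⋙ DerivedCategory.Q)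
    _ _ (Functor.whiskerRight (NatTrans.mapHomologicalComplex τ _) DerivedCategory.Q)

/-- An object `X` of `D(S)` has finite injective dimension: there is an `n` such that
`Ext^i(N, X) = 0` for all `S`-modules `N` and all `i ≥ n`. -/
def HasFiniteInjectiveDimension {S : Type u} [Ring S] (X : DerivedCategory (ModuleCat.{u} S)) :
    Prop :=
  ∃ n : ℤ, ∀ (N : ModuleCat.{u} S) (i : ℤ), n ≤ i →
    Subsingleton ((DerivedCategory.singleFunctor (ModuleCat.{u} S) 0).obj N ⟶ X⟦i⟧)

variable (A : Type u) [Ring A] [Algebra z A]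

/-- A dualizing complex over `A` (an algebra over the central ring `z`): a bounded complex of
`z`-central bimodules satisfying the usual three conditions.

The natural morphism `A → RHom_A(R, R)` (`a` goes to right multiplication by `a`) is an isomorphism
iff it is bijective on cohomology; `Hⁱ(RHom_A(R, R)) = Hom_{D(A)}(R, R[i])`, and `A` sits in
degree 0. Likewise for `A → RHom_{A^o}(R, R)` (`a` goes to left multiplication by `a`). -/
structure IsDualizing (R : DerivedCategory (ModuleCat.{u} (Env z A))) : Prop where
  bounded : ∃ a b : ℤ, R.IsGE a ∧ R.IsLE b
  injective_left : HasFiniteInjectiveDimension ((leftRes z A).mapDerivedCategory.obj R)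
  injective_right : HasFiniteInjectiveDimension ((rightRes z A).mapDerivedCategory.obj R)
  finite_left : ∀ n : ℤ, Module.Finite A
    ((leftRes z A).obj ((DerivedCategory.homologyFunctor _ n).obj R))
  finite_right : ∀ n : ℤ, Module.Finite Aᵐᵒᵖ
    ((rightRes z A).obj ((DerivedCategory.homologyFunctor _ n).obj R))
  end_left : Function.Bijective fun a : A => (derivedNatTrans (rightMul z A a)).app R
  ext_left : ∀ i : ℤ, i ≠ 0 → Subsingleton
    ((leftRes z A).mapDerivedCategory.obj R ⟶ ((leftRes z A).mapDerivedCategory.obj R)⟦i⟧)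
  end_right : Function.Bijective fun a : A => (derivedNatTrans (leftMul z A a)).app R
  ext_right : ∀ i : ℤ, i ≠ 0 → Subsingleton
    ((rightRes z A).mapDerivedCategory.obj R ⟶ ((rightRes z A).mapDerivedCategory.obj R)⟦i⟧)

end Dualizing

section Rigid

variable (A : Type u) [Ring A] [Algebra z A]

/-- The automorphism `(a ⊗ b) ⊗ (c ⊗ d) ↦ (a ⊗ d) ⊗ (c ⊗ b)` of `A^e ⊗_z A^e`. -/
def outerInner : Env z A ⊗[z] Env z A →ₐ[z] Env z A ⊗[z] Env z A :=
  (Algebra.TensorProduct.map (AlgHom.id z (Env z A))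
      (Algebra.TensorProduct.comm z Aᵐᵒᵖ A).toAlgHom).comp
    ((Algebra.TensorProduct.tensorTensorTensorComm z z z z A Aᵐᵒᵖ Aᵐᵒᵖ A).toAlgHom.comp
      (Algebra.TensorProduct.map (AlgHom.id z (Env z A))
        (Algebra.TensorProduct.comm z A Aᵐᵒᵖ).toAlgHom))

theorem outerInner_tmul (a c : A) (b d : Aᵐᵒᵖ) :
    outerInner z A ((a ⊗ₜ b) ⊗ₜ (c ⊗ₜ d)) = (a ⊗ₜ d) ⊗ₜ (c ⊗ₜ b) :=
  rfl

/-- `W ↦ Hom_{A^e}(A, W)` for an `A^e ⊗_z A^e`-module `W` such as `M ⊗_z N` with `M` and `N`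
bimodules. The bimodule homomorphisms are taken for the outer structure,
`a (m ⊗ n) b = a m ⊗ n b`, and the values are bimodules through the inner structure,
`c (m ⊗ n) d = m d ⊗ c n`. -/
def outerHom : ModuleCat.{u} (Env z A ⊗[z] Env z A) ⥤ ModuleCat.{u} (Env z A) :=
  ModuleCat.restrictScalars (outerInner z A).toRingHom ⋙ homFunctor z (Env z A) (Env z A) A

instance outerHom_additive : (outerHom z A).Additive := by
  unfold outerHom
  infer_instance

/-- `R` is `z`-rigid: `R ≅ RHom_{A ⊗_z A^o}(A, R ⊗_z R)` in `D(A ⊗_z A^o)`. -/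
def IsRigid (R : DerivedCategory (ModuleCat.{u} (Env z A))) : Prop :=
  ∃ W : DerivedCategory (ModuleCat.{u} (Env z A ⊗[z] Env z A)),
    IsDerivedTensor z R R W ∧ IsRightDerived (outerHom z A) W R

end Rigid

section BaseChange

variable (z' : Type u) [CommRing z'] [Algebra z z'] (A : Type u) [Ring A] [Algebra z A]

/-- The base change `A' = z' ⊗_z A`, a `z'`-algebra. -/
abbrev BaseChange : Type u := z' ⊗[z] A

theorem commute_zero_tensor (w : z' ⊗[z] Env z A) : Commute 0 w :=
  (zero_mul w).trans (mul_zero w).symm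

/-- The canonical map (an isomorphism) `A' ⊗_{z'} A'^o → z' ⊗_z (A ⊗_z A^o)`,
`(s ⊗ a) ⊗ (t ⊗ b) ↦ s t ⊗ (a ⊗ b)`. -/
def envBaseChange : Env z' (BaseChange z z' A) →ₐ[z'] z' ⊗[z] Env z A :=
  Algebra.TensorProduct.lift
    (Algebra.TensorProduct.map (AlgHom.id z' z') Algebra.TensorProduct.includeLeft)
    ((Algebra.TensorProduct.map (AlgEquiv.toOpposite z' z').symm.toAlgHom
      Algebra.TensorProduct.includeRight).comp
      (Algebra.TensorProduct.opAlgEquiv z z' z' A).symm.toAlgHom)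
    (fun x y => by
      induction x using TensorProduct.induction_on with
      | zero => rw [map_zero]; exact commute_zero_tensor z z' A _
      | add x₁ x₂ h₁ h₂ => simpa only [map_add] using h₁.add_left h₂
      | tmul s a =>
        induction y using MulOpposite.rec' with
        | h y =>
          induction y using TensorProduct.induction_on with
          | zero => rw [MulOpposite.op_zero, map_zero]; exact (commute_zero_tensor z z' A _).symm
          | add y₁ y₂ h₁ h₂ => simpa only [MulOpposite.op_add, map_add] using h₁.add_right h₂
          | tmul t b => simp [Commute, SemiconjBy, mul_comm])

theorem envBaseChange_tmul (s t : z') (a b : A) :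
    envBaseChange z z' A ((s ⊗ₜ a) ⊗ₜ MulOpposite.op (t ⊗ₜ b)) =
      (s * t) ⊗ₜ (a ⊗ₜ MulOpposite.op b) := by
  simp [envBaseChange]

/-- The base change `M ↦ z' ⊗_z M` from `z`-central `A`-bimodules to `z'`-central
`A'`-bimodules. -/
def baseChange : ModuleCat.{u} (Env z A) ⥤ ModuleCat.{u} (Env z' (BaseChange z z' A)) :=
  (tensorFunctor z z' (Env z A)).obj (ModuleCat.of z' z') ⋙
    ModuleCat.restrictScalars (envBaseChange z z' A).toRingHom

instance baseChange_additive : (baseChange z z' A).Additive := by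
  unfold baseChange
  infer_instance

/-- `R' ≅ R ⊗^L_z z'` in `D(A' ⊗_{z'} A'^o)`. (K-projective complexes over `A ⊗_z A^o` are K-flat
over `z` when `A` is flat over `z`.) -/
def IsDerivedBaseChange (R : DerivedCategory (ModuleCat.{u} (Env z A)))
    (R' : DerivedCategory (ModuleCat.{u} (Env z' (BaseChange z z' A)))) : Prop :=
  IsLeftDerived (baseChange z z' A) R R'

end BaseChange

end

end DualizingComplex

/-!
# Base change of dualizing complexes

The object `R` is represented by a bounded above complex `P` of projective bimodules and by a
bounded complex `G` of bimodules that are flat over `z` (`exists_flat_model`). This is where the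
regularity of `z` enters first. Being of finite type over a field, `z` has finite Krull dimension
`D`, so that a complex of flat `z`-modules that is exact in degrees at most `n` remains exact in
degrees at most `n - D` after tensoring with any module (`tensorExactLE_of_exact`). This is proved
for cyclic modules `z/J` by Noetherian induction; over the local ring of a prime ideal one divides
out a regular system of parameters to reach the residue field. It follows that a truncation of `P`
still has flat terms (`flat_truncGE`), and that base change preserves quasi-isomorphisms of complexes
of flat modules (`bc_quasiIso`). Hence `R'` is represented by `z' ⊗ P` and by `z' ⊗ G`.

For the finiteness of the cohomology and for the isomorphism `A ≅ RHom(R, R)`, let `F` be a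
resolution of `G` on one side by finitely generated free modules. The complex `Hom(F, G)` has
`z`-flat terms, since these are finite products of terms of `G`, and it commutes with base change
(`flat_homComplex_of_finiteFree`, `isIso_bcHomComplex`). The condition on `R` says that the unit
`A → Hom(F, G)` is a quasi-isomorphism (`quasiIso_homComplexUnit_iff`); both sides are flat, and so
it remains one after base change (`HasDerivedEnd.bc`).

The injective dimension is measured by the degrees from which on `Ext(N, -)` vanishes for all
modules `N` (`ExtVanishing`). It stays finite under base change along `z → z'`
(`exists_baseExtVanishing`) because this homomorphism can be factored, locally at a maximal ideal of
`z'`, through a polynomial ring `z[x₁, …, x_m]`, one of its localizations, and a surjection of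
regular local rings. A polynomial variable raises the bound by at most one
(`extVanishing_of_polynomial`, from the sequence `0 → N → Hom_S(S[X], N) → Hom_S(S[X], N) → 0`). A
localization preserves it (`ExtVanishing.bc_of_epi`): over a Noetherian ring, injectivity of a
module means solvability of finite systems of equations, which passes to flat base changes. A
surjection of regular local rings is a composition of quotients by nonzerodivisors
(`exists_mem_ker_notMem_sq`), none of which raises the bound (`ExtVanishing.quotient`). The local
bounds are uniform, and give a global one (`ExtVanishing.of_local`). The rings that occur are
Noetherian by Hilbert's basis theorem over a noncommutative ring (`isNoetherianRing_polynomial`).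

For rigidity, `R ⊗^L R` is represented by the total tensor product of `G` with itself, which is
bounded with flat terms (`nonempty_tensorComplex_iso`, `flat_tensorComplex`). As the enveloping
algebra is Noetherian, `A` has a resolution `F` by finitely generated free bimodules, and
`RHom(A, R ⊗^L R)` is represented by the Hom complex from `F` (`isRightDerived_homFunctor_iff`). Its
terms are flat, and the formation of tensor products and of Hom complexes commutes with base change
(`nonempty_bc_tensorComplex_iso`, `nonempty_bc_homComplex_iso`). The rigidity isomorphism of `R`,
an isomorphism between complexes of flat modules, therefore induces one for `R'`
(`exists_rigid_bc`).
-/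


namespace DualizingComplex

/-! ### Regular local rings -/

section RegularLocal

open IsLocalRing

variable {R : Type*} [CommRing R]

/-- Cutting down by an element of `m ∖ m²` drops the number of generators of `m`. -/
theorem spanFinrank_maximalIdeal_quotient_add_one_le [IsLocalRing R] [IsNoetherianRing R] {x : R}
    (hx : x ∈ maximalIdeal R) (hx' : x ∉ maximalIdeal R ^ 2) :
    ((maximalIdeal R).map (Ideal.Quotient.mk (Ideal.span {x}))).spanFinrank + 1 ≤
      (maximalIdeal R).spanFinrank := by
  classical
  obtain ⟨s, hs, hspan⟩ :=
    (IsNoetherian.noetherian (maximalIdeal R)).exists_span_finset_card_eq_spanFinrank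
  have hx1 := hx
  rw [← hspan, Submodule.mem_span_finset] at hx1
  obtain ⟨a, -, hax⟩ := hx1
  have hsm : ∀ y ∈ s, y ∈ maximalIdeal R := fun y hy => hspan ▸ Submodule.subset_span hy
  -- some generator has a unit coefficient in `x`, and is redundant modulo `x`
  obtain ⟨y, hys, hy⟩ : ∃ y ∈ s, IsUnit (a y) := by
    by_contra! h
    apply hx'
    rw [← hax, pow_two]
    exact Ideal.sum_mem _ fun y hy => Ideal.mul_mem_mul ((mem_maximalIdeal _).2 (h y hy)) (hsm y hy)
  have key : (maximalIdeal R).map (Ideal.Quotient.mk (Ideal.span {x})) =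
      Submodule.span _ (((s.erase y).image (Ideal.Quotient.mk (Ideal.span {x})) : Finset _) :
        Set (R ⧸ Ideal.span {x})) := by
    apply le_antisymm
    · conv_lhs => rw [← hspan]
      change Ideal.map _ (Ideal.span _) ≤ _
      rw [Ideal.map_span, Ideal.span_le]
      rintro _ ⟨w, hw, rfl⟩
      by_cases hwy : w = y
      · subst hwy
        have h0 : Ideal.Quotient.mk (Ideal.span {x}) x = 0 :=
          Ideal.Quotient.eq_zero_iff_mem.2 (Ideal.mem_span_singleton_self x)
        have h2 : Ideal.Quotient.mk (Ideal.span {x}) (a w) * Ideal.Quotient.mk (Ideal.span {x}) w +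
            Ideal.Quotient.mk (Ideal.span {x}) (∑ i ∈ s.erase w, a i • i) = 0 := by
          rw [← map_mul, ← map_add, ← smul_eq_mul, Finset.add_sum_erase _ (fun i => a i • i) hw,
            hax, h0]
        obtain ⟨b, hb⟩ := hy.exists_left_inv
        have h1 : Ideal.Quotient.mk (Ideal.span {x}) w = - (Ideal.Quotient.mk _ b *
            Ideal.Quotient.mk (Ideal.span {x}) (∑ i ∈ s.erase w, a i • i)) := by
          have := congrArg (fun t => Ideal.Quotient.mk (Ideal.span {x}) b * t) h2
          simp only [mul_add, mul_zero, ← mul_assoc, ← map_mul, hb, one_mul] at this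
          rw [eq_neg_iff_add_eq_zero, ← map_mul]
          exact this
        rw [h1]
        refine neg_mem (Ideal.mul_mem_left _ _ ?_)
        rw [map_sum]
        refine Ideal.sum_mem _ fun i hi => ?_
        rw [smul_eq_mul, map_mul]
        exact Ideal.mul_mem_left _ _ (Submodule.subset_span (Finset.mem_coe.2
          (Finset.mem_image_of_mem _ hi)))
      · exact Submodule.subset_span (Finset.mem_coe.2
          (Finset.mem_image_of_mem _ (Finset.mem_erase.2 ⟨hwy, hw⟩)))
    · rw [Submodule.span_le]
      intro w hw
      obtain ⟨v, hv, rfl⟩ := Finset.mem_image.1 (Finset.mem_coe.1 hw)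
      exact Ideal.mem_map_of_mem _ (hsm v (Finset.mem_of_mem_erase hv))
  rw [key, ← hs]
  refine le_trans (Nat.add_le_add_right (Submodule.spanFinrank_span_le_ncard_of_finite
    (Finset.finite_toSet _)) 1) ?_
  rw [Set.ncard_coe_finset]
  refine le_trans (Nat.add_le_add_right Finset.card_image_le 1) ?_
  rw [Finset.card_erase_add_one hys]

theorem map_maximalIdeal_of_surjective [IsLocalRing R] {S : Type*} [CommRing S] [IsLocalRing S]
    (f : R →+* S) (hf : Function.Surjective f) :
    (maximalIdeal R).map f = maximalIdeal S := by
  have h := ((local_hom_TFAE f).out 0 4).1 (Function.Surjective.isLocalHom f hf)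
  rw [← h, Ideal.map_comap_of_surjective f hf]

theorem quotient_isLocalRing [IsLocalRing R] {I : Ideal R} (hI : I ≤ maximalIdeal R) :
    IsLocalRing (R ⧸ I) :=
  have : Nontrivial (R ⧸ I) := Ideal.Quotient.nontrivial_iff.2
    (fun h => (maximalIdeal.isMaximal R).ne_top (top_le_iff.1 (h ▸ hI)))
  IsLocalRing.of_surjective' (Ideal.Quotient.mk I) Ideal.Quotient.mk_surjective

/-- The quotient of a regular local ring by an element of `m ∖ m²` is regular, of dimension one
less. -/
theorem isRegularLocalRing_quotient [IsRegularLocalRing R] {x : R}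
    (hx : x ∈ maximalIdeal R) (hx' : x ∉ maximalIdeal R ^ 2) :
    IsRegularLocalRing (R ⧸ Ideal.span {x}) ∧
      ∃ _ : IsLocalRing (R ⧸ Ideal.span {x}),
      (maximalIdeal (R ⧸ Ideal.span {x})).spanFinrank + 1 = (maximalIdeal R).spanFinrank := by
  have hloc : IsLocalRing (R ⧸ Ideal.span {x}) :=
    quotient_isLocalRing ((Ideal.span_singleton_le_iff_mem _).2 hx)
  have h1 := spanFinrank_maximalIdeal_quotient_add_one_le hx hx'
  rw [map_maximalIdeal_of_surjective _ Ideal.Quotient.mk_surjective] at h1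
  have h2 : ringKrullDim R ≤ ringKrullDim (R ⧸ Ideal.span {x}) + 1 := by
    rw [← IsLocalRing.maximalIdeal_height_eq_ringKrullDim]
    exact Ideal.height_le_ringKrullDim_quotient_add_one hx
  have h3 := ringKrullDim_le_spanFinrank_maximalIdeal (R ⧸ Ideal.span {x})
  rw [← IsRegularLocalRing.spanFinrank_maximalIdeal (R := R)] at h2
  have h4 : (maximalIdeal (R ⧸ Ideal.span {x})).spanFinrank + 1 = (maximalIdeal R).spanFinrank := by
    refine le_antisymm h1 ?_
    have := h2.trans (add_le_add_left h3 1)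
    exact_mod_cast this
  refine ⟨IsRegularLocalRing.of_spanFinrank_maximalIdeal_le _ ?_, hloc, h4⟩
  rw [← h4] at h2
  push_cast at h2
  generalize ringKrullDim (R ⧸ Ideal.span {x}) = d at h2 h3
  induction d with
  | bot =>
    rw [WithBot.bot_add, le_bot_iff] at h2
    exact absurd h2 (by exact_mod_cast WithBot.coe_ne_bot)
  | coe d =>
    induction d with
    | top => exact le_top
    | coe d =>
      have h5 : (maximalIdeal (R ⧸ Ideal.span {x})).spanFinrank + 1 ≤ d + 1 := by exact_mod_cast h2
      exact_mod_cast Nat.le_of_succ_le_succ h5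

/-- By induction on the dimension. Prime avoidance gives `x ∈ m ∖ m²` outside all minimal primes; as
`R / x` is a domain, some minimal prime `p` lies in `(x)`, so that `p = x p` and `p = 0` by
Nakayama's lemma. -/
theorem isDomain_of_isRegularLocalRing_aux (n : ℕ) : ∀ (R : Type u) [CommRing R]
    [IsRegularLocalRing R], (maximalIdeal R).spanFinrank = n → IsDomain R := by
  induction n with
  | zero =>
    intro R _ _ h
    have hm : maximalIdeal R = ⊥ :=
      (Submodule.spanFinrank_eq_zero_iff_eq_bot (IsNoetherian.noetherian _)).1 h
    have : IsField R := (IsLocalRing.isField_iff_maximalIdeal_eq).2 hm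
    exact this.isDomain
  | succ n ih =>
    intro R _ _ h
    have hdim : ringKrullDim R = (n + 1 : ℕ) := by
      rw [← h, IsRegularLocalRing.spanFinrank_maximalIdeal]
    obtain ⟨x, hx, hx2, hxp⟩ : ∃ x ∈ maximalIdeal R, x ∉ maximalIdeal R ^ 2 ∧
        ∀ p ∈ minimalPrimes R, x ∉ p := by
      by_contra! hcon
      have hsub : ((maximalIdeal R : Ideal R) : Set R) ⊆
          ⋃ i ∈ insert (maximalIdeal R ^ 2) (minimalPrimes R), ((id i : Ideal R) : Set R) := by
        intro x hx
        simp only [Set.mem_iUnion, id]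
        by_cases hx2 : x ∈ maximalIdeal R ^ 2
        · exact ⟨_, Set.mem_insert _ _, hx2⟩
        · obtain ⟨p, hp, hxp⟩ := hcon x hx hx2
          exact ⟨p, Set.mem_insert_of_mem _ hp, hxp⟩
      replace hsub := (Ideal.subset_union_prime_finite
        ((minimalPrimes.finite_of_isNoetherianRing R).insert _)
        (maximalIdeal R ^ 2) (maximalIdeal R ^ 2)
        (fun i hi h1 _ => ((Set.mem_insert_iff.1 hi).resolve_left h1).1.1)).1 hsub
      obtain ⟨i, hi, hle⟩ := hsub
      rcases Set.mem_insert_iff.1 hi with rfl | hi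
      · have hbot : maximalIdeal R = ⊥ := by
          refine Submodule.eq_bot_of_le_smul_of_le_jacobson_bot (maximalIdeal R) _
            (IsNoetherian.noetherian _) ?_ (IsLocalRing.maximalIdeal_le_jacobson _)
          rw [smul_eq_mul, ← pow_two]; exact hle
        rw [hbot, Submodule.spanFinrank_bot] at h
        omega
      · have him : i = maximalIdeal R :=
          le_antisymm (IsLocalRing.le_maximalIdeal hi.1.1.ne_top) hle
        have h0 : (maximalIdeal R).height = 0 :=
          Ideal.height_eq_zero_iff.2 (him ▸ hi)
        have := IsLocalRing.maximalIdeal_height_eq_ringKrullDim (R := R)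
        rw [h0, hdim] at this
        norm_cast at this
    obtain ⟨hreg, _, hrank⟩ := isRegularLocalRing_quotient hx hx2
    have hdom : IsDomain (R ⧸ Ideal.span {x}) := ih _ (by omega)
    have hprime : (Ideal.span {x}).IsPrime := (Ideal.Quotient.isDomain_iff_prime _).1 hdom
    obtain ⟨p, hp, hpx⟩ := Ideal.exists_minimalPrimes_le (I := (⊥ : Ideal R))
      (J := Ideal.span {x}) bot_le
    have hpp := hp.1.1
    have hpbot : p = ⊥ := by
      refine Submodule.eq_bot_of_le_smul_of_le_jacobson_bot (maximalIdeal R) _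
        (IsNoetherian.noetherian _) ?_ (IsLocalRing.maximalIdeal_le_jacobson _)
      intro w hw
      obtain ⟨v, rfl⟩ := Ideal.mem_span_singleton'.1 (hpx hw)
      rw [mul_comm]
      exact Submodule.smul_mem_smul hx ((hpp.mem_or_mem hw).resolve_right (hxp p hp))
    subst hpbot
    exact IsDomain.of_bot_isPrime R

instance isDomain_of_isRegularLocalRing (R : Type u) [CommRing R] [IsRegularLocalRing R] :
    IsDomain R :=
  isDomain_of_isRegularLocalRing_aux _ R rfl

/-- A regular quotient of a regular local ring, if proper, is cut out by equations one of which is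
part of a regular system of parameters. -/
theorem exists_mem_ker_notMem_sq {R : Type u} [CommRing R] [IsRegularLocalRing R]
    {S : Type*} [CommRing S] [IsRegularLocalRing S] (f : R →+* S) (hf : Function.Surjective f)
    (hker : RingHom.ker f ≠ ⊥) :
    ∃ x ∈ maximalIdeal R, x ∉ maximalIdeal R ^ 2 ∧ f x = 0 := by
  classical
  have hle : RingHom.ker f ≤ maximalIdeal R :=
    IsLocalRing.le_maximalIdeal (RingHom.ker_ne_top f)
  by_contra! hcon
  have hsq : RingHom.ker f ≤ maximalIdeal R ^ 2 := by
    intro x hx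
    by_contra h
    exact hcon x (hle hx) h hx
  have hmap := map_maximalIdeal_of_surjective f hf
  obtain ⟨s, hs, hspan⟩ :=
    (IsNoetherian.noetherian (maximalIdeal S)).exists_span_finset_card_eq_spanFinrank
  choose g hg using hf
  -- as the kernel lies in `m²`, by Nakayama's lemma lifts of generators of the maximal ideal of
  -- `S` generate that of `R`
  have hgs : Submodule.span R ((s.image g : Finset R) : Set R) = maximalIdeal R := by
    apply le_antisymm
    · rw [Submodule.span_le]
      intro w hw
      obtain ⟨v, hv, rfl⟩ := Finset.mem_image.1 (Finset.mem_coe.1 hw)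
      have hv' : v ∈ maximalIdeal S := hspan ▸ Submodule.subset_span hv
      by_contra hu
      have := (IsLocalRing.notMem_maximalIdeal.1 hu).map f
      rw [hg] at this
      exact (IsLocalRing.mem_maximalIdeal _).1 hv' this
    · refine Submodule.le_of_le_smul_of_le_jacobson_bot (I := maximalIdeal R)
        (IsNoetherian.noetherian _) (IsLocalRing.maximalIdeal_le_jacobson _) ?_
      intro x hx
      have hfx : f x ∈ maximalIdeal S := hmap ▸ Ideal.mem_map_of_mem f hx
      have hsp : Ideal.map f (Ideal.span ((s.image g : Finset R) : Set R)) =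
          maximalIdeal S := by
        rw [Ideal.map_span, ← hspan]
        congr 1
        ext w
        simp [hg]
      rw [← hsp, Ideal.mem_map_iff_of_surjective f (fun y => ⟨g y, hg y⟩)] at hfx
      obtain ⟨y, hy, hyx⟩ := hfx
      rw [show x = y + (x - y) by ring]
      refine Submodule.add_mem_sup hy ?_
      rw [smul_eq_mul, ← pow_two]
      exact hsq (by rw [RingHom.mem_ker, map_sub, hyx, sub_self])
  have hrank : (maximalIdeal R).spanFinrank ≤ (maximalIdeal S).spanFinrank := by
    rw [← hgs, ← hs]
    refine (Submodule.spanFinrank_span_le_ncard_of_finite (Finset.finite_toSet _)).trans ?_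
    rw [Set.ncard_coe_finset]
    exact Finset.card_image_le
  -- hence `dim R ≤ dim S`, against a nonzero kernel in a domain
  obtain ⟨r, hr, hr0⟩ := Submodule.exists_mem_ne_zero_of_ne_bot hker
  have hdim := ringKrullDim_quotient_succ_le_of_nonZeroDivisor (mem_nonZeroDivisors_of_ne_zero hr0)
  have hdim2 : ringKrullDim S ≤ ringKrullDim (R ⧸ Ideal.span {r}) :=
    ringKrullDim_le_of_surjective
      (Ideal.Quotient.lift (Ideal.span {r}) f (fun a ha => by
        obtain ⟨b, rfl⟩ := Ideal.mem_span_singleton'.1 ha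
        rw [map_mul, (RingHom.mem_ker).1 hr, mul_zero]))
      (Ideal.Quotient.lift_surjective_of_surjective _ _ (fun y => ⟨g y, hg y⟩))
  have h5 := (add_le_add_left hdim2 1).trans hdim
  rw [← IsRegularLocalRing.spanFinrank_maximalIdeal (R := S),
    ← IsRegularLocalRing.spanFinrank_maximalIdeal (R := R)] at h5
  have h6 : (maximalIdeal S).spanFinrank + 1 ≤ (maximalIdeal R).spanFinrank := by exact_mod_cast h5
  omega

end RegularLocal

/-! ### Tensor products of complexes of flat modules over a regular ring -/

section TensorExact

variable {z : Type u} [CommRing z] (C : CochainComplex (ModuleCat.{u} z) ℤ)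

/-- `M ⊗ Cⁱ → M ⊗ Cʲ → M ⊗ Cᵏ` is exact whenever `i`, `j`, `k` are consecutive and `j ≤ n`. -/
def TensorExactLE (M : Type u) [AddCommGroup M] [Module z M] (n : ℤ) : Prop :=
  ∀ i j k : ℤ, i + 1 = j → j + 1 = k → j ≤ n →
    Function.Exact ((C.d i j).hom.lTensor M) ((C.d j k).hom.lTensor M)

variable {C}

section

variable {M M₁ M₂ M₃ : Type u} [AddCommGroup M] [Module z M]
  [AddCommGroup M₁] [Module z M₁] [AddCommGroup M₂] [Module z M₂] [AddCommGroup M₃] [Module z M₃]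
  {n : ℤ}

theorem lTensor_d_d (i j k : ℤ) (x : M ⊗[z] C.X i) :
    (C.d j k).hom.lTensor M ((C.d i j).hom.lTensor M x) = 0 := by
  rw [← LinearMap.comp_apply, ← LinearMap.lTensor_comp, ← ModuleCat.hom_comp, C.d_comp_d]
  simp

theorem lTensor_rTensor_comm (f : M₁ →ₗ[z] M₂) {X Y : ModuleCat.{u} z} (d : X ⟶ Y)
    (x : M₁ ⊗[z] X) :
    d.hom.lTensor M₂ (f.rTensor X x) = f.rTensor Y (d.hom.lTensor M₁ x) := by
  rw [← LinearMap.comp_apply, ← LinearMap.comp_apply, LinearMap.lTensor_comp_rTensor,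
    LinearMap.rTensor_comp_lTensor]

theorem TensorExactLE.mono {m : ℤ} (h : TensorExactLE C M n) (hm : m ≤ n) : TensorExactLE C M m :=
  fun i j k hi hj hk => h i j k hi hj (hk.trans hm)

theorem TensorExactLE.of_linearEquiv (h : TensorExactLE C M₁ n) (e : M₁ ≃ₗ[z] M₂) :
    TensorExactLE C M₂ n := by
  intro i j k hi hj hk x
  refine ⟨fun hx => ?_, fun ⟨y, hy⟩ => hy ▸ lTensor_d_d _ _ _ _⟩
  have h1 : (C.d j k).hom.lTensor M₁ (e.symm.toLinearMap.rTensor _ x) = 0 := by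
    rw [lTensor_rTensor_comm, hx, map_zero]
  obtain ⟨y, hy⟩ := (h i j k hi hj hk _).1 h1
  refine ⟨e.toLinearMap.rTensor _ y, ?_⟩
  rw [lTensor_rTensor_comm, hy, ← LinearMap.comp_apply, ← LinearMap.rTensor_comp]
  simp

theorem TensorExactLE.of_flat [Module.Flat z M]
    (h : ∀ i j k : ℤ, i + 1 = j → j + 1 = k → j ≤ n → Function.Exact (C.d i j).hom (C.d j k).hom) :
    TensorExactLE C M n :=
  fun i j k hi hj hk => Module.Flat.lTensor_exact M (h i j k hi hj hk)

variable {f : M₁ →ₗ[z] M₂} {g : M₂ →ₗ[z] M₃}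

theorem TensorExactLE.middle [∀ i, Module.Flat z (C.X i)] (hf : Function.Injective f)
    (hfg : Function.Exact f g) (hg : Function.Surjective g)
    (h₁ : TensorExactLE C M₁ n) (h₃ : TensorExactLE C M₃ n) : TensorExactLE C M₂ n := by
  intro i j k hi hj hk x
  refine ⟨fun hx => ?_, fun ⟨y, hy⟩ => hy ▸ lTensor_d_d _ _ _ _⟩
  have h1 : (C.d j k).hom.lTensor M₃ (g.rTensor _ x) = 0 := by
    rw [lTensor_rTensor_comm, hx, map_zero]
  obtain ⟨y, hy⟩ := (h₃ i j k hi hj hk _).1 h1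
  obtain ⟨y, rfl⟩ := LinearMap.rTensor_surjective (C.X i) hg y
  rw [lTensor_rTensor_comm, ← sub_eq_zero, ← map_sub] at hy
  obtain ⟨w, hw⟩ := (rTensor_exact (C.X j) hfg hg _).1 hy
  have h2 : (C.d j k).hom.lTensor M₁ w = 0 := by
    apply Module.Flat.rTensor_preserves_injective_linearMap (M := C.X k) f hf
    rw [map_zero, ← lTensor_rTensor_comm, hw, map_sub, hx, lTensor_d_d, sub_zero]
  obtain ⟨v, rfl⟩ := (h₁ i j k hi hj hk _).1 h2
  refine ⟨y - f.rTensor _ v, ?_⟩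
  rw [map_sub, lTensor_rTensor_comm, hw]
  abel

theorem TensorExactLE.right [∀ i, Module.Flat z (C.X i)] (hf : Function.Injective f)
    (hfg : Function.Exact f g) (hg : Function.Surjective g)
    (h₁ : TensorExactLE C M₁ n) (h₂ : TensorExactLE C M₂ n) : TensorExactLE C M₃ (n - 1) := by
  intro i j k hi hj hk x
  refine ⟨fun hx => ?_, fun ⟨y, hy⟩ => hy ▸ lTensor_d_d _ _ _ _⟩
  obtain ⟨y, rfl⟩ := LinearMap.rTensor_surjective (C.X j) hg x
  rw [lTensor_rTensor_comm] at hx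
  obtain ⟨w, hw⟩ := (rTensor_exact (C.X k) hfg hg _).1 hx
  have h1 : (C.d k (k + 1)).hom.lTensor M₁ w = 0 := by
    apply Module.Flat.rTensor_preserves_injective_linearMap (M := C.X (k + 1)) f hf
    rw [map_zero, ← lTensor_rTensor_comm, hw, lTensor_d_d]
  obtain ⟨v, rfl⟩ := (h₁ j k (k + 1) hj rfl (by omega) _).1 h1
  have h2 : (C.d j k).hom.lTensor M₂ (y - f.rTensor _ v) = 0 := by
    rw [map_sub, ← hw, lTensor_rTensor_comm, sub_self]
  obtain ⟨t, ht⟩ := (h₂ i j k hi hj (by omega) _).1 h2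
  refine ⟨g.rTensor _ t, ?_⟩
  rw [lTensor_rTensor_comm, ht, map_sub, sub_eq_self, ← LinearMap.comp_apply,
    ← LinearMap.rTensor_comp, hfg.linearMap_comp_eq_zero]
  simp

end

section IdealQuotient

/-- Multiplication by `a`, from `z/(J : a)` to `z/J`. -/
abbrev colonMap (J : Ideal z) (a : z) :
    (z ⧸ (Submodule.comap (LinearMap.mulLeft z a) J)) →ₗ[z] (z ⧸ J) :=
  Submodule.mapQ _ J (LinearMap.mulLeft z a) le_rfl

theorem colonMap_injective (J : Ideal z) (a : z) : Function.Injective (colonMap J a) := by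
  rw [← LinearMap.ker_eq_bot, Submodule.ker_mapQ, Submodule.mkQ_map_self]

theorem colonMap_exact (J : Ideal z) (a : z) :
    Function.Exact (colonMap J a)
      (Submodule.factor (le_sup_left : J ≤ J ⊔ Ideal.span {a})) := by
  intro x
  obtain ⟨x, rfl⟩ := Submodule.Quotient.mk_surjective _ x
  change Submodule.Quotient.mk x = 0 ↔ _
  rw [Submodule.Quotient.mk_eq_zero, Submodule.mem_sup]
  constructor
  · rintro ⟨y, hy, w, hw, rfl⟩
    obtain ⟨v, rfl⟩ := Ideal.mem_span_singleton'.1 hw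
    refine ⟨Submodule.Quotient.mk v, ?_⟩
    change Submodule.Quotient.mk (a * v) = _
    rw [Submodule.Quotient.eq, mul_comm a v]
    simpa using hy
  · rintro ⟨w, hw⟩
    obtain ⟨w, rfl⟩ := Submodule.Quotient.mk_surjective _ w
    change Submodule.Quotient.mk (a * w) = _ at hw
    rw [Submodule.Quotient.eq] at hw
    refine ⟨x - a * w, ?_, a * w, Ideal.mul_mem_right _ _ (Ideal.mem_span_singleton_self a),
      by ring⟩
    have := J.neg_mem hw
    simpa using this

variable [∀ i, Module.Flat z (C.X i)] {n : ℤ}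

/-- For a regular local `z`-algebra `R`, exactness of `R ⊗ C` passes to the residue field, with a
loss bounded by the dimension of `R`. -/
theorem TensorExactLE.residueField (d : ℕ) : ∀ (n : ℤ) (R : Type u) [CommRing R] [Algebra z R]
    [IsRegularLocalRing R], (IsLocalRing.maximalIdeal R).spanFinrank = d → TensorExactLE C R n →
    ∀ (K : Type u) [Field K] [Algebra z K] (φ : R →ₐ[z] K), Function.Surjective φ →
      TensorExactLE C K (n - d) := by
  induction d with
  | zero =>
    intro n R _ _ _ hd hR K _ _ φ hφ
    have hm := (Submodule.spanFinrank_eq_zero_iff_eq_bot (IsNoetherian.noetherian _)).1 hd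
    have hinj : Function.Injective φ := by
      refine (RingHom.injective_iff_ker_eq_bot φ.toRingHom).2 ?_
      rw [← hm]
      exact IsLocalRing.ker_eq_maximalIdeal φ.toRingHom hφ
    simpa using hR.of_linearEquiv (LinearEquiv.ofBijective φ.toLinearMap ⟨hinj, hφ⟩)
  | succ d ih =>
    intro n R _ _ _ hd hR K _ _ φ hφ
    obtain ⟨x, hx, hx2⟩ : ∃ x ∈ IsLocalRing.maximalIdeal R, x ∉ IsLocalRing.maximalIdeal R ^ 2 := by
      by_contra! hle
      have hbot : IsLocalRing.maximalIdeal R = ⊥ := by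
        refine Submodule.eq_bot_of_le_smul_of_le_jacobson_bot (IsLocalRing.maximalIdeal R) _
          (IsNoetherian.noetherian _) ?_ (IsLocalRing.maximalIdeal_le_jacobson _)
        rw [smul_eq_mul, ← pow_two]; exact hle
      rw [hbot, Submodule.spanFinrank_bot] at hd
      omega
    have hx0 : x ≠ 0 := fun h => hx2 (h ▸ Ideal.zero_mem _)
    obtain ⟨hreg, _, hrank⟩ := isRegularLocalRing_quotient hx hx2
    have hinj : Function.Injective (LinearMap.mulLeft z x) := mul_right_injective₀ hx0
    let q : R →ₐ[z] R ⧸ Ideal.span {x} := Ideal.Quotient.mkₐ z _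
    have hex : Function.Exact (LinearMap.mulLeft z x) q.toLinearMap := by
      intro y
      change Ideal.Quotient.mk (Ideal.span {x}) y = 0 ↔ _
      rw [Ideal.Quotient.eq_zero_iff_mem, Ideal.mem_span_singleton']
      constructor
      · rintro ⟨w, rfl⟩; exact ⟨w, mul_comm _ _⟩
      · rintro ⟨w, rfl⟩; exact ⟨w, mul_comm _ _⟩
    -- the sequence `0 → R → R → R/x → 0` given by multiplication by `x` costs one degree
    have h1 := TensorExactLE.right (C := C) hinj hex Ideal.Quotient.mk_surjective hR hR
    have hxK : ∀ a ∈ Ideal.span {x}, φ a = 0 := by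
      intro a ha
      rw [← IsLocalRing.ker_eq_maximalIdeal φ.toRingHom hφ] at hx
      obtain ⟨b, rfl⟩ := Ideal.mem_span_singleton'.1 ha
      rw [map_mul, show φ x = 0 from hx, mul_zero]
    have h2 := ih (n - 1) (R ⧸ Ideal.span {x}) (by omega) h1 K (Ideal.Quotient.liftₐ _ φ hxK)
      (Ideal.Quotient.lift_surjective_of_surjective _ _ hφ)
    push_cast
    convert h2 using 1
    ring

/-- For `p` prime, `z/p ⊗ C` is exact if it is so over the residue field of `p` and over the proper
quotients of `z/p`. -/
theorem TensorExactLE.quotient_prime (p : Ideal z) [p.IsPrime] {K : Type u} [Field K]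
    [Algebra z K] [Algebra (z ⧸ p) K] [IsScalarTower z (z ⧸ p) K] [IsFractionRing (z ⧸ p) K]
    (hK : TensorExactLE C K n) (h : ∀ a ∉ p, TensorExactLE C (z ⧸ (p ⊔ Ideal.span {a})) n) :
    TensorExactLE C (z ⧸ p) n := by
  let ι : (z ⧸ p) →ₗ[z] K := (IsScalarTower.toAlgHom z (z ⧸ p) K).toLinearMap
  have hι : Function.Injective ι := IsFractionRing.injective (z ⧸ p) K
  -- elements of `K ⊗ Cⁱ` have a common denominator
  have hden : ∀ (i : ℤ) (x : K ⊗[z] C.X i), ∃ a ∉ p, ∃ y, a • x = ι.rTensor _ y := by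
    intro i x
    induction x with
    | zero => exact ⟨1, fun h1 => ‹p.IsPrime›.ne_top (p.eq_top_iff_one.2 h1), 0, by simp⟩
    | add x₁ x₂ h₁ h₂ =>
      obtain ⟨a₁, ha₁, y₁, h₁⟩ := h₁
      obtain ⟨a₂, ha₂, y₂, h₂⟩ := h₂
      refine ⟨a₁ * a₂, fun hm => (‹p.IsPrime›.mem_or_mem hm).elim ha₁ ha₂, a₂ • y₁ + a₁ • y₂, ?_⟩
      rw [smul_add, map_add, map_smul, map_smul, ← h₁, ← h₂, smul_smul, smul_smul, mul_comm a₂]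
    | tmul k c =>
      obtain ⟨a, b, hb, rfl⟩ := IsFractionRing.div_surjective (A := z ⧸ p) k
      obtain ⟨a, rfl⟩ := Ideal.Quotient.mk_surjective a
      obtain ⟨b, rfl⟩ := Ideal.Quotient.mk_surjective b
      have hb0 := nonZeroDivisors.ne_zero hb
      refine ⟨b, fun hbp => hb0 (Ideal.Quotient.eq_zero_iff_mem.2 hbp),
        Ideal.Quotient.mk p a ⊗ₜ c, ?_⟩
      have hbK : algebraMap (z ⧸ p) K (Ideal.Quotient.mk p b) ≠ 0 := by
        rw [Ne, map_eq_zero_iff _ (IsFractionRing.injective (z ⧸ p) K)]; exact hb0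
      rw [LinearMap.rTensor_tmul, TensorProduct.smul_tmul', Algebra.smul_def,
        IsScalarTower.algebraMap_apply z (z ⧸ p) K]
      congr 1
      exact mul_div_cancel₀ _ hbK
  intro i j k hi hj hk x
  refine ⟨fun hx => ?_, fun ⟨y, hy⟩ => hy ▸ lTensor_d_d _ _ _ _⟩
  -- over the residue field the cocycle is a boundary, so that `a • x = d v` for some `a ∉ p`
  obtain ⟨y, hy⟩ := (hK i j k hi hj hk (ι.rTensor _ x)).1 (by
    rw [lTensor_rTensor_comm, hx, map_zero])
  obtain ⟨a, ha, v, hv⟩ := hden i y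
  have hinj := Module.Flat.rTensor_preserves_injective_linearMap (M := C.X j) ι hι
  have hxv : a • x = (C.d i j).hom.lTensor _ v := by
    apply hinj
    rw [map_smul, ← hy, ← map_smul, hv, lTensor_rTensor_comm]
  have hcolon : (Submodule.comap (LinearMap.mulLeft z a) p) = p := by
    ext t
    simp only [Submodule.mem_comap, LinearMap.mulLeft_apply]
    exact ⟨fun h => (‹p.IsPrime›.mem_or_mem h).resolve_left ha, fun h => p.mul_mem_left _ h⟩
  have hex := colonMap_exact p a
  have hinj' := colonMap_injective p a
  have hmul : ∀ w, colonMap p a w = a • Submodule.factor hcolon.le w := by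
    intro w
    obtain ⟨w, rfl⟩ := Submodule.Quotient.mk_surjective _ w
    rfl
  let π : (z ⧸ p) →ₗ[z] _ := Submodule.factor (le_sup_left : p ≤ p ⊔ Ideal.span {a})
  have hπ : Function.Surjective π := Submodule.factor_surjective _
  have hmulinj : Function.Injective (LinearMap.lsmul z (z ⧸ p) a) := by
    intro w w' hw
    obtain ⟨w, rfl⟩ := Ideal.Quotient.mk_surjective w
    obtain ⟨w', rfl⟩ := Ideal.Quotient.mk_surjective w'
    apply congrArg (Submodule.factor hcolon.le) (hinj' (a₁ := Submodule.Quotient.mk w)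
      (a₂ := Submodule.Quotient.mk w') ?_)
    rw [hmul, hmul]
    exact hw
  have hexmul : Function.Exact (LinearMap.lsmul z (z ⧸ p) a) π := by
    intro w
    rw [hex w]
    constructor
    · rintro ⟨v, rfl⟩; exact ⟨_, (hmul v).symm⟩
    · rintro ⟨v, rfl⟩
      obtain ⟨v, rfl⟩ := Ideal.Quotient.mk_surjective v
      exact ⟨Submodule.Quotient.mk v, hmul _⟩
  have hsm : ∀ (m : ℤ) (w : (z ⧸ p) ⊗[z] C.X m),
      (LinearMap.lsmul z (z ⧸ p) a).rTensor (C.X m) w = a • w := by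
    intro m w
    have : (LinearMap.lsmul z (z ⧸ p) a).rTensor (C.X m) = LinearMap.lsmul z _ a := by
      ext; simp [TensorProduct.smul_tmul']
    rw [this]; rfl
  -- modulo `p + (a)` the element `v` is a cocycle; subtracting a boundary makes it divisible by `a`
  obtain ⟨u, hu⟩ := (h a ha (i - 1) i j (by omega) hi (by omega) (π.rTensor _ v)).1 (by
    rw [lTensor_rTensor_comm, ← hxv, ← hsm, ← LinearMap.comp_apply, ← LinearMap.rTensor_comp,
      hexmul.linearMap_comp_eq_zero]
    simp)
  obtain ⟨u, rfl⟩ := LinearMap.rTensor_surjective (C.X (i - 1)) hπ u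
  rw [lTensor_rTensor_comm, eq_comm, ← sub_eq_zero, ← map_sub] at hu
  obtain ⟨v', hv'⟩ := (rTensor_exact (C.X i) hexmul hπ _).1 hu
  refine ⟨v', ?_⟩
  apply Module.Flat.rTensor_preserves_injective_linearMap (M := C.X j) _ hmulinj
  rw [← lTensor_rTensor_comm, hv', map_sub, lTensor_d_d, sub_zero, ← hxv, hsm]

variable [IsRegularRing z] {D : ℕ} (hD : ringKrullDim z ≤ D)

include hD in
/-- Over a regular ring of dimension at most `D`, a complex of flat modules that is exact in degrees
at most `n` stays so in degrees at most `n - D` after tensoring with any cyclic module. -/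
theorem tensorExactLE_quotient
    (hC : ∀ i j k : ℤ, i + 1 = j → j + 1 = k → j ≤ n → Function.Exact (C.d i j).hom (C.d j k).hom)
    (J : Ideal z) : TensorExactLE C (z ⧸ J) (n - D) := by
  refine IsNoetherian.induction (P := fun J : Ideal z => TensorExactLE C (z ⧸ J) (n - D))
    (fun (J : Ideal z) ih => ?_) J
  by_cases hJ : J.IsPrime
  · refine TensorExactLE.quotient_prime J (K := J.ResidueField) ?_ ?_
    · have h1 : TensorExactLE C (Localization.AtPrime J) n := TensorExactLE.of_flat hC
      have hrank : (IsLocalRing.maximalIdeal (Localization.AtPrime J)).spanFinrank ≤ D := by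
        have h2 : ((IsLocalRing.maximalIdeal (Localization.AtPrime J)).spanFinrank : WithBot ℕ∞) =
            ringKrullDim (Localization.AtPrime J) := IsRegularLocalRing.spanFinrank_maximalIdeal
        rw [IsLocalization.AtPrime.ringKrullDim_eq_height J] at h2
        have h3 := (h2.le.trans (Ideal.height_le_ringKrullDim_of_ne_top hJ.ne_top)).trans hD
        exact_mod_cast h3
      refine (TensorExactLE.residueField _ n (Localization.AtPrime J) rfl h1 J.ResidueField
        (IsScalarTower.toAlgHom z _ _) IsLocalRing.residue_surjective).mono ?_
      omega
    · intro a ha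
      refine ih _ (lt_of_le_of_ne le_sup_left fun h => ha ?_)
      rw [h]
      exact Ideal.mem_sup_right (Ideal.mem_span_singleton_self a)
  -- for `J` not prime, the exact sequence `0 → z/(J : a) → z/J → z/(J + (a)) → 0` has proper
  -- quotients of `z/J` as outer terms
  · rw [Ideal.not_isPrime_iff] at hJ
    rcases hJ with rfl | ⟨a, ha, b, hb, hab⟩
    · intro i j k _ _ _ x
      have : Subsingleton (z ⧸ (⊤ : Ideal z)) := Ideal.Quotient.subsingleton_iff.2 rfl
      have : Subsingleton ((z ⧸ (⊤ : Ideal z)) ⊗[z] C.X j) := inferInstance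
      exact ⟨fun _ => ⟨0, Subsingleton.elim _ _⟩, fun ⟨y, hy⟩ => hy ▸ lTensor_d_d _ _ _ _⟩
    · refine TensorExactLE.middle (colonMap_injective J a) (colonMap_exact J a)
        (Submodule.factor_surjective _) (ih _ ?_) (ih _ ?_)
      · refine lt_of_le_of_ne (fun x hx => J.mul_mem_left a hx) fun h => hb ?_
        rw [h]
        exact hab
      · refine lt_of_le_of_ne le_sup_left fun h => ha ?_
        rw [h]
        exact Ideal.mem_sup_right (Ideal.mem_span_singleton_self a)

include hD in
/-- Far to the left, the cokernels of an exact complex of flat modules over a regular ring of finite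
dimension are flat. -/
theorem flat_coker_of_exact
    (hC : ∀ i j k : ℤ, i + 1 = j → j + 1 = k → j ≤ n → Function.Exact (C.d i j).hom (C.d j k).hom)
    (i j : ℤ) (hij : i + 1 = j) (hj : j ≤ n - D + 1) :
    Module.Flat z (C.X j ⧸ LinearMap.range (C.d i j).hom) := by
  rw [Module.Flat.iff_lTensor_injective]
  intro J _
  refine lTensor_injective_of_exact_of_exact_of_rTensor_injective
    (f₁ := (LinearMap.range (C.d i j).hom).subtype) (f₂ := (LinearMap.range (C.d i j).hom).mkQ)
    (g₂ := Submodule.mkQ J)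
    (LinearMap.exact_subtype_mkQ _) (Submodule.mkQ_surjective _) (LinearMap.exact_subtype_mkQ _)
    (Submodule.mkQ_surjective _) ?_
    (Module.Flat.lTensor_preserves_injective_linearMap _ J.injective_subtype)
  rw [injective_iff_map_eq_zero]
  intro x hx
  obtain ⟨y, rfl⟩ := LinearMap.rTensor_surjective (z ⧸ J) (C.d i j).hom.surjective_rangeRestrict x
  rw [← LinearMap.comp_apply, ← LinearMap.rTensor_comp] at hx
  change (C.d i j).hom.rTensor (z ⧸ J) y = 0 at hx
  have h1 := (tensorExactLE_quotient hD hC J (i - 1) i j (by omega) hij (by omega)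
    (TensorProduct.comm z _ _ y)).1 (by
      rw [← LinearMap.comm_comp_rTensor_comp_comm_eq]
      simp [hx])
  obtain ⟨w, hw⟩ := h1
  obtain ⟨w, rfl⟩ := (TensorProduct.comm z _ _).surjective w
  rw [← LinearMap.comm_comp_rTensor_comp_comm_eq] at hw
  simp only [LinearMap.coe_comp, Function.comp_apply, LinearEquiv.coe_coe,
    TensorProduct.comm_comm, EmbeddingLike.apply_eq_iff_eq] at hw
  rw [← hw, ← LinearMap.comp_apply, ← LinearMap.rTensor_comp]
  have h0 : (C.d i j).hom.rangeRestrict ∘ₗ (C.d (i - 1) i).hom = 0 := by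
    ext t
    exact congrArg (fun f => f.hom t) (C.d_comp_d (i - 1) i j)
  rw [h0]
  simp

include hD in
/-- A complex of flat modules that is exact in degrees at most `n` stays so in degrees at most `n -
D` after tensoring with any module: far to the left its cokernels are flat. -/
theorem tensorExactLE_of_exact
    (hC : ∀ i j k : ℤ, i + 1 = j → j + 1 = k → j ≤ n → Function.Exact (C.d i j).hom (C.d j k).hom)
    (M : Type u) [AddCommGroup M] [Module z M] : TensorExactLE C M (n - D) := by
  intro i j k hi hj hk x
  refine ⟨fun hx => ?_, fun ⟨y, hy⟩ => hy ▸ lTensor_d_d _ _ _ _⟩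
  have hflat := flat_coker_of_exact hD hC j k hj (by omega)
  have hex := hC i j k hi hj (by omega)
  let g : (C.X j ⧸ LinearMap.range (C.d i j).hom) →ₗ[z] C.X k :=
    Submodule.liftQ _ (C.d j k).hom (fun w hw => (hex w).2 hw)
  have hg : Function.Injective g := by
    rw [← LinearMap.ker_eq_bot]
    exact Submodule.ker_liftQ_eq_bot _ _ _ (fun w hw => (hex w).1 hw)
  have hgf : Function.Exact g (LinearMap.range (C.d j k).hom).mkQ := by
    intro w
    rw [Submodule.mkQ_apply, Submodule.Quotient.mk_eq_zero]
    constructor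
    · rintro ⟨v, rfl⟩; exact ⟨Submodule.Quotient.mk v, rfl⟩
    · rintro ⟨v, rfl⟩
      obtain ⟨v, rfl⟩ := Submodule.Quotient.mk_surjective _ v
      exact ⟨v, rfl⟩
  have hinj := LinearMap.lTensor_injective_of_exact_of_flat _ (Submodule.mkQ_surjective _) g hg
    hgf M
  have h1 : (LinearMap.range (C.d i j).hom).mkQ.lTensor M x = 0 := by
    apply hinj
    rw [map_zero, ← LinearMap.comp_apply, ← LinearMap.lTensor_comp]
    exact hx
  exact (lTensor_exact M (LinearMap.exact_map_mkQ_range _) (Submodule.mkQ_surjective _) x).1 h1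

end IdealQuotient

end TensorExact

/-! ### Morphisms and resolutions in derived categories -/

section Lifts

variable {C : Type (u + 1)} [Category.{u} C] [Abelian C]

theorem exists_Q_map_eq_of_isKProjective {P L : CochainComplex C ℤ} [P.IsKProjective]
    (g : DerivedCategory.Q.obj P ⟶ DerivedCategory.Q.obj L) :
    ∃ f : P ⟶ L, DerivedCategory.Q.map f = g := by
  obtain ⟨f, hf⟩ := (CochainComplex.IsKProjective.Qh_map_bijective P
    ((HomotopyCategory.quotient C (ComplexShape.up ℤ)).obj L)).2
    ((DerivedCategory.quotientCompQhIso C).hom.app P ≫ g ≫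
      (DerivedCategory.quotientCompQhIso C).inv.app L)
  obtain ⟨f, rfl⟩ := (HomotopyCategory.quotient C (ComplexShape.up ℤ)).map_surjective f
  refine ⟨f, ?_⟩
  have := (DerivedCategory.quotientCompQhIso C).hom.naturality f
  rw [← cancel_epi ((DerivedCategory.quotientCompQhIso C).hom.app P), ← this,
    Functor.comp_map, hf]
  simp

theorem exists_Q_map_eq_of_isKInjective {K L : CochainComplex C ℤ} [L.IsKInjective]
    (g : DerivedCategory.Q.obj K ⟶ DerivedCategory.Q.obj L) :
    ∃ f : K ⟶ L, DerivedCategory.Q.map f = g := by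
  obtain ⟨f, hf⟩ := (CochainComplex.IsKInjective.Qh_map_bijective
    ((HomotopyCategory.quotient C (ComplexShape.up ℤ)).obj K) L).2
    ((DerivedCategory.quotientCompQhIso C).hom.app K ≫ g ≫
      (DerivedCategory.quotientCompQhIso C).inv.app L)
  obtain ⟨f, rfl⟩ := (HomotopyCategory.quotient C (ComplexShape.up ℤ)).map_surjective f
  refine ⟨f, ?_⟩
  have := (DerivedCategory.quotientCompQhIso C).hom.naturality f
  rw [← cancel_epi ((DerivedCategory.quotientCompQhIso C).hom.app K), ← this,
    Functor.comp_map, hf]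
  simp

theorem exists_quasiIso_of_isKProjective {P L : CochainComplex C ℤ} [P.IsKProjective]
    (e : DerivedCategory.Q.obj P ≅ DerivedCategory.Q.obj L) : ∃ f : P ⟶ L, QuasiIso f := by
  obtain ⟨f, hf⟩ := exists_Q_map_eq_of_isKProjective e.hom
  refine ⟨f, ?_⟩
  rw [← DerivedCategory.isIso_Q_map_iff_quasiIso, hf]
  infer_instance

theorem exists_quasiIso_of_isKInjective {K L : CochainComplex C ℤ} [L.IsKInjective]
    (e : DerivedCategory.Q.obj K ≅ DerivedCategory.Q.obj L) : ∃ f : K ⟶ L, QuasiIso f := by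
  obtain ⟨f, hf⟩ := exists_Q_map_eq_of_isKInjective e.hom
  refine ⟨f, ?_⟩
  rw [← DerivedCategory.isIso_Q_map_iff_quasiIso, hf]
  infer_instance

theorem nonempty_homotopyEquiv_of_isKProjective {P P' : CochainComplex C ℤ} [P.IsKProjective]
    [P'.IsKProjective] (e : DerivedCategory.Q.obj P ≅ DerivedCategory.Q.obj P') :
    Nonempty (HomotopyEquiv P P') := by
  obtain ⟨f, hf⟩ := exists_quasiIso_of_isKProjective e
  obtain ⟨h, -⟩ := (CochainComplex.IsKProjective.quasiIso_iff f).1 hf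
  exact ⟨h⟩

theorem nonempty_homotopyEquiv_of_isKInjective {K K' : CochainComplex C ℤ} [K.IsKInjective]
    [K'.IsKInjective] (e : DerivedCategory.Q.obj K ≅ DerivedCategory.Q.obj K') :
    Nonempty (HomotopyEquiv K K') := by
  obtain ⟨f, hf⟩ := exists_quasiIso_of_isKInjective e
  obtain ⟨h, -⟩ := (CochainComplex.IsKInjective.quasiIso_iff f).1 hf
  exact ⟨h⟩

/-- Homotopy equivalent complexes are isomorphic in the derived category. -/
noncomputable def isoOfHomotopyEquiv {K K' : CochainComplex C ℤ} (h : HomotopyEquiv K K') :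
    DerivedCategory.Q.obj K ≅ DerivedCategory.Q.obj K' :=
  have := h.quasiIso_hom
  asIso (DerivedCategory.Q.map h.hom)

end Lifts

section LeftResolution

variable {C : Type (u + 1)} [Category.{u} C] [Abelian C]

/-- `X` is represented by a bounded above complex whose terms satisfy `F`. -/
def HasLeftResolution (F : ObjectProperty C) (X : DerivedCategory C) : Prop :=
  ∃ (P : CochainComplex C ℤ) (b : ℤ), P.IsStrictlyLE b ∧ (∀ n, F (P.X n)) ∧
    Nonempty (DerivedCategory.Q.obj P ≅ X)

variable {F : ObjectProperty C}

theorem HasLeftResolution.of_iso {X Y : DerivedCategory C} (h : HasLeftResolution F X)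
    (e : X ≅ Y) : HasLeftResolution F Y := by
  obtain ⟨P, b, hb, hF, ⟨i⟩⟩ := h
  exact ⟨P, b, hb, hF, ⟨i ≪≫ e⟩⟩

theorem HasLeftResolution.shift {X : DerivedCategory C} (h : HasLeftResolution F X) (a : ℤ) :
    HasLeftResolution F (X⟦a⟧) := by
  obtain ⟨P, b, hb, hF, ⟨i⟩⟩ := h
  exact ⟨P⟦a⟧, b - a, P.isStrictlyLE_shift b a _ (by ring), fun n => hF _,
    ⟨(DerivedCategory.Q.commShiftIso a).app P ≪≫ (shiftFunctor _ a).mapIso i⟩⟩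

variable [F.IsClosedUnderIsomorphisms]

/-- The mapping cone of a lift of `T.mor₁` to the resolutions of `T.obj₁` and `T.obj₂` resolves
`T.obj₃`. -/
theorem HasLeftResolution.of_distinguished (hproj : ∀ X, F X → Projective X)
    (hbiprod : ∀ X Y, F X → F Y → F (X ⊞ Y)) (T : Pretriangulated.Triangle (DerivedCategory C))
    (hT : T ∈ Pretriangulated.distinguishedTriangles)
    (h₁ : HasLeftResolution F T.obj₁) (h₂ : HasLeftResolution F T.obj₂) :
    HasLeftResolution F T.obj₃ := by
  obtain ⟨P, b, hb, hP, ⟨i⟩⟩ := h₁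
  obtain ⟨P', b', hb', hP', ⟨i'⟩⟩ := h₂
  have := fun n => hproj _ (hP n)
  have : P.IsKProjective := CochainComplex.isKProjective_of_projective P b
  obtain ⟨f, hf⟩ := exists_Q_map_eq_of_isKProjective (i.hom ≫ T.mor₁ ≫ i'.inv)
  refine ⟨CochainComplex.mappingCone f, max b b', ?_, ?_, ?_⟩
  · rw [CochainComplex.isStrictlyLE_iff]
    intro n hn
    refine (Limits.IsZero.of_iso ?_
      (HomologicalComplex.homotopyCofiber.XIsoBiprod f n (n + 1) rfl))
    rw [Limits.biprod_isZero_iff]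
    exact ⟨P.isZero_of_isStrictlyLE b _ (by have := le_max_left b b'; omega),
      P'.isZero_of_isStrictlyLE b' _ (by have := le_max_right b b'; omega)⟩
  · intro n
    exact F.prop_of_iso (HomologicalComplex.homotopyCofiber.XIsoBiprod f n (n + 1) rfl).symm
      (hbiprod _ _ (hP _) (hP' _))
  · have hd : DerivedCategory.Q.mapTriangle.obj (CochainComplex.mappingCone.triangle f) ∈
        Pretriangulated.distinguishedTriangles :=
      (DerivedCategory.mem_distTriang_iff _).2 ⟨_, _, f, ⟨Iso.refl _⟩⟩
    obtain ⟨e, -⟩ := Pretriangulated.exists_iso_of_arrow_iso _ _ hd hT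
      (Arrow.isoMk i i' (by
        change i.hom ≫ T.mor₁ = DerivedCategory.Q.map f ≫ i'.hom
        rw [hf]; simp))
    exact ⟨(Pretriangulated.Triangle.π₃).mapIso e⟩

/-- Bounded complexes are left resolved by objects of `F` as soon as their cohomology objects
are. -/
theorem HasLeftResolution.of_homology (hproj : ∀ X, F X → Projective X)
    (hbiprod : ∀ X Y, F X → F Y → F (X ⊞ Y)) (M : ObjectProperty C)
    [M.IsClosedUnderIsomorphisms] (hzero : ∀ X, Limits.IsZero X → M X)
    (hM : ∀ X, M X → HasLeftResolution F ((DerivedCategory.singleFunctor C 0).obj X))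
    (n : ℕ) : ∀ (a : ℤ) (X : DerivedCategory C), X.IsGE a → X.IsLE (a + n) →
      (∀ i, M ((DerivedCategory.homologyFunctor C i).obj X)) → HasLeftResolution F X := by
  have hsingle : ∀ (a : ℤ) (X : DerivedCategory C), X.IsGE a → X.IsLE a →
      (∀ i, M ((DerivedCategory.homologyFunctor C i).obj X)) → HasLeftResolution F X := by
    intro a X _ _ hX
    obtain ⟨A, ⟨e⟩⟩ := DerivedCategory.exists_iso_singleFunctor_obj_of_isGE_of_isLE X a
    have e2 : A ≅ (DerivedCategory.homologyFunctor C a).obj X :=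
      ((DerivedCategory.singleFunctorCompHomologyFunctorIso C a).symm.app A) ≪≫
        (DerivedCategory.homologyFunctor C a).mapIso e.symm
    refine ((hM A (M.prop_of_iso e2.symm (hX a))).shift (-a)).of_iso (Iso.trans ?_ e.symm)
    exact (((DerivedCategory.singleFunctors C).shiftIso (-a) a 0 (by simp)).app A)
  induction n with
  | zero => intro a X h1 h2 hX; exact hsingle a X h1 (by simpa using h2) hX
  | succ n ih =>
    intro a X h1 h2 hX
    obtain ⟨K, ⟨e⟩⟩ : ∃ K, Nonempty (DerivedCategory.Q.obj K ≅ X) :=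
      ⟨_, ⟨DerivedCategory.Q.objObjPreimageIso X⟩⟩
    have hKM : ∀ i, M (K.homology i) := fun i => M.prop_of_iso
      ((DerivedCategory.homologyFunctor C i).mapIso e.symm ≪≫
        (DerivedCategory.homologyFunctorFactors C i).app K) (hX i)
    have hKGE : K.IsGE a := by
      rw [← DerivedCategory.isGE_Q_obj_iff]
      exact DerivedCategory.TStructure.t.isGE_of_iso e.symm a
    have hKLE : K.IsLE (a + (n + 1 : ℕ)) := by
      rw [← DerivedCategory.isLE_Q_obj_iff]
      exact DerivedCategory.TStructure.t.isLE_of_iso e.symm _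
    -- induction on the amplitude, through the triangle of the truncation at `a`
    have hlt : HasLeftResolution F (DerivedCategory.Q.obj (K.truncLE a)) := by
      have hGE : (K.truncLE a).IsGE a := by
        rw [CochainComplex.isGE_iff]
        intro i hi
        have h3 := K.exactAt_of_isGE a i hi
        rw [HomologicalComplex.exactAt_iff_isZero_homology] at h3 ⊢
        have := K.quasiIsoAt_ιTruncLE a i hi.le
        exact h3.of_iso (asIso (HomologicalComplex.homologyMap (K.ιTruncLE a) i))
      refine hsingle a _ inferInstance inferInstance fun i => ?_
      refine M.prop_of_iso ((DerivedCategory.homologyFunctorFactors C i).symm.app _) ?_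
      by_cases hi : i ≤ a
      · have := K.quasiIsoAt_ιTruncLE a i hi
        exact M.prop_of_iso (asIso (HomologicalComplex.homologyMap (K.ιTruncLE a) i)).symm (hKM i)
      · refine hzero _ ?_
        have h3 := (K.truncLE a).exactAt_of_isLE a i (by omega)
        rwa [HomologicalComplex.exactAt_iff_isZero_homology] at h3
    have hge : HasLeftResolution F (DerivedCategory.Q.obj (K.truncGE (a + 1))) := by
      have hLE : (K.truncGE (a + 1)).IsLE (a + 1 + n) := by
        rw [CochainComplex.isLE_iff]
        intro i hi
        have h3 := K.exactAt_of_isLE (a + (n + 1 : ℕ)) i (by push_cast; omega)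
        rw [HomologicalComplex.exactAt_iff_isZero_homology] at h3 ⊢
        have := K.quasiIsoAt_πTruncGE (a + 1) i (by omega)
        exact h3.of_iso (asIso (HomologicalComplex.homologyMap (K.πTruncGE (a + 1)) i)).symm
      refine ih (a + 1) _ inferInstance inferInstance fun i => ?_
      refine M.prop_of_iso ((DerivedCategory.homologyFunctorFactors C i).symm.app _) ?_
      by_cases hi : a + 1 ≤ i
      · have := K.quasiIsoAt_πTruncGE (a + 1) i hi
        exact M.prop_of_iso (isoOfQuasiIsoAt (K.πTruncGE (a + 1)) i) (hKM i)
      · refine hzero _ ?_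
        have h3 := (K.truncGE (a + 1)).exactAt_of_isGE (a + 1) i (by omega)
        rwa [HomologicalComplex.exactAt_iff_isZero_homology] at h3
    have hS := K.shortComplexTruncLE_shortExact a
    have hT := Pretriangulated.inv_rot_of_distTriang _
      (DerivedCategory.triangleOfSES_distinguished hS)
    refine (HasLeftResolution.of_distinguished hproj hbiprod _ hT ?_ hlt).of_iso e
    exact (hge.of_iso (asIso (DerivedCategory.Q.map
      (K.shortComplexTruncLEX₃ToTruncGE a (a + 1)))).symm).shift (-1)

end LeftResolution

/-! ### Complexes of modules -/

section ModuleComplexes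

variable {S : Type u} [Ring S]

theorem exactAt_iff_function_exact (K : CochainComplex (ModuleCat.{u} S) ℤ) (i j k : ℤ)
    (hij : i + 1 = j) (hjk : j + 1 = k) :
    K.ExactAt j ↔ Function.Exact (K.d i j).hom (K.d j k).hom := by
  rw [K.exactAt_iff' i j k (by simp [← hij]) (by simp [hjk]),
    ShortComplex.ShortExact.moduleCat_exact_iff_function_exact]
  rfl

theorem exact_of_exactAt {K : CochainComplex (ModuleCat.{u} S) ℤ} {j : ℤ} (h : K.ExactAt j)
    (i : ℤ) (hij : i + 1 = j) (k : ℤ) (x : K.X j) (hx : (K.d j k).hom x = 0) (hk : j + 1 = k) :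
    ∃ y : K.X i, (K.d i j).hom y = x :=
  ((exactAt_iff_function_exact K i j k hij hk).1 h x).1 hx

theorem d_d_apply (K : CochainComplex (ModuleCat.{u} S) ℤ) (i j k : ℤ) (x : K.X i) :
    (K.d j k).hom ((K.d i j).hom x) = 0 := by
  rw [← LinearMap.comp_apply, ← ModuleCat.hom_comp, K.d_comp_d]; rfl

theorem comm_apply {K L : CochainComplex (ModuleCat.{u} S) ℤ} (f : K ⟶ L) (i j : ℤ) (x : K.X i) :
    (f.f j).hom ((K.d i j).hom x) = (L.d i j).hom ((f.f i).hom x) := by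
  rw [← LinearMap.comp_apply, ← ModuleCat.hom_comp, ← f.comm]; rfl

end ModuleComplexes

section Acyclic

variable {C : Type (u + 1)} [Category.{u} C] [Abelian C]

theorem isZero_Q_obj_iff_acyclic (K : CochainComplex C ℤ) :
    Limits.IsZero (DerivedCategory.Q.obj K) ↔ K.Acyclic := by
  constructor
  · intro h i
    rw [HomologicalComplex.exactAt_iff_isZero_homology]
    exact ((DerivedCategory.homologyFunctor C i).map_isZero h).of_iso
      ((DerivedCategory.homologyFunctorFactors C i).symm.app K)
  · intro h
    have hq : QuasiIso (0 : K ⟶ K) := by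
      rw [quasiIso_iff]
      intro i
      rw [quasiIsoAt_iff_exactAt _ _ (h i)]
      exact h i
    rw [← DerivedCategory.isIso_Q_map_iff_quasiIso, Functor.map_zero] at hq
    exact (Limits.isIsoZeroEquivIsoZero _ _ hq).1.isZero_iff.2 (Limits.isZero_zero _)

theorem quasiIso_iff_acyclic_mappingCone {K L : CochainComplex C ℤ} (f : K ⟶ L) :
    QuasiIso f ↔ (CochainComplex.mappingCone f).Acyclic := by
  have hd : DerivedCategory.Q.mapTriangle.obj (CochainComplex.mappingCone.triangle f) ∈
      Pretriangulated.distinguishedTriangles :=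
    (DerivedCategory.mem_distTriang_iff _).2 ⟨_, _, f, ⟨Iso.refl _⟩⟩
  rw [← isZero_Q_obj_iff_acyclic, ← DerivedCategory.isIso_Q_map_iff_quasiIso]
  exact (Pretriangulated.Triangle.isZero₃_iff_isIso₁ _ hd).symm

theorem acyclic_of_iso {K L : CochainComplex C ℤ} (e : K ≅ L) (h : K.Acyclic) : L.Acyclic :=
  fun i => (h i).of_iso e

end Acyclic

section Elements

open CochainComplex

variable {S : Type u} [Ring S] {K L : CochainComplex (ModuleCat.{u} S) ℤ} (f : K ⟶ L)

theorem mappingCone_ext {i j : ℤ} (hij : i + 1 = j) {x y : (mappingCone f).X i}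
    (h₁ : ((mappingCone.fst f).1.v i j hij).hom x = ((mappingCone.fst f).1.v i j hij).hom y)
    (h₂ : ((mappingCone.snd f).v i i (add_zero i)).hom x =
      ((mappingCone.snd f).v i i (add_zero i)).hom y) : x = y := by
  have h := mappingCone.id_X f i j hij
  rw [← LinearMap.id_apply (R := S) x, ← LinearMap.id_apply (R := S) y, ← ModuleCat.hom_id, ← h]
  simp only [ModuleCat.hom_add, ModuleCat.hom_comp, LinearMap.add_apply, LinearMap.comp_apply,
    h₁, h₂]

theorem exists_mappingCone_apply {i j : ℤ} (hij : i + 1 = j) (a : K.X j) (b : L.X i) :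
    ∃ x : (mappingCone f).X i, ((mappingCone.fst f).1.v i j hij).hom x = a ∧
      ((mappingCone.snd f).v i i (add_zero i)).hom x = b := by
  refine ⟨((mappingCone.inl f).v j i (by omega)).hom a + ((mappingCone.inr f).f i).hom b, ?_, ?_⟩
  · rw [map_add, ← LinearMap.comp_apply, ← LinearMap.comp_apply, ← ModuleCat.hom_comp,
      ← ModuleCat.hom_comp]
    simp
  · rw [map_add, ← LinearMap.comp_apply, ← LinearMap.comp_apply, ← ModuleCat.hom_comp,
      ← ModuleCat.hom_comp]
    simp

theorem mappingCone_fst_d {i j k : ℤ} (hij : i + 1 = j) (hjk : j + 1 = k)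
    (x : (mappingCone f).X i) :
    ((mappingCone.fst f).1.v j k hjk).hom (((mappingCone f).d i j).hom x) =
      -(K.d j k).hom (((mappingCone.fst f).1.v i j hij).hom x) := by
  have := congrArg (fun g => g.hom x) (mappingCone.d_fst_v f i j k hij hjk)
  simpa using this

theorem mappingCone_snd_d {i j : ℤ} (hij : i + 1 = j) (x : (mappingCone f).X i) :
    ((mappingCone.snd f).v j j (add_zero j)).hom (((mappingCone f).d i j).hom x) =
      (f.f j).hom (((mappingCone.fst f).1.v i j hij).hom x) +
        (L.d i j).hom (((mappingCone.snd f).v i i (add_zero i)).hom x) := by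
  have := congrArg (fun g => g.hom x) (mappingCone.d_snd_v f i j hij)
  simpa using this

/-- A map of complexes of modules is a quasi-isomorphism if and only if it is surjective and
injective on cohomology, in terms of elements. -/
theorem quasiIso_iff_elements :
    QuasiIso f ↔
    (∀ (i j k : ℤ), i + 1 = j → j + 1 = k → ∀ y : L.X j, (L.d j k).hom y = 0 →
      ∃ (x : K.X j) (w : L.X i), (K.d j k).hom x = 0 ∧ y = (f.f j).hom x + (L.d i j).hom w) ∧
    (∀ (i j k : ℤ), i + 1 = j → j + 1 = k → ∀ x : K.X j, (K.d j k).hom x = 0 →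
      ∀ w : L.X i, (f.f j).hom x = (L.d i j).hom w → ∃ v : K.X i, x = (K.d i j).hom v) := by
  rw [quasiIso_iff_acyclic_mappingCone]
  constructor
  · intro h
    refine ⟨fun i j k hij hjk y hy => ?_, fun i j k hij hjk x hx w hw => ?_⟩
    · obtain ⟨y', h1, h2⟩ := exists_mappingCone_apply f hjk 0 y
      obtain ⟨x, hx⟩ := exact_of_exactAt (h j) i hij k y' (by
        refine mappingCone_ext f (i := k) (j := k + 1) rfl ?_ ?_
        · rw [mappingCone_fst_d f hjk rfl, h1]; simp
        · rw [mappingCone_snd_d f hjk, h1, h2, hy]; simp) hjk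
      refine ⟨((mappingCone.fst f).1.v i j hij).hom x,
        ((mappingCone.snd f).v i i (add_zero i)).hom x, ?_, ?_⟩
      · have := mappingCone_fst_d f hij hjk x
        rw [hx, h1] at this
        exact neg_eq_zero.1 this.symm
      · rw [← mappingCone_snd_d f hij, hx, h2]
    · obtain ⟨y', h1, h2⟩ := exists_mappingCone_apply f hij x (-w)
      obtain ⟨v, hv⟩ := exact_of_exactAt (h i) (i - 1) (by omega) j y' (by
        refine mappingCone_ext f hjk ?_ ?_
        · rw [mappingCone_fst_d f hij hjk, h1, hx]; simp
        · rw [mappingCone_snd_d f hij, h1, h2, hw]; simp) hij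
      refine ⟨-((mappingCone.fst f).1.v (i - 1) i (by omega)).hom v, ?_⟩
      rw [map_neg, ← mappingCone_fst_d f (by omega) hij, hv, h1]
  · rintro ⟨hs, hi⟩ j
    rw [exactAt_iff_function_exact _ (j - 1) j (j + 1) (by omega) rfl]
    intro x
    refine ⟨fun hx => ?_, ?_⟩
    · have h1 := mappingCone_fst_d f (j := j + 1) rfl rfl x
      have h2 := mappingCone_snd_d f (j := j + 1) rfl x
      rw [hx, map_zero] at h1 h2
      obtain ⟨v, hv⟩ := hi j (j + 1) (j + 1 + 1) rfl rfl _ (neg_eq_zero.1 h1.symm)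
        (-((mappingCone.snd f).v j j (add_zero j)).hom x) (by
          rw [map_neg]; exact eq_neg_of_add_eq_zero_left h2.symm)
      obtain ⟨x', w, hx', hw⟩ := hs (j - 1) j (j + 1) (by omega) rfl
        (((mappingCone.snd f).v j j (add_zero j)).hom x + (f.f j).hom v) (by
          rw [map_add, ← comm_apply, add_comm ((L.d j (j + 1)).hom _)]
          exact (congrArg (fun t => (f.f (j + 1)).hom t + _) hv.symm).trans h2.symm)
      obtain ⟨y, h3, h4⟩ := exists_mappingCone_apply f (i := j - 1) (j := j) (by omega)
        (x' - v) w
      refine ⟨y, mappingCone_ext f (j := j + 1) rfl ?_ ?_⟩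
      · rw [mappingCone_fst_d f (by omega) rfl, h3, map_sub, hx', hv]; simp
      · rw [mappingCone_snd_d f (by omega), h3, h4, map_sub, sub_add_eq_add_sub, ← hw]; simp
    · rintro ⟨y, rfl⟩
      exact d_d_apply _ _ _ _ _

end Elements

section ModuleResolutions

variable {S : Type u} [Ring S] {F M : ObjectProperty (ModuleCat.{u} S)}

/-- If every module in the class `M` is a quotient of a projective module in the class `F` with
kernel in `M`, then iterating this gives left resolutions. -/
theorem hasLeftResolution_single [F.IsClosedUnderIsomorphisms] (hproj : ∀ X, F X → Projective X)
    (hzero : ∀ X, Limits.IsZero X → F X)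
    (h : ∀ X, M X → ∃ (P : ModuleCat.{u} S) (π : P ⟶ X), F P ∧ Epi π ∧ M (Limits.kernel π))
    (X : ModuleCat.{u} S) (hX : M X) :
    HasLeftResolution F ((DerivedCategory.singleFunctor (ModuleCat.{u} S) 0).obj X) := by
  choose P π hP hπ hK using h
  let K : ℕ → { Y // M Y } := fun n => n.rec ⟨X, hX⟩ fun _ Y => ⟨Limits.kernel (π Y.1 Y.2), hK _ _⟩
  let p : ∀ n, P (K n).1 (K n).2 ⟶ (K n).1 := fun n => π _ _
  have hp : ∀ n, Epi (p n) := fun n => hπ _ _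
  let κ : ∀ n, (K (n + 1)).1 ⟶ P (K n).1 (K n).2 := fun n => Limits.kernel.ι (p n)
  have hκ : ∀ n, κ n ≫ p n = 0 := fun n => Limits.kernel.condition _
  have hκm : ∀ n, Mono (κ n) := fun n =>
    inferInstanceAs (Mono (Limits.equalizer.ι (p n) 0))
  have hexact : ∀ n, (ShortComplex.mk (κ n) (p n) (hκ n)).Exact := fun n =>
    ShortComplex.exact_kernel (p n)
  have hd : ∀ n, (p (n + 1 + 1) ≫ κ (n + 1)) ≫ (p (n + 1) ≫ κ n) = 0 := fun n => by
    simp [reassoc_of% hκ]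
  let Q : ChainComplex (ModuleCat.{u} S) ℕ :=
    ChainComplex.of (fun n => P (K n).1 (K n).2) (fun n => p (n + 1) ≫ κ n) hd
  have hQd : ∀ n, Q.d (n + 1) n = p (n + 1) ≫ κ n := fun n =>
    ChainComplex.of_d (fun n => P (K n).1 (K n).2) (d := fun n => p (n + 1) ≫ κ n) n
  have hex0 : ∀ n, (ShortComplex.mk (p (n + 1) ≫ κ n) (p n) (by simp [hκ])).Exact := fun n => by
    rw [ShortComplex.moduleCat_exact_iff]
    intro x hx
    obtain ⟨y, hy⟩ := (ShortComplex.moduleCat_exact_iff _).1 (hexact n) x hx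
    obtain ⟨w, hw⟩ := (ModuleCat.epi_iff_surjective _).1 (hp (n + 1)) y
    exact ⟨w, (congrArg (κ n) hw).trans hy⟩
  have hex1 : ∀ n, (ShortComplex.mk _ _ (hd n)).Exact := fun n => by
    rw [ShortComplex.moduleCat_exact_iff]
    intro x hx
    refine (ShortComplex.moduleCat_exact_iff _).1 (hex0 (n + 1)) x ?_
    exact (ModuleCat.mono_iff_injective _).1 (hκm n) (hx.trans (map_zero (κ n).hom).symm)
  have hQ : ∀ n, Projective (Q.X n) := fun n => hproj _ (hP _ _)
  let ε : Q ⟶ (ChainComplex.single₀ _).obj X :=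
    (ChainComplex.toSingle₀Equiv _ _).symm ⟨p 0, by
      rw [hQd, Category.assoc, hκ, Limits.comp_zero]⟩
  have hε : QuasiIso ε := by
    refine ⟨fun n => ?_⟩
    cases n with
    | zero =>
      rw [ChainComplex.quasiIsoAt₀_iff, ShortComplex.quasiIso_iff_of_zeros']
      · refine (ShortComplex.exact_and_epi_g_iff_of_iso ?_).2 ⟨hex0 0, hp 0⟩
        exact ShortComplex.isoMk (Iso.refl _) (Iso.refl _) (Iso.refl _)
          ((Category.id_comp _).trans ((hQd 0).symm.trans (Category.comp_id _).symm))
          (by simp [ε]; exact (Category.id_comp _).trans (Category.comp_id _).symm)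
      all_goals rfl
    | succ n =>
      rw [quasiIsoAt_iff_exactAt']
      · rw [HomologicalComplex.exactAt_iff' _ (n + 1 + 1) (n + 1) n (by simp) (by simp)]
        refine ShortComplex.exact_of_iso ?_ (hex1 n)
        exact ShortComplex.isoMk (Iso.refl _) (Iso.refl _) (Iso.refl _)
          ((Category.id_comp _).trans ((hQd (n + 1)).trans (Category.comp_id _).symm))
          ((Category.id_comp _).trans ((hQd n).trans (Category.comp_id _).symm))
      · apply ChainComplex.exactAt_succ_single_obj
  let R : ProjectiveResolution X := { complex := Q, π := ε }
  refine ⟨R.cochainComplex, 0, inferInstance, fun n => ?_, ⟨?_⟩⟩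
  · by_cases hn : n ≤ 0
    · obtain ⟨k, rfl⟩ := Int.exists_eq_neg_ofNat hn
      exact F.prop_of_iso (R.cochainComplexXIso (-k) k).symm (hP _ _)
    · exact hzero _ (CochainComplex.isZero_of_isStrictlyLE _ 0 _)
  · exact asIso (DerivedCategory.Q.map R.π') ≪≫
      ((SingleFunctors.evaluation _ _ 0).mapIso
        (DerivedCategory.singleFunctorsPostcompQIso (ModuleCat.{u} S))).symm.app X

/-- Projective modules. -/
abbrev projectives (S : Type u) [Ring S] : ObjectProperty (ModuleCat.{u} S) := fun X => Projective X

/-- Finitely generated modules. -/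
abbrev finiteModules (S : Type u) [Ring S] : ObjectProperty (ModuleCat.{u} S) :=
  fun X => Module.Finite S X

/-- Finitely generated free modules. -/
abbrev finiteFreeModules (S : Type u) [Ring S] : ObjectProperty (ModuleCat.{u} S) :=
  fun X => Module.Free S X ∧ Module.Finite S X

instance : (projectives S).IsClosedUnderIsomorphisms where
  of_iso e h := Projective.of_iso e h

instance : (finiteModules S).IsClosedUnderIsomorphisms where
  of_iso e h := by
    have : Module.Finite S _ := h
    exact Module.Finite.equiv e.toLinearEquiv

instance : (finiteFreeModules S).IsClosedUnderIsomorphisms where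
  of_iso e h := by
    obtain ⟨h1, h2⟩ := h
    exact ⟨Module.Free.of_equiv e.toLinearEquiv, Module.Finite.equiv e.toLinearEquiv⟩

theorem projective_of_finiteFree {X : ModuleCat.{u} S} (h : finiteFreeModules S X) :
    Projective X := by
  have := h.1
  exact (IsProjective.iff_projective X).1 (Module.Projective.of_free (P := X))

/-- Bounded complexes have bounded above projective resolutions. -/
theorem hasLeftResolution_projective (X : DerivedCategory (ModuleCat.{u} S)) {a b : ℤ}
    [h₁ : X.IsGE a] [h₂ : X.IsLE b] : HasLeftResolution (projectives S) X := by
  obtain ⟨n, hn⟩ : ∃ n : ℕ, b ≤ a + n := ⟨(b - a).toNat, by omega⟩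
  refine HasLeftResolution.of_homology (fun _ h => h) (fun X Y hX hY => ?_) ⊤ (fun _ _ => trivial)
    (fun X hX => hasLeftResolution_single (fun _ h => h)
      (fun X hX => hX.projective) (fun Y _ => ⟨Projective.over Y, Projective.π Y,
      inferInstanceAs (Projective (Projective.over Y)), inferInstance, trivial⟩) X hX)
    n a X h₁ ?_ (fun _ => trivial)
  · have : Projective X := hX
    have : Projective Y := hY
    exact inferInstanceAs (Projective (X ⊞ Y))
  · exact DerivedCategory.TStructure.t.isLE_of_le X b _ hn

theorem hasLeftResolution_finiteFree_single [IsNoetherianRing S] (X : ModuleCat.{u} S)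
    (hX : Module.Finite S X) : HasLeftResolution (finiteFreeModules S)
      ((DerivedCategory.singleFunctor (ModuleCat.{u} S) 0).obj X) := by
  refine hasLeftResolution_single (M := finiteModules S) (fun _ h => projective_of_finiteFree h)
      (fun X hX => ?_) (fun Y hY => ?_) X hX
  · have := ModuleCat.subsingleton_of_isZero hX
    exact ⟨inferInstanceAs (Module.Free S X), inferInstanceAs (Module.Finite S X)⟩
  · have : Module.Finite S Y := hY
    obtain ⟨m, f, hf⟩ := Module.Finite.exists_fin' S Y
    let e : ULift.{u} (Fin m) ≃ Fin m := Equiv.ulift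
    refine ⟨ModuleCat.of S (ULift.{u} (Fin m) → S),
      ModuleCat.ofHom (f ∘ₗ (LinearEquiv.funCongrLeft S S e.symm).toLinearMap), ?_, ?_, ?_⟩
    · exact ⟨inferInstanceAs (Module.Free S (ULift.{u} (Fin m) → S)),
        inferInstanceAs (Module.Finite S (ULift.{u} (Fin m) → S))⟩
    · rw [ModuleCat.epi_iff_surjective]
      exact hf.comp (LinearEquiv.surjective _)
    · have : IsNoetherian S (ULift.{u} (Fin m) → S) := inferInstance
      exact Module.Finite.of_injective (Limits.kernel.ι (ModuleCat.ofHom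
        (f ∘ₗ (LinearEquiv.funCongrLeft S S e.symm).toLinearMap))).hom
        ((ModuleCat.mono_iff_injective _).1 inferInstance)

/-- Over a Noetherian ring, bounded complexes with finitely generated cohomology have bounded above
resolutions by finitely generated free modules. -/
theorem hasLeftResolution_finiteFree [IsNoetherianRing S] (X : DerivedCategory (ModuleCat.{u} S))
    {a b : ℤ} [h₁ : X.IsGE a] [h₂ : X.IsLE b]
    (hX : ∀ i, Module.Finite S ((DerivedCategory.homologyFunctor (ModuleCat.{u} S) i).obj X)) :
    HasLeftResolution (finiteFreeModules S) X := by
  obtain ⟨n, hn⟩ : ∃ n : ℕ, b ≤ a + n := ⟨(b - a).toNat, by omega⟩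
  refine HasLeftResolution.of_homology (fun _ h => projective_of_finiteFree h)
    (fun X Y hX hY => ?_) (finiteModules S) (fun X hX => ?_) hasLeftResolution_finiteFree_single
    n a X h₁ ?_ hX
  · obtain ⟨h1, h2⟩ := hX
    obtain ⟨h3, h4⟩ := hY
    have e := (ModuleCat.biprodIsoProd X Y).toLinearEquiv
    exact ⟨Module.Free.of_equiv e.symm, Module.Finite.equiv e.symm⟩
  · have := ModuleCat.subsingleton_of_isZero hX
    exact inferInstanceAs (Module.Finite S X)
  · exact DerivedCategory.TStructure.t.isLE_of_le X b _ hn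

end ModuleResolutions

/-! ### Base change along a homomorphism of commutative rings -/

section BaseChangeFunctor

attribute [local instance] baseModule baseModule_isScalarTower tensorModule

section TensorElements

variable {z : Type u} [CommRing z] {S c : Type u} [Ring S] [Algebra z S] [Ring c] [Algebra z c]
  (X : ModuleCat.{u} c) (M : ModuleCat.{u} S)

variable {X M} in
/-- The element `a ⊗ m` of the tensor product of two modules. -/
def tensorMk (a : X) (m : M) : ((tensorFunctor z c S).obj X).obj M := a ⊗ₜ[z] m

variable {X M}

theorem tensor_induction {p : ((tensorFunctor z c S).obj X).obj M → Prop}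
    (x : ((tensorFunctor z c S).obj X).obj M)
    (zero : p 0) (mk : ∀ a m, p (tensorMk a m)) (add : ∀ x y, p x → p y → p (x + y)) : p x :=
  TensorProduct.induction_on (motive := p) x zero mk add

theorem tensorMk_add (a : X) (m m' : M) :
    tensorMk (z := z) a (m + m') = tensorMk a m + tensorMk a m' :=
  TensorProduct.tmul_add _ _ _

theorem add_tensorMk (a a' : X) (m : M) :
    tensorMk (z := z) (a + a') m = tensorMk a m + tensorMk a' m :=
  TensorProduct.add_tmul _ _ _

theorem tensorMk_zero (a : X) : tensorMk (z := z) a (0 : M) = 0 :=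
  TensorProduct.tmul_zero _ _

theorem zero_tensorMk (m : M) : tensorMk (z := z) (0 : X) m = 0 :=
  TensorProduct.zero_tmul _ _

theorem algebraMap_smul_tensorMk (r : z) (a : X) (m : M) :
    tensorMk (z := z) (algebraMap z c r • a) m = tensorMk a (algebraMap z S r • m) :=
  TensorProduct.smul_tmul r a m

theorem tmul_smul_tensorMk (a : c) (s : S) (x : X) (m : M) :
    (a ⊗ₜ[z] s : c ⊗[z] S) • tensorMk (z := z) x m = tensorMk (a • x) (s • m) :=
  rfl

/-- The additive map on a tensor product of modules given by a balanced biadditive map. -/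
def tensorLift {P : Type*} [AddCommGroup P] (g : X →+ M →+ P)
    (hg : ∀ (r : z) a m, g (algebraMap z c r • a) m = g a (algebraMap z S r • m)) :
    ((tensorFunctor z c S).obj X).obj M →+ P :=
  TensorProduct.liftAddHom (R := z) (M := X) (N := M) g hg

end TensorElements

variable {z : Type u} [CommRing z] {S T c : Type u} [Ring S] [Algebra z S] [CommRing c]
  [Algebra z c] [Ring T] (σ : T ≃+* c ⊗[z] S)

/-- Base change `M ↦ c ⊗_z M` of modules over a `z`-algebra `S`, with values in the modules over a
ring `T` identified with `c ⊗_z S`. -/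
noncomputable abbrev bc : ModuleCat.{u} S ⥤ ModuleCat.{u} T :=
  (tensorFunctor z c S).obj (ModuleCat.of c c) ⋙ ModuleCat.restrictScalars σ.toRingHom

/-- The homomorphism `s ↦ 1 ⊗ s` from `S` to `T ≃ c ⊗_z S`. -/
noncomputable def bcInclude : S →+* T :=
  σ.symm.toRingHom.comp (Algebra.TensorProduct.includeRight (R := z) (A := c) (B := S)).toRingHom

/-- The element `a ⊗ m` of the base change of `M`. -/
noncomputable def bcMk {M : ModuleCat.{u} S} (a : c) (m : M) : (bc σ).obj M :=
  tensorMk (X := ModuleCat.of c c) (z := z) a m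

theorem bc_induction {M : ModuleCat.{u} S} {p : (bc σ).obj M → Prop} (x : (bc σ).obj M)
    (zero : p 0) (mk : ∀ a m, p (bcMk σ a m)) (add : ∀ x y, p x → p y → p (x + y)) : p x :=
  tensor_induction (z := z) (X := ModuleCat.of c c) (p := p) x zero mk add

theorem bcMk_add {M : ModuleCat.{u} S} (a : c) (m m' : M) :
    bcMk σ a (m + m') = bcMk σ a m + bcMk σ a m' :=
  tensorMk_add (X := ModuleCat.of c c) a m m'

theorem add_bcMk {M : ModuleCat.{u} S} (a a' : c) (m : M) :
    bcMk σ (a + a') m = bcMk σ a m + bcMk σ a' m :=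
  add_tensorMk (X := ModuleCat.of c c) a a' m

@[simp]
theorem bcMk_zero {M : ModuleCat.{u} S} (a : c) : bcMk σ a (0 : M) = 0 :=
  tensorMk_zero (X := ModuleCat.of c c) a

theorem zero_bcMk {M : ModuleCat.{u} S} (m : M) : bcMk σ (0 : c) m = 0 :=
  zero_tensorMk (X := ModuleCat.of c c) m

theorem algebraMap_bcMk {M : ModuleCat.{u} S} (r : z) (a : c) (m : M) :
    bcMk σ (algebraMap z c r * a) m = bcMk σ a (algebraMap z S r • m) :=
  algebraMap_smul_tensorMk (X := ModuleCat.of c c) r a m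

theorem symm_tmul_smul_bcMk {M : ModuleCat.{u} S} (a a' : c) (s : S) (m : M) :
    σ.symm (a ⊗ₜ s) • bcMk σ a' m = bcMk σ (a * a') (s • m) := by
  have h : σ.symm (a ⊗ₜ s) • bcMk σ a' m =
      (σ (σ.symm (a ⊗ₜ s)) • (tensorMk (X := ModuleCat.of c c) (z := z) a' m) :
        ((tensorFunctor z c S).obj (ModuleCat.of c c)).obj M) := rfl
  rw [h, σ.apply_symm_apply]
  rfl

theorem smul_bc_induction {p : T → Prop} (t : T) (zero : p 0) (mk : ∀ a s, p (σ.symm (a ⊗ₜ s)))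
    (add : ∀ x y, p x → p y → p (x + y)) : p t := by
  rw [← σ.symm_apply_apply t]
  induction σ t using TensorProduct.induction_on with
  | zero => simpa
  | tmul a s => exact mk a s
  | add x y hx hy => simpa using add _ _ hx hy

theorem bcMk_eq_smul {M : ModuleCat.{u} S} (a : c) (m : M) :
    bcMk σ a m = σ.symm (a ⊗ₜ 1) • bcMk σ 1 m := by
  rw [symm_tmul_smul_bcMk, mul_one, one_smul]

theorem bc_map_bcMk {M N : ModuleCat.{u} S} (f : M ⟶ N) (a : c) (m : M) :
    ((bc σ).map f).hom (bcMk σ a m) = bcMk σ a (f.hom m) :=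
  rfl

theorem bcInclude_smul_bcMk {M : ModuleCat.{u} S} (s : S) (a : c) (m : M) :
    bcInclude σ s • bcMk σ a m = bcMk σ a (s • m) := by
  change σ.symm ((1 : c) ⊗ₜ s) • _ = _
  rw [symm_tmul_smul_bcMk, one_mul]

theorem bc_hom_ext {M : ModuleCat.{u} S} {N : ModuleCat.{u} T} {f g : (bc σ).obj M ⟶ N}
    (h : ∀ m : M, f.hom (bcMk σ 1 m) = g.hom (bcMk σ 1 m)) : f = g := by
  ext x
  induction x using bc_induction with
  | zero => rw [map_zero, map_zero]
  | mk a m => rw [bcMk_eq_smul, map_smul, map_smul, h]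
  | add x y hx hy => rw [map_add, map_add, hx, hy]

/-- The linear map `c ⊗_z M → N` that extends an `S`-linear map `M → N` to a `T`-module `N`. -/
noncomputable def bcLift {M : ModuleCat.{u} S} {N : ModuleCat.{u} T}
    (h : M ⟶ (ModuleCat.restrictScalars (bcInclude σ)).obj N) : (bc σ).obj M ⟶ N :=
  let h₀ : M →+ N := h.hom.toAddMonoidHom
  have hs : ∀ (s : S) (m : M), h₀ (s • m) = bcInclude σ s • h₀ m :=
    fun s m => map_smul h.hom s m
  let l : (bc σ).obj M →+ N := tensorLift (z := z) (X := ModuleCat.of c c) (M := M) (P := N)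
    { toFun := fun a : c =>
        (DistribSMul.toAddMonoidHom N (σ.symm (a ⊗ₜ[z] (1 : S)))).comp h₀
      map_zero' := by
        ext m
        change σ.symm ((0 : c) ⊗ₜ[z] (1 : S)) • h₀ m = (0 : N)
        rw [TensorProduct.zero_tmul, map_zero, zero_smul]
      map_add' := fun a b : c => by
        ext m
        change σ.symm ((a + b) ⊗ₜ[z] (1 : S)) • h₀ m =
          σ.symm (a ⊗ₜ[z] (1 : S)) • h₀ m + σ.symm (b ⊗ₜ[z] (1 : S)) • h₀ m
        rw [TensorProduct.add_tmul, map_add, add_smul] }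
    (fun (r : z) (a : c) (m : M) => by
      change σ.symm ((algebraMap z c r * a) ⊗ₜ[z] (1 : S)) • h₀ m =
        σ.symm (a ⊗ₜ[z] (1 : S)) • h₀ (algebraMap z S r • m)
      rw [hs, smul_smul]
      congr 1
      change _ = _ * σ.symm ((1 : c) ⊗ₜ[z] algebraMap z S r)
      rw [← map_mul, Algebra.TensorProduct.tmul_mul_tmul, mul_one, one_mul,
        Algebra.algebraMap_eq_smul_one, Algebra.algebraMap_eq_smul_one, smul_mul_assoc, one_mul,
        TensorProduct.smul_tmul])
  have hl : ∀ (a : c) (m : M), l (bcMk σ a m) = σ.symm (a ⊗ₜ[z] (1 : S)) • h₀ m :=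
    fun a m => rfl
  ModuleCat.ofHom (X := (bc σ).obj M)
    { toFun := l
      map_add' := map_add l
      map_smul' := fun t x => by
        change l (t • x) = t • l x
        induction t using smul_bc_induction σ with
        | zero => rw [zero_smul, zero_smul, map_zero]
        | add t t' h1 h2 => rw [add_smul, add_smul, map_add, h1, h2]
        | mk a s =>
          induction x using bc_induction with
          | zero => rw [smul_zero, map_zero, smul_zero]
          | add x y h1 h2 => rw [smul_add, map_add, map_add, smul_add, h1, h2]
          | mk a' m =>
            rw [symm_tmul_smul_bcMk, hl, hl, hs, smul_smul, smul_smul]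
            congr 1
            change _ * σ.symm ((1 : c) ⊗ₜ[z] s) = _
            rw [← map_mul, ← map_mul]
            simp }

theorem bcLift_bcMk {M : ModuleCat.{u} S} {N : ModuleCat.{u} T}
    (h : M ⟶ (ModuleCat.restrictScalars (bcInclude σ)).obj N) (a : c) (m : M) :
    (bcLift σ h).hom (bcMk σ a m) = σ.symm (a ⊗ₜ (1 : S)) • (h.hom m : N) :=
  rfl

theorem bcLift_one {M : ModuleCat.{u} S} {N : ModuleCat.{u} T}
    (h : M ⟶ (ModuleCat.restrictScalars (bcInclude σ)).obj N) (m : M) :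
    (bcLift σ h).hom (bcMk σ 1 m) = (h.hom m : N) := by
  rw [bcLift_bcMk, ← Algebra.TensorProduct.one_def, map_one, one_smul]

/-- The map `m ↦ 1 ⊗ m`. -/
noncomputable def bcUnit (M : ModuleCat.{u} S) :
    M ⟶ (ModuleCat.restrictScalars (bcInclude σ)).obj ((bc σ).obj M) :=
  ModuleCat.ofHom (Y := (ModuleCat.restrictScalars (bcInclude σ)).obj ((bc σ).obj M))
    { toFun := fun m => bcMk σ 1 m
      map_add' := bcMk_add σ 1
      map_smul' := fun s m => (bcInclude_smul_bcMk σ s 1 m).symm }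

/-- Base change is left adjoint to restriction of scalars. -/
noncomputable def bcAdj : bc σ ⊣ ModuleCat.restrictScalars.{u} (bcInclude σ) :=
  Adjunction.mkOfHomEquiv
    { homEquiv := fun M N =>
        { toFun := fun g => bcUnit σ M ≫ (ModuleCat.restrictScalars (bcInclude σ)).map g
          invFun := fun h => bcLift σ h
          left_inv := fun g => bc_hom_ext σ fun m => bcLift_one σ _ m
          right_inv := fun h => by
            ext m
            exact bcLift_one σ h m }
      homEquiv_naturality_left_symm := fun f g => bc_hom_ext σ fun m =>
        (bcLift_one σ _ m).trans (bcLift_one σ g (f.hom m)).symm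
      homEquiv_naturality_right := fun f g => rfl }

instance : (bc σ).IsLeftAdjoint := (bcAdj σ).isLeftAdjoint

end BaseChangeFunctor

section BaseChangeComplexes

attribute [local instance 50] baseModule baseModule_isScalarTower tensorModule

variable {z : Type u} [CommRing z] {S T c : Type u} [Ring S] [Algebra z S] [CommRing c]
  [Algebra z c] [Ring T] (σ : T ≃+* c ⊗[z] S)

theorem bc_map_projective {P : ModuleCat.{u} S} (hP : Projective P) : Projective ((bc σ).obj P) :=
  (bcAdj σ).map_projective P hP

theorem flat_finsupp {ι : Type*} {M : Type*} [AddCommGroup M] [Module z M] [Module.Flat z M] :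
    Module.Flat z (ι →₀ M) := by
  classical
  exact Module.Flat.of_linearEquiv (finsuppLequivDFinsupp (ι := ι) (M := M) z)

theorem flat_prod {M N : Type*} [AddCommGroup M] [AddCommGroup N] [Module z M] [Module z N]
    [Module.Flat z M] [Module.Flat z N] : Module.Flat z (M × N) := by
  rw [Module.Flat.iff_rTensor_preserves_injective_linearMap]
  intro A B _ _ _ _ f hf
  rw [injective_iff_map_eq_zero]
  intro x hx
  have h : ∀ y : A ⊗[z] (M × N), TensorProduct.prodRight z z B M N (f.rTensor _ y) =
      (f.rTensor M).prodMap (f.rTensor N) (TensorProduct.prodRight z z A M N y) := fun y => by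
    induction y with
    | zero => rw [map_zero, map_zero, map_zero, map_zero]
    | tmul a m => simp
    | add y₁ y₂ h₁ h₂ => simp only [map_add, h₁, h₂]
  have h0 := h x
  rw [hx, map_zero] at h0
  refine (TensorProduct.prodRight z z A M N).injective ?_
  rw [map_zero]
  refine Prod.ext ?_ ?_
  · exact Module.Flat.rTensor_preserves_injective_linearMap f hf
      ((congrArg Prod.fst h0).symm.trans (map_zero _).symm)
  · exact Module.Flat.rTensor_preserves_injective_linearMap f hf
      ((congrArg Prod.snd h0).symm.trans (map_zero _).symm)

/-- Projective modules over a flat `z`-algebra are flat over `z`. -/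
theorem flat_of_projective [Module.Flat z S] (P : ModuleCat.{u} S) [hP : Projective P] :
    Module.Flat z P := by
  have h1 : Module.Projective S P := (IsProjective.iff_projective P).2 hP
  obtain ⟨s, hs⟩ := h1.out
  have : Module.Flat z (P →₀ S) := flat_finsupp
  exact Module.Flat.of_retract (s.restrictScalars z)
    ((Finsupp.linearCombination S (id : P → P)).restrictScalars z)
    (LinearMap.ext fun x => hs x)

/-- A complex of `S`-modules, as a complex of `z`-modules. -/
noncomputable abbrev baseComplex (K : CochainComplex (ModuleCat.{u} S) ℤ) :
    CochainComplex (ModuleCat.{u} z) ℤ :=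
  ((ModuleCat.restrictScalars (algebraMap z S)).mapHomologicalComplex _).obj K

theorem baseComplex_exact {K : CochainComplex (ModuleCat.{u} S) ℤ} {n : ℤ}
    (hK : ∀ j ≤ n, K.ExactAt j) (i j k : ℤ) (hij : i + 1 = j) (hjk : j + 1 = k) (hj : j ≤ n) :
    Function.Exact ((baseComplex (z := z) K).d i j).hom ((baseComplex (z := z) K).d j k).hom :=
  (exactAt_iff_function_exact K i j k hij hjk).1 (hK j hj)

variable [IsRegularRing z] {D : ℕ} (hD : ringKrullDim z ≤ D)
include hD

/-- For a complex of flat modules, `tensorExactLE_of_exact` in terms of the functor `X ⊗_z -`. -/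
theorem tensorFunctor_exactAt (X : ModuleCat.{u} c) (K : CochainComplex (ModuleCat.{u} S) ℤ)
    [hflat : ∀ i, Module.Flat z (K.X i)] {n : ℤ} (hK : ∀ j ≤ n, K.ExactAt j) (j : ℤ)
    (hj : j ≤ n - D) :
    ((((tensorFunctor z c S).obj X).mapHomologicalComplex _).obj K).ExactAt j := by
  have : ∀ i, Module.Flat z ((baseComplex (z := z) K).X i) := hflat
  rw [exactAt_iff_function_exact _ (j - 1) j (j + 1) (by omega) rfl]
  exact tensorExactLE_of_exact hD (baseComplex_exact (z := z) hK) X (j - 1) j (j + 1) (by omega) rfl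
    hj

/-- Base change of a complex of flat modules over a regular ring of finite dimension preserves
exactness in small degrees. -/
theorem bc_exactAt (K : CochainComplex (ModuleCat.{u} S) ℤ)
    [hflat : ∀ i, Module.Flat z (K.X i)] {n : ℤ} (hK : ∀ j ≤ n, K.ExactAt j) (j : ℤ)
    (hj : j ≤ n - D) : (((bc σ).mapHomologicalComplex _).obj K).ExactAt j := by
  have h := tensorFunctor_exactAt hD (ModuleCat.of c c) K hK j hj
  rw [exactAt_iff_function_exact _ (j - 1) j (j + 1) (by omega) rfl] at h ⊢
  exact h

theorem bc_acyclic (K : CochainComplex (ModuleCat.{u} S) ℤ)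
    [hflat : ∀ i, Module.Flat z (K.X i)] (hK : K.Acyclic) :
    (((bc σ).mapHomologicalComplex _).obj K).Acyclic :=
  fun j => bc_exactAt σ hD K (n := j + D) (fun i _ => hK i) j (by omega)

/-- A quasi-isomorphism between complexes of flat modules, bounded or not, remains one after base
change, since its cone remains acyclic. -/
theorem bc_quasiIso {K L : CochainComplex (ModuleCat.{u} S) ℤ}
    [hK : ∀ i, Module.Flat z (K.X i)] [hL : ∀ i, Module.Flat z (L.X i)] (f : K ⟶ L) [QuasiIso f] :
    QuasiIso (((bc σ).mapHomologicalComplex _).map f) := by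
  have hf : QuasiIso f := inferInstance
  rw [quasiIso_iff_acyclic_mappingCone] at hf ⊢
  have hflat : ∀ i, Module.Flat z ((CochainComplex.mappingCone f).X i) := fun i => by
    let e := ((HomologicalComplex.homotopyCofiber.XIsoBiprod f i (i + 1) rfl) ≪≫
      ModuleCat.biprodIsoProd _ _).toLinearEquiv
    have : Module.Flat z (K.X (i + 1) × L.X i) := flat_prod
    exact Module.Flat.of_linearEquiv (e.restrictScalars z)
  exact acyclic_of_iso (CochainComplex.mappingCone.mapHomologicalComplexIso f (bc σ))
    (bc_acyclic σ hD _ hf)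

omit [Algebra z c] in
/-- Truncating a complex of flat modules below its cohomology gives a complex of flat modules. -/
theorem flat_truncGE (K : CochainComplex (ModuleCat.{u} S) ℤ)
    [hflat : ∀ i, Module.Flat z (K.X i)] {n : ℤ} (hK : ∀ j ≤ n, K.ExactAt j) (i : ℤ) :
    Module.Flat z ((K.truncGE (n - D + 1)).X i) := by
  have : ∀ i, Module.Flat z ((baseComplex (z := z) K).X i) := hflat
  obtain hi | rfl | hi := lt_trichotomy i (n - D + 1)
  · have := ModuleCat.subsingleton_of_isZero
      ((K.truncGE (n - D + 1)).isZero_of_isStrictlyGE (n - D + 1) i hi)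
    infer_instance
  · have h := flat_coker_of_exact hD (baseComplex_exact (z := z) hK) (n - D) (n - D + 1) rfl le_rfl
    let e₁ := K.opcyclesIsCokernel (n - D) (n - D + 1) (by simp)
    let e₂ := ModuleCat.cokernelIsColimit (K.d (n - D) (n - D + 1))
    let e := (K.truncGEXIsoOpcycles (n - D + 1) ≪≫
      e₁.coconePointUniqueUpToIso e₂).toLinearEquiv
    let Q := ModuleCat.of S (K.X (n - D + 1) ⧸ LinearMap.range (K.d (n - D) (n - D + 1)).hom)
    let e₃ : Q ≃+ ((baseComplex (z := z) K).X (n - D + 1) ⧸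
        LinearMap.range ((baseComplex (z := z) K).d (n - D) (n - D + 1)).hom) :=
      (Submodule.Quotient.restrictScalarsEquiv z
        (LinearMap.range (K.d (n - D) (n - D + 1)).hom)).symm.toAddEquiv
    have hQ : Module.Flat z Q := Module.Flat.of_linearEquiv (e₃.toLinearEquiv fun r x => by
      obtain ⟨x, rfl⟩ := Submodule.Quotient.mk_surjective _ x
      rfl)
    exact @Module.Flat.of_linearEquiv _ _ _ _ _ _ _ _ hQ (e.restrictScalars z)
  · exact Module.Flat.of_linearEquiv
      ((K.truncGEXIso (n - D + 1) i hi).toLinearEquiv.restrictScalars z)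

end BaseChangeComplexes

/-! ### Hom complexes as complexes of modules -/

section HomComplexes

open CochainComplex CochainComplex.HomComplex

variable {S B : Type u} [Ring S] [Ring B] {F F' G G' : CochainComplex (ModuleCat.{u} S) ℤ}

/-- The `B`-module structure on the cochains from `F` to `G` induced by an action of `B` on `G`. -/
abbrev cochainModule (F : CochainComplex (ModuleCat.{u} S) ℤ) (ρ : B →+* End G) (n : ℤ) :
    Module B (Cochain F G n) where
  smul b φ := φ.comp (Cochain.ofHom (ρ b)) (add_zero n)
  one_smul φ := by
    change φ.comp (Cochain.ofHom (ρ 1)) (add_zero n) = φ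
    rw [map_one]
    exact Cochain.comp_id φ
  mul_smul b b' φ := by
    change φ.comp (Cochain.ofHom (ρ (b * b'))) (add_zero n) =
      (φ.comp (Cochain.ofHom (ρ b')) (add_zero n)).comp (Cochain.ofHom (ρ b)) (add_zero n)
    rw [map_mul, Cochain.comp_assoc_of_third_is_zero_cochain, ← Cochain.ofHom_comp]
    rfl
  smul_zero b := Cochain.zero_comp _ _
  smul_add b φ ψ := Cochain.add_comp _ _ _ _
  add_smul b b' φ := by
    change φ.comp (Cochain.ofHom (ρ (b + b'))) (add_zero n) = _
    rw [map_add]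
    exact (congrArg (fun t => φ.comp t (add_zero n)) (Cochain.ofHom_add _ _)).trans
      (Cochain.comp_add _ _ _ _)
  zero_smul φ := by
    change φ.comp (Cochain.ofHom (ρ 0)) (add_zero n) = 0
    rw [map_zero]
    exact (congrArg (fun t => φ.comp t (add_zero n)) (Cochain.ofHom_zero _ _)).trans
      (Cochain.comp_zero _ _)

/-- The complex of homomorphisms from `F` to `G`, as a complex of modules over a ring `B` that acts
on `G`. -/
noncomputable def homComplex (F : CochainComplex (ModuleCat.{u} S) ℤ) (ρ : B →+* End G) :
    CochainComplex (ModuleCat.{u} B) ℤ where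
  X n := @ModuleCat.of B _ (Cochain F G n) _ (cochainModule F ρ n)
  d i j := @ModuleCat.ofHom B _ _ _ _ (cochainModule F ρ i) _ (cochainModule F ρ j)
    (letI := cochainModule F ρ i
     letI := cochainModule F ρ j
     { toFun := δ i j
       map_add' := δ_add i j
       map_smul' := fun b φ => δ_comp_ofHom φ (ρ b) j })
  shape i j h := by
    let _ := cochainModule F ρ i
    let _ := cochainModule F ρ j
    exact ModuleCat.hom_ext (LinearMap.ext fun φ => δ_shape i j h φ)
  d_comp_d' i j k _ _ := by
    let _ := cochainModule F ρ i
    let _ := cochainModule F ρ k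
    exact ModuleCat.hom_ext (LinearMap.ext fun φ => δ_δ i j k φ)

/-- A cochain, as an element of the Hom complex. -/
def homComplexMk (ρ : B →+* End G) {n : ℤ} (φ : Cochain F G n) : (homComplex F ρ).X n := φ

/-- An element of the Hom complex, as a cochain. -/
def homComplexVal {ρ : B →+* End G} {n : ℤ} (φ : (homComplex F ρ).X n) : Cochain F G n := φ

theorem homComplex_d_apply (ρ : B →+* End G) (i j : ℤ) (φ : Cochain F G i) :
    ((homComplex F ρ).d i j).hom (homComplexMk ρ φ) = homComplexMk ρ (δ i j φ) :=
  rfl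

theorem homComplex_smul (ρ : B →+* End G) {n : ℤ} (b : B) (φ : Cochain F G n) :
    b • homComplexMk ρ φ = homComplexMk ρ (φ.comp (Cochain.ofHom (ρ b)) (add_zero n)) :=
  rfl

/-- The map of Hom complexes given by composition with an equivariant map. -/
noncomputable def homComplexMapRight (F : CochainComplex (ModuleCat.{u} S) ℤ) {ρ : B →+* End G}
    {ρ' : B →+* End G'} (f : G ⟶ G') (hf : ∀ b, (ρ b : G ⟶ G) ≫ f = f ≫ (ρ' b : G' ⟶ G')) :
    homComplex F ρ ⟶ homComplex F ρ' where
  f n := ModuleCat.ofHom (X := (homComplex F ρ).X n) (Y := (homComplex F ρ').X n)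
    { toFun := fun φ => homComplexMk ρ' ((homComplexVal φ).comp (Cochain.ofHom f) (add_zero n))
      map_add' := fun φ ψ => Cochain.add_comp _ _ _ _
      map_smul' := fun b φ => by
        change ((homComplexVal φ).comp (Cochain.ofHom (ρ b : G ⟶ G)) (add_zero n)).comp
          (Cochain.ofHom f) (add_zero n) = ((homComplexVal φ).comp (Cochain.ofHom f)
            (add_zero n)).comp (Cochain.ofHom (ρ' b : G' ⟶ G')) (add_zero n)
        rw [Cochain.comp_assoc_of_third_is_zero_cochain,
          Cochain.comp_assoc_of_third_is_zero_cochain, ← Cochain.ofHom_comp, ← Cochain.ofHom_comp,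
          hf] }
  comm' i j _ := by
    ext φ
    exact δ_comp_ofHom (homComplexVal φ) f j

/-- The map of Hom complexes given by precomposition. -/
noncomputable def homComplexMapLeft (ρ : B →+* End G) (f : F ⟶ F') :
    homComplex F' ρ ⟶ homComplex F ρ where
  f n := ModuleCat.ofHom (X := (homComplex F' ρ).X n) (Y := (homComplex F ρ).X n)
    { toFun := fun φ => homComplexMk ρ ((Cochain.ofHom f).comp (homComplexVal φ) (zero_add n))
      map_add' := fun φ ψ => Cochain.comp_add _ _ _ _
      map_smul' := fun b φ =>
        (Cochain.comp_assoc_of_third_is_zero_cochain _ _ _ _).symm }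
  comm' i j _ := by
    ext φ
    exact δ_ofHom_comp f (homComplexVal φ) j

end HomComplexes

section Cocycles

open CochainComplex CochainComplex.HomComplex

variable {C : Type (u + 1)} [Category.{u} C] [Abelian C] {K L L' J : CochainComplex C ℤ}

theorem acyclic_shift (hL : L.Acyclic) (n : ℤ) : (L⟦n⟧).Acyclic := by
  rw [← isZero_Q_obj_iff_acyclic] at hL ⊢
  exact ((CategoryTheory.shiftFunctor _ n).map_isZero hL).of_iso
    ((DerivedCategory.Q.commShiftIso n).app L)

theorem eq_δ_iff_toHom_eq_zero {n m : ℤ} (hm : m + 1 = n) (x : Cocycle K L n) :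
    (∃ α : Cochain K L m, δ m n α = x) ↔ (CohomologyClass.mk x).toHom = 0 := by
  rw [CohomologyClass.toHom_mk_eq_zero_iff, mem_coboundaries_iff _ _ hm]

theorem eq_δ_of_cocycle_of_isKProjective [K.IsKProjective] (hL : L.Acyclic) {n m : ℤ}
    (hm : m + 1 = n) (x : Cocycle K L n) : ∃ α : Cochain K L m, δ m n α = x := by
  rw [eq_δ_iff_toHom_eq_zero hm]
  obtain ⟨f, hf⟩ := (HomotopyCategory.quotient C _).map_surjective (CohomologyClass.mk x).toHom
  obtain ⟨h⟩ := IsKProjective.nonempty_homotopy_zero f (acyclic_shift hL n)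
  rw [← hf, HomotopyCategory.eq_of_homotopy _ _ h, Functor.map_zero]

/-- Morphisms in the derived category from a K-projective complex, or to a K-injective one, are
cohomology classes of the Hom complex. -/
theorem forall_eq_δ_iff_subsingleton
    (hKL : ∀ n : ℤ, Function.Bijective (DerivedCategory.Qh.map :
      ((HomotopyCategory.quotient C (ComplexShape.up ℤ)).obj K ⟶
        (HomotopyCategory.quotient C (ComplexShape.up ℤ)).obj (L⟦n⟧)) → _))
    {n m : ℤ} (hm : m + 1 = n) :
    (∀ x : Cocycle K L n, ∃ α : Cochain K L m, δ m n α = x) ↔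
      Subsingleton (DerivedCategory.Q.obj K ⟶ (DerivedCategory.Q.obj L)⟦n⟧) := by
  have e : ((HomotopyCategory.quotient C _).obj K ⟶ (HomotopyCategory.quotient C _).obj (L⟦n⟧)) ≃
      (DerivedCategory.Q.obj K ⟶ (DerivedCategory.Q.obj L)⟦n⟧) :=
    (Equiv.ofBijective _ (hKL n)).trans
      (Iso.homCongr ((DerivedCategory.quotientCompQhIso C).app K)
        ((DerivedCategory.quotientCompQhIso C).app (L⟦n⟧) ≪≫
          (DerivedCategory.Q.commShiftIso n).app L))
  rw [← e.subsingleton_congr]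
  constructor
  · intro h
    refine ⟨fun f g => ?_⟩
    have h0 : ∀ f : (HomotopyCategory.quotient C _).obj K ⟶
        (HomotopyCategory.quotient C _).obj (L⟦n⟧), f = 0 := fun f => by
      obtain ⟨x, rfl⟩ := (CohomologyClass.toHom_bijective K L n).2 f
      obtain ⟨x, rfl⟩ := x.mk_surjective
      exact (eq_δ_iff_toHom_eq_zero hm x).1 (h x)
    rw [h0 f, h0 g]
  · intro h x
    rw [eq_δ_iff_toHom_eq_zero hm]
    exact Subsingleton.elim _ _

theorem forall_eq_δ_iff_of_isKProjective [K.IsKProjective] {n m : ℤ} (hm : m + 1 = n) :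
    (∀ x : Cocycle K L n, ∃ α : Cochain K L m, δ m n α = x) ↔
      Subsingleton (DerivedCategory.Q.obj K ⟶ (DerivedCategory.Q.obj L)⟦n⟧) :=
  forall_eq_δ_iff_subsingleton (fun _ => IsKProjective.Qh_map_bijective _ _) hm

theorem forall_eq_δ_iff_of_isKInjective [L.IsKInjective] {n m : ℤ} (hm : m + 1 = n) :
    (∀ x : Cocycle K L n, ∃ α : Cochain K L m, δ m n α = x) ↔
      Subsingleton (DerivedCategory.Q.obj K ⟶ (DerivedCategory.Q.obj L)⟦n⟧) :=
  forall_eq_δ_iff_subsingleton (fun _ => IsKInjective.Qh_map_bijective _ _) hm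

/-- Composition with a quasi-isomorphism `f` is surjective on cohomology of Hom complexes, as soon
as cocycles with values in the cone of `f` are coboundaries. -/
theorem exists_cocycle_comp_right (f : L ⟶ L')
    (hcone : ∀ (n m : ℤ), m + 1 = n → ∀ x : Cocycle K (mappingCone f) n,
      ∃ α : Cochain K (mappingCone f) m, δ m n α = x)
    {i j k : ℤ} (hij : i + 1 = j) (hjk : j + 1 = k) (ψ : Cochain K L' j) (hψ : δ j k ψ = 0) :
    ∃ (φ : Cochain K L j) (w : Cochain K L' i), δ j k φ = 0 ∧
      ψ = φ.comp (Cochain.ofHom f) (add_zero j) + δ i j w := by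
  obtain ⟨α, hα⟩ := hcone j i hij (Cocycle.mk (ψ.comp (Cochain.ofHom (mappingCone.inr f))
    (add_zero j)) k hjk (by rw [δ_comp_ofHom, hψ, Cochain.zero_comp]))
  replace hα : δ i j α = ψ.comp (Cochain.ofHom (mappingCone.inr f)) (add_zero j) := hα
  have h1 := congrArg (fun t => t.comp (mappingCone.snd f) (add_zero j)) hα
  have h2 := congrArg (fun t => t.comp (mappingCone.fst f).1 hjk) hα
  have h3 := δ_comp α (mappingCone.snd f) (add_zero i) j 1 j hij hij (zero_add 1)
  have h4 := δ_comp α (mappingCone.fst f).1 hij j 2 k hjk hij rfl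
  rw [Cocycle.δ_eq_zero, Cochain.comp_zero, zero_add] at h4
  rw [Cochain.comp_assoc_of_second_is_zero_cochain, mappingCone.inr_snd, Cochain.comp_id] at h1
  rw [Cochain.comp_assoc_of_second_is_zero_cochain, mappingCone.inr_fst, Cochain.comp_zero] at h2
  rw [mappingCone.δ_snd, h1] at h3
  refine ⟨α.comp (mappingCone.fst f).1 hij, α.comp (mappingCone.snd f) (add_zero i), ?_, ?_⟩
  · rw [h4, h2, smul_zero]
  · rw [h3, Cochain.comp_neg, Cochain.comp_assoc_of_third_is_zero_cochain]
    simp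

/-- Composition with a quasi-isomorphism `f` is injective on cohomology of Hom complexes, as soon as
cocycles with values in the cone of `f` are coboundaries. -/
theorem exists_eq_δ_comp_right (f : L ⟶ L')
    (hcone : ∀ (n m : ℤ), m + 1 = n → ∀ x : Cocycle K (mappingCone f) n,
      ∃ α : Cochain K (mappingCone f) m, δ m n α = x)
    {i j k : ℤ} (hij : i + 1 = j) (hjk : j + 1 = k) (φ : Cochain K L j) (hφ : δ j k φ = 0)
    (w : Cochain K L' i) (hw : φ.comp (Cochain.ofHom f) (add_zero j) = δ i j w) :
    ∃ v : Cochain K L i, φ = δ i j v := by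
  obtain ⟨α, hα⟩ := hcone i (i - 1) (by omega) (Cocycle.mk
    (φ.comp (mappingCone.inl f) (by omega) - w.comp (Cochain.ofHom (mappingCone.inr f))
    (add_zero i)) j hij (by
      rw [δ_sub, δ_comp_ofHom, δ_comp φ (mappingCone.inl f) (n₁₂ := i) (by omega) k 0 j hij hjk
        (by omega), hφ, Cochain.zero_comp, smul_zero, add_zero, mappingCone.δ_inl,
        Cochain.ofHom_comp, ← Cochain.comp_assoc_of_third_is_zero_cochain, hw, sub_self]))
  replace hα : δ (i - 1) i α = φ.comp (mappingCone.inl f) (by omega) -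
    w.comp (Cochain.ofHom (mappingCone.inr f)) (add_zero i) := hα
  have h2 := congrArg (fun t => t.comp (mappingCone.fst f).1 hij) hα
  have h4 := δ_comp α (mappingCone.fst f).1 (sub_add_cancel i 1) i 2 j hij (by omega) rfl
  rw [Cocycle.δ_eq_zero, Cochain.comp_zero, zero_add] at h4
  rw [Cochain.sub_comp, Cochain.comp_assoc_of_second_is_zero_cochain, mappingCone.inr_fst,
    Cochain.comp_zero, sub_zero, Cochain.comp_assoc _ _ _ _ (neg_add_cancel 1) (by omega),
    mappingCone.inl_fst, Cochain.comp_id] at h2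
  rw [h2] at h4
  refine ⟨-α.comp (mappingCone.fst f).1 (sub_add_cancel i 1), ?_⟩
  rw [δ_neg, h4]
  simp

end Cocycles

section Cocycles

open CochainComplex CochainComplex.HomComplex

variable {C : Type (u + 1)} [Category.{u} C] [Abelian C] {K K' J : CochainComplex C ℤ}

/-- Precomposition with a quasi-isomorphism `f` is surjective on cohomology of Hom complexes, as
soon as cocycles on the cone of `f` are coboundaries. -/
theorem exists_cocycle_comp_left (f : K ⟶ K')
    (hcone : ∀ (n m : ℤ), m + 1 = n → ∀ x : Cocycle (mappingCone f) J n,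
      ∃ α : Cochain (mappingCone f) J m, δ m n α = x)
    {i j k : ℤ} (hij : i + 1 = j) (hjk : j + 1 = k) (ψ : Cochain K J j) (hψ : δ j k ψ = 0) :
    ∃ (φ : Cochain K' J j) (w : Cochain K J i), δ j k φ = 0 ∧
      ψ = (Cochain.ofHom f).comp φ (zero_add j) + δ i j w := by
  obtain ⟨α, hα⟩ := hcone k j hjk (Cocycle.mk ((mappingCone.fst f).1.comp ψ (by omega)) (k + 1) rfl
    (by
      rw [δ_comp (mappingCone.fst f).1 ψ (n₁₂ := k) (by omega) 2 k (k + 1) rfl rfl hjk,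
        Cocycle.δ_eq_zero, hψ, Cochain.comp_zero, Cochain.zero_comp, smul_zero, add_zero]))
  replace hα : δ j k α = (mappingCone.fst f).1.comp ψ (by omega) := hα
  refine ⟨-(j.negOnePow • (Cochain.ofHom (mappingCone.inr f)).comp α (zero_add j)),
    (mappingCone.inl f).comp α (by omega), ?_, ?_⟩
  · rw [δ_neg, δ_units_smul, δ_ofHom_comp, hα, ← Cochain.comp_assoc_of_first_is_zero_cochain,
      mappingCone.inr_fst, Cochain.zero_comp, smul_zero, neg_zero]
  · rw [δ_comp (mappingCone.inl f) α (n₁₂ := i) (by omega) 0 k j hij (by omega) hjk, hα,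
      mappingCone.δ_inl, ← Cochain.comp_assoc _ _ _ (neg_add_cancel 1) (by omega) (by omega),
      mappingCone.inl_fst, Cochain.id_comp, Cochain.ofHom_comp,
      Cochain.comp_assoc_of_first_is_zero_cochain, Cochain.comp_neg, Cochain.comp_units_smul]
    abel

/-- Composition with a quasi-isomorphism `f` is injective on cohomology of Hom complexes, as soon as
cocycles on the cone of `f` are coboundaries. -/
theorem exists_eq_δ_comp_left (f : K ⟶ K')
    (hcone : ∀ (n m : ℤ), m + 1 = n → ∀ x : Cocycle (mappingCone f) J n,
      ∃ α : Cochain (mappingCone f) J m, δ m n α = x)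
    {i j k : ℤ} (hij : i + 1 = j) (hjk : j + 1 = k) (φ : Cochain K' J j) (hφ : δ j k φ = 0)
    (w : Cochain K J i) (hw : (Cochain.ofHom f).comp φ (zero_add j) = δ i j w) :
    ∃ v : Cochain K' J i, φ = δ i j v := by
  obtain ⟨α, hα⟩ := hcone j i hij (Cocycle.mk ((mappingCone.snd f).comp φ (zero_add j) +
    j.negOnePow • (mappingCone.fst f).1.comp w (by omega)) k hjk (by
      rw [δ_add, δ_units_smul, δ_comp (mappingCone.fst f).1 w (n₁₂ := j) (by omega) 2 j k hjk
        rfl hij,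
        Cocycle.δ_eq_zero, Cochain.zero_comp, smul_zero, add_zero, ← hw,
        δ_zero_cochain_comp _ _ k hjk, hφ, Cochain.comp_zero, mappingCone.δ_snd, zero_add,
        Cochain.neg_comp, Cochain.comp_assoc_of_second_is_zero_cochain, smul_neg, neg_add_cancel]))
  replace hα : δ i j α = (mappingCone.snd f).comp φ (zero_add j) +
    j.negOnePow • (mappingCone.fst f).1.comp w (by omega) := hα
  refine ⟨(Cochain.ofHom (mappingCone.inr f)).comp α (zero_add i), ?_⟩
  rw [δ_ofHom_comp, hα, Cochain.comp_add, Cochain.comp_units_smul,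
    ← Cochain.comp_assoc_of_first_is_zero_cochain, ← Cochain.comp_assoc_of_first_is_zero_cochain,
    mappingCone.inr_fst, mappingCone.inr_snd, Cochain.id_comp, Cochain.zero_comp, smul_zero,
    add_zero]

end Cocycles

section HomComplexes

open CochainComplex CochainComplex.HomComplex

variable {S B : Type u} [Ring S] [Ring B] {F F' G G' : CochainComplex (ModuleCat.{u} S) ℤ}

theorem quasiIso_homComplexMapRight [F.IsKProjective] {ρ : B →+* End G}
    {ρ' : B →+* End G'} (f : G ⟶ G') (hf : ∀ b, (ρ b : G ⟶ G) ≫ f = f ≫ (ρ' b : G' ⟶ G'))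
    [hq : QuasiIso f] : QuasiIso (homComplexMapRight F f hf) := by
  have hcone : ∀ (n m : ℤ), m + 1 = n → ∀ x : Cocycle F (mappingCone f) n,
      ∃ α : Cochain F (mappingCone f) m, δ m n α = x := fun n m hm x =>
    eq_δ_of_cocycle_of_isKProjective ((quasiIso_iff_acyclic_mappingCone f).1 hq) hm x
  rw [quasiIso_iff_elements]
  refine ⟨fun i j k hij hjk ψ hψ => ?_, fun i j k hij hjk φ hφ w hw => ?_⟩
  · obtain ⟨φ, w, h1, h2⟩ := exists_cocycle_comp_right f hcone hij hjk (homComplexVal ψ) hψ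
    exact ⟨φ, w, h1, h2⟩
  · exact exists_eq_δ_comp_right f hcone hij hjk (homComplexVal φ) hφ (homComplexVal w) hw

theorem quasiIso_homComplexMapLeft [G.IsKInjective] (ρ : B →+* End G) (f : F ⟶ F')
    [hq : QuasiIso f] : QuasiIso (homComplexMapLeft ρ f) := by
  have hcone : ∀ (n m : ℤ), m + 1 = n → ∀ x : Cocycle (mappingCone f) G n,
      ∃ α : Cochain (mappingCone f) G m, δ m n α = x := fun n m hm x =>
    IsKInjective.eq_δ_of_cocycle x ((quasiIso_iff_acyclic_mappingCone f).1 hq) m hm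
  rw [quasiIso_iff_elements]
  refine ⟨fun i j k hij hjk ψ hψ => ?_, fun i j k hij hjk φ hφ w hw => ?_⟩
  · obtain ⟨φ, w, h1, h2⟩ := exists_cocycle_comp_left f hcone hij hjk (homComplexVal ψ) hψ
    exact ⟨φ, w, h1, h2⟩
  · exact exists_eq_δ_comp_left f hcone hij hjk (homComplexVal φ) hφ (homComplexVal w) hw

end HomComplexes

/-! ### Base change of Hom complexes -/

section FreeFamilies

variable {S : Type u} [Ring S]

/-- The family `b` of elements of `M` is a basis of `M`, stated as a universal property. -/
def IsFreeFamily (M : ModuleCat.{u} S) {ι : Type*} (b : ι → M) : Prop :=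
  ∀ N : ModuleCat.{u} S, Function.Bijective fun (f : M ⟶ N) (i : ι) => f.hom (b i)

theorem isFreeFamily_basis {M : ModuleCat.{u} S} {ι : Type*} (b : Module.Basis ι S M) :
    IsFreeFamily M b := fun _ =>
  ⟨fun _ _ h => ModuleCat.hom_ext (b.ext fun i => congrFun h i),
    fun y => ⟨ModuleCat.ofHom (b.constr ℕ y), funext fun i => b.constr_basis ℕ y i⟩⟩

theorem IsFreeFamily.bc {z : Type u} [CommRing z] {T c : Type u} [Algebra z S] [CommRing c]
    [Algebra z c] [Ring T] (σ : T ≃+* c ⊗[z] S) {M : ModuleCat.{u} S} {ι : Type*} {b : ι → M}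
    (hb : IsFreeFamily M b) : IsFreeFamily ((bc σ).obj M) fun i => bcMk σ 1 (b i) := fun N =>
  (hb ((ModuleCat.restrictScalars (bcInclude σ)).obj N)).comp ((bcAdj σ).homEquiv M N).bijective

end FreeFamilies

section EvalCochains

open CochainComplex CochainComplex.HomComplex

variable {S : Type u} [Ring S] {F G : CochainComplex (ModuleCat.{u} S) ℤ} {ι : ℤ → Type u}
  (b : ∀ p, ι p → F.X p) (n : ℤ) (s : Finset ℤ)

/-- A cochain, evaluated on families of elements of the terms in the degrees in `s`. -/
def evalCochain (φ : Cochain F G n) (x : Σ p : s, ι p) : G.X (x.1 + n) :=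
  (φ.v x.1 (x.1 + n) rfl).hom (b _ x.2)

/-- A cochain is determined by its values on bases; only degrees in which both `F` and the shift of
`G` may be nonzero matter. -/
theorem evalCochain_bijective (hb : ∀ p, IsFreeFamily (F.X p) (b p))
    (hs : ∀ p ∉ s, Limits.IsZero (F.X p) ∨ Limits.IsZero (G.X (p + n))) :
    Function.Bijective (evalCochain (G := G) b n s) := by
  constructor
  · intro φ ψ h
    refine Cochain.ext _ _ fun p q hpq => ?_
    subst hpq
    by_cases hp : p ∈ s
    · exact (hb p (G.X (p + n))).1 (funext fun i => congrFun h ⟨⟨p, hp⟩, i⟩)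
    · obtain h0 | h0 := hs p hp
      · exact h0.eq_of_src _ _
      · exact h0.eq_of_tgt _ _
  · intro y
    choose g hg using fun p : s => (hb p (G.X (p + n))).2 fun i => y ⟨p, i⟩
    let φ : ∀ p, F.X p ⟶ G.X (p + n) := fun p => if h : p ∈ s then g ⟨p, h⟩ else 0
    refine ⟨Cochain.mk fun p q hpq => φ p ≫ (G.XIsoOfEq hpq).hom, ?_⟩
    ext ⟨⟨p, hp⟩, i⟩
    have h1 : ((Cochain.mk fun p q hpq => φ p ≫ (G.XIsoOfEq hpq).hom : Cochain F G n).v p (p + n)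
      rfl) = g ⟨p, hp⟩ := by simp [φ, hp]
    unfold evalCochain
    rw [h1]
    exact congrFun (hg ⟨p, hp⟩) i

end EvalCochains

section TensorPi

attribute [local instance 50] baseModule baseModule_isScalarTower tensorModule

variable {z : Type u} [CommRing z] {S B c : Type u} [Ring S] [Algebra z S] [Ring B] [Algebra z B]
  [Ring c] [Algebra z c]

theorem flat_of_pi {M : ModuleCat.{u} B} {ι : Type u} [Finite ι] {N : ι → ModuleCat.{u} S}
    (e : M →+ ∀ i, N i) (he : Function.Bijective e)
    (hz : ∀ (r : z) m i, e (algebraMap z B r • m) i = algebraMap z S r • e m i)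
    [hN : ∀ i, Module.Flat z (N i)] : Module.Flat z M := by
  classical
  have := Fintype.ofFinite ι
  let e' : M ≃ₗ[z] ∀ i, N i := (AddEquiv.ofBijective e he).toLinearEquiv
    fun r m => funext fun i => hz r m i
  exact Module.Flat.of_linearEquiv (e'.trans (DFinsupp.linearEquivFunOnFintype (R := z)).symm)

/-- The tensor product with `X` commutes with the identification of `M` with a finite product. The
map `L` is any additive one that is given by `e` on pure tensors. -/
theorem bijective_of_tensor_pi {X : ModuleCat.{u} c} {M : ModuleCat.{u} B} {ι : Type u} [Finite ι]
    {N : ι → ModuleCat.{u} S} (e : M →+ ∀ i, N i) (he : Function.Bijective e)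
    (hz : ∀ (r : z) m i, e (algebraMap z B r • m) i = algebraMap z S r • e m i)
    (L : ((tensorFunctor z c B).obj X).obj M → ∀ i, ((tensorFunctor z c S).obj X).obj (N i))
    (hL0 : L 0 = 0) (hLadd : ∀ x y, L (x + y) = L x + L y)
    (hL : ∀ a m i, L (tensorMk a m) i = tensorMk a (e m i)) : Function.Bijective L := by
  classical
  have := Fintype.ofFinite ι
  let e' : M ≃ₗ[z] ∀ i, N i := (AddEquiv.ofBijective e he).toLinearEquiv
    fun r m => funext fun i => hz r m i
  let E := (TensorProduct.congr (LinearEquiv.refl z X) e').trans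
    (TensorProduct.piRight z z X fun i => N i)
  have h : L = E := by
    funext x
    induction x using tensor_induction with
    | zero => rw [hL0]; exact (map_zero E).symm
    | add x y hx hy => rw [hLadd, hx, hy]; exact (map_add E _ _).symm
    | mk a m =>
      funext i
      rw [hL]
      rfl
  rw [h]
  exact E.bijective

end TensorPi

section Comparison

open CochainComplex CochainComplex.HomComplex

attribute [local instance 50] baseModule baseModule_isScalarTower tensorModule

variable {z : Type u} [CommRing z] {S B c T B' : Type u} [Ring S] [Algebra z S] [Ring B]
  [Algebra z B] [CommRing c] [Algebra z c] [Ring T] [Ring B'] (σ : T ≃+* c ⊗[z] S)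
  (β : B' ≃+* c ⊗[z] B) {F G : CochainComplex (ModuleCat.{u} S) ℤ} (ρ : B →+* End G)

/-- Base change of complexes. -/
noncomputable abbrev bcComplex : CochainComplex (ModuleCat.{u} S) ℤ ⥤
    CochainComplex (ModuleCat.{u} T) ℤ :=
  (bc σ).mapHomologicalComplex (ComplexShape.up ℤ)

/-- An action of `B` on a complex of `S`-modules is `z`-linear. -/
def IsBaseLinear (z : Type u) [CommRing z] [Algebra z S] [Algebra z B] (ρ : B →+* End G) : Prop :=
  ∀ (r : z) (n : ℤ) (x : G.X n),
    ((ρ (algebraMap z B r) : G ⟶ G).f n).hom x = algebraMap z S r • x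

/-- The action `ρ'` of `B' ≃ c ⊗ B` on `c ⊗ G` is the base change of the action `ρ` of `B`
on `G`. -/
structure IsBaseChangeAction (ρ : B →+* End G) (ρ' : B' →+* End ((bcComplex σ).obj G)) : Prop where
  map_include (b : B) : ρ' (bcInclude β b) = (bcComplex σ).map (ρ b : G ⟶ G)
  map_scalar (a : c) (n : ℤ) (x : ((bcComplex σ).obj G).X n) :
    ((ρ' (β.symm (a ⊗ₜ 1)) : (bcComplex σ).obj G ⟶ (bcComplex σ).obj G).f n).hom x =
      σ.symm (a ⊗ₜ 1) • x

variable {ρ} {ρ' : B' →+* End ((bcComplex σ).obj G)} (hρ' : IsBaseChangeAction σ β ρ ρ')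

include hρ' in
theorem map_bc_smul {n : ℤ} (b : B) (φ : Cochain F G n) :
    (φ.comp (Cochain.ofHom (ρ b : G ⟶ G)) (add_zero n)).map (bc σ) =
      (φ.map (bc σ)).comp (Cochain.ofHom
        (ρ' (bcInclude β b) : (bcComplex σ).obj G ⟶ (bcComplex σ).obj G)) (add_zero n) := by
  rw [hρ'.map_include, Cochain.map_comp, Cochain.map_ofHom]

variable (F) in
/-- The map `Hom(F, G) → Hom(c ⊗ F, c ⊗ G)` in degree `n`. -/
noncomputable def bcCochain (n : ℤ) : (homComplex F ρ).X n ⟶ (ModuleCat.restrictScalars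
    (bcInclude β)).obj ((homComplex ((bcComplex σ).obj F) ρ').X n) :=
  ModuleCat.ofHom (X := (homComplex F ρ).X n) (Y := (ModuleCat.restrictScalars (bcInclude β)).obj
      ((homComplex ((bcComplex σ).obj F) ρ').X n))
      { toFun := fun φ => homComplexMk ρ' ((homComplexVal φ).map (bc σ))
        map_add' := fun _ _ => Cochain.map_add _ _ _
        map_smul' := fun b φ => map_bc_smul σ β hρ' b (homComplexVal φ) }

variable (F) in
/-- The comparison map `c ⊗ Hom(F, G) → Hom(c ⊗ F, c ⊗ G)`. -/
noncomputable def bcHomComplex :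
    (bcComplex β).obj (homComplex F ρ) ⟶ homComplex ((bcComplex σ).obj F) ρ' where
  f n := bcLift β (bcCochain σ β F hρ' n)
  comm' i j _ := bc_hom_ext β fun φ => by
    change ((homComplex ((bcComplex σ).obj F) ρ').d i j).hom
      ((bcLift β (bcCochain σ β F hρ' i)).hom (bcMk β 1 φ)) =
      (bcLift β (bcCochain σ β F hρ' j)).hom (bcMk β 1 (((homComplex F ρ).d i j).hom φ))
    rw [bcLift_one, bcLift_one]
    have h : δ i j ((homComplexVal φ).map (bc σ)) = (δ i j (homComplexVal φ)).map (bc σ) :=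
      δ_map i j _ _
    exact congrArg (homComplexMk ρ') h

theorem bcHomComplex_bcMk (n : ℤ) (a : c) (φ : Cochain F G n) :
    ((bcHomComplex σ β F hρ').f n).hom (bcMk β a (homComplexMk ρ φ)) =
      β.symm (a ⊗ₜ 1) • homComplexMk ρ' (φ.map (bc σ)) :=
  rfl

variable {ι : ℤ → Type u} {b : ∀ p, ι p → F.X p} {n : ℤ} {s : Finset ℤ}

theorem evalCochain_smul (hρ : IsBaseLinear z ρ) (r : z) (φ : (homComplex F ρ).X n)
    (x : Σ p : s, ι p) : evalCochain b n s (homComplexVal (algebraMap z B r • φ)) x =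
      algebraMap z S r • evalCochain b n s (homComplexVal φ) x := by
  change ((((homComplexVal φ).comp (Cochain.ofHom (ρ (algebraMap z B r) : G ⟶ G))
    (add_zero n)).v x.1 (x.1 + n) rfl).hom (b _ x.2)) = _
  rw [Cochain.comp_zero_cochain_v, Cochain.ofHom_v]
  exact hρ r _ _

/-- Evaluation of cochains, as a homomorphism. -/
def evalCochainHom (ρ : B →+* End G) (b : ∀ p, ι p → F.X p) (n : ℤ) (s : Finset ℤ) :
    (homComplex F ρ).X n →+ ∀ x : Σ p : s, ι p, G.X (x.1 + n) where
  toFun φ := evalCochain b n s (homComplexVal φ)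
  map_zero' := rfl
  map_add' _ _ := rfl

/-- If `F` has finitely generated free terms and finitely many degrees matter, then the cochains of
degree `n` form a finite product of terms of `G`. -/
theorem flat_homComplex (hρ : IsBaseLinear z ρ) [∀ p, Finite (ι p)]
    (hb : ∀ p, IsFreeFamily (F.X p) (b p))
    (hs : ∀ p ∉ s, Limits.IsZero (F.X p) ∨ Limits.IsZero (G.X (p + n)))
    [∀ i, Module.Flat z (G.X i)] : Module.Flat z ((homComplex F ρ).X n) :=
  flat_of_pi (M := (homComplex F ρ).X n) (N := fun x : Σ p : s, ι p => G.X (x.1 + n))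
    (evalCochainHom ρ b n s) (evalCochain_bijective b n s hb hs)
    (fun r φ x => evalCochain_smul hρ r φ x)

include hρ' in
/-- Both sides are the same finite product of modules `c ⊗ Gⁱ`, by evaluation on bases. -/
theorem bijective_bcHomComplex (hρ : IsBaseLinear z ρ) [∀ p, Finite (ι p)]
    (hb : ∀ p, IsFreeFamily (F.X p) (b p))
    (hs : ∀ p ∉ s, Limits.IsZero (F.X p) ∨ Limits.IsZero (G.X (p + n))) :
    Function.Bijective ((bcHomComplex σ β F hρ').f n).hom := by
  let L : ((tensorFunctor z c B).obj (ModuleCat.of c c)).obj ((homComplex F ρ).X n) →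
      ∀ x : Σ p : s, ι p, ((tensorFunctor z c S).obj (ModuleCat.of c c)).obj (G.X (x.1 + n)) :=
    fun y => evalCochain (fun p i => bcMk σ 1 (b p i)) n s
      (homComplexVal (((bcHomComplex σ β F hρ').f n).hom y))
  have hL : Function.Bijective L := by
    refine bijective_of_tensor_pi (evalCochainHom ρ b n s)
      (evalCochain_bijective b n s hb hs) (fun r φ x => evalCochain_smul hρ r φ x) L ?_ ?_ ?_
    · exact congrArg (fun y => evalCochain (fun p i => bcMk σ 1 (b p i)) n s (homComplexVal y))
        (map_zero ((bcHomComplex σ β F hρ').f n).hom)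
    · exact fun x y => congrArg (fun y => evalCochain (fun p i => bcMk σ 1 (b p i)) n s
        (homComplexVal y)) (map_add ((bcHomComplex σ β F hρ').f n).hom x y)
    · intro a φ x
      change ((((homComplexVal φ).map (bc σ)).comp (Cochain.ofHom (ρ' (β.symm (a ⊗ₜ 1)) :
        (bcComplex σ).obj G ⟶ (bcComplex σ).obj G)) (add_zero n)).v x.1 (x.1 + n) rfl).hom
          (bcMk σ 1 (b _ x.2)) = bcMk σ a (((homComplexVal φ).v x.1 (x.1 + n) rfl).hom (b _ x.2))
      rw [Cochain.comp_zero_cochain_v, Cochain.ofHom_v]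
      exact (hρ'.map_scalar a _ _).trans (bcMk_eq_smul σ a _).symm
  have hE := evalCochain_bijective (F := (bcComplex σ).obj F) (G := (bcComplex σ).obj G)
    (fun p i => bcMk σ 1 (b p i)) n s (fun p => (hb p).bc σ)
    (fun p hp => (hs p hp).imp (bc σ).map_isZero (bc σ).map_isZero)
  exact (Function.Bijective.of_comp_iff' hE _).1 hL

end Comparison

/-! ### The unit morphism into a Hom complex -/

section Single

variable {B : Type u} [Ring B] {K : CochainComplex (ModuleCat.{u} B) ℤ} {M : ModuleCat.{u} B}

/-- A map from `M`, placed in degree zero, to `K` is a quasi-isomorphism if and only if it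
identifies `M` with the cohomology of `K`, in terms of elements. -/
theorem quasiIso_mkHomFromSingle_iff (φ : M ⟶ K.X 0)
    (hφ : ∀ k, (ComplexShape.up ℤ).Rel 0 k → φ ≫ K.d 0 k = 0) :
    QuasiIso (HomologicalComplex.mkHomFromSingle φ hφ) ↔ (∀ i ≠ 0, K.ExactAt i) ∧
      (∀ x : K.X 0, (K.d 0 1).hom x = 0 →
        ∃ (m : M) (w : K.X (-1)), x = φ.hom m + (K.d (-1) 0).hom w) ∧
      (∀ (m : M) (w : K.X (-1)), φ.hom m = (K.d (-1) 0).hom w → m = 0) := by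
  let e := (HomologicalComplex.singleObjXSelf (ComplexShape.up ℤ) 0 M).toLinearEquiv
  have he : ∀ x, ((HomologicalComplex.mkHomFromSingle φ hφ).f 0).hom x = φ.hom (e x) := fun x =>
    congrArg (fun g => g.hom x) (HomologicalComplex.mkHomFromSingle_f φ hφ)
  have h0 : ∀ i ≠ 0, ∀ x : ((HomologicalComplex.single _ (ComplexShape.up ℤ) 0).obj M).X i,
      x = 0 := fun i hi x => by
    have := ModuleCat.subsingleton_of_isZero
      (HomologicalComplex.isZero_single_obj_X (ComplexShape.up ℤ) 0 M i hi)
    exact Subsingleton.elim _ _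
  have hd : ∀ i j, ((HomologicalComplex.single _ (ComplexShape.up ℤ) 0).obj M).d i j = 0 :=
    fun _ _ => rfl
  rw [quasiIso_iff_elements]
  constructor
  · rintro ⟨hs, hi⟩
    refine ⟨fun i hi => ?_, fun x hx => ?_, fun m w h => ?_⟩
    · rw [exactAt_iff_function_exact K (i - 1) i (i + 1) (by omega) rfl]
      refine fun y => ⟨fun hy => ?_, ?_⟩
      · obtain ⟨x, w, -, h⟩ := hs (i - 1) i (i + 1) (by omega) rfl y hy
        rw [h0 i hi x, map_zero, zero_add] at h
        exact ⟨w, h.symm⟩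
      · rintro ⟨w, rfl⟩
        exact d_d_apply K _ _ _ w
    · obtain ⟨m, w, -, h⟩ := hs (-1) 0 1 rfl rfl x hx
      exact ⟨e m, w, by rw [h, he]⟩
    · obtain ⟨v, hv⟩ := hi (-1) 0 1 rfl rfl (e.symm m) (by rw [hd]; rfl) w
        (by rw [he, e.apply_symm_apply, h])
      rw [hd] at hv
      exact e.symm.map_eq_zero_iff.1 hv
  · rintro ⟨h1, h2, h3⟩
    refine ⟨fun i j k hij hjk y hy => ?_, fun i j k hij hjk x hx w hw => ⟨0, ?_⟩⟩
    · by_cases hj : j = 0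
      · subst hj
        obtain rfl : i = -1 := by omega
        obtain rfl : k = 1 := by omega
        obtain ⟨m, w, h⟩ := h2 y hy
        exact ⟨e.symm m, w, by rw [hd]; rfl, by rw [he, e.apply_symm_apply, h]⟩
      · obtain ⟨w, hw⟩ := exact_of_exactAt (h1 j hj) i hij k y hy hjk
        exact ⟨0, w, by rw [map_zero], by rw [map_zero, zero_add, hw]⟩
    · rw [map_zero]
      by_cases hj : j = 0
      · subst hj
        obtain rfl : i = -1 := by omega
        rw [he] at hw
        exact e.map_eq_zero_iff.1 (h3 _ w hw)
      · exact h0 j hj x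

end Single

section SingleMaps

variable {C D : Type*} [Category* C] [Category* D] [Preadditive C] [Preadditive D]
  [Limits.HasZeroObject C] [Limits.HasZeroObject D]

theorem mkHomFromSingle_comp {K L : CochainComplex C ℤ} {M : C} (φ : M ⟶ K.X 0)
    (hφ : ∀ k, (ComplexShape.up ℤ).Rel 0 k → φ ≫ K.d 0 k = 0) (f : K ⟶ L) :
    HomologicalComplex.mkHomFromSingle φ hφ ≫ f = HomologicalComplex.mkHomFromSingle (φ ≫ f.f 0)
      (fun k hk => by rw [Category.assoc, f.comm, reassoc_of% hφ k hk, Limits.zero_comp]) := by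
  apply HomologicalComplex.from_single_hom_ext
  rw [HomologicalComplex.comp_f, HomologicalComplex.mkHomFromSingle_f,
    HomologicalComplex.mkHomFromSingle_f, Category.assoc]

theorem single_map_comp_mkHomFromSingle {K : CochainComplex C ℤ} {M N : C} (g : N ⟶ M)
    (φ : M ⟶ K.X 0) (hφ : ∀ k, (ComplexShape.up ℤ).Rel 0 k → φ ≫ K.d 0 k = 0) :
    (HomologicalComplex.single C (ComplexShape.up ℤ) 0).map g ≫
      HomologicalComplex.mkHomFromSingle φ hφ = HomologicalComplex.mkHomFromSingle (g ≫ φ)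
        (fun k hk => by rw [Category.assoc, hφ k hk, Limits.comp_zero]) := by
  apply HomologicalComplex.from_single_hom_ext
  rw [HomologicalComplex.comp_f, HomologicalComplex.mkHomFromSingle_f,
    HomologicalComplex.mkHomFromSingle_f, HomologicalComplex.single_map_f_self]
  simp

theorem singleMap_inv_comp_map_mkHomFromSingle (H : C ⥤ D) [H.Additive] {K : CochainComplex C ℤ}
    {M : C} (φ : M ⟶ K.X 0) (hφ : ∀ k, (ComplexShape.up ℤ).Rel 0 k → φ ≫ K.d 0 k = 0) :
    (HomologicalComplex.singleMapHomologicalComplex H (ComplexShape.up ℤ) 0).inv.app M ≫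
      (H.mapHomologicalComplex _).map (HomologicalComplex.mkHomFromSingle φ hφ) =
    HomologicalComplex.mkHomFromSingle (K := (H.mapHomologicalComplex _).obj K) (H.map φ)
      (fun k hk => by
        change H.map φ ≫ H.map (K.d 0 k) = 0
        rw [← H.map_comp, hφ k hk, H.map_zero]) := by
  apply HomologicalComplex.from_single_hom_ext
  refine Eq.trans ?_ (HomologicalComplex.mkHomFromSingle_f (K := (H.mapHomologicalComplex _).obj K)
    (H.map φ) _).symm
  rw [HomologicalComplex.comp_f, HomologicalComplex.singleMapHomologicalComplex_inv_app_self]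
  refine (Category.assoc _ _ _).trans (congrArg _ ?_)
  refine (H.map_comp _ _).symm.trans (congrArg H.map ?_)
  rw [HomologicalComplex.mkHomFromSingle_f, Iso.inv_hom_id_assoc]

end SingleMaps

section Unit

open CochainComplex CochainComplex.HomComplex

variable {S B : Type u} [Ring S] [Ring B] {F G : CochainComplex (ModuleCat.{u} S) ℤ}

/-- The linear map `b ↦ b • x` from `B` to `M`. -/
def elementMap (M : ModuleCat.{u} B) (x : M) : ModuleCat.of B B ⟶ M :=
  ModuleCat.ofHom (LinearMap.toSpanSingleton B M x)

theorem elementMap_apply (M : ModuleCat.{u} B) (x : M) (b : B) : (elementMap M x).hom b = b • x :=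
  rfl

theorem hom_ext_one {M : ModuleCat.{u} B} {f g : ModuleCat.of B B ⟶ M}
    (h : f.hom (1 : B) = g.hom (1 : B)) : f = g :=
  ModuleCat.hom_ext (LinearMap.ext_ring h)

/-- The map `b ↦ ρ(b) ∘ q` from `B` to the complex of homomorphisms from `F` to `G`. -/
noncomputable def homComplexUnit (q : F ⟶ G) (ρ : B →+* End G) :
    (HomologicalComplex.single _ (ComplexShape.up ℤ) 0).obj (ModuleCat.of B B) ⟶ homComplex F ρ :=
  HomologicalComplex.mkHomFromSingle (elementMap ((homComplex F ρ).X 0)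
    (homComplexMk ρ (Cochain.ofHom q)))
    fun k _ => ModuleCat.hom_ext (LinearMap.ext fun b => by
      change ((homComplex F ρ).d 0 k).hom (b • homComplexMk ρ (Cochain.ofHom q)) = 0
      rw [map_smul, homComplex_d_apply, δ_ofHom]
      exact smul_zero (A := (homComplex F ρ).X k) b)

theorem smul_homComplexMk_ofHom (q : F ⟶ G) (ρ : B →+* End G) (b : B) :
    b • homComplexMk ρ (Cochain.ofHom q) = homComplexMk ρ (Cochain.ofHom (q ≫ (ρ b : G ⟶ G))) := by
  rw [homComplex_smul, Cochain.ofHom_comp]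

theorem Q_map_eq_zero_iff [F.IsKProjective] (f : F ⟶ G) :
    DerivedCategory.Q.map f = 0 ↔ ∃ w : Cochain F G (-1), Cochain.ofHom f = δ (-1) 0 w := by
  constructor
  · intro h
    have h1 : DerivedCategory.Qh.map ((HomotopyCategory.quotient _ (ComplexShape.up ℤ)).map f) =
        DerivedCategory.Qh.map 0 := by
      have h2 := (DerivedCategory.quotientCompQhIso (ModuleCat.{u} S)).hom.naturality f
      rw [h, Limits.comp_zero] at h2
      rw [Functor.map_zero]
      exact (cancel_mono ((DerivedCategory.quotientCompQhIso (ModuleCat.{u} S)).hom.app G)).1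
        (h2.trans Limits.zero_comp.symm)
    have h3 := (IsKProjective.Qh_map_bijective _ _).1 h1
    rw [← Functor.map_zero (HomotopyCategory.quotient _ (ComplexShape.up ℤ))] at h3
    obtain ⟨w, hw⟩ := Cochain.equivHomotopy _ _ (HomotopyCategory.homotopyOfEq _ _ h3)
    exact ⟨w, by simpa using hw⟩
  · rintro ⟨w, hw⟩
    rw [DerivedCategory.Q_map_eq_of_homotopy _ ((Cochain.equivHomotopy f 0).symm
      ⟨w, by simpa using hw⟩), Functor.map_zero]

/-- The map `B → Hom(F, G)` is a quasi-isomorphism if and only if `B` is the endomorphism ring of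
`G` in the derived category and `Ext^i(G, G) = 0` for `i ≠ 0`. -/
theorem quasiIso_homComplexUnit_iff [F.IsKProjective] (q : F ⟶ G) [hq : QuasiIso q]
    (ρ : B →+* End G) : QuasiIso (homComplexUnit q ρ) ↔
      (∀ i : ℤ, i ≠ 0 → Subsingleton (DerivedCategory.Q.obj G ⟶ (DerivedCategory.Q.obj G)⟦i⟧)) ∧
      Function.Bijective fun b : B => DerivedCategory.Q.map (ρ b : G ⟶ G) := by
  have hq' : IsIso (DerivedCategory.Q.map q) := (DerivedCategory.isIso_Q_map_iff_quasiIso _ q).2 hq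
  have hK : ∀ b : B, DerivedCategory.Q.map (ρ b : G ⟶ G) = 0 ↔
      ∃ w : Cochain F G (-1), Cochain.ofHom (q ≫ (ρ b : G ⟶ G)) = δ (-1) 0 w := fun b => by
    rw [← Q_map_eq_zero_iff, Functor.map_comp, Preadditive.IsIso.comp_left_eq_zero]
  let Φ : B →+ (DerivedCategory.Q.obj G ⟶ DerivedCategory.Q.obj G) :=
    { toFun := fun b => DerivedCategory.Q.map (ρ b : G ⟶ G)
      map_zero' := by rw [map_zero]; exact Functor.map_zero _ _ _
      map_add' := fun b b' => by rw [map_add]; exact Functor.map_add _ }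
  refine (quasiIso_mkHomFromSingle_iff _ _).trans (and_congr (forall₂_congr fun i hi => ?_) ?_)
  · have e : Subsingleton (DerivedCategory.Q.obj F ⟶ (DerivedCategory.Q.obj G)⟦i⟧) ↔
        Subsingleton (DerivedCategory.Q.obj G ⟶ (DerivedCategory.Q.obj G)⟦i⟧) :=
      ((asIso (DerivedCategory.Q.map q)).homCongr (Iso.refl _)).subsingleton_congr
    rw [← e, ← forall_eq_δ_iff_of_isKProjective (n := i) (m := i - 1) (by omega),
      exactAt_iff_function_exact _ (i - 1) i (i + 1) (by omega) rfl]
    constructor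
    · intro h x
      exact (h x.1).1 (x.δ_eq_zero _)
    · refine fun h y => ⟨fun hy => h (Cocycle.mk y (i + 1) rfl hy), ?_⟩
      rintro ⟨w, rfl⟩
      exact d_d_apply (homComplex F ρ) _ _ _ w
  · have hΦ : Function.Bijective Φ ↔ (∀ g, ∃ b, Φ b = g) ∧ ∀ b, Φ b = 0 → b = 0 :=
      ⟨fun h => ⟨h.2, fun b hb => h.1 (hb.trans (map_zero Φ).symm)⟩,
        fun h => ⟨(injective_iff_map_eq_zero Φ).2 h.2, h.1⟩⟩
    refine Iff.trans (and_congr ?_ ?_) hΦ.symm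
    · constructor
      · intro h g
        obtain ⟨f, hf⟩ := exists_Q_map_eq_of_isKProjective (DerivedCategory.Q.map q ≫ g)
        obtain ⟨b, w, hw⟩ := h (Cochain.ofHom f) (δ_ofHom f)
        replace hw : Cochain.ofHom f = homComplexVal (b • homComplexMk ρ (Cochain.ofHom q)) +
          δ (-1) 0 w := hw
        rw [smul_homComplexMk_ofHom] at hw
        refine ⟨b, (cancel_epi (DerivedCategory.Q.map q)).1 ?_⟩
        rw [← hf]
        change DerivedCategory.Q.map q ≫ DerivedCategory.Q.map (ρ b : G ⟶ G) = _
        rw [← Functor.map_comp]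
        exact (DerivedCategory.Q_map_eq_of_homotopy _ ((Cochain.equivHomotopy _ _).symm
          ⟨w, hw.trans (add_comm _ _)⟩)).symm
      · intro h x hx
        obtain ⟨f, hf⟩ := (Cocycle.equivHom F G).surjective (Cocycle.mk x 1 rfl hx)
        obtain ⟨b, hb⟩ := h (inv (DerivedCategory.Q.map q) ≫ DerivedCategory.Q.map f)
        rw [IsIso.eq_inv_comp] at hb
        have h0 : DerivedCategory.Q.map (f - q ≫ (ρ b : G ⟶ G)) = 0 := by
          rw [Functor.map_sub, Functor.map_comp, sub_eq_zero]
          exact hb.symm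
        obtain ⟨w, hw⟩ := (Q_map_eq_zero_iff _).1 h0
        refine ⟨b, w, ?_⟩
        change homComplexVal x = homComplexVal (b • homComplexMk ρ (Cochain.ofHom q)) + δ (-1) 0 w
        rw [smul_homComplexMk_ofHom, ← hw, Cochain.ofHom_sub]
        have hx' : Cochain.ofHom f = x := congrArg (fun t : Cocycle F G 0 => t.1) hf
        rw [hx']
        exact (add_sub_cancel _ _).symm
    · refine forall_congr' fun b => ?_
      have h1 : ∀ w : (homComplex F ρ).X (-1), (b • homComplexMk ρ (Cochain.ofHom q) =
          ((homComplex F ρ).d (-1) 0).hom w) ↔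
          Cochain.ofHom (q ≫ (ρ b : G ⟶ G)) = δ (-1) 0 (homComplexVal w) := fun w => by
        rw [smul_homComplexMk_ofHom]; rfl
      have h2 : Φ b = 0 ↔ _ := hK b
      rw [h2]
      exact ⟨fun h ⟨w, hw⟩ => h w ((h1 w).2 hw), fun h w hw => h ⟨w, (h1 w).1 hw⟩⟩

end Unit

section UnitBaseChange

open CochainComplex CochainComplex.HomComplex

attribute [local instance 50] baseModule baseModule_isScalarTower tensorModule

variable {z : Type u} [CommRing z] {S B c T B' : Type u} [Ring S] [Algebra z S] [Ring B]
  [Algebra z B] [CommRing c] [Algebra z c] [Ring T] [Ring B'] (σ : T ≃+* c ⊗[z] S)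
  (β : B' ≃+* c ⊗[z] B) {F G : CochainComplex (ModuleCat.{u} S) ℤ} (ρ : B →+* End G)

theorem finiteFree_isFreeFamily {P : ModuleCat.{u} S} (h : finiteFreeModules S P) :
    ∃ (ι : Type u) (_ : Finite ι) (b : ι → P), IsFreeFamily P b := by
  obtain ⟨h1, h2⟩ := h
  exact ⟨Module.Free.ChooseBasisIndex S P, inferInstance, _,
    isFreeFamily_basis (Module.Free.chooseBasis S P)⟩

/-- The identification of `B'` with the base change of `B`. -/
noncomputable def bcSelf : ModuleCat.of B' B' ⟶ (bc β).obj (ModuleCat.of B B) :=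
  elementMap _ (bcMk β (M := ModuleCat.of B B) 1 (1 : B))

theorem bcSelf_apply (t : B') : (bcSelf β).hom t = t • bcMk β (M := ModuleCat.of B B) 1 (1 : B) :=
  rfl

theorem bcSelf_bijective : Function.Bijective (bcSelf β).hom := by
  let f : (bc β).obj (ModuleCat.of B B) →+ B' :=
    tensorLift (z := z) (X := ModuleCat.of c c) (M := ModuleCat.of B B)
      { toFun := fun a : c => β.symm.toAddMonoidHom.comp (TensorProduct.mk z c B a).toAddMonoidHom
        map_zero' := AddMonoidHom.ext fun b : B => by
          change β.symm ((0 : c) ⊗ₜ[z] b) = 0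
          rw [TensorProduct.zero_tmul, map_zero]
        map_add' := fun a a' : c => AddMonoidHom.ext fun b : B => by
          change β.symm ((a + a') ⊗ₜ[z] b) = β.symm (a ⊗ₜ[z] b) + β.symm (a' ⊗ₜ[z] b)
          rw [TensorProduct.add_tmul, map_add] }
      (fun (r : z) (a : c) (b : B) => by
        change β.symm ((algebraMap z c r * a) ⊗ₜ[z] b) = β.symm (a ⊗ₜ[z] (algebraMap z B r * b))
        rw [← Algebra.smul_def, ← Algebra.smul_def, TensorProduct.smul_tmul])
  have hf : ∀ (a : c) (b : B), f (bcMk β (M := ModuleCat.of B B) a b) = β.symm (a ⊗ₜ b) :=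
    fun a b => rfl
  have h : ∀ (a : c) (b : B), (bcSelf β).hom (β.symm (a ⊗ₜ b)) =
      bcMk β (M := ModuleCat.of B B) a b := fun a b => by
    rw [bcSelf_apply, symm_tmul_smul_bcMk, mul_one]
    exact congrArg (bcMk β (M := ModuleCat.of B B) a) (mul_one b)
  refine Function.bijective_iff_has_inverse.2 ⟨f, fun t => ?_, fun x => ?_⟩
  · induction t using smul_bc_induction β with
    | zero => rw [map_zero, map_zero]
    | mk a s => rw [h, hf]
    | add x y hx hy => rw [map_add, map_add, hx, hy]
  · induction x using bc_induction with
    | zero => rw [map_zero, map_zero]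
    | mk a s => rw [hf, h]
    | add x y hx hy => rw [map_add, map_add, hx, hy]

variable {ρ} {ρ' : B' →+* End ((bcComplex σ).obj G)} (hρ' : IsBaseChangeAction σ β ρ ρ')

/-- The unit morphism of the base change is the base change of the unit morphism. -/
theorem homComplexUnit_bc (q : F ⟶ G) :
    homComplexUnit ((bcComplex σ).map q) ρ' =
      (HomologicalComplex.single _ (ComplexShape.up ℤ) 0).map (bcSelf β) ≫
      (HomologicalComplex.singleMapHomologicalComplex (bc β) (ComplexShape.up ℤ) 0).inv.app _ ≫
      (bcComplex β).map (homComplexUnit q ρ) ≫ bcHomComplex σ β F hρ' := by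
  refine Eq.symm ((congrArg ((HomologicalComplex.single _ (ComplexShape.up ℤ) 0).map (bcSelf β) ≫ ·)
    ((Category.assoc _ _ _).symm.trans ((congrArg (· ≫ bcHomComplex σ β F hρ')
      (singleMap_inv_comp_map_mkHomFromSingle (bc β) _ _)).trans
      (mkHomFromSingle_comp _ _ _)))).trans ((single_map_comp_mkHomFromSingle _ _ _).trans ?_))
  unfold homComplexUnit
  congr 1
  refine hom_ext_one ?_
  have h1 : (bcSelf β).hom (1 : B') = bcMk β (M := ModuleCat.of B B) 1 (1 : B) := one_smul _ _
  have h2 : ∀ x : (bc β).obj (ModuleCat.of B B), x = bcMk β (M := ModuleCat.of B B) 1 (1 : B) →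
      ((bcHomComplex σ β F hρ').f 0).hom (((bc β).map (elementMap ((homComplex F ρ).X 0)
        (homComplexMk ρ (Cochain.ofHom q)))).hom x) =
      (1 : B') • homComplexMk ρ' (Cochain.ofHom ((bcComplex σ).map q)) := by
    rintro _ rfl
    rw [bc_map_bcMk, elementMap_apply, one_smul, one_smul]
    refine (bcHomComplex_bcMk σ β hρ' 0 1 (Cochain.ofHom q)).trans ?_
    rw [← Algebra.TensorProduct.one_def, map_one, one_smul, Cochain.map_ofHom]
  exact h2 _ h1

/-- The complex of homomorphisms from a bounded above complex of finitely generated free modules to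
a bounded below complex commutes with base change. -/
theorem isIso_bcHomComplex (hρ : IsBaseLinear z ρ) {a b : ℤ} [F.IsStrictlyLE b] [G.IsStrictlyGE a]
    (hF : ∀ n, finiteFreeModules S (F.X n)) : IsIso (bcHomComplex σ β F hρ') := by
  choose ι _ e he using fun n => finiteFree_isFreeFamily (hF n)
  have : ∀ n, IsIso ((bcHomComplex σ β F hρ').f n) := fun n => by
    rw [ConcreteCategory.isIso_iff_bijective]
    refine bijective_bcHomComplex σ β hρ' (s := Finset.Icc (a - n) b) hρ he fun p hp => ?_
    rw [Finset.mem_Icc, not_and_or, not_le, not_le] at hp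
    exact hp.symm.imp (fun h => F.isZero_of_isStrictlyLE b p)
      fun h => G.isZero_of_isStrictlyGE a _ (by omega)
  exact HomologicalComplex.Hom.isIso_of_components _

theorem flat_homComplex_of_finiteFree (hρ : IsBaseLinear z ρ) {a b : ℤ} [F.IsStrictlyLE b]
    [G.IsStrictlyGE a] (hF : ∀ n, finiteFreeModules S (F.X n)) [∀ i, Module.Flat z (G.X i)]
    (n : ℤ) : Module.Flat z ((homComplex F ρ).X n) := by
  choose ι _ e he using fun n => finiteFree_isFreeFamily (hF n)
  refine flat_homComplex (s := Finset.Icc (a - n) b) hρ he fun p hp => ?_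
  rw [Finset.mem_Icc, not_and_or, not_le, not_le] at hp
  exact hp.symm.imp (fun h => F.isZero_of_isStrictlyLE b p)
      fun h => G.isZero_of_isStrictlyGE a _ (by omega)

include hρ' in
/-- If `B` is the derived endomorphism ring of `G`, then `c ⊗ B` is that of `c ⊗ G`. -/
theorem quasiIso_homComplexUnit_bc [IsRegularRing z] {D : ℕ} (hD : ringKrullDim z ≤ D)
    (hρ : IsBaseLinear z ρ) {a b : ℤ} [F.IsStrictlyLE b] [G.IsStrictlyGE a]
    (hF : ∀ n, finiteFreeModules S (F.X n)) [∀ i, Module.Flat z (G.X i)] [Module.Flat z B]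
    (q : F ⟶ G) [QuasiIso (homComplexUnit q ρ)] :
    QuasiIso (homComplexUnit ((bcComplex σ).map q) ρ') := by
  have h1 := flat_homComplex_of_finiteFree (F := F) (a := a) (b := b) hρ hF
  have h2 : ∀ i, Module.Flat z (((HomologicalComplex.single _ (ComplexShape.up ℤ) 0).obj
      (ModuleCat.of B B)).X i) := fun i => by
    by_cases hi : i = 0
    · subst hi
      exact Module.Flat.of_linearEquiv ((HomologicalComplex.singleObjXSelf (ComplexShape.up ℤ) 0
        (ModuleCat.of B B)).toLinearEquiv.restrictScalars z)
    · have := ModuleCat.subsingleton_of_isZero (HomologicalComplex.isZero_single_obj_X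
        (ComplexShape.up ℤ) 0 (ModuleCat.of B B) i hi)
      infer_instance
  have h3 := bc_quasiIso β hD (homComplexUnit q ρ)
  have h4 := isIso_bcHomComplex σ β hρ' hρ (a := a) (b := b) hF
  have h5 : IsIso (bcSelf β) := (ConcreteCategory.isIso_iff_bijective _).2 (bcSelf_bijective β)
  rw [homComplexUnit_bc σ β hρ' q]
  infer_instance

end UnitBaseChange

/-! ### Derived endomorphism rings -/

section DerivedEnd

variable {S B : Type u} [Ring S] [Ring B] {G G' : CochainComplex (ModuleCat.{u} S) ℤ}

/-- The action `ρ` identifies `B` with the derived endomorphism ring `RHom(G, G)`. -/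
structure HasDerivedEnd (ρ : B →+* End G) : Prop where
  ext (i : ℤ) (hi : i ≠ 0) :
    Subsingleton (DerivedCategory.Q.obj G ⟶ (DerivedCategory.Q.obj G)⟦i⟧)
  bijective : Function.Bijective fun b : B => DerivedCategory.Q.map (ρ b : G ⟶ G)

theorem hasDerivedEnd_iff_of_quasiIso {ρ : B →+* End G} {ρ' : B →+* End G'} (f : G ⟶ G')
    [hq : QuasiIso f] (hf : ∀ b, (ρ b : G ⟶ G) ≫ f = f ≫ (ρ' b : G' ⟶ G')) :
    HasDerivedEnd ρ ↔ HasDerivedEnd ρ' := by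
  have hq' : IsIso (DerivedCategory.Q.map f) := (DerivedCategory.isIso_Q_map_iff_quasiIso _ f).2 hq
  let e := asIso (DerivedCategory.Q.map f)
  have h1 : (∀ i : ℤ, i ≠ 0 → Subsingleton (DerivedCategory.Q.obj G ⟶
        (DerivedCategory.Q.obj G)⟦i⟧)) ↔
      ∀ i : ℤ, i ≠ 0 →
        Subsingleton (DerivedCategory.Q.obj G' ⟶ (DerivedCategory.Q.obj G')⟦i⟧) :=
    forall₂_congr fun i _ =>
      (e.homCongr ((CategoryTheory.shiftFunctor _ i).mapIso e)).subsingleton_congr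
  have h2 : (fun b : B => DerivedCategory.Q.map (ρ' b : G' ⟶ G')) =
      e.homCongr e ∘ fun b : B => DerivedCategory.Q.map (ρ b : G ⟶ G) := by
    funext b
    change _ = e.inv ≫ DerivedCategory.Q.map (ρ b : G ⟶ G) ≫ DerivedCategory.Q.map f
    rw [← Functor.map_comp, hf, Functor.map_comp, Iso.eq_inv_comp]
    rfl
  constructor
  · rintro ⟨h, h'⟩
    exact ⟨h1.1 h, by rw [h2]; exact (e.homCongr e).bijective.comp h'⟩
  · rintro ⟨h, h'⟩
    rw [h2] at h'
    exact ⟨h1.2 h, (Function.Bijective.of_comp_iff' (e.homCongr e).bijective _).1 h'⟩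

end DerivedEnd

section Actions

variable {E S B : Type u} [Ring E] [Ring S] [Ring B]

variable (iS : S →+* E) in
/-- Restriction of scalars for complexes. -/
noncomputable abbrev resComplex : CochainComplex (ModuleCat.{u} E) ℤ ⥤
    CochainComplex (ModuleCat.{u} S) ℤ :=
  (ModuleCat.restrictScalars iS).mapHomologicalComplex (ComplexShape.up ℤ)

/-- The action on a complex of `E`-modules of a ring `B` over `E` whose image commutes with that
of `S`, by endomorphisms of the underlying complex of `S`-modules. -/
noncomputable def commAction (iS : S →+* E) (iB : B →+* E) (h : ∀ s b, Commute (iS s) (iB b))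
    (K : CochainComplex (ModuleCat.{u} E) ℤ) :
    B →+* End ((resComplex iS).obj K) where
  toFun b :=
    { f := fun n => ModuleCat.ofHom (X := (ModuleCat.restrictScalars iS).obj (K.X n))
        (Y := (ModuleCat.restrictScalars iS).obj (K.X n))
        { toFun := fun x : K.X n => iB b • x
          map_add' := fun x y : K.X n => smul_add _ _ _
          map_smul' := fun s (x : K.X n) => by
            change iB b • iS s • x = iS s • iB b • x
            rw [smul_smul, smul_smul, (h s b).eq] }
      comm' := fun i j _ => ModuleCat.hom_ext (LinearMap.ext fun x : K.X i =>
        map_smul (K.d i j).hom (iB b) x) }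
  map_one' :=
    HomologicalComplex.hom_ext _ _ fun n => ModuleCat.hom_ext (LinearMap.ext fun (x : K.X n) =>
      (congrArg (· • x) (map_one iB)).trans (one_smul E x))
  map_mul' b b' :=
    HomologicalComplex.hom_ext _ _ fun n => ModuleCat.hom_ext (LinearMap.ext fun (x : K.X n) =>
      (congrArg (· • x) (map_mul iB b b')).trans (mul_smul _ _ x))
  map_zero' :=
    HomologicalComplex.hom_ext _ _ fun n => ModuleCat.hom_ext (LinearMap.ext fun (x : K.X n) =>
      (congrArg (· • x) (map_zero iB)).trans (zero_smul E x))
  map_add' b b' :=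
    HomologicalComplex.hom_ext _ _ fun n => ModuleCat.hom_ext (LinearMap.ext fun (x : K.X n) =>
      (congrArg (· • x) (map_add iB b b')).trans (add_smul _ _ x))

theorem commAction_comm (iS : S →+* E) (iB : B →+* E) (h : ∀ s b, Commute (iS s) (iB b))
    {K L : CochainComplex (ModuleCat.{u} E) ℤ} (f : K ⟶ L) (b : B) :
    (commAction iS iB h K b : _ ⟶ _) ≫
        (resComplex iS).map f =
      (resComplex iS).map f ≫
        (commAction iS iB h L b : _ ⟶ _) :=
  HomologicalComplex.hom_ext _ _ fun n => ModuleCat.hom_ext (LinearMap.ext fun x : K.X n =>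
    map_smul (f.f n).hom (iB b) x)

/-- Transport of endomorphisms along an isomorphism, as a homomorphism of rings. -/
def conjEnd {C : Type*} [Category* C] [Preadditive C] {X Y : C} (e : X ≅ Y) : End Y →+* End X where
  toFun f := e.hom ≫ f ≫ e.inv
  map_one' := by simp [End.one_def]
  map_mul' f g := by simp [End.mul_def]
  map_zero' := by
    change e.hom ≫ (0 : Y ⟶ Y) ≫ e.inv = 0
    simp
  map_add' f g := by
    change e.hom ≫ ((f : Y ⟶ Y) + g) ≫ e.inv =
      e.hom ≫ (f : Y ⟶ Y) ≫ e.inv + e.hom ≫ (g : Y ⟶ Y) ≫ e.inv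
    rw [Preadditive.add_comp, Preadditive.comp_add]

theorem quasiIso_restrictScalars (iS : S →+* E) {K L : CochainComplex (ModuleCat.{u} E) ℤ}
    (f : K ⟶ L) [hf : QuasiIso f] : QuasiIso
      ((resComplex iS).map f) := by
  rw [quasiIso_iff_elements] at hf ⊢
  exact hf

end Actions

section RestrictBaseChange

attribute [local instance 50] baseModule baseModule_isScalarTower tensorModule

variable {z : Type u} [CommRing z] {c E S B E' S' B' : Type u} [CommRing c] [Algebra z c]
  [Ring E] [Ring S] [Ring B] [Ring E'] [Ring S'] [Ring B'] [Algebra z E] [Algebra z S] [Algebra z B]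
  {iS : S →ₐ[z] E} {iB : B →ₐ[z] E} {iS' : S' →+* E'} {iB' : B' →+* E'}
  {σE : E' ≃+* c ⊗[z] E} {σS : S' ≃+* c ⊗[z] S} {σB : B' ≃+* c ⊗[z] B}
  (hS : ∀ a s, iS' (σS.symm (a ⊗ₜ s)) = σE.symm (a ⊗ₜ iS s))
  (hB : ∀ a b, iB' (σB.symm (a ⊗ₜ b)) = σE.symm (a ⊗ₜ iB b))
  (h : ∀ s b, Commute (iS s) (iB b)) (h' : ∀ s b, Commute (iS' s) (iB' b))

theorem isBaseLinear_commAction (K : CochainComplex (ModuleCat.{u} E) ℤ) :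
    IsBaseLinear z (commAction iS.toRingHom iB.toRingHom h K) := fun r n (x : K.X n) => by
  change iB (algebraMap z B r) • x = iS (algebraMap z S r) • x
  rw [iB.commutes, iS.commutes]

/-- Base change commutes with restriction of scalars: the comparison map. -/
noncomputable def bcResHom (M : ModuleCat.{u} E) :
    (bc σS).obj ((ModuleCat.restrictScalars iS.toRingHom).obj M) ⟶
      (ModuleCat.restrictScalars iS').obj ((bc σE).obj M) :=
  bcLift σS (ModuleCat.ofHom (X := (ModuleCat.restrictScalars iS.toRingHom).obj M)
    (Y := (ModuleCat.restrictScalars (bcInclude σS)).obj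
      ((ModuleCat.restrictScalars iS').obj ((bc σE).obj M)))
    { toFun := fun m : M => bcMk σE 1 m
      map_add' := fun m m' : M => bcMk_add σE 1 m m'
      map_smul' := fun s (m : M) => by
        change bcMk σE 1 (iS s • m) = iS' (σS.symm (1 ⊗ₜ s)) • bcMk σE 1 m
        rw [hS, symm_tmul_smul_bcMk, one_mul] })

theorem bcResHom_bcMk (M : ModuleCat.{u} E) (a : c) (m : M) :
    (bcResHom hS M).hom (bcMk σS (M := (ModuleCat.restrictScalars iS.toRingHom).obj M) a m) =
      bcMk σE a m := by
  refine (bcLift_bcMk σS _ a _).trans ?_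
  change iS' (σS.symm (a ⊗ₜ 1)) • bcMk σE 1 m = bcMk σE a m
  rw [hS, symm_tmul_smul_bcMk, map_one, one_smul, mul_one]

theorem bcResHom_bijective (M : ModuleCat.{u} E) : Function.Bijective (bcResHom hS M).hom := by
  let g : (bc σE).obj M →+ (bc σS).obj ((ModuleCat.restrictScalars iS.toRingHom).obj M) :=
    tensorLift (z := z) (X := ModuleCat.of c c) (M := M)
      { toFun := fun a : c =>
          { toFun := fun m => bcMk σS (M := (ModuleCat.restrictScalars iS.toRingHom).obj M) a m
            map_zero' := bcMk_zero σS (M := (ModuleCat.restrictScalars iS.toRingHom).obj M) a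
            map_add' := bcMk_add σS (M := (ModuleCat.restrictScalars iS.toRingHom).obj M) a }
        map_zero' := AddMonoidHom.ext fun m =>
          zero_bcMk σS (M := (ModuleCat.restrictScalars iS.toRingHom).obj M) m
        map_add' := fun a a' : c => AddMonoidHom.ext fun m =>
          add_bcMk σS (M := (ModuleCat.restrictScalars iS.toRingHom).obj M) a a' m }
      (fun (r : z) (a : c) (m : M) => by
        have h1 := algebraMap_bcMk σS (M := (ModuleCat.restrictScalars iS.toRingHom).obj M) r a m
        refine h1.trans (congrArg (bcMk σS
          (M := (ModuleCat.restrictScalars iS.toRingHom).obj M) a) ?_)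
        exact congrArg (· • m) (iS.commutes r))
  have hg : ∀ a (m : M), g (bcMk σE a m) =
      bcMk σS (M := (ModuleCat.restrictScalars iS.toRingHom).obj M) a m := fun a m => rfl
  refine Function.bijective_iff_has_inverse.2 ⟨g, fun x => ?_, fun x => ?_⟩
  · induction x using bc_induction with
    | zero => rw [map_zero]; exact map_zero g
    | mk a s => exact congrArg g (bcResHom_bcMk hS M a s)
    | add x y hx hy =>
      rw [map_add]
      exact (map_add g _ _).trans (congrArg₂ _ hx hy)
  · induction x using bc_induction (σ := σE) (M := M) with
    | zero => exact (congrArg _ (map_zero g)).trans (map_zero _)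
    | mk a s => exact bcResHom_bcMk hS M a s
    | add x y hx hy =>
      exact (congrArg _ (map_add g x y)).trans ((map_add _ _ _).trans (congrArg₂ _ hx hy))

/-- Base change of complexes commutes with restriction of scalars. -/
noncomputable def bcResIso (K : CochainComplex (ModuleCat.{u} E) ℤ) :
    (bcComplex σS).obj ((resComplex iS.toRingHom).obj K) ≅
    (resComplex iS').obj
      ((bcComplex σE).obj K) :=
  HomologicalComplex.Hom.isoOfComponents (fun n =>
    @asIso _ _ _ _ (bcResHom hS (K.X n))
      ((ConcreteCategory.isIso_iff_bijective _).2 (bcResHom_bijective hS (K.X n))))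
      fun i j _ => bc_hom_ext σS fun m : K.X i => by
      change ((bc σE).map (K.d i j)).hom ((bcResHom hS (K.X i)).hom (bcMk σS
        (M := (ModuleCat.restrictScalars iS.toRingHom).obj (K.X i)) 1 m)) =
        (bcResHom hS (K.X j)).hom (bcMk σS
        (M := (ModuleCat.restrictScalars iS.toRingHom).obj (K.X j)) 1 ((K.d i j).hom m))
      rw [bcResHom_bcMk, bcResHom_bcMk, bc_map_bcMk]

theorem bcResIso_hom_bcMk (K : CochainComplex (ModuleCat.{u} E) ℤ) (n : ℤ) (a : c) (m : K.X n) :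
    ((bcResIso hS K).hom.f n).hom
      (bcMk σS (M := (ModuleCat.restrictScalars iS.toRingHom).obj (K.X n)) a m) = bcMk σE a m :=
  bcResHom_bcMk hS (K.X n) a m

include hB in
/-- The action of `B'` on the base change of `K` is the base change of the action of `B` on `K`. -/
theorem isBaseChangeAction_conjEnd (K : CochainComplex (ModuleCat.{u} E) ℤ) :
    IsBaseChangeAction σS σB (commAction iS.toRingHom iB.toRingHom h K)
      ((conjEnd (bcResIso hS K)).comp (commAction iS' iB' h' ((bcComplex σE).obj K))) where
  map_include b := by
    change (bcResIso hS K).hom ≫ (commAction iS' iB' h' ((bcComplex σE).obj K)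
      (bcInclude σB b) : _ ⟶ _) ≫ (bcResIso hS K).inv = _
    rw [← Category.assoc, Iso.comp_inv_eq]
    ext n : 1
    refine bc_hom_ext σS fun m : K.X n => ?_
    refine (congrArg (fun y : (bc σE).obj (K.X n) => iB' (σB.symm (1 ⊗ₜ b)) • y)
      (bcResIso_hom_bcMk hS K n 1 m)).trans (Eq.trans ?_
        (bcResIso_hom_bcMk hS K n 1 (iB b • m)).symm)
    rw [hB, symm_tmul_smul_bcMk, one_mul]
  map_scalar a n x := by
    have h1 : ∀ y : (bc σE).obj (K.X n), ((bcResIso hS K).hom.f n).hom x = y →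
        ((bcResIso hS K).hom.f n).hom (σS.symm (a ⊗ₜ 1) • x) = iB' (σB.symm (a ⊗ₜ 1)) • y := by
      rintro y rfl
      rw [map_smul, hB, map_one, ← map_one iS, ← hS]
      rfl
    exact (congrArg ((bcResIso hS K).inv.f n).hom (h1 _ rfl).symm).trans
      (congrArg (fun f => f.hom (σS.symm (a ⊗ₜ 1) • x))
        (HomologicalComplex.congr_hom (bcResIso hS K).hom_inv_id n))

include hS hB in
/-- If `B` is the derived endomorphism ring over `S` of a bounded complex of `z`-flat `E`-modules
with finitely generated cohomology over `S`, then `c ⊗ B` is that of its base change: the unit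
morphism `B → Hom_S(F, K)`, for `F` a resolution by finitely generated free modules, is a
quasi-isomorphism of complexes of flat modules and commutes with base change. -/
theorem HasDerivedEnd.bc [IsRegularRing z] {D : ℕ} (hD : ringKrullDim z ≤ D) [Module.Flat z S]
    [Module.Flat z B] [IsNoetherianRing S] (K : CochainComplex (ModuleCat.{u} E) ℤ) {a b : ℤ}
    [K.IsStrictlyGE a] [K.IsStrictlyLE b] [hK : ∀ i, Module.Flat z (K.X i)]
    (hfin : ∀ i, Module.Finite S ((DerivedCategory.homologyFunctor (ModuleCat.{u} S) i).obj
      (DerivedCategory.Q.obj ((resComplex iS.toRingHom).obj K))))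
    (hend : HasDerivedEnd (commAction iS.toRingHom iB.toRingHom h K)) :
    HasDerivedEnd (commAction iS' iB' h' ((bcComplex σE).obj K)) := by
  obtain ⟨F, b', hb', hF, ⟨e⟩⟩ := hasLeftResolution_finiteFree (S := S) _ (a := a) (b := b) hfin
  have hFp : ∀ n, Projective (F.X n) := fun n => projective_of_finiteFree (hF n)
  have : F.IsKProjective := CochainComplex.isKProjective_of_projective F b'
  obtain ⟨q, hq⟩ := exists_quasiIso_of_isKProjective e
  have h1 := (quasiIso_homComplexUnit_iff q _).2 ⟨hend.ext, hend.bijective⟩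
  have hKS : ∀ i, Module.Flat z (((resComplex iS.toRingHom).obj K).X i) := fun i => by
    refine @Module.Flat.of_linearEquiv z (K.X i) _ _ _ _ _ _ (hK i)
      { toFun := fun x => x
        invFun := fun x => x
        map_add' := fun _ _ => rfl
        map_smul' := fun r (x : K.X i) => congrArg (· • x) (iS.commutes r) }
  have hact := isBaseChangeAction_conjEnd hS hB h h' K
  have h2 := quasiIso_homComplexUnit_bc σS σB hact hD (isBaseLinear_commAction h K)
    (a := a) (b := b') hF q
  have hFflat : ∀ i, Module.Flat z (F.X i) := fun i => flat_of_projective (F.X i)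
  have hq' : QuasiIso ((bcComplex σS).map q) := bc_quasiIso σS hD q
  have hFp' : ∀ n, Projective (((bcComplex σS).obj F).X n) := fun n =>
    bc_map_projective σS (hFp n)
  have : ((bcComplex σS).obj F).IsKProjective := CochainComplex.isKProjective_of_projective _ b'
  obtain ⟨h3, h4⟩ := (quasiIso_homComplexUnit_iff ((bcComplex σS).map q) _).1 h2
  exact (hasDerivedEnd_iff_of_quasiIso (bcResIso hS K).hom fun t => by
    change ((bcResIso hS K).hom ≫ (commAction iS' iB' h' ((bcComplex σE).obj K) t : _ ⟶ _) ≫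
      (bcResIso hS K).inv) ≫ _ = _
    rw [Category.assoc, Category.assoc, Iso.inv_hom_id, Category.comp_id]).1 ⟨h3, h4⟩

end RestrictBaseChange

/-! ### Cohomology and endomorphisms of dualizing complexes -/

section Homology

variable {E S : Type u} [Ring E] [Ring S]

/-- Restriction of scalars commutes with cohomology. -/
theorem nonempty_homology_restrictScalars_iso (iS : S →+* E)
    {K : CochainComplex (ModuleCat.{u} E) ℤ} {X : DerivedCategory (ModuleCat.{u} E)}
    (e : DerivedCategory.Q.obj K ≅ X) (n : ℤ) :
    Nonempty ((DerivedCategory.homologyFunctor (ModuleCat.{u} S) n).obj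
      (DerivedCategory.Q.obj ((resComplex iS).obj K)) ≅
      (ModuleCat.restrictScalars iS).obj
        ((DerivedCategory.homologyFunctor (ModuleCat.{u} E) n).obj X)) := by
  let e₁ := (DerivedCategory.homologyFunctorFactors (ModuleCat.{u} S) n).app ((resComplex iS).obj K)
  let e₂ : ((resComplex iS).obj K).homology n ≅ (ModuleCat.restrictScalars iS).obj (K.homology n) :=
    (K.sc n).mapHomologyIso (ModuleCat.restrictScalars iS)
  let e₃ := (ModuleCat.restrictScalars iS).mapIso
    (((DerivedCategory.homologyFunctorFactors (ModuleCat.{u} E) n).app K).symm ≪≫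
      (DerivedCategory.homologyFunctor _ n).mapIso e)
  exact ⟨e₁ ≪≫ e₂ ≪≫ e₃⟩

theorem finite_of_iso {M N : ModuleCat.{u} S} (e : M ≅ N) (h : Module.Finite S M) :
    Module.Finite S N :=
  Module.Finite.equiv e.toLinearEquiv

/-- The cohomology of a complex of finitely generated modules over a Noetherian ring is finitely
generated. -/
theorem finite_homology [IsNoetherianRing S] (K : CochainComplex (ModuleCat.{u} S) ℤ)
    (hK : ∀ n, Module.Finite S (K.X n)) (n : ℤ) : Module.Finite S
      ((DerivedCategory.homologyFunctor (ModuleCat.{u} S) n).obj (DerivedCategory.Q.obj K)) := by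
  have h1 : Module.Finite S (K.cycles n) := Module.Finite.of_injective (K.iCycles n).hom
    ((ModuleCat.mono_iff_injective _).1 inferInstance)
  have h2 : Module.Finite S (K.homology n) := Module.Finite.of_surjective (K.homologyπ n).hom
    ((ModuleCat.epi_iff_surjective _).1 inferInstance)
  exact finite_of_iso ((DerivedCategory.homologyFunctorFactors (ModuleCat.{u} S) n).app K).symm h2

/-- Restriction of scalars commutes with the passage to the derived category. -/
theorem nonempty_restrictScalars_iso (iS : S →+* E)
    {K : CochainComplex (ModuleCat.{u} E) ℤ} {X : DerivedCategory (ModuleCat.{u} E)}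
    (e : DerivedCategory.Q.obj K ≅ X) :
    Nonempty (DerivedCategory.Q.obj ((resComplex iS).obj K) ≅
      (ModuleCat.restrictScalars iS).mapDerivedCategory.obj X) :=
  ⟨((ModuleCat.restrictScalars iS).mapDerivedCategoryFactors.app K).symm ≪≫
    (ModuleCat.restrictScalars iS).mapDerivedCategory.mapIso e⟩

end Homology

section NatTrans

variable {C D : Type (u + 1)} [Category.{u} C] [Category.{u} D] [Abelian C] [Abelian D]
  {F G : C ⥤ D} [F.Additive] [G.Additive]
  [Limits.PreservesFiniteLimits F] [Limits.PreservesFiniteColimits F]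
  [Limits.PreservesFiniteLimits G] [Limits.PreservesFiniteColimits G]

theorem derivedNatTrans_app_Q (τ : F ⟶ G) (K : CochainComplex C ℤ) :
    (derivedNatTrans τ).app (DerivedCategory.Q.obj K) = F.mapDerivedCategoryFactors.hom.app K ≫
      DerivedCategory.Q.map ((NatTrans.mapHomologicalComplex τ _).app K) ≫
        G.mapDerivedCategoryFactors.inv.app K :=
  Localization.liftNatTrans_app _ _ _ _ _ _ _ _

theorem bijective_derivedNatTrans_iff {ι : Type*} (τ : ι → (F ⟶ G)) {K : CochainComplex C ℤ}
    {X : DerivedCategory C} (e : DerivedCategory.Q.obj K ≅ X) :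
    Function.Bijective (fun a => (derivedNatTrans (τ a)).app X) ↔
      Function.Bijective fun a =>
        DerivedCategory.Q.map ((NatTrans.mapHomologicalComplex (τ a)
          (ComplexShape.up ℤ)).app K) := by
  let E := Iso.homCongr ((F.mapDerivedCategoryFactors.app K).symm ≪≫ F.mapDerivedCategory.mapIso e)
    ((G.mapDerivedCategoryFactors.app K).symm ≪≫ G.mapDerivedCategory.mapIso e)
  have h : (fun a => (derivedNatTrans (τ a)).app X) = E ∘ fun a =>
      DerivedCategory.Q.map ((NatTrans.mapHomologicalComplex (τ a) (ComplexShape.up ℤ)).app K) := by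
    funext a
    have h1 := (derivedNatTrans (τ a)).naturality e.hom
    rw [derivedNatTrans_app_Q] at h1
    rw [(Iso.eq_inv_comp (F.mapDerivedCategory.mapIso e)).2 h1]
    simp [E, Iso.homCongr]
  rw [h]
  exact Function.Bijective.of_comp_iff' E.bijective _

end NatTrans

section Bimodules

variable {z : Type u} [CommRing z] {A : Type u} [Ring A] [Algebra z A]

theorem commute_includeLeft_includeRight (a : A) (b : Aᵐᵒᵖ) :
    Commute ((Algebra.TensorProduct.includeLeft : A →ₐ[z] Env z A) a)
      ((Algebra.TensorProduct.includeRight : Aᵐᵒᵖ →ₐ[z] Env z A) b) := by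
  simp [Commute, SemiconjBy]

variable {K : CochainComplex (ModuleCat.{u} (Env z A)) ℤ}
  {R : DerivedCategory (ModuleCat.{u} (Env z A))} (e : DerivedCategory.Q.obj K ≅ R)
include e

/-- The condition that `A → RHom_A(R, R)` is an isomorphism, in terms of a complex representing
`R`. -/
theorem hasDerivedEnd_left_iff :
    HasDerivedEnd (commAction (Algebra.TensorProduct.includeLeft : A →ₐ[z] Env z A).toRingHom
      (Algebra.TensorProduct.includeRight : Aᵐᵒᵖ →ₐ[z] Env z A).toRingHom
      commute_includeLeft_includeRight K) ↔
    (∀ i : ℤ, i ≠ 0 → Subsingleton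
      ((leftRes z A).mapDerivedCategory.obj R ⟶ ((leftRes z A).mapDerivedCategory.obj R)⟦i⟧)) ∧
    Function.Bijective fun a : A => (derivedNatTrans (rightMul z A a)).app R := by
  obtain ⟨e'⟩ := nonempty_restrictScalars_iso
    (Algebra.TensorProduct.includeLeft : A →ₐ[z] Env z A).toRingHom e
  rw [bijective_derivedNatTrans_iff (rightMul z A) e]
  have h1 := fun i : ℤ =>
    (e'.homCongr ((CategoryTheory.shiftFunctor _ i).mapIso e')).subsingleton_congr
  have h2 : (Function.Bijective fun b : Aᵐᵒᵖ => DerivedCategory.Q.map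
      (commAction (Algebra.TensorProduct.includeLeft : A →ₐ[z] Env z A).toRingHom
      (Algebra.TensorProduct.includeRight : Aᵐᵒᵖ →ₐ[z] Env z A).toRingHom
      commute_includeLeft_includeRight K b : _ ⟶ _)) ↔ Function.Bijective fun a : A =>
        DerivedCategory.Q.map ((NatTrans.mapHomologicalComplex (rightMul z A a)
          (ComplexShape.up ℤ)).app K) :=
    (Function.Bijective.of_comp_iff _ MulOpposite.opEquiv.bijective).symm
  exact ⟨fun h => ⟨fun i hi => (h1 i).1 (h.1 i hi), h2.1 h.2⟩,
    fun h => ⟨fun i hi => (h1 i).2 (h.1 i hi), h2.2 h.2⟩⟩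

/-- The condition that `A → RHom_{A^o}(R, R)` is an isomorphism, in terms of a complex representing
`R`. -/
theorem hasDerivedEnd_right_iff :
    HasDerivedEnd (commAction (Algebra.TensorProduct.includeRight : Aᵐᵒᵖ →ₐ[z] Env z A).toRingHom
      (Algebra.TensorProduct.includeLeft : A →ₐ[z] Env z A).toRingHom
      (fun b a => (commute_includeLeft_includeRight a b).symm) K) ↔
    (∀ i : ℤ, i ≠ 0 → Subsingleton
      ((rightRes z A).mapDerivedCategory.obj R ⟶ ((rightRes z A).mapDerivedCategory.obj R)⟦i⟧)) ∧
    Function.Bijective fun a : A => (derivedNatTrans (leftMul z A a)).app R := by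
  obtain ⟨e'⟩ := nonempty_restrictScalars_iso
    (Algebra.TensorProduct.includeRight : Aᵐᵒᵖ →ₐ[z] Env z A).toRingHom e
  rw [bijective_derivedNatTrans_iff (leftMul z A) e]
  have h1 := fun i : ℤ =>
    (e'.homCongr ((CategoryTheory.shiftFunctor _ i).mapIso e')).subsingleton_congr
  exact ⟨fun h => ⟨fun i hi => (h1 i).1 (h.1 i hi), h.2⟩,
    fun h => ⟨fun i hi => (h1 i).2 (h.1 i hi), h.2⟩⟩

end Bimodules

section FiniteBaseChange

attribute [local instance 50] baseModule baseModule_isScalarTower tensorModule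

variable {z : Type u} [CommRing z] {c S S' : Type u} [CommRing c] [Algebra z c]
  [Ring S] [Ring S'] [Algebra z S] (σ : S' ≃+* c ⊗[z] S)

theorem finite_bc {M : ModuleCat.{u} S} (hM : Module.Finite S M) :
    Module.Finite S' ((bc σ).obj M) := by
  obtain ⟨s, hs⟩ := hM.fg_top
  have h1 : ∀ m : M, bcMk σ 1 m ∈ Submodule.span S' (bcMk σ 1 '' (s : Set M)) := fun m => by
    have hm : m ∈ Submodule.span S (s : Set M) := hs ▸ Submodule.mem_top
    induction hm using Submodule.span_induction with
    | mem x hx => exact Submodule.subset_span ⟨x, hx, rfl⟩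
    | zero => rw [bcMk_zero]; exact zero_mem _
    | add x y _ _ hx hy => rw [bcMk_add]; exact add_mem hx hy
    | smul r x _ hx => rw [← bcInclude_smul_bcMk]; exact Submodule.smul_mem _ _ hx
  have h2 : Submodule.span S' (bcMk σ 1 '' (s : Set M)) = ⊤ := by
    rw [eq_top_iff]
    rintro x -
    induction x using bc_induction with
    | zero => exact zero_mem _
    | mk a m => rw [bcMk_eq_smul]; exact Submodule.smul_mem _ _ (h1 m)
    | add x y hx hy => exact add_mem hx hy
  exact ⟨h2 ▸ Submodule.fg_span (s.finite_toSet.image _)⟩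

/-- Base change preserves finite generation of cohomology. -/
theorem finite_homology_bc [IsRegularRing z] {D : ℕ} (hD : ringKrullDim z ≤ D) [Module.Flat z S]
    [IsNoetherianRing S] [IsNoetherianRing S'] (G : CochainComplex (ModuleCat.{u} S) ℤ) {a b : ℤ}
    [G.IsStrictlyGE a] [G.IsStrictlyLE b] [hG : ∀ i, Module.Flat z (G.X i)]
    (hfin : ∀ i, Module.Finite S ((DerivedCategory.homologyFunctor (ModuleCat.{u} S) i).obj
      (DerivedCategory.Q.obj G))) (i : ℤ) :
    Module.Finite S' ((DerivedCategory.homologyFunctor (ModuleCat.{u} S') i).obj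
      (DerivedCategory.Q.obj ((bcComplex σ).obj G))) := by
  obtain ⟨F, b', hb', hF, ⟨e⟩⟩ := hasLeftResolution_finiteFree (S := S) _ (a := a) (b := b) hfin
  have hFp : ∀ n, Projective (F.X n) := fun n => projective_of_finiteFree (hF n)
  have : F.IsKProjective := CochainComplex.isKProjective_of_projective F b'
  obtain ⟨q, hq⟩ := exists_quasiIso_of_isKProjective e
  have hFflat : ∀ i, Module.Flat z (F.X i) := fun i => flat_of_projective (F.X i)
  have hq' : QuasiIso ((bcComplex σ).map q) := bc_quasiIso σ hD q
  have hq'' := (DerivedCategory.isIso_Q_map_iff_quasiIso _ ((bcComplex σ).map q)).2 hq'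
  refine finite_of_iso ((DerivedCategory.homologyFunctor _ i).mapIso
    (asIso (DerivedCategory.Q.map ((bcComplex σ).map q)))) (finite_homology _ (fun n => ?_) i)
  exact finite_bc σ (hF n).2

end FiniteBaseChange

/-! ### Finite injective dimension -/

section ExtVanishing

variable {S : Type u} [Ring S]

/-- `Ext^i(N, X) = 0` for all modules `N` and all `i ≥ n`. -/
def ExtVanishing (n : ℤ) (X : DerivedCategory (ModuleCat.{u} S)) : Prop :=
  ∀ (N : ModuleCat.{u} S) (i : ℤ), n ≤ i →
    Subsingleton ((DerivedCategory.singleFunctor (ModuleCat.{u} S) 0).obj N ⟶ X⟦i⟧)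

variable {n : ℤ} {X Y : DerivedCategory (ModuleCat.{u} S)}

theorem ExtVanishing.mono (h : ExtVanishing n X) {m : ℤ} (hm : n ≤ m) : ExtVanishing m X :=
  fun N i hi => h N i (hm.trans hi)

theorem ExtVanishing.of_iso (h : ExtVanishing n X) (e : X ≅ Y) : ExtVanishing n Y :=
  fun N i hi => (((Iso.refl _).homCongr
    ((CategoryTheory.shiftFunctor _ i).mapIso e)).subsingleton_congr).1 (h N i hi)

theorem extVanishing_shift_iff : ExtVanishing n (X⟦(1 : ℤ)⟧) ↔ ExtVanishing (n + 1) X := by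
  have e : ∀ (N : ModuleCat.{u} S) (i : ℤ),
      Subsingleton ((DerivedCategory.singleFunctor (ModuleCat.{u} S) 0).obj N ⟶ X⟦(1 : ℤ)⟧⟦i⟧) ↔
        Subsingleton ((DerivedCategory.singleFunctor (ModuleCat.{u} S) 0).obj N ⟶ X⟦i + 1⟧) :=
    fun N i => ((Iso.refl _).homCongr
      ((shiftFunctorAdd' _ 1 i (i + 1) (add_comm _ _)).symm.app X)).subsingleton_congr
  constructor
  · intro h N i hi
    obtain ⟨j, rfl⟩ : ∃ j, i = j + 1 := ⟨i - 1, by ring⟩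
    exact (e N j).1 (h N j (by omega))
  · exact fun h N i hi => (e N i).2 (h N (i + 1) (by omega))

theorem ExtVanishing.obj₃ {T : Pretriangulated.Triangle (DerivedCategory (ModuleCat.{u} S))}
    (hT : T ∈ Pretriangulated.distinguishedTriangles) (h₁ : ExtVanishing (n + 1) T.obj₁)
    (h₂ : ExtVanishing n T.obj₂) : ExtVanishing n T.obj₃ := fun N i hi => by
  have h0 : ∀ f : (DerivedCategory.singleFunctor (ModuleCat.{u} S) 0).obj N ⟶ T.obj₃⟦i⟧, f = 0 := by
    intro f
    have hT' := Pretriangulated.Triangle.shift_distinguished T hT i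
    have := extVanishing_shift_iff.2 h₁ N i hi
    have hs : Subsingleton ((DerivedCategory.singleFunctor (ModuleCat.{u} S) 0).obj N ⟶
        T.obj₁⟦i⟧⟦(1 : ℤ)⟧) := (((Iso.refl _).homCongr
      ((shiftFunctorComm (DerivedCategory (ModuleCat.{u} S)) 1 i).app T.obj₁)).subsingleton_congr).1
        this
    obtain ⟨g, hg⟩ := Pretriangulated.Triangle.coyoneda_exact₃ _ hT' f (hs.elim _ _)
    have hs' := h₂ N i hi
    rw [hg, hs'.elim g 0]
    exact Limits.zero_comp
  exact ⟨fun f g => (h0 f).trans (h0 g).symm⟩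

theorem ExtVanishing.obj₁ {T : Pretriangulated.Triangle (DerivedCategory (ModuleCat.{u} S))}
    (hT : T ∈ Pretriangulated.distinguishedTriangles) (h₂ : ExtVanishing n T.obj₂)
    (h₃ : ExtVanishing n T.obj₃) : ExtVanishing (n + 1) T.obj₁ :=
  extVanishing_shift_iff.1 (ExtVanishing.obj₃ (Pretriangulated.rot_of_distTriang _ hT)
    (h₂.mono (by omega)) h₃)

/-- For a K-injective complex, the vanishing of `Ext` says that maps to the cocycles lift along the
differential. -/
theorem extVanishing_iff_of_isKInjective (J : CochainComplex (ModuleCat.{u} S) ℤ)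
    [J.IsKInjective] : ExtVanishing n (DerivedCategory.Q.obj J) ↔
      ∀ (N : ModuleCat.{u} S) (i j k : ℤ), n ≤ j → i + 1 = j → j + 1 = k → ∀ f : N ⟶ J.X j,
        f ≫ J.d j k = 0 → ∃ g : N ⟶ J.X i, g ≫ J.d i j = f := by
  have key : ∀ (N : ModuleCat.{u} S) (i j k : ℤ), i + 1 = j → j + 1 = k →
      (Subsingleton ((DerivedCategory.singleFunctor (ModuleCat.{u} S) 0).obj N ⟶
        (DerivedCategory.Q.obj J)⟦j⟧) ↔
      ∀ f : N ⟶ J.X j, f ≫ J.d j k = 0 → ∃ g : N ⟶ J.X i, g ≫ J.d i j = f) := by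
    intro N i j k hij hjk
    have e : Subsingleton ((DerivedCategory.singleFunctor (ModuleCat.{u} S) 0).obj N ⟶
        (DerivedCategory.Q.obj J)⟦j⟧) ↔ Subsingleton (DerivedCategory.Q.obj
          ((CochainComplex.singleFunctor (ModuleCat.{u} S) 0).obj N) ⟶
            (DerivedCategory.Q.obj J)⟦j⟧) := Iff.rfl
    rw [e, ← forall_eq_δ_iff_of_isKInjective hij]
    constructor
    · intro h f hf
      obtain ⟨α, hα⟩ := h (CochainComplex.HomComplex.Cocycle.fromSingleMk f (zero_add j) k hjk hf)
      obtain ⟨g, rfl⟩ := CochainComplex.HomComplex.Cochain.fromSingleMk_surjective α i (zero_add i)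
      rw [CochainComplex.HomComplex.Cochain.δ_fromSingleMk _ _ _ j (zero_add j)] at hα
      have h1 := CochainComplex.HomComplex.Cochain.congr_v hα 0 j (zero_add j)
      rw [CochainComplex.HomComplex.Cochain.fromSingleMk_v] at h1
      exact ⟨g, (cancel_epi (HomologicalComplex.singleObjXSelf (ComplexShape.up ℤ) 0 N).hom).1
        (h1.trans (CochainComplex.HomComplex.Cochain.fromSingleMk_v f (zero_add j)))⟩
    · intro h x
      obtain ⟨f, hf, rfl⟩ := CochainComplex.HomComplex.Cocycle.fromSingleMk_surjective x j
        (zero_add j) k hjk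
      obtain ⟨g, hg⟩ := h f hf
      refine ⟨CochainComplex.HomComplex.Cochain.fromSingleMk g (zero_add i), ?_⟩
      rw [CochainComplex.HomComplex.Cochain.δ_fromSingleMk _ _ _ j (zero_add j), hg]
      rfl
  constructor
  · intro h N i j k hj hij hjk
    exact (key N i j k hij hjk).1 (h N j hj)
  · intro h N j hj
    exact (key N (j - 1) j (j + 1) (by omega) rfl).2 (h N _ _ _ hj (by omega) rfl)

end ExtVanishing

section Split

variable {S T : Type u} [Ring S] [Ring T]

/-- The differentials of `J` are split surjections onto the cocycles in degrees at least `n`. -/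
def IsSplitAbove (n : ℤ) (J : CochainComplex (ModuleCat.{u} S) ℤ) : Prop :=
  ∀ i j k : ℤ, n ≤ j → i + 1 = j → j + 1 = k →
    ∃ s : Limits.kernel (J.d j k) ⟶ J.X i, s ≫ J.d i j = Limits.kernel.ι (J.d j k)

variable {n : ℤ} {J : CochainComplex (ModuleCat.{u} S) ℤ}

theorem IsSplitAbove.exists_lift (h : IsSplitAbove n J) {N : ModuleCat.{u} S} {i j k : ℤ}
    (hj : n ≤ j) (hij : i + 1 = j) (hjk : j + 1 = k) (f : N ⟶ J.X j) (hf : f ≫ J.d j k = 0) :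
    ∃ g : N ⟶ J.X i, g ≫ J.d i j = f := by
  obtain ⟨s, hs⟩ := h i j k hj hij hjk
  exact ⟨Limits.kernel.lift _ f hf ≫ s, by rw [Category.assoc, hs, Limits.kernel.lift_ι]⟩

/-- The inclusion of the cocycles is the universal map to be lifted along the differential. -/
theorem isSplitAbove_iff [J.IsKInjective] :
    IsSplitAbove n J ↔ ExtVanishing n (DerivedCategory.Q.obj J) := by
  rw [extVanishing_iff_of_isKInjective]
  exact ⟨fun h N i j k hj hij hjk f hf => h.exists_lift hj hij hjk f hf,
    fun h i j k hj hij hjk => h _ i j k hj hij hjk _ (Limits.kernel.condition _)⟩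

theorem IsSplitAbove.map (h : IsSplitAbove n J) (H : ModuleCat.{u} S ⥤ ModuleCat.{u} T)
    [H.Additive] [Limits.PreservesFiniteLimits H] :
    IsSplitAbove n ((H.mapHomologicalComplex (ComplexShape.up ℤ)).obj J) := by
  intro i j k hj hij hjk
  obtain ⟨s, hs⟩ := h i j k hj hij hjk
  refine ⟨(Limits.PreservesKernel.iso H (J.d j k)).inv ≫ H.map s, ?_⟩
  exact (Category.assoc _ _ _).trans ((congrArg (_ ≫ ·) ((H.map_comp _ _).symm.trans
    (congrArg H.map hs))).trans (Limits.PreservesKernel.iso_inv_ι H (J.d j k)))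

/-- In the range where the complex splits, the cocycles of a complex of injective modules are
injective. -/
theorem IsSplitAbove.injective_kernel (h : IsSplitAbove n J) {i j k : ℤ}
    (hj : n ≤ j) (hij : i + 1 = j) (hjk : j + 1 = k) [hJ : Injective (J.X i)] :
    Injective (Limits.kernel (J.d j k)) := by
  obtain ⟨s, hs⟩ := h i j k hj hij hjk
  exact Retract.injective ⟨s, Limits.kernel.lift _ (J.d i j) (J.d_comp_d i j k), by
    rw [← cancel_mono (Limits.kernel.ι (J.d j k)), Category.assoc, Limits.kernel.lift_ι, hs,
      Category.id_comp]⟩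

/-- Bounded below complexes have injective resolutions. -/
theorem exists_injective_resolution (K : CochainComplex (ModuleCat.{u} S) ℤ) (a : ℤ)
    [K.IsStrictlyGE a] : ∃ (J : CochainComplex (ModuleCat.{u} S) ℤ) (f : K ⟶ J), Mono f ∧
      QuasiIso f ∧ (∀ i, Injective (J.X i)) ∧ J.IsStrictlyGE (a - 1) := by
  obtain ⟨J, f, h1, h2, h3, h4⟩ :=
    CochainComplex.Plus.modelCategoryQuillen.exists_mono_quasiIso_injective K (a - 1) a
  exact ⟨J, f, h1, h2, h3, h4⟩

end Split

/-! ### Flat base change of injective modules -/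

section FlatInjective

attribute [local instance 50] baseModule baseModule_isScalarTower tensorModule

variable {z : Type u} [CommRing z] {c S T : Type u} [CommRing c] [Algebra z c] [Ring S] [Ring T]
  [Algebra z S] (σ : T ≃+* c ⊗[z] S)

/-- Baer's criterion in terms of equations: the system `b j • x = y j` is solvable in an injective
module if the `y j` satisfy all linear relations between the `b j`. -/
theorem exists_smul_eq_of_injective {E : Type u} [AddCommGroup E] [Module S E]
    (hE : Module.Baer S E) {k : ℕ} (b : Fin k → S) (y : Fin k → E)
    (hy : ∀ r : Fin k → S, ∑ j, r j • b j = 0 → ∑ j, r j • y j = 0) :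
    ∃ x : E, ∀ j, b j • x = y j := by
  classical
  let p := Fintype.linearCombination S b
  let q := Fintype.linearCombination S y
  have hpq : LinearMap.ker p ≤ LinearMap.ker q := fun r hr => hy r hr
  let g : LinearMap.range p →ₗ[S] E :=
    ((LinearMap.ker p).liftQ q hpq).comp p.quotKerEquivRange.symm.toLinearMap
  obtain ⟨g', hg'⟩ := hE (LinearMap.range p) g
  refine ⟨g' 1, fun j => ?_⟩
  have h1 : p (Pi.single j 1) = b j := by simp [p]
  have h2 := hg' (p (Pi.single j 1)) ⟨_, rfl⟩
  have h3 : g ⟨p (Pi.single j 1), ⟨_, rfl⟩⟩ = q (Pi.single j 1) := by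
    have : (⟨p (Pi.single j 1), ⟨_, rfl⟩⟩ : LinearMap.range p) =
        p.quotKerEquivRange (Submodule.Quotient.mk (Pi.single j 1)) := rfl
    simp [g, this]
  rw [h3, h1] at h2
  rw [← map_smul, smul_eq_mul, mul_one, h2]
  simp [q]

/-- The converse of `exists_smul_eq_of_injective`, over a Noetherian ring. -/
theorem baer_of_exists_smul_eq [IsNoetherianRing S] {E : Type u} [AddCommGroup E] [Module S E]
    (h : ∀ {k : ℕ} (b : Fin k → S) (y : Fin k → E),
      (∀ r : Fin k → S, ∑ j, r j • b j = 0 → ∑ j, r j • y j = 0) → ∃ x : E, ∀ j, b j • x = y j) :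
    Module.Baer S E := fun I f => by
  obtain ⟨k, b, hb⟩ := Submodule.fg_iff_exists_fin_generating_family.1 (IsNoetherian.noetherian I)
  have hbI : ∀ j, b j ∈ I := fun j => hb ▸ Submodule.subset_span ⟨j, rfl⟩
  obtain ⟨x, hx⟩ := h b (fun j => f ⟨b j, hbI j⟩) (fun r hr => by
    have h1 : ∑ j, r j • (⟨b j, hbI j⟩ : I) = 0 := by
      apply Subtype.ext
      simpa using hr
    rw [← map_zero f, ← h1, map_sum]
    simp only [map_smul])
  refine ⟨LinearMap.toSpanSingleton S E x, fun s hs' => ?_⟩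
  have h1 : ∀ t ∈ Submodule.span S (Set.range b), ∀ ht : t ∈ I, t • x = f ⟨t, ht⟩ := by
    intro t ht
    induction ht using Submodule.span_induction with
    | mem t ht =>
      obtain ⟨j, rfl⟩ := ht
      exact fun _ => hx j
    | zero =>
      intro ht
      rw [zero_smul]
      exact (map_zero f).symm
    | add s t hs ht h1 h2 =>
      intro hst
      rw [add_smul, h1 (hb ▸ hs), h2 (hb ▸ ht), ← map_add]
      rfl
    | smul a s hs h =>
      intro has
      rw [smul_assoc, h (hb ▸ hs), ← map_smul]
      rfl
  exact h1 s (hb ▸ hs') hs'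

theorem smul_tensor_sum {X : ModuleCat.{u} c} {E : ModuleCat.{u} S} {k : ℕ} (r : Fin k → S)
    (y : X ⊗[z] (Fin k → E)) (v : (Fin k → E) →ₗ[z] E) (hv : ∀ e, v e = ∑ j, r j • e j) :
    v.lTensor X y = ∑ j, ((1 : c) ⊗ₜ[z] r j : c ⊗[z] S) •
      TensorProduct.piRight z z X (fun _ => E) y j := by
  induction y with
  | zero => simp
  | add y₁ y₂ h₁ h₂ => simp only [map_add, h₁, h₂, Pi.add_apply, smul_add, Finset.sum_add_distrib]
  | tmul a e =>
    simp only [LinearMap.lTensor_tmul, hv, TensorProduct.tmul_sum, TensorProduct.piRight_apply,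
      TensorProduct.piRightHom_tmul, tensorModule_smul_tmul, one_smul]

/-- Solvability of such systems passes to the tensor product with a flat module. The relations
between the `b j` are finitely generated, so that compatible families `y` form the kernel of a map
between finite powers of the module, and kernels commute with flat tensor products. -/
theorem exists_tensor_smul_eq [IsNoetherianRing S] (X : ModuleCat.{u} c) [Module.Flat z X]
    (E : ModuleCat.{u} S) (hE : Module.Baer S E) {k : ℕ} (b : Fin k → S)
    (y : Fin k → ((tensorFunctor z c S).obj X).obj E)
    (hy : ∀ r : Fin k → S, ∑ j, r j • b j = 0 → ∑ j, ((1 : c) ⊗ₜ[z] r j : c ⊗[z] S) • y j = 0) :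
    ∃ x : ((tensorFunctor z c S).obj X).obj E, ∀ j, ((1 : c) ⊗ₜ[z] b j : c ⊗[z] S) • x = y j := by
  classical
  let p := Fintype.linearCombination S b
  obtain ⟨m, r, hr⟩ := Submodule.fg_iff_exists_fin_generating_family.1
    (IsNoetherian.noetherian (LinearMap.ker p))
  let vl : Fin m → ((Fin k → E) →ₗ[z] E) := fun l =>
    ∑ j, (Algebra.lsmul z z E (r l j)).comp (LinearMap.proj j)
  have hvl : ∀ l e, vl l e = ∑ j, r l j • e j := fun l e => by simp [vl]
  let v : (Fin k → E) →ₗ[z] (Fin m → E) := LinearMap.pi vl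
  let y' : X ⊗[z] (Fin k → E) := (TensorProduct.piRight z z X (fun _ => E)).symm y
  have hy' : v.lTensor X y' = 0 := by
    apply (TensorProduct.piRight z z X (fun _ : Fin m => E)).injective
    rw [map_zero]
    funext l
    have h1 : ∀ t, TensorProduct.piRight z z X (fun _ : Fin m => E) (v.lTensor X t) l =
        (vl l).lTensor X t := fun t => by
      induction t with
      | zero => simp
      | add y₁ y₂ h₁ h₂ => simp only [map_add, Pi.add_apply, h₁, h₂]
      | tmul a e => simp [v]
    have hrl : r l ∈ LinearMap.ker p := hr ▸ Submodule.subset_span ⟨l, rfl⟩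
    refine (h1 y').trans ((smul_tensor_sum (c := c) (r l) y' (vl l) (hvl l)).trans
      (Eq.trans (Finset.sum_congr rfl fun j _ => congrArg _ ?_) (hy (r l) hrl)))
    exact congrFun (LinearEquiv.apply_symm_apply _ y) j
  have hex := Module.Flat.lTensor_exact X (LinearMap.exact_subtype_ker_map v)
  obtain ⟨w, hw⟩ := (hex y').1 hy'
  have key : ∀ w : X ⊗[z] (LinearMap.ker v), ∃ x : X ⊗[z] E, ∀ j,
      ((1 : c) ⊗ₜ[z] b j : c ⊗[z] S) • x = TensorProduct.piRight z z X (fun _ => E)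
        ((LinearMap.ker v).subtype.lTensor X w) j := fun w => by
    induction w with
    | zero => exact ⟨0, fun j => by simp⟩
    | add w₁ w₂ h₁ h₂ =>
      obtain ⟨x₁, h₁⟩ := h₁
      obtain ⟨x₂, h₂⟩ := h₂
      exact ⟨x₁ + x₂, fun j => by rw [smul_add, h₁, h₂, map_add, map_add]; rfl⟩
    | tmul a e =>
      obtain ⟨x, hx⟩ := exists_smul_eq_of_injective hE b e.1 (fun s hs => by
        have hs' : s ∈ LinearMap.ker p := hs
        rw [← hr] at hs'
        clear hs
        induction hs' using Submodule.span_induction with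
        | mem s hs =>
          obtain ⟨l, rfl⟩ := hs
          rw [← hvl]
          exact congrFun e.2 l
        | zero => simp
        | add s t _ _ h1 h2 => simp [add_smul, Finset.sum_add_distrib, h1, h2]
        | smul t s _ h => simp [mul_smul, ← Finset.smul_sum, h])
      exact ⟨a ⊗ₜ x, fun j => by
        rw [tensorModule_smul_tmul, one_smul, hx]
        simp⟩
  obtain ⟨x, hx⟩ := key w
  refine ⟨x, fun j => (hx j).trans ?_⟩
  rw [hw]
  exact congrFun (LinearEquiv.apply_symm_apply _ y) j

/-- Flatness of `c` over `z`, for the module structure obtained by restricting scalars from `c`. -/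
theorem flat_self {z c : Type u} [CommRing z] [Ring c] [Algebra z c] [hc : Module.Flat z c] :
    @Module.Flat z (ModuleCat.of c c) _ _ (baseModule z (ModuleCat.of c c)) := by
  have h : (baseModule z (ModuleCat.of c c) : Module z c) = Algebra.toModule :=
    Module.ext' _ _ fun r x => (Algebra.smul_def r x).symm
  exact (congrArg (fun m : Module z c => @Module.Flat z c _ _ m) h).mpr hc

/-- Over a Noetherian ring, the tensor product of an injective module with a flat module over a
central subring is injective. -/
theorem injective_restrictScalars_bc [IsNoetherianRing S] [hc : Module.Flat z c]
    (E : ModuleCat.{u} S) [hE : Injective E] :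
    Injective ((ModuleCat.restrictScalars (bcInclude σ)).obj ((bc σ).obj E)) := by
  have hE' : Module.Baer S E :=
    Module.Baer.of_injective ((Module.injective_iff_injective_object S E).2 hE)
  let W := ((tensorFunctor z c S).obj (ModuleCat.of c c)).obj E
  let V := (ModuleCat.restrictScalars (bcInclude σ)).obj ((bc σ).obj E)
  let ε : V ≃+ W := AddEquiv.refl W
  have hs : ∀ (s : S) (x : V), ε (s • x) = ((1 : c) ⊗ₜ[z] s : c ⊗[z] S) • ε x := fun s x => by
    change (σ (σ.symm ((1 : c) ⊗ₜ[z] s)) • ε x : W) = _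
    rw [σ.apply_symm_apply]
  have hV : Module.Baer S V := baer_of_exists_smul_eq fun b y hy => by
    obtain ⟨x, hx⟩ := @exists_tensor_smul_eq z _ c S _ _ _ _ _ (ModuleCat.of c c) flat_self E hE' _
      b (fun j => ε (y j)) (fun r h => by
        rw [← map_zero ε, ← hy r h, map_sum]
        exact Finset.sum_congr rfl fun j _ => (hs _ _).symm)
    exact ⟨ε.symm x, fun j => ε.injective ((hs _ _).trans (hx j))⟩
  exact (Module.injective_iff_injective_object S V).1 (Module.Baer.injective hV)

end FlatInjective

/-! ### Flat base change of complexes of finite injective dimension -/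

section FlatBaseChange

attribute [local instance 50] baseModule baseModule_isScalarTower tensorModule

variable {z : Type u} [CommRing z] {c S T : Type u} [CommRing c] [Algebra z c] [Ring S] [Ring T]
  [Algebra z S] (σ : T ≃+* c ⊗[z] S)

theorem tensorFunctor_map_injective (X : ModuleCat.{u} c) [Module.Flat z X] {M N : ModuleCat.{u} S}
    (f : M ⟶ N) (hf : Function.Injective f.hom) :
    Function.Injective (((tensorFunctor z c S).obj X).map f).hom :=
  Module.Flat.lTensor_preserves_injective_linearMap (M := X) (f.hom.restrictScalars z) hf

instance bc_preservesMonomorphisms [hc : Module.Flat z c] : (bc σ).PreservesMonomorphisms where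
  preserves {M N} f hf := by
    rw [ModuleCat.mono_iff_injective] at hf ⊢
    exact @tensorFunctor_map_injective z _ c S _ _ _ _ (ModuleCat.of c c) flat_self M N f hf

instance bc_preservesHomology [hc : Module.Flat z c] : (bc σ).PreservesHomology := by
  have : Limits.PreservesColimitsOfSize.{0, 0} (bc σ) :=
    (bcAdj σ).leftAdjoint_preservesColimits
  exact Functor.preservesHomology_of_preservesMonos_and_cokernels (bc σ)

instance bc_preservesFiniteLimits [hc : Module.Flat z c] :
    Limits.PreservesFiniteLimits (bc σ) :=
  (bc σ).preservesFiniteLimits_of_preservesHomology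

theorem bc_quasiIso_of_flat [hc : Module.Flat z c] {K L : CochainComplex (ModuleCat.{u} S) ℤ}
    (f : K ⟶ L) [QuasiIso f] : QuasiIso ((bcComplex σ).map f) :=
  inferInstanceAs (QuasiIso (((bc σ).mapHomologicalComplex _).map f))

/-- Finite injective dimension passes to a flat base change, if the base change of injective
modules is injective. -/
theorem ExtVanishing.bc_of_injective [Module.Flat z c]
    (hinj : ∀ E : ModuleCat.{u} S, Injective E → Injective ((bc σ).obj E)) {n : ℤ}
    (K : CochainComplex (ModuleCat.{u} S) ℤ) (a : ℤ) [K.IsStrictlyGE a]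
    (h : ExtVanishing n (DerivedCategory.Q.obj K)) :
    ExtVanishing n (DerivedCategory.Q.obj ((bcComplex σ).obj K)) := by
  obtain ⟨J, f, -, hf, hJ, hJ'⟩ := exists_injective_resolution K a
  have : J.IsKInjective := CochainComplex.isKInjective_of_injective J (a - 1)
  have hJT : ∀ i, Injective (((bcComplex σ).obj J).X i) := fun i => hinj _ (hJ i)
  have : ((bcComplex σ).obj J).IsKInjective :=
    CochainComplex.isKInjective_of_injective _ (a - 1)
  have hf' := (DerivedCategory.isIso_Q_map_iff_quasiIso _ f).2 hf
  have hf'' := (DerivedCategory.isIso_Q_map_iff_quasiIso _ ((bcComplex σ).map f)).2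
    (bc_quasiIso_of_flat σ f)
  have h1 : IsSplitAbove n J := isSplitAbove_iff.2 (h.of_iso (asIso (DerivedCategory.Q.map f)))
  exact (isSplitAbove_iff.1 (h1.map (bc σ))).of_iso
    (asIso (DerivedCategory.Q.map ((bcComplex σ).map f))).symm

/-- If `z → c` is an epimorphism of commutative rings, then the linear maps between modules over
`c ⊗_z S` are the `S`-linear maps. -/
theorem full_restrictScalars_bcInclude (hepi : ∀ a : c, a ⊗ₜ[z] (1 : c) = 1 ⊗ₜ a) :
    (ModuleCat.restrictScalars.{u} (bcInclude σ)).Full where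
  map_surjective {M N} f := by
    let f₀ : M →+ N := f.hom.toAddMonoidHom
    have hf₀ : ∀ (s : S) (m : M), f₀ (bcInclude σ s • m) = bcInclude σ s • f₀ m :=
      fun s (m : (ModuleCat.restrictScalars (bcInclude σ)).obj M) => map_smul f.hom s m
    have hz : ∀ (r : z) (b : c), σ.symm ((r • b) ⊗ₜ[z] (1 : S)) =
        bcInclude σ (algebraMap z S r) * σ.symm (b ⊗ₜ 1) := fun r b => by
      change _ = σ.symm ((1 : c) ⊗ₜ[z] algebraMap z S r) * _
      rw [← map_mul, Algebra.TensorProduct.tmul_mul_tmul, one_mul, mul_one,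
        Algebra.algebraMap_eq_smul_one, TensorProduct.tmul_smul, TensorProduct.smul_tmul']
    have hz' : ∀ (r : z) (b : c), σ.symm ((r • b) ⊗ₜ[z] (1 : S)) =
        σ.symm (b ⊗ₜ 1) * bcInclude σ (algebraMap z S r) := fun r b => by
      change _ = _ * σ.symm ((1 : c) ⊗ₜ[z] algebraMap z S r)
      rw [← map_mul, Algebra.TensorProduct.tmul_mul_tmul, one_mul, mul_one,
        Algebra.algebraMap_eq_smul_one, TensorProduct.tmul_smul, TensorProduct.smul_tmul']
    have hc : ∀ (a : c) (m : M), f₀ (σ.symm (a ⊗ₜ 1) • m) = σ.symm (a ⊗ₜ (1 : S)) • f₀ m := by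
      intro a m
      let g : c →+ c →+ N :=
        { toFun := fun a =>
            { toFun := fun b => σ.symm (a ⊗ₜ (1 : S)) • f₀ (σ.symm (b ⊗ₜ (1 : S)) • m)
              map_zero' := by simp
              map_add' := fun b b' => by simp only [TensorProduct.add_tmul, map_add, add_smul,
                smul_add] }
          map_zero' := by ext b; simp
          map_add' := fun a a' => by
            ext b
            simp only [TensorProduct.add_tmul, map_add, add_smul, AddMonoidHom.coe_mk,
              ZeroHom.coe_mk, AddMonoidHom.add_apply] }
      let G := TensorProduct.liftAddHom (R := z) g (fun r a b => by
        change σ.symm ((r • a) ⊗ₜ (1 : S)) • f₀ (σ.symm (b ⊗ₜ (1 : S)) • m) =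
          σ.symm (a ⊗ₜ (1 : S)) • f₀ (σ.symm ((r • b) ⊗ₜ (1 : S)) • m)
        rw [hz r b, mul_smul, hf₀, hz' r a, mul_smul])
      have h1 := congrArg G (hepi a)
      change σ.symm (a ⊗ₜ (1 : S)) • f₀ (σ.symm ((1 : c) ⊗ₜ (1 : S)) • m) =
        σ.symm ((1 : c) ⊗ₜ (1 : S)) • f₀ (σ.symm (a ⊗ₜ (1 : S)) • m) at h1
      rw [← Algebra.TensorProduct.one_def, map_one, one_smul, one_smul] at h1
      exact h1.symm
    refine ⟨ModuleCat.ofHom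
      { toFun := f₀
        map_add' := map_add f₀
        map_smul' := fun t m => ?_ }, rfl⟩
    rw [RingHom.id_apply]
    induction t using smul_bc_induction σ with
    | zero => rw [zero_smul, zero_smul, map_zero]
    | add x y h1 h2 => rw [add_smul, add_smul, map_add, h1, h2]
    | mk a s =>
      have h1 : σ.symm (a ⊗ₜ s) = σ.symm (a ⊗ₜ[z] (1 : S)) * bcInclude σ s := by
        change _ = _ * σ.symm ((1 : c) ⊗ₜ[z] s)
        rw [← map_mul, Algebra.TensorProduct.tmul_mul_tmul, one_mul, mul_one]
      rw [h1, mul_smul, mul_smul, hc, hf₀]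

/-- Finite injective dimension passes to a base change along a flat epimorphism, such as a
localization. -/
theorem ExtVanishing.bc_of_epi [IsNoetherianRing S] [Module.Flat z c]
    (hepi : ∀ a : c, a ⊗ₜ[z] (1 : c) = 1 ⊗ₜ a) {n : ℤ}
    (K : CochainComplex (ModuleCat.{u} S) ℤ) (a : ℤ) [K.IsStrictlyGE a]
    (h : ExtVanishing n (DerivedCategory.Q.obj K)) :
    ExtVanishing n (DerivedCategory.Q.obj ((bcComplex σ).obj K)) :=
  h.bc_of_injective σ (fun E hE => by
    have := full_restrictScalars_bcInclude σ hepi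
    exact (ModuleCat.restrictScalars (bcInclude σ)).injective_of_map_injective
      (injective_restrictScalars_bc σ E)) K a

end FlatBaseChange

section Equivalence

variable {S T : Type u} [Ring S] [Ring T]

/-- Finite injective dimension does not change under an isomorphism of rings. -/
theorem ExtVanishing.restrictScalars_equiv (e : T ≃+* S) {n : ℤ}
    (K : CochainComplex (ModuleCat.{u} S) ℤ) (a : ℤ) [K.IsStrictlyGE a]
    (h : ExtVanishing n (DerivedCategory.Q.obj K)) :
    ExtVanishing n (DerivedCategory.Q.obj ((resComplex e.toRingHom).obj K)) := by
  obtain ⟨J, f, -, hf, hJ, hJ'⟩ := exists_injective_resolution K a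
  have : J.IsKInjective := CochainComplex.isKInjective_of_injective J (a - 1)
  have hJT : ∀ i, Injective (((resComplex e.toRingHom).obj J).X i) := fun i =>
    ((ModuleCat.restrictScalarsEquivalenceOfRingEquiv e).map_injective_iff (J.X i)).2 (hJ i)
  have : ((resComplex e.toRingHom).obj J).IsKInjective :=
    CochainComplex.isKInjective_of_injective _ (a - 1)
  have hf' := (DerivedCategory.isIso_Q_map_iff_quasiIso _ f).2 hf
  have hf'' := (DerivedCategory.isIso_Q_map_iff_quasiIso _ ((resComplex e.toRingHom).map f)).2
    (quasiIso_restrictScalars _ f)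
  have h1 : IsSplitAbove n J := isSplitAbove_iff.2 (h.of_iso (asIso (DerivedCategory.Q.map f)))
  exact (isSplitAbove_iff.1 (h1.map (ModuleCat.restrictScalars e.toRingHom))).of_iso
    (asIso (DerivedCategory.Q.map ((resComplex e.toRingHom).map f))).symm

end Equivalence

section Transitivity

variable {z : Type u} [CommRing z] {c₁ c₂ S T₁ T₂ : Type u} [CommRing c₁] [Algebra z c₁]
  [CommRing c₂] [Algebra z c₂] [Algebra c₁ c₂] [Ring S] [Algebra z S] [Ring T₁] [Algebra c₁ T₁]
  [Ring T₂] (σ₁ : T₁ ≃+* c₁ ⊗[z] S) (σ₂ : T₂ ≃+* c₂ ⊗[c₁] T₁) (σ : T₂ ≃+* c₂ ⊗[z] S)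

/-- Base change in stages. -/
noncomputable def bcCompIso (h : bcInclude σ = (bcInclude σ₂).comp (bcInclude σ₁)) :
    bc σ ≅ bc σ₁ ⋙ bc σ₂ :=
  Adjunction.leftAdjointUniq (bcAdj σ) (((bcAdj σ₁).comp (bcAdj σ₂)).ofNatIsoRight
    (ModuleCat.restrictScalarsComp' _ _ _ h).symm)

/-- Base change of complexes in stages. -/
noncomputable def bcComplexCompIso (h : bcInclude σ = (bcInclude σ₂).comp (bcInclude σ₁))
    (K : CochainComplex (ModuleCat.{u} S) ℤ) :
    (bcComplex σ).obj K ≅ (bcComplex σ₂).obj ((bcComplex σ₁).obj K) :=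
  (NatIso.mapHomologicalComplex (bcCompIso σ₁ σ₂ σ h) (ComplexShape.up ℤ)).app K

end Transitivity

/-! ### Coextension of scalars -/

section Coextend

variable {S T : Type u} [Ring S] [Ring T] (f : S →+* T)

instance coextendScalars_additive : (ModuleCat.coextendScalars.{u, u, u} f).Additive :=
  (ModuleCat.restrictCoextendScalarsAdj.{u} f).right_adjoint_additive

instance coextendScalars_preservesFiniteLimits :
    Limits.PreservesFiniteLimits (ModuleCat.coextendScalars.{u, u, u} f) := by
  have : Limits.PreservesLimitsOfSize.{0, 0} (ModuleCat.coextendScalars.{u, u, u} f) :=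
    (ModuleCat.restrictCoextendScalarsAdj.{u} f).rightAdjoint_preservesLimits
  infer_instance

/-- Coextension of scalars of complexes. -/
noncomputable abbrev coextComplex : CochainComplex (ModuleCat.{u} S) ℤ ⥤
    CochainComplex (ModuleCat.{u} T) ℤ :=
  (ModuleCat.coextendScalars f).mapHomologicalComplex _

section Elements

variable {f} {M M' : ModuleCat.{u} S}

/-- The value of an element of the coextension of scalars at `t`. -/
noncomputable def coextEval (t : T) : (ModuleCat.coextendScalars.{u, u, u} f).obj M →+ M where
  toFun φ := ModuleCat.CoextendScalars.equiv f M φ t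
  map_zero' := rfl
  map_add' _ _ := rfl

/-- The element of the coextension of scalars given by an additive map that is linear over the
smaller ring. -/
noncomputable def coextMk (g : T →+ M) (hg : ∀ s t, g (f s * t) = s • g t) :
    (ModuleCat.coextendScalars.{u, u, u} f).obj M :=
  (ModuleCat.CoextendScalars.equiv f M).symm
    { toFun := fun t : T => g t
      map_add' := fun t t' : T => map_add g t t'
      map_smul' := fun s (t : T) => hg s t }

theorem coext_ext {φ ψ : (ModuleCat.coextendScalars.{u, u, u} f).obj M}
    (h : ∀ t, coextEval t φ = coextEval t ψ) : φ = ψ :=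
  ModuleCat.CoextendScalars.ext (LinearMap.ext h)

theorem coextEval_smul (φ : (ModuleCat.coextendScalars.{u, u, u} f).obj M) (t t' : T) :
    coextEval t (t' • φ) = coextEval (t * t') φ :=
  rfl

theorem coextEval_mul (φ : (ModuleCat.coextendScalars.{u, u, u} f).obj M) (s : S) (t : T) :
    coextEval (f s * t) φ = s • coextEval t φ :=
  (ModuleCat.CoextendScalars.equiv f M φ).map_smul s (t : (ModuleCat.restrictScalars f).obj
    (ModuleCat.of T T))

theorem coextEval_add (φ : (ModuleCat.coextendScalars.{u, u, u} f).obj M) (t t' : T) :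
    coextEval (t + t') φ = coextEval t φ + coextEval t' φ :=
  (ModuleCat.CoextendScalars.equiv f M φ).map_add (t : (ModuleCat.restrictScalars f).obj
    (ModuleCat.of T T)) t'

theorem coextEval_zero (φ : (ModuleCat.coextendScalars.{u, u, u} f).obj M) :
    coextEval 0 φ = 0 :=
  (ModuleCat.CoextendScalars.equiv f M φ).map_zero

end Elements

/-- A bounded below complex of injective modules that splits above `n` coextends to a complex with
the corresponding vanishing of `Ext`. -/
theorem extVanishing_coextComplex {n a : ℤ} (J : CochainComplex (ModuleCat.{u} S) ℤ)
    [J.IsStrictlyGE a] (hJ : ∀ i, Injective (J.X i)) (h : IsSplitAbove n J) :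
    ExtVanishing n (DerivedCategory.Q.obj ((coextComplex f).obj J)) := by
  have : ∀ i, Injective (((coextComplex f).obj J).X i) := fun i =>
    Injective.injective_of_adjoint (ModuleCat.restrictCoextendScalarsAdj.{u} f) (J.X i)
  have : ((coextComplex f).obj J).IsKInjective := CochainComplex.isKInjective_of_injective _ a
  exact isSplitAbove_iff.1 (h.map (ModuleCat.coextendScalars f))

theorem shortExact_of_elements {X : ShortComplex (ModuleCat.{u} S)}
    (h₁ : Function.Injective X.f.hom) (h₂ : ∀ y, X.g.hom y = 0 → ∃ x, X.f.hom x = y)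
    (h₃ : Function.Surjective X.g.hom) : X.ShortExact where
  exact := (ShortComplex.moduleCat_exact_iff X).2 h₂
  mono_f := (ModuleCat.mono_iff_injective _).2 h₁
  epi_g := (ModuleCat.epi_iff_surjective _).2 h₃

end Coextend

section Polynomial

open Polynomial

variable {S T : Type u} [Ring S] [Ring T] (e : T ≃+* S[X])

/-- The inclusion of the constants into a polynomial ring. -/
noncomputable def polyInclude : S →+* T := e.symm.toRingHom.comp C

theorem commute_symm_X (t : T) : e.symm X * t = t * e.symm X := by
  apply e.injective
  rw [map_mul, map_mul, e.apply_symm_apply]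
  exact (Polynomial.X_mul)

/-- Multiplication by the variable. -/
noncomputable def varMul : 𝟭 (ModuleCat.{u} T) ⟶ 𝟭 (ModuleCat.{u} T) where
  app N := ModuleCat.ofHom
    { toFun := fun m : N => e.symm X • m
      map_add' := smul_add _
      map_smul' := fun t m => by
        rw [RingHom.id_apply, smul_smul, smul_smul, commute_symm_X] }
  naturality N N' g := by
    ext m
    exact (map_smul g.hom (e.symm X) m).symm

/-- The functor of maps from the polynomial ring to the underlying `S`-module of an
`S[X]`-module. -/
noncomputable abbrev polyCoext : ModuleCat.{u} T ⥤ ModuleCat.{u} T :=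
  ModuleCat.restrictScalars (polyInclude e) ⋙ ModuleCat.coextendScalars (polyInclude e)

/-- The evaluation of an element of `polyCoext` at `t`. -/
noncomputable def polyEval {e : T ≃+* S[X]} {N : ModuleCat.{u} T} (t : T) :
    (polyCoext e).obj N →+ N :=
  coextEval (f := polyInclude e) (M := (ModuleCat.restrictScalars (polyInclude e)).obj N) t

/-- The map `φ ↦ (t ↦ φ (t X) - X φ(t))`. -/
noncomputable def polyDiff : polyCoext e ⟶ polyCoext e :=
  (show polyCoext e ⟶ polyCoext e from Functor.whiskerLeft (polyCoext e) (varMul e)) -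
    (show polyCoext e ⟶ polyCoext e from Functor.whiskerRight (varMul e) (polyCoext e))

/-- The map `m ↦ (t ↦ t m)`. -/
noncomputable def polyUnit : 𝟭 (ModuleCat.{u} T) ⟶ polyCoext e :=
  (ModuleCat.restrictCoextendScalarsAdj.{u} (polyInclude e)).unit

variable {e} {N : ModuleCat.{u} T}

theorem polyEval_polyDiff (φ : (polyCoext e).obj N) (t : T) :
    polyEval t (((polyDiff e).app N).hom φ) = polyEval (t * e.symm X) φ - e.symm X • polyEval t φ :=
  rfl

theorem polyEval_polyUnit (m : N) (t : T) :
    polyEval t (((polyUnit e).app N).hom m) = t • m :=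
  rfl

theorem polyEval_mul (φ : (polyCoext e).obj N) (s : S) (t : T) :
    polyEval (polyInclude e s * t) φ = polyInclude e s • polyEval t φ :=
  coextEval_mul (f := polyInclude e) φ s t

theorem polyEval_add (φ : (polyCoext e).obj N) (t t' : T) :
    polyEval (t + t') φ = polyEval t φ + polyEval t' φ :=
  coextEval_add (f := polyInclude e) φ t t'

theorem poly_induction {p : T → Prop} (t : T)
    (mk : ∀ s k, p (polyInclude e s * e.symm X ^ k)) (add : ∀ x y, p x → p y → p (x + y))
    : p t := by
  rw [← e.symm_apply_apply t]
  induction e t using Polynomial.induction_on' with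
  | add x y hx hy => rw [map_add]; exact add _ _ hx hy
  | monomial k s =>
    rw [← C_mul_X_pow_eq_monomial, map_mul, map_pow]
    exact mk s k

theorem polyCoext_ext {φ ψ : (polyCoext e).obj N}
    (h : ∀ k : ℕ, polyEval (e.symm X ^ k) φ = polyEval (e.symm X ^ k) ψ) : φ = ψ :=
  coext_ext fun t => by
    change polyEval t φ = polyEval t ψ
    induction t using poly_induction (e := e) with
    | mk s k => rw [polyEval_mul, polyEval_mul, h]
    | add x y hx hy => rw [polyEval_add, polyEval_add, hx, hy]

theorem exists_polyEval (m : ℕ → N) : ∃ φ : (polyCoext e).obj N,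
    ∀ k, polyEval (e.symm X ^ k) φ = m k := by
  let : Module S N := Module.compHom N (polyInclude e)
  let g : S[X] →ₗ[S] N := Polynomial.lsum fun k => LinearMap.toSpanSingleton S N (m k)
  refine ⟨coextMk (f := polyInclude e)
    (M := (ModuleCat.restrictScalars (polyInclude e)).obj N)
    (g.toAddMonoidHom.comp e.toAddMonoidHom) fun s t => ?_, fun k => ?_⟩
  · have h1 : e (polyInclude e s * t) = s • e t := by
      rw [map_mul, Polynomial.smul_eq_C_mul]
      congr 1
      exact e.apply_symm_apply _
    change g (e (polyInclude e s * t)) = s • g (e t)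
    rw [h1, map_smul]
  · change g (e (e.symm X ^ k)) = m k
    rw [map_pow, e.apply_symm_apply, ← Polynomial.monomial_one_right_eq_X_pow]
    simp [g, Polynomial.lsum_apply]

/-- The sequence `0 → N → Hom_S(S[X], N) → Hom_S(S[X], N) → 0` is exact. -/
theorem shortExact_poly (N : ModuleCat.{u} T) (w : (polyUnit e).app N ≫ (polyDiff e).app N = 0) :
    (ShortComplex.mk _ _ w).ShortExact := by
  refine shortExact_of_elements (fun m m' h => ?_) (fun φ hφ => ⟨polyEval 1 φ, ?_⟩) (fun ψ => ?_)
  · have h1 := congrArg (polyEval (e := e) (N := N) 1) h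
    dsimp only at h1
    rw [polyEval_polyUnit, polyEval_polyUnit, one_smul, one_smul] at h1
    exact h1
  · refine polyCoext_ext fun k => ?_
    dsimp only
    rw [polyEval_polyUnit]
    induction k with
    | zero => rw [pow_zero, one_smul]
    | succ k ih =>
      have h1 := congrArg (polyEval (e := e) (N := N) (e.symm X ^ k)) hφ
      dsimp only at h1
      rw [polyEval_polyDiff, map_zero, sub_eq_zero] at h1
      rw [pow_succ, h1, ← ih, smul_smul, ← pow_succ, ← pow_succ']
  -- a preimage of `ψ` is found by recursion on its values at the powers of the variable
  · let m : ℕ → N := Nat.rec 0 fun k y => polyEval (e.symm X ^ k) ψ + e.symm X • y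
    obtain ⟨φ, hφ⟩ := exists_polyEval (e := e) m
    refine ⟨φ, polyCoext_ext fun k => ?_⟩
    dsimp only
    rw [polyEval_polyDiff, ← pow_succ, hφ, hφ]
    exact add_sub_cancel_right _ _

theorem polyUnit_polyDiff : polyUnit e ≫ polyDiff e = 0 := by
  ext N m
  refine polyCoext_ext fun k => ?_
  change polyEval _ (((polyDiff e).app N).hom (((polyUnit e).app N).hom m)) = polyEval _ 0
  rw [polyEval_polyDiff, polyEval_polyUnit, polyEval_polyUnit, ← pow_succ, smul_smul, ← pow_succ',
    sub_self, map_zero]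

/-- A complex of `S[X]`-modules whose terms are injective over `S` and that splits over `S` in
degrees at least `n` satisfies the vanishing of `Ext` over `S[X]` in degrees at least `n + 1`: it is
the fibre of an endomorphism of a complex coextended from `S`. -/
theorem extVanishing_of_polynomial {n a : ℤ} (L : CochainComplex (ModuleCat.{u} T) ℤ)
    [L.IsStrictlyGE a]
    (hL : ∀ i, Injective ((ModuleCat.restrictScalars (polyInclude e)).obj (L.X i)))
    (h : IsSplitAbove n ((resComplex (polyInclude e)).obj L)) :
    ExtVanishing (n + 1) (DerivedCategory.Q.obj L) := by
  let α : L ⟶ (coextComplex (polyInclude e)).obj ((resComplex (polyInclude e)).obj L) :=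
    (NatTrans.mapHomologicalComplex (polyUnit e) (ComplexShape.up ℤ)).app L
  let β : (coextComplex (polyInclude e)).obj ((resComplex (polyInclude e)).obj L) ⟶
      (coextComplex (polyInclude e)).obj ((resComplex (polyInclude e)).obj L) :=
    (NatTrans.mapHomologicalComplex (polyDiff e) (ComplexShape.up ℤ)).app L
  have w : α ≫ β = 0 := HomologicalComplex.hom_ext _ _ fun i =>
    congrArg (fun τ => τ.app (L.X i)) (polyUnit_polyDiff (e := e))
  have hse : (ShortComplex.mk α β w).ShortExact :=
    HomologicalComplex.shortExact_of_degreewise_shortExact _ fun i =>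
      shortExact_poly (e := e) (L.X i)
      (congrArg (fun τ => τ.app (L.X i)) (polyUnit_polyDiff (e := e)))
  have hc := extVanishing_coextComplex (polyInclude e) (a := a)
    ((resComplex (polyInclude e)).obj L) hL h
  exact ExtVanishing.obj₁ (DerivedCategory.triangleOfSES_distinguished hse) hc hc

end Polynomial

/-! ### Quotients by a central nonzerodivisor -/

section Quotient

variable {B T : Type u} [Ring B] [Ring T] {π : B →+* T} {x : B}

section Elements

variable {M : ModuleCat.{u} B}

theorem coextEval_apply_eq_smul (φ : (ModuleCat.coextendScalars.{u, u, u} π).obj M) (b : B) :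
    coextEval (π b) φ = b • coextEval 1 φ := by
  rw [← coextEval_mul, mul_one]

theorem coext_ext_one (hπ : Function.Surjective π)
    {φ ψ : (ModuleCat.coextendScalars.{u, u, u} π).obj M} (h : coextEval 1 φ = coextEval 1 ψ) :
    φ = ψ :=
  coext_ext fun t => by
    obtain ⟨b, rfl⟩ := hπ t
    rw [coextEval_apply_eq_smul, coextEval_apply_eq_smul, h]

theorem smul_coextEval_one (hx : π x = 0) (φ : (ModuleCat.coextendScalars.{u, u, u} π).obj M) :
    x • coextEval 1 φ = 0 := by
  rw [← coextEval_apply_eq_smul, hx, coextEval_zero]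

theorem exists_coextEval_one (hπ : Function.Surjective π) (hcomm : ∀ b, Commute x b)
    (hker : ∀ b, π b = 0 → ∃ b', b = x * b') (m : M) (hm : x • m = 0) :
    ∃ φ : (ModuleCat.coextendScalars.{u, u, u} π).obj M, coextEval 1 φ = m := by
  have key : ∀ b b', π b = π b' → b • m = b' • m := fun b b' h => by
    obtain ⟨a, ha⟩ := hker (b - b') (by rw [map_sub, h, sub_self])
    rw [← sub_eq_zero, ← sub_smul, ha, (hcomm a).eq, mul_smul, hm, smul_zero]
  have hs := Function.surjInv_eq hπ
  refine ⟨coextMk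
    { toFun := fun t => Function.surjInv hπ t • m
      map_zero' := by rw [key _ 0 (by rw [hs, map_zero]), zero_smul]
      map_add' := fun t t' => by
        rw [← add_smul]
        exact key _ _ (by rw [map_add, hs, hs, hs]) } (fun s t => ?_), ?_⟩
  · change Function.surjInv hπ _ • m = s • Function.surjInv hπ t • m
    rw [smul_smul]
    exact key _ _ (by rw [map_mul, hs, hs])
  · exact (key _ 1 (by rw [hs, map_one])).trans (one_smul _ _)

/-- Injective modules are divisible by central nonzerodivisors. -/
theorem exists_smul_eq_of_isRegular (hcomm : ∀ b, Commute x b) (hreg : ∀ b, x * b = 0 → b = 0)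
    [hM : Injective M] (m : M) : ∃ w : M, x • w = m := by
  obtain ⟨w, hw⟩ := exists_smul_eq_of_injective
    (Module.Baer.of_injective ((Module.injective_iff_injective_object B M).2 hM))
    (fun _ : Fin 1 => x) (fun _ => m) (fun r hr => by
      have h0 : r 0 = 0 := hreg _ (by simpa [(hcomm (r 0)).eq] using hr)
      simp [h0])
  exact ⟨w, hw 0⟩

end Elements

theorem extVanishing_of_acyclic {K : CochainComplex (ModuleCat.{u} B) ℤ} (hK : K.Acyclic) (n : ℤ) :
    ExtVanishing n (DerivedCategory.Q.obj K) := fun N i _ => by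
  have h := (CategoryTheory.shiftFunctor _ i).map_isZero ((isZero_Q_obj_iff_acyclic K).2 hK)
  exact ⟨fun f g => h.eq_of_tgt f g⟩

/-- A linear map given by a functional relation. -/
theorem exists_hom_of_relation {M N : ModuleCat.{u} T} (r : M → N → Prop)
    (hex : ∀ m, ∃ n, r m n) (huniq : ∀ m n n', r m n → r m n' → n = n')
    (hadd : ∀ m m' n n', r m n → r m' n' → r (m + m') (n + n'))
    (hsmul : ∀ (t : T) m n, r m n → r (t • m) (t • n)) :
    ∃ q : M ⟶ N, ∀ m n, r m n ↔ q.hom m = n := by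
  choose q hq using hex
  exact ⟨ModuleCat.ofHom
    { toFun := q
      map_add' := fun m m' => huniq _ _ _ (hq _) (hadd _ _ _ _ (hq m) (hq m'))
      map_smul' := fun t m => huniq _ _ _ (hq _) (hsmul t _ _ (hq m)) },
    fun m n => ⟨fun h => huniq _ _ _ (hq m) h, fun h => h ▸ hq m⟩⟩

/-- Let `B → T` be the quotient by a central nonzerodivisor `x` and let `Y` be a complex of
`x`-torsion-free modules. The quotient `Y / x Y` has at most the injective dimension over `T` that
`Y` has over `B`: for an injective resolution `Y ⊆ J` with cokernel `C`, the snake lemma gives a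
short exact sequence `0 → J[x] → C[x] → Y / x Y → 0` in which `C[x]` is acyclic. -/
theorem ExtVanishing.quotient (hπ : Function.Surjective π) (hcomm : ∀ b, Commute x b)
    (hreg : ∀ b, x * b = 0 → b = 0) (hx : π x = 0) (hker : ∀ b, π b = 0 → ∃ b', b = x * b')
    {n a : ℤ} {Y : CochainComplex (ModuleCat.{u} B) ℤ} [Y.IsStrictlyGE a]
    (hY : ∀ i (y : Y.X i), x • y = 0 → y = 0) {Y' : CochainComplex (ModuleCat.{u} T) ℤ}
    (v : Y ⟶ (resComplex π).obj Y') (hv : ∀ i, Function.Surjective (v.f i).hom)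
    (hv' : ∀ i (y : Y.X i), (v.f i).hom y = 0 → ∃ y', y = x • y')
    (h : ExtVanishing n (DerivedCategory.Q.obj Y)) : ExtVanishing n (DerivedCategory.Q.obj Y') := by
  obtain ⟨J, f, hf, hf', hJ, hJ'⟩ := exists_injective_resolution Y a
  have hJK : J.IsKInjective := CochainComplex.isKInjective_of_injective J (a - 1)
  have hQf := (DerivedCategory.isIso_Q_map_iff_quasiIso _ f).2 hf'
  have hJn : IsSplitAbove n J := isSplitAbove_iff.2 (h.of_iso (asIso (DerivedCategory.Q.map f)))
  let p := Limits.cokernel.π f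
  have hse : (ShortComplex.mk f p (Limits.cokernel.condition f)).ShortExact :=
    { exact := ShortComplex.exact_cokernel f, mono_f := hf, epi_g := inferInstance }
  have hsei := fun i => hse.map_of_exact (HomologicalComplex.eval (ModuleCat.{u} B) _ i)
  have hfi : ∀ i, Function.Injective (f.f i).hom := fun i =>
    (ModuleCat.mono_iff_injective _).1 (hsei i).mono_f
  have hpi : ∀ i, Function.Surjective (p.f i).hom := fun i =>
    (ModuleCat.epi_iff_surjective _).1 (hsei i).epi_g
  have hex : ∀ i j, (p.f i).hom j = 0 → ∃ y, (f.f i).hom y = j := fun i =>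
    (ShortComplex.moduleCat_exact_iff _).1 (hsei i).exact
  have hCa : (Limits.cokernel f).Acyclic := hse.acyclic_X₃ hf'
  -- `C = J / Y` is divisible by `x`, as `J` is
  have hdiv : ∀ i (c : (Limits.cokernel f).X i), ∃ c', x • c' = c := fun i c => by
    obtain ⟨j, rfl⟩ := hpi i c
    obtain ⟨j', rfl⟩ := exists_smul_eq_of_isRegular hcomm hreg j
    exact ⟨(p.f i).hom j', (map_smul (p.f i).hom x j').symm⟩
  let v₀ : ∀ i, Y.X i →+ Y'.X i := fun i => (v.f i).hom.toAddMonoidHom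
  have hvs : ∀ i (b : B) (y : Y.X i), v₀ i (b • y) = π b • v₀ i y :=
    fun i b y => map_smul (v.f i).hom b y
  -- the connecting map `C[x] → Y / x Y`, as a relation
  let r : ∀ i, (ModuleCat.coextendScalars.{u, u, u} π).obj ((Limits.cokernel f).X i) →
      Y'.X i → Prop := fun i φ y' =>
    ∃ (j : J.X i) (y : Y.X i), (p.f i).hom j = coextEval 1 φ ∧ x • j = (f.f i).hom y ∧
      v₀ i y = y'
  have hr : ∀ i, ∃ q : (ModuleCat.coextendScalars.{u, u, u} π).obj ((Limits.cokernel f).X i) ⟶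
      Y'.X i,
      ∀ φ y', r i φ y' ↔ q.hom φ = y' := fun i => by
    refine exists_hom_of_relation (r i) (fun φ => ?_) ?_ ?_ ?_
    · obtain ⟨j, hj⟩ := hpi i (coextEval 1 φ)
      obtain ⟨y, hy⟩ := hex i (x • j) (by rw [map_smul, hj, smul_coextEval_one hx])
      exact ⟨_, j, y, hj, hy.symm, rfl⟩
    · rintro φ _ _ ⟨j, y, h1, h2, rfl⟩ ⟨j', y', h1', h2', rfl⟩
      obtain ⟨w, hw⟩ := hex i (j - j') (by rw [map_sub, h1, h1', sub_self])
      have hyw : y - y' = x • w := hfi i (by rw [map_sub, ← h2, ← h2', map_smul, hw, smul_sub])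
      have h3 := hvs i x w
      rw [← hyw, hx, zero_smul] at h3
      exact sub_eq_zero.1 ((map_sub (v₀ i) y y').symm.trans h3)
    · rintro φ φ' _ _ ⟨j, y, h1, h2, rfl⟩ ⟨j', y', h1', h2', rfl⟩
      exact ⟨j + j', y + y', by rw [map_add, h1, h1', map_add], by rw [smul_add, h2, h2', map_add],
        map_add (v₀ i) y y'⟩
    · rintro t φ _ ⟨j, y, h1, h2, rfl⟩
      obtain ⟨b, rfl⟩ := hπ t
      refine ⟨b • j, b • y, ?_, ?_, hvs i b y⟩
      · rw [map_smul, h1, coextEval_smul, one_mul, coextEval_apply_eq_smul]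
      · rw [smul_smul, (hcomm b).eq, mul_smul, h2, map_smul]
  choose q hq using hr
  let α : (coextComplex π).obj J ⟶ (coextComplex π).obj (Limits.cokernel f) :=
    (coextComplex π).map p
  let β : (coextComplex π).obj (Limits.cokernel f) ⟶ Y' :=
    { f := q
      comm' := fun i i' _ => by
        ext φ
        obtain ⟨j, y, h1, h2, h3⟩ := (hq i φ _).2 rfl
        refine ((hq i' _ _).1 ⟨(J.d i i').hom j, (Y.d i i').hom y, ?_, ?_, ?_⟩).symm
        · rw [comm_apply, h1]
          rfl
        · rw [comm_apply, ← h2, map_smul]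
        · exact (comm_apply v i i' y).trans (congrArg (Y'.d i i').hom h3) }
  have w : α ≫ β = 0 := HomologicalComplex.hom_ext _ _ fun i => ModuleCat.hom_ext <|
    LinearMap.ext fun φ : (ModuleCat.coextendScalars.{u, u, u} π).obj (J.X i) =>
      (hq i _ _).1 ⟨coextEval 1 φ, 0, rfl, by rw [smul_coextEval_one hx, map_zero],
        map_zero (v₀ i)⟩
  -- coextension of scalars along `B → B / x` is the passage to the `x`-torsion
  have hse' : (ShortComplex.mk α β w).ShortExact :=
    HomologicalComplex.shortExact_of_degreewise_shortExact _ fun i => by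
      refine shortExact_of_elements
        (fun (φ φ' : (ModuleCat.coextendScalars.{u, u, u} π).obj (J.X i)) hφ => ?_)
        (fun (φ : (ModuleCat.coextendScalars.{u, u, u} π).obj ((Limits.cokernel f).X i)) hφ => ?_)
        (fun y' : Y'.X i => ?_)
      · refine coext_ext_one hπ (sub_eq_zero.1 ?_)
        have h1 : (p.f i).hom (coextEval 1 φ) = (p.f i).hom (coextEval 1 φ') :=
          congrArg (coextEval (f := π) (M := (Limits.cokernel f).X i) 1) hφ
        obtain ⟨y, hy⟩ := hex i (coextEval 1 φ - coextEval 1 φ') (by rw [map_sub, h1, sub_self])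
        have h2 : y = 0 := hY i y (hfi i (by
          rw [map_smul, hy, smul_sub, smul_coextEval_one hx, smul_coextEval_one hx, sub_self,
            map_zero]))
        rw [← hy, h2, map_zero]
      · obtain ⟨j, y, h1, h2, h3⟩ := (hq i φ 0).2 hφ
        obtain ⟨y', rfl⟩ := hv' i y h3
        obtain ⟨ψ, hψ⟩ := exists_coextEval_one hπ hcomm hker (j - (f.f i).hom y') (by
          rw [smul_sub, h2, map_smul, sub_self])
        refine ⟨ψ, coext_ext_one hπ ?_⟩
        have h4 : (p.f i).hom ((f.f i).hom y') = 0 := by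
          rw [← LinearMap.comp_apply, ← ModuleCat.hom_comp, ← HomologicalComplex.comp_f,
            Limits.cokernel.condition]
          rfl
        exact (congrArg (p.f i).hom hψ).trans (by rw [map_sub, h4, sub_zero, h1])
      · obtain ⟨y, hy⟩ := hv i y'
        obtain ⟨j, hj⟩ := exists_smul_eq_of_isRegular hcomm hreg ((f.f i).hom y)
        obtain ⟨φ, hφ⟩ := exists_coextEval_one hπ hcomm hker ((p.f i).hom j) (by
          rw [← map_smul, hj, ← LinearMap.comp_apply, ← ModuleCat.hom_comp,
            ← HomologicalComplex.comp_f, Limits.cokernel.condition]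
          rfl)
        exact ⟨φ, (hq i φ y').1 ⟨j, y, hφ.symm, hj, hy⟩⟩
  -- `C[x]` is acyclic, as `0 → C[x] → C → C → 0` is exact and `C` is acyclic
  have hac : ((coextComplex π).obj (Limits.cokernel f)).Acyclic := fun j => by
    rw [exactAt_iff_function_exact _ (j - 1) j (j + 1) (by omega) rfl]
    refine fun φ : (ModuleCat.coextendScalars.{u, u, u} π).obj ((Limits.cokernel f).X j) =>
      ⟨fun hφ => ?_, ?_⟩
    · obtain ⟨e, he⟩ := exact_of_exactAt (hCa j) (j - 1) (by omega) (j + 1) (coextEval 1 φ)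
        (congrArg (coextEval (f := π) (M := (Limits.cokernel f).X (j + 1)) 1) hφ) rfl
      obtain ⟨g, hg⟩ := exact_of_exactAt (hCa (j - 1)) (j - 1 - 1) (by omega) j (x • e)
        (by rw [map_smul, he, smul_coextEval_one hx]) (by omega)
      obtain ⟨g', rfl⟩ := hdiv _ g
      obtain ⟨ψ, hψ⟩ := exists_coextEval_one hπ hcomm hker
        (e - ((Limits.cokernel f).d (j - 1 - 1) (j - 1)).hom g') (by
          rw [smul_sub, ← map_smul, hg, sub_self])
      refine ⟨ψ, coext_ext_one hπ ?_⟩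
      exact (congrArg ((Limits.cokernel f).d (j - 1) j).hom hψ).trans (by
        rw [map_sub, he, d_d_apply, sub_zero])
    · rintro ⟨ψ, rfl⟩
      exact d_d_apply _ _ _ _ _
  exact ExtVanishing.obj₃ (DerivedCategory.triangleOfSES_distinguished hse')
    ((extVanishing_coextComplex (a := a - 1) π J hJ hJn).mono (by omega))
    (extVanishing_of_acyclic hac n)

end Quotient

/-! ### Injective dimension is local -/

section Localization

attribute [local instance 50] baseModule baseModule_isScalarTower tensorModule

variable {z : Type u} [CommRing z] {c S T : Type u} [CommRing c] [Algebra z c] [Ring S] [Ring T]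
  [Algebra z S] (σ : T ≃+* c ⊗[z] S)

theorem tmul_one_eq_of_isLocalization (M : Submonoid z) [IsLocalization M c]
    (a : c) : a ⊗ₜ[z] (1 : c) = 1 ⊗ₜ a := by
  have h := (IsLocalization.bijective_linearMap_mul' M c).1
  exact h (by simp)

theorem exists_smul_eq_bcMk (M : Submonoid z) [IsLocalization M c]
    {N : ModuleCat.{u} S} (x : (bc σ).obj N) :
    ∃ s ∈ M, ∃ n : N, bcInclude σ (algebraMap z S s) • x = bcMk σ 1 n := by
  induction x using bc_induction with
  | zero => exact ⟨1, one_mem _, 0, by rw [smul_zero, bcMk_zero]⟩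
  | mk a n =>
    obtain ⟨⟨r, s⟩, h⟩ := IsLocalization.surj M a
    refine ⟨s, s.2, algebraMap z S r • n, ?_⟩
    rw [bcInclude_smul_bcMk, ← algebraMap_bcMk, ← algebraMap_bcMk, mul_comm, h, mul_one]
  | add x y hx hy =>
    obtain ⟨s, hs, n, hn⟩ := hx
    obtain ⟨s', hs', n', hn'⟩ := hy
    refine ⟨s' * s, mul_mem hs' hs, algebraMap z S s' • n + algebraMap z S s • n', ?_⟩
    rw [smul_add, bcMk_add, ← bcInclude_smul_bcMk, ← bcInclude_smul_bcMk, ← hn, ← hn', smul_smul,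
      smul_smul, ← map_mul, ← map_mul, ← map_mul, ← map_mul, mul_comm s s']

/-- The underlying group of the base change of a module is the tensor product. -/
noncomputable def bcToTensor (N : ModuleCat.{u} S) : (bc σ).obj N →+ c ⊗[z] N :=
  tensorLift (z := z) (X := ModuleCat.of c c) (M := N) (P := c ⊗[z] N)
    { toFun := fun a : c => (TensorProduct.mk z c N a).toAddMonoidHom
      map_zero' := by ext; exact TensorProduct.zero_tmul _ _
      map_add' := fun a b : c => by ext; exact TensorProduct.add_tmul _ _ _ }
    (fun (r : z) (a : c) n => by
      change (algebraMap z c r * a) ⊗ₜ[z] n = a ⊗ₜ (r • n)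
      rw [← Algebra.smul_def, TensorProduct.smul_tmul])

theorem bcToTensor_bcMk {N : ModuleCat.{u} S} (a : c) (n : N) :
    bcToTensor σ N (bcMk σ a n) = a ⊗ₜ n :=
  rfl

theorem bcToTensor_bijective (N : ModuleCat.{u} S) : Function.Bijective (bcToTensor σ N) := by
  let l : c ⊗[z] N →+ (bc σ).obj N := TensorProduct.liftAddHom (R := z)
    { toFun := fun a : c =>
        { toFun := fun n => bcMk σ a n
          map_zero' := bcMk_zero σ a
          map_add' := bcMk_add σ a }
      map_zero' := by ext n; exact zero_bcMk σ n
      map_add' := fun a b : c => by ext n; exact add_bcMk σ a b n }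
    (fun r a n => by
      change bcMk σ (r • a) n = bcMk σ a (algebraMap z S r • n)
      rw [← algebraMap_bcMk, Algebra.smul_def])
  have hl : ∀ a n, l (a ⊗ₜ n) = bcMk σ a n := fun a n => rfl
  refine Function.bijective_iff_has_inverse.2 ⟨l, fun x => ?_, fun x => ?_⟩
  · induction x using bc_induction with
    | zero => rw [map_zero, map_zero]
    | mk a n => rw [bcToTensor_bcMk, hl]
    | add x y hx hy => rw [map_add, map_add, hx, hy]
  · induction x with
    | zero => rw [map_zero, map_zero]
    | tmul a n => rw [hl, bcToTensor_bcMk]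
    | add x y hx hy => rw [map_add, map_add, hx, hy]

theorem exists_smul_eq_zero_of_bcMk (M : Submonoid z) [IsLocalization M c]
    {N : ModuleCat.{u} S} {n : N} (h : bcMk σ 1 n = 0) :
    ∃ s ∈ M, algebraMap z S s • n = 0 := by
  have h1 : TensorProduct.mk z c N 1 n = TensorProduct.mk z c N 1 0 :=
    (congrArg (bcToTensor σ N) h).trans ((map_zero _).trans (map_zero _).symm)
  have : IsLocalizedModule M (TensorProduct.mk z c N 1) :=
    (isLocalizedModule_iff_isBaseChange M c _).2 (TensorProduct.isBaseChange z N c)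
  obtain ⟨s, hs⟩ := (IsLocalizedModule.eq_iff_exists M (TensorProduct.mk z c N 1)).1 h1
  exact ⟨s, s.2, by
    rw [smul_zero] at hs
    exact hs⟩

theorem bcMk_one_sub {N : ModuleCat.{u} S} (n n' : N) :
    bcMk σ (1 : c) (n - n') = bcMk σ 1 n - bcMk σ 1 n' :=
  map_sub (bcUnit σ N).hom n n'

theorem bcMk_one_sum {N : ModuleCat.{u} S} {k : ℕ} (r : Fin k → S) (y : Fin k → N) :
    bcMk σ (1 : c) (∑ j, r j • y j) = ∑ j, bcInclude σ (r j) • bcMk σ (1 : c) (y j) :=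
  (map_sum (bcUnit σ N).hom _ _).trans
    (Finset.sum_congr rfl fun _ _ => map_smul (bcUnit σ N).hom _ _)

theorem restrictScalars_bcInclude_injective [Module.Flat z c] (E : ModuleCat.{u} T)
    (hE : Injective E) : Injective ((ModuleCat.restrictScalars (bcInclude σ)).obj E) :=
  (bcAdj σ).map_injective E hE

end Localization

section Split

variable {S : Type u} [Ring S] {n : ℤ} {J : CochainComplex (ModuleCat.{u} S) ℤ}

theorem IsSplitAbove.exists_d_eq (h : IsSplitAbove n J) {i j k : ℤ} (hj : n ≤ j) (hij : i + 1 = j)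
    (hjk : j + 1 = k) (x : J.X j) (hx : (J.d j k).hom x = 0) : ∃ y, (J.d i j).hom y = x := by
  obtain ⟨g, hg⟩ := h.exists_lift hj hij hjk
    (ModuleCat.ofHom (LinearMap.toSpanSingleton S (J.X j) x))
    (ModuleCat.hom_ext (LinearMap.ext_ring (by simpa using hx)))
  refine ⟨g.hom (1 : S), ?_⟩
  have h1 := congrArg (fun q => q.hom (1 : S)) hg
  exact h1.trans (one_smul S x)

/-- Where the complex is exact and the preceding module of cocycles is injective, the differential
is a split surjection onto the cocycles. -/
theorem exists_section_of_injective_kernel {i j k : ℤ} [Injective (Limits.kernel (J.d i j))]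
    (h : ∀ x, (J.d j k).hom x = 0 → ∃ y, (J.d i j).hom y = x) :
    ∃ s : Limits.kernel (J.d j k) ⟶ J.X i, s ≫ J.d i j = Limits.kernel.ι (J.d j k) := by
  let p := Limits.kernel.lift (J.d j k) (J.d i j) (J.d_comp_d i j k)
  have hp : p ≫ Limits.kernel.ι (J.d j k) = J.d i j := Limits.kernel.lift_ι _ _ _
  have w : Limits.kernel.ι (J.d i j) ≫ p = 0 := by
    rw [← cancel_mono (Limits.kernel.ι (J.d j k)), Category.assoc, hp,
      Limits.kernel.condition, Limits.zero_comp]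
  have hι := (ModuleCat.mono_iff_injective (Limits.kernel.ι (J.d j k))).1 inferInstance
  have hsurj : Function.Surjective p.hom := fun x => by
    have h0 := congrArg (fun q => q.hom x) (Limits.kernel.condition (J.d j k))
    obtain ⟨y, hy⟩ := h ((Limits.kernel.ι (J.d j k)).hom x) h0
    exact ⟨y, hι ((congrArg (fun q => q.hom y) hp).trans hy)⟩
  have hse : (ShortComplex.mk _ p w).ShortExact :=
    { exact := by
        refine ShortComplex.exact_of_f_is_kernel _ (Limits.KernelFork.IsLimit.ofι' _ w
          fun {A} q hq => ⟨Limits.kernel.lift _ q ?_, Limits.kernel.lift_ι _ _ _⟩)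
        rw [← hp, ← Category.assoc, hq, Limits.zero_comp]
      mono_f := inferInstanceAs (Mono (Limits.kernel.ι _))
      epi_g := (ModuleCat.epi_iff_surjective _).2 hsurj }
  have : Injective (ShortComplex.mk _ p w).X₁ := ‹Injective (Limits.kernel (J.d i j))›
  obtain ⟨s, hs⟩ : ∃ s : Limits.kernel (J.d j k) ⟶ J.X i, s ≫ p = 𝟙 _ :=
    ⟨hse.splittingOfInjective.s, hse.splittingOfInjective.s_g⟩
  exact ⟨s, by rw [← hp, ← Category.assoc, hs, Category.id_comp]⟩

end Split

section LocalToGlobal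

variable {c T : Type u} [CommRing c] [Ring T] [Algebra c T]

/-- Base change to the local ring at a prime ideal. -/
noncomputable abbrev bcLocal (m : Ideal c) [m.IsPrime] :
    ModuleCat.{u} T ⥤ ModuleCat.{u} (Localization.AtPrime m ⊗[c] T) :=
  bc (RingEquiv.refl (Localization.AtPrime m ⊗[c] T))

theorem eq_top_of_forall_isMaximal {W : Ideal c} (h : ∀ m : Ideal c, m.IsMaximal → ∃ w ∈ W, w ∉ m) :
    W = ⊤ := by
  by_contra hW
  obtain ⟨m, hm, hWm⟩ := Ideal.exists_le_maximal W hW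
  obtain ⟨w, hw, hwm⟩ := h m hm
  exact hwm (hWm hw)

theorem algebraMap_smul_comm {Z : Type*} [AddCommGroup Z] [Module T Z] (r : c) (t : T) (y : Z) :
    algebraMap c T r • t • y = t • algebraMap c T r • y := by
  rw [smul_smul, smul_smul, Algebra.commutes]

/-- Over a Noetherian algebra, a module whose localizations at the maximal ideals of the base are
injective is injective. -/
theorem injective_of_local [IsNoetherianRing T] (Z : ModuleCat.{u} T)
    (h : ∀ (m : Ideal c) [m.IsMaximal], Injective ((bcLocal m).obj Z)) : Injective Z := by
  refine (Module.injective_iff_injective_object T Z).1 (Module.Baer.injective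
    (baer_of_exists_smul_eq fun {k} b y hy => ?_))
  -- the ideal of those `w` for which the system `b j • x = w • y j` is solvable
  let W : Ideal c :=
    { carrier := {w | ∃ x : Z, ∀ j, b j • x = algebraMap c T w • y j}
      zero_mem' := ⟨0, fun j => by rw [smul_zero, map_zero, zero_smul]⟩
      add_mem' := fun ⟨x, hx⟩ ⟨x', hx'⟩ => ⟨x + x', fun j => by
        rw [smul_add, hx, hx', map_add, add_smul]⟩
      smul_mem' := fun r w ⟨x, hx⟩ => ⟨algebraMap c T r • x, fun j => by
        rw [← algebraMap_smul_comm, hx, smul_smul, ← map_mul, smul_eq_mul]⟩ }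
  have hW : W = ⊤ := eq_top_of_forall_isMaximal fun m hm => by
    have hp := hm.isPrime
    let σ := RingEquiv.refl (Localization.AtPrime m ⊗[c] T)
    have := restrictScalars_bcInclude_injective σ _ (h m)
    obtain ⟨x, hx⟩ := exists_smul_eq_of_injective (Module.Baer.of_injective
      ((Module.injective_iff_injective_object T
        ((ModuleCat.restrictScalars (bcInclude σ)).obj ((bc σ).obj Z))).2 this)) b
      (fun j => bcMk σ 1 (y j)) (fun r hr => by
        exact (bcMk_one_sum σ r y).symm.trans
          ((congrArg (bcMk σ 1) (hy r hr)).trans (bcMk_zero σ 1)))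
    let x₀ : (bc σ).obj Z := x
    have hx' : ∀ j, bcInclude σ (b j) • x₀ = bcMk σ 1 (y j) := hx
    obtain ⟨s, hs, n, hn⟩ := exists_smul_eq_bcMk σ m.primeCompl x₀
    have h2 : ∀ j, ∃ t ∈ m.primeCompl,
        algebraMap c T t • (b j • n - algebraMap c T s • y j) = 0 := fun j => by
      refine exists_smul_eq_zero_of_bcMk σ m.primeCompl ?_
      rw [bcMk_one_sub, ← bcInclude_smul_bcMk, ← bcInclude_smul_bcMk, ← hn, ← hx', smul_smul,
        smul_smul, ← map_mul, ← map_mul, Algebra.commutes, sub_self]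
    choose t ht ht' using h2
    refine ⟨(∏ j, t j) * s, ⟨algebraMap c T (∏ j, t j) • n, fun j => ?_⟩, fun hmem => ?_⟩
    · rw [← algebraMap_smul_comm, map_mul, mul_smul, ← sub_eq_zero, ← smul_sub,
        ← Finset.prod_erase_mul _ _ (Finset.mem_univ j), map_mul, mul_smul, ht', smul_zero]
    · exact (mul_mem (prod_mem fun j _ => ht j) hs : _ ∈ m.primeCompl) hmem
  obtain ⟨x, hx⟩ : (1 : c) ∈ W := hW ▸ Submodule.mem_top
  exact ⟨x, fun j => by rw [hx, map_one, one_smul]⟩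

/-- If the localizations of a bounded below complex at all maximal ideals of the base satisfy the
vanishing of `Ext` in degrees at least `n`, then the complex does in degrees at least `n + 1`: the
modules of cocycles of an injective resolution are injective in degrees at least `n`. -/
theorem ExtVanishing.of_local [IsNoetherianRing T] {n a : ℤ}
    (K : CochainComplex (ModuleCat.{u} T) ℤ) [K.IsStrictlyGE a]
    (h : ∀ (m : Ideal c) [m.IsMaximal], ExtVanishing n (DerivedCategory.Q.obj
      ((bcComplex (RingEquiv.refl (Localization.AtPrime m ⊗[c] T))).obj K))) :
    ExtVanishing (n + 1) (DerivedCategory.Q.obj K) := by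
  obtain ⟨J, f, -, hf, hJ, hJ'⟩ := exists_injective_resolution K a
  have hJK : J.IsKInjective := CochainComplex.isKInjective_of_injective J (a - 1)
  have hQf := (DerivedCategory.isIso_Q_map_iff_quasiIso _ f).2 hf
  refine ExtVanishing.of_iso (isSplitAbove_iff.1 ?_) (asIso (DerivedCategory.Q.map f)).symm
  have hflat : ∀ (m : Ideal c) [m.IsMaximal], Module.Flat c (Localization.AtPrime m) :=
    fun m _ => IsLocalization.flat _ m.primeCompl
  have hJm : ∀ (m : Ideal c) [m.IsMaximal] i, Injective ((bcLocal m).obj (J.X i)) := fun m _ i => by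
    have := full_restrictScalars_bcInclude (RingEquiv.refl (Localization.AtPrime m ⊗[c] T))
      (tmul_one_eq_of_isLocalization m.primeCompl)
    have := hflat m
    exact (ModuleCat.restrictScalars (bcInclude (RingEquiv.refl
      (Localization.AtPrime m ⊗[c] T)))).injective_of_map_injective
      (injective_restrictScalars_bc _ (J.X i))
  have hsplit : ∀ (m : Ideal c) [m.IsMaximal], IsSplitAbove n
      ((bcComplex (RingEquiv.refl (Localization.AtPrime m ⊗[c] T))).obj J) := fun m _ => by
    have := hflat m
    have hi : ∀ i, Injective (((bcComplex (RingEquiv.refl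
      (Localization.AtPrime m ⊗[c] T))).obj J).X i) := hJm m
    have : ((bcComplex (RingEquiv.refl (Localization.AtPrime m ⊗[c] T))).obj J).IsKInjective :=
      CochainComplex.isKInjective_of_injective _ (a - 1)
    have hq := (DerivedCategory.isIso_Q_map_iff_quasiIso _
      ((bcComplex (RingEquiv.refl (Localization.AtPrime m ⊗[c] T))).map f)).2
      (bc_quasiIso_of_flat _ f)
    exact isSplitAbove_iff.2 ((h m).of_iso
      (@asIso _ _ _ _ (DerivedCategory.Q.map ((bcComplex _).map f)) hq))
  have hker : ∀ i j k : ℤ, n ≤ j → i + 1 = j → j + 1 = k →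
      Injective (Limits.kernel (J.d j k)) := fun i j k hj hij hjk =>
    injective_of_local _ fun m _ => by
      have := hflat m
      have hi : Injective (((bcComplex (RingEquiv.refl
        (Localization.AtPrime m ⊗[c] T))).obj J).X i) := hJm m i
      have := (hsplit m).injective_kernel hj hij hjk
      exact Injective.of_iso (Limits.PreservesKernel.iso (bcLocal m) (J.d j k)).symm this
  have hexact : ∀ i j k : ℤ, n ≤ j → i + 1 = j → j + 1 = k → ∀ x : J.X j, (J.d j k).hom x = 0 →
      ∃ y, (J.d i j).hom y = x := fun i j k hj hij hjk x hx => by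
    let W : Ideal c :=
      { carrier := {w | ∃ y, (J.d i j).hom y = algebraMap c T w • x}
        zero_mem' := ⟨0, by rw [map_zero, map_zero, zero_smul]⟩
        add_mem' := fun ⟨y, hy⟩ ⟨y', hy'⟩ => ⟨y + y', by rw [map_add, hy, hy', map_add, add_smul]⟩
        smul_mem' := fun r w ⟨y, hy⟩ => ⟨algebraMap c T r • y, by
          rw [map_smul, hy, smul_smul, ← map_mul, smul_eq_mul]⟩ }
    have hW : W = ⊤ := eq_top_of_forall_isMaximal fun m hm => by
      have hp := hm.isPrime
      let σ := RingEquiv.refl (Localization.AtPrime m ⊗[c] T)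
      let α : J.X i ⟶ J.X j := J.d i j
      obtain ⟨v₀, hv₀⟩ := (hsplit m).exists_d_eq hj hij hjk (bcMk σ 1 x) (by
        exact (congrArg (bcMk σ 1) hx).trans (bcMk_zero σ 1))
      let v : (bc σ).obj (J.X i) := v₀
      have hv : ((bc σ).map α).hom v = bcMk σ 1 x := hv₀
      obtain ⟨s, hs, y, hy⟩ := exists_smul_eq_bcMk σ m.primeCompl v
      obtain ⟨t, ht, ht'⟩ := exists_smul_eq_zero_of_bcMk σ m.primeCompl
        (n := α.hom y - algebraMap c T s • x) (by
          rw [bcMk_one_sub, ← bc_map_bcMk, ← hy, map_smul, hv, bcInclude_smul_bcMk, sub_self])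
      refine ⟨t * s, ⟨algebraMap c T t • y, ?_⟩, fun hmem => ?_⟩
      · rw [map_smul, map_mul, mul_smul, ← sub_eq_zero, ← smul_sub]
        exact ht'
      · exact (mul_mem ht hs : _ ∈ m.primeCompl) hmem
    obtain ⟨y, hy⟩ : (1 : c) ∈ W := hW ▸ Submodule.mem_top
    exact ⟨y, by rw [hy, map_one, one_smul]⟩
  intro i j k hj hij hjk
  have := hker (i - 1) i j (by omega) (by omega) hij
  exact exists_section_of_injective_kernel (hexact i j k (by omega) hij hjk)

end LocalToGlobal

/-! ### Base change to polynomial rings and to quotients by a nonzerodivisor -/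

section Steps

attribute [local instance 50] baseModule baseModule_isScalarTower tensorModule

section Polynomial

open Polynomial

variable {z : Type u} [CommRing z] {S T : Type u} [Ring S] [Ring T] [Algebra z S]
  (σ : T ≃+* z[X] ⊗[z] S)

/-- The identification of `z[X] ⊗_z S` with `S[X]`. -/
noncomputable def tensorPolynomialEquiv : T ≃+* S[X] :=
  σ.trans ((Algebra.TensorProduct.comm z z[X] S).trans (polyEquivTensor z S).symm).toRingEquiv

theorem polyInclude_tensorPolynomialEquiv :
    polyInclude (tensorPolynomialEquiv σ) = bcInclude σ := by
  ext s
  apply (tensorPolynomialEquiv σ).injective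
  refine ((tensorPolynomialEquiv σ).apply_symm_apply (C s)).trans ?_
  change C s = (polyEquivTensor z S).symm (Algebra.TensorProduct.comm z z[X] S
    (σ (σ.symm ((1 : z[X]) ⊗ₜ s))))
  rw [σ.apply_symm_apply, Algebra.TensorProduct.comm_tmul, polyEquivTensor_symm_apply_tmul_eq_smul,
    Polynomial.map_one, Polynomial.smul_eq_C_mul, mul_one]

/-- Passage to a polynomial ring raises the injective dimension by at most one: base change of an
injective resolution along the flat map `S → S[X]` gives a complex of modules injective over `S`,
and `extVanishing_of_polynomial` applies. -/
theorem ExtVanishing.bc_polynomial [IsNoetherianRing S] {n : ℤ}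
    (K : CochainComplex (ModuleCat.{u} S) ℤ) (a : ℤ) [K.IsStrictlyGE a]
    (h : ExtVanishing n (DerivedCategory.Q.obj K)) :
    ExtVanishing (n + 1) (DerivedCategory.Q.obj ((bcComplex σ).obj K)) := by
  obtain ⟨J, f, -, hf, hJ, hJ'⟩ := exists_injective_resolution K a
  have : J.IsKInjective := CochainComplex.isKInjective_of_injective J (a - 1)
  have hf' := (DerivedCategory.isIso_Q_map_iff_quasiIso _ f).2 hf
  have hf'' := (DerivedCategory.isIso_Q_map_iff_quasiIso _ ((bcComplex σ).map f)).2
    (bc_quasiIso_of_flat σ f)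
  have h1 : IsSplitAbove n J := isSplitAbove_iff.2 (h.of_iso (asIso (DerivedCategory.Q.map f)))
  have h2 := (h1.map (bc σ)).map (ModuleCat.restrictScalars (bcInclude σ))
  have h3 : ∀ i, Injective ((ModuleCat.restrictScalars (bcInclude σ)).obj
    (((bcComplex σ).obj J).X i)) := fun i => injective_restrictScalars_bc σ (J.X i)
  rw [← polyInclude_tensorPolynomialEquiv] at h2 h3
  exact (extVanishing_of_polynomial (a := a - 1) ((bcComplex σ).obj J) h3 h2).of_iso
    (asIso (DerivedCategory.Q.map ((bcComplex σ).map f))).symm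

end Polynomial

section Quotient

variable {z : Type u} [CommRing z] {c S T : Type u} [CommRing c] [Algebra z c] [Ring S] [Ring T]
  [Algebra z S] (σ : T ≃+* c ⊗[z] S)

omit [Ring S] [Ring T] [Algebra z S] in
theorem exists_smul_eq_of_tmul_eq_zero (hc : Function.Surjective (algebraMap z c)) {x : z}
    (hx : RingHom.ker (algebraMap z c) = Ideal.span {x}) {N : Type u} [AddCommGroup N] [Module z N]
    {n : N} (hn : (1 : c) ⊗ₜ[z] n = 0) : ∃ n', n = x • n' := by
  have hex : Function.Exact (LinearMap.mulLeft z x) (Algebra.linearMap z c) := fun r => by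
    have : (Algebra.linearMap z c) r = 0 ↔ r ∈ Ideal.span {x} := by
      rw [← hx, RingHom.mem_ker, Algebra.linearMap_apply]
    rw [this, Ideal.mem_span_singleton]
    exact ⟨fun ⟨y, hy⟩ => ⟨y, hy.symm⟩, fun ⟨y, hy⟩ => ⟨y, hy.symm⟩⟩
  obtain ⟨t, ht⟩ := (rTensor_exact N hex hc ((1 : z) ⊗ₜ n)).1 (by simpa using hn)
  refine ⟨TensorProduct.lid z N t, ?_⟩
  have h1 : ∀ t, TensorProduct.lid z N ((LinearMap.mulLeft z x).rTensor N t) =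
      x • TensorProduct.lid z N t := fun t => by
    induction t with
    | zero => simp
    | tmul a n => simp [mul_smul]
    | add x y hx hy => rw [map_add, map_add, hx, hy, map_add, smul_add]
  rw [← h1, ht, TensorProduct.lid_tmul, one_smul]

theorem bcInclude_surjective (hc : Function.Surjective (algebraMap z c)) :
    Function.Surjective (bcInclude σ) := fun t => by
  induction t using smul_bc_induction σ with
  | zero => exact ⟨0, map_zero _⟩
  | mk a s =>
    obtain ⟨r, rfl⟩ := hc a
    refine ⟨r • s, ?_⟩
    change σ.symm ((1 : c) ⊗ₜ[z] (r • s)) = _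
    rw [Algebra.algebraMap_eq_smul_one, TensorProduct.smul_tmul]
  | add x y hx hy =>
    obtain ⟨x, rfl⟩ := hx
    obtain ⟨y, rfl⟩ := hy
    exact ⟨x + y, map_add _ _ _⟩

/-- The quotient by a nonzerodivisor `x` of the base does not raise the injective dimension of a
complex of flat modules. -/
theorem ExtVanishing.bc_quotient [Module.Flat z S] (hc : Function.Surjective (algebraMap z c))
    {x : z} (hx : RingHom.ker (algebraMap z c) = Ideal.span {x}) (hreg : x ∈ nonZeroDivisors z)
    {n : ℤ} (K : CochainComplex (ModuleCat.{u} S) ℤ) (a : ℤ) [K.IsStrictlyGE a]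
    (hK : ∀ i, Module.Flat z (K.X i)) (h : ExtVanishing n (DerivedCategory.Q.obj K)) :
    ExtVanishing n (DerivedCategory.Q.obj ((bcComplex σ).obj K)) := by
  have hxc : algebraMap z c x = 0 := by
    rw [← RingHom.mem_ker, hx]
    exact Ideal.mem_span_singleton_self x
  let v : K ⟶ (resComplex (bcInclude σ)).obj ((bcComplex σ).obj K) :=
    (NatTrans.mapHomologicalComplex (bcAdj σ).unit (ComplexShape.up ℤ)).app K
  have hv : ∀ i (m : K.X i), ((v.f i).hom m : (bc σ).obj (K.X i)) = bcMk σ 1 m := fun i m => rfl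
  refine ExtVanishing.quotient (π := bcInclude σ) (x := algebraMap z S x) (a := a)
    (bcInclude_surjective σ hc) (fun b => Algebra.commutes x b) (fun b hb => ?_) ?_ (fun b hb => ?_)
    (fun i y hy => ?_) v (fun i => ?_) (fun i y hy => ?_) h
  · rw [← Algebra.smul_def] at hb
    exact (Module.Flat.isSMulRegular_of_nonZeroDivisors hreg).right_eq_zero_of_smul hb
  · change σ.symm ((1 : c) ⊗ₜ[z] algebraMap z S x) = 0
    rw [Algebra.algebraMap_eq_smul_one, ← TensorProduct.smul_tmul, ← Algebra.algebraMap_eq_smul_one,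
      hxc, TensorProduct.zero_tmul, map_zero]
  · obtain ⟨b', hb'⟩ := exists_smul_eq_of_tmul_eq_zero hc hx (σ.symm.injective
      (hb.trans (map_zero _).symm))
    exact ⟨b', hb'.trans (Algebra.smul_def x b')⟩
  · have := hK i
    exact (Module.Flat.isSMulRegular_of_nonZeroDivisors (M := K.X i) hreg).right_eq_zero_of_smul hy
  · intro (t : (bc σ).obj (K.X i))
    induction t using bc_induction with
    | zero => exact ⟨0, map_zero _⟩
    | mk r m =>
      obtain ⟨r, rfl⟩ := hc r
      exact ⟨algebraMap z S r • m, (hv i _).trans (by rw [← algebraMap_bcMk, mul_one])⟩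
    | add t t' h1 h2 =>
      obtain ⟨y, rfl⟩ := h1
      obtain ⟨y', rfl⟩ := h2
      exact ⟨y + y', map_add _ _ _⟩
  · exact exists_smul_eq_of_tmul_eq_zero hc hx
      ((congrArg (bcToTensor σ (K.X i)) ((hv i y).symm.trans hy)).trans (map_zero _))

end Quotient

end Steps

/-! ### Finite injective dimension under base change between regular rings -/

section Stages

attribute [local instance 50] baseModule baseModule_isScalarTower tensorModule

variable {z : Type u} [CommRing z] {S : Type u} [Ring S] [Algebra z S]

/-- Two base changes along the same homomorphism of rings agree. -/
noncomputable def bcComplexCongr {c c' T : Type u} [CommRing c] [Algebra z c] [CommRing c']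
    [Algebra z c'] [Ring T] (σ : T ≃+* c ⊗[z] S) (σ' : T ≃+* c' ⊗[z] S)
    (h : bcInclude σ = bcInclude σ') (K : CochainComplex (ModuleCat.{u} S) ℤ) :
    (bcComplex σ).obj K ≅ (bcComplex σ').obj K :=
  (NatIso.mapHomologicalComplex (Adjunction.leftAdjointUniq (bcAdj σ)
    ((bcAdj σ').ofNatIsoRight (ModuleCat.restrictScalarsCongr h.symm)))
      (ComplexShape.up ℤ)).app K

variable (z) in
/-- The base change of `X` to the `z`-algebra `c` satisfies `Ext^i(N, -) = 0` for `i ≥ n`. -/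
def BaseExtVanishing (X : CochainComplex (ModuleCat.{u} S) ℤ) (n : ℤ)
    (c : Type u) [CommRing c] [Algebra z c] : Prop :=
  ∀ (T : Type u) [Ring T] (σ : T ≃+* c ⊗[z] S),
    ExtVanishing n (DerivedCategory.Q.obj ((bcComplex σ).obj X))

variable {X : CochainComplex (ModuleCat.{u} S) ℤ} {n a : ℤ} [X.IsStrictlyGE a]
  {c c' : Type u} [CommRing c] [Algebra z c] [CommRing c']
  [Algebra z c']

include a in
theorem baseExtVanishing_of_equiv {T : Type u} [Ring T] (σ : T ≃+* c ⊗[z] S)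
    (h : ExtVanishing n (DerivedCategory.Q.obj ((bcComplex σ).obj X))) :
    BaseExtVanishing z X n c := fun T' _ σ' => by
  let e : T' ≃+* T := σ'.trans σ.symm
  have h1 := h.restrictScalars_equiv e _ a
  refine h1.of_iso (DerivedCategory.Q.mapIso ?_)
  let τ : bc σ ⋙ ModuleCat.restrictScalars e.toRingHom ≅ bc σ' :=
    Functor.isoWhiskerLeft ((tensorFunctor z c S).obj (ModuleCat.of c c))
      (ModuleCat.restrictScalarsComp' e.toRingHom σ.toRingHom σ'.toRingHom (RingHom.ext fun t =>
        (σ.apply_symm_apply (σ' t)).symm)).symm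
  exact (NatIso.mapHomologicalComplex τ (ComplexShape.up ℤ)).app X

include a in
theorem baseExtVanishing_algEquiv (e : c ≃ₐ[z] c') (h : BaseExtVanishing z X n c) :
    BaseExtVanishing z X n c' := by
  let σ : c ⊗[z] S ≃+* c' ⊗[z] S := (Algebra.TensorProduct.congr e AlgEquiv.refl).toRingEquiv
  refine baseExtVanishing_of_equiv (a := a) σ ((h _ (RingEquiv.refl _)).of_iso
    (DerivedCategory.Q.mapIso (bcComplexCongr _ σ ?_ X)))
  ext s
  apply σ.injective
  refine Eq.trans ?_ (σ.apply_symm_apply _).symm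
  change e 1 ⊗ₜ[z] s = 1 ⊗ₜ s
  rw [map_one]

omit [X.IsStrictlyGE a] in
/-- The base change of a flat module is flat. -/
theorem flat_bc_obj {T : Type u} [Ring T] [Algebra c T] {σ : T ≃+* c ⊗[z] S}
    (hσ : ∀ a, σ.symm (a ⊗ₜ 1) = algebraMap c T a) (M : ModuleCat.{u} S) [Module.Flat z M] :
    Module.Flat c ((bc σ).obj M) := by
  let e := AddEquiv.ofBijective _ (bcToTensor_bijective σ M)
  refine Module.Flat.of_linearEquiv (e.toLinearEquiv fun r x => ?_)
  induction x using bc_induction with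
  | zero => rw [smul_zero, map_zero, smul_zero]
  | add x y hx hy => rw [smul_add, map_add, map_add, hx, hy, smul_add]
  | mk a m =>
    have h : r • bcMk σ a m = bcMk σ (r * a) m := by
      rw [← algebraMap_smul T r (bcMk σ a m), ← hσ, symm_tmul_smul_bcMk, one_smul]
    rw [h]
    exact TensorProduct.smul_tmul' r a m |>.symm

section Tower

variable [Algebra c c'] [IsScalarTower z c c']

omit [X.IsStrictlyGE a] in
variable (z S c c') in
/-- Transitivity of base change for algebras. -/
noncomputable def tensorTowerEquiv : c' ⊗[c] (c ⊗[z] S) ≃+* c' ⊗[z] S :=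
  (AlgEquiv.ofLinearEquiv (TensorProduct.AlgebraTensorModule.cancelBaseChange z c c' c' S).symm
    (by simp [Algebra.TensorProduct.one_def])
    (LinearMap.map_mul_of_map_mul_tmul (fun _ _ _ _ => by simp))).symm.toRingEquiv

omit [X.IsStrictlyGE a] in
theorem tensorTowerEquiv_symm_tmul (s : S) :
    (tensorTowerEquiv z S c c').symm (1 ⊗ₜ s) = 1 ⊗ₜ (1 ⊗ₜ s) :=
  rfl

include a in
/-- The base change from `z` to `c'` may be done in two stages through `c`. -/
theorem baseExtVanishing_tower_iff : BaseExtVanishing z X n c' ↔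
    BaseExtVanishing c ((bcComplex (RingEquiv.refl (c ⊗[z] S))).obj X) n c' := by
  let σ := tensorTowerEquiv z S c c'
  have hσ : bcInclude σ = (bcInclude (RingEquiv.refl (c' ⊗[c] (c ⊗[z] S)))).comp
      (bcInclude (RingEquiv.refl (c ⊗[z] S))) :=
    RingHom.ext fun s => tensorTowerEquiv_symm_tmul s
  have e := bcComplexCompIso (RingEquiv.refl (c ⊗[z] S)) (RingEquiv.refl (c' ⊗[c] (c ⊗[z] S)))
    σ hσ X
  exact ⟨fun h => baseExtVanishing_of_equiv (a := a) _
    ((h _ σ).of_iso (DerivedCategory.Q.mapIso e)),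
    fun h => baseExtVanishing_of_equiv (a := a) σ
      ((h _ (RingEquiv.refl _)).of_iso (DerivedCategory.Q.mapIso e.symm))⟩

include a in
theorem BaseExtVanishing.of_epi [IsNoetherianRing (c ⊗[z] S)] [Module.Flat c c']
    (hepi : ∀ a : c', a ⊗ₜ[c] (1 : c') = 1 ⊗ₜ a) (h : BaseExtVanishing z X n c) :
    BaseExtVanishing z X n c' :=
  (baseExtVanishing_tower_iff (a := a) (c := c)).2 fun _ _ σ =>
    (h _ (RingEquiv.refl _)).bc_of_epi σ hepi _ a

end Tower

include a in
theorem BaseExtVanishing.polynomial [IsNoetherianRing (c ⊗[z] S)] (h : BaseExtVanishing z X n c) :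
    BaseExtVanishing z X (n + 1) (Polynomial c) :=
  (baseExtVanishing_tower_iff (a := a) (c := c)).2 fun _ _ σ =>
    (h _ (RingEquiv.refl _)).bc_polynomial σ _ a

include a in
theorem BaseExtVanishing.quotient [Module.Flat z S] (hX : ∀ i, Module.Flat z (X.X i)) {x : c}
    (hx : x ∈ nonZeroDivisors c) (h : BaseExtVanishing z X n c) :
    BaseExtVanishing z X n (c ⧸ Ideal.span {x}) :=
  (baseExtVanishing_tower_iff (a := a) (c := c)).2 fun _ _ σ =>
    (h _ (RingEquiv.refl _)).bc_quotient σ Ideal.Quotient.mk_surjective Ideal.mk_ker hx _ a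
      fun i => by
        have := hX i
        exact flat_bc_obj (fun _ => rfl) (X.X i)

include a in
theorem BaseExtVanishing.of_local [IsNoetherianRing (c ⊗[z] S)]
    (h : ∀ (m : Ideal c) [m.IsMaximal], BaseExtVanishing z X n (Localization.AtPrime m)) :
    BaseExtVanishing z X (n + 1) c :=
  baseExtVanishing_of_equiv (a := a) (RingEquiv.refl _) (ExtVanishing.of_local (c := c) (a := a) _
    fun m _ => (baseExtVanishing_tower_iff (a := a) (c := c)).1 (h m) _ _)

end Stages

section Hilbert

open Polynomial

/-- Hilbert's basis theorem for polynomials in a central variable over a noncommutative ring. -/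
theorem isNoetherianRing_polynomial (S : Type*) [Ring S] [IsNoetherianRing S] :
    IsNoetherianRing S[X] := isNoetherianRing_iff.2 ⟨fun I : Ideal S[X] => by
  classical
  -- the coefficients of degree `n` of the elements of `I` of degree at most `n`
  let L : ℕ →o Submodule S S :=
    ⟨fun n => (I.degreeLE n).map (lcoeff S n), monotone_nat_of_le_succ fun n x hx => by
      obtain ⟨p, hp, rfl⟩ := hx
      refine ⟨X * p, ⟨mem_degreeLE.2 ((degree_le_iff_coeff_zero _ _).2 fun m hm => ?_),
        I.mul_mem_left X hp.2⟩, by simp⟩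
      obtain ⟨m, rfl⟩ : ∃ m', m = m' + 1 := ⟨m - 1, by
        have : n + 1 < m := by exact_mod_cast hm
        omega⟩
      rw [coeff_X_mul]
      refine (degree_le_iff_coeff_zero _ _).1 (mem_degreeLE.1 hp.1) m ?_
      have : n + 1 < m + 1 := by exact_mod_cast hm
      exact_mod_cast (by omega : n < m)⟩
  obtain ⟨N, hN⟩ := monotone_stabilizes_iff_noetherian.2 ‹IsNoetherianRing S› L
  have hfg : (I.degreeLE N).FG := by
    have h1 : IsNoetherian S (Polynomial.degreeLE S (N : WithBot ℕ)) :=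
      isNoetherian_of_fg_of_noetherian _ ⟨_, degreeLE_eq_span_X_pow.symm⟩
    exact (h1.noetherian (Submodule.comap (Polynomial.degreeLE S (N : WithBot ℕ)).subtype
      (I.degreeLE N))).map _ |> fun h => by
        rw [Submodule.map_comap_subtype] at h
        have h2 : Polynomial.degreeLE S (N : WithBot ℕ) ⊓ I.degreeLE N = I.degreeLE N :=
          inf_eq_right.2 inf_le_left
        exact h2 ▸ h
  obtain ⟨s, hs⟩ := hfg
  have hD : I.degreeLE N ≤ (Submodule.span S[X] (s : Set S[X])).restrictScalars S := by
    rw [← hs, Submodule.span_le]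
    exact Submodule.subset_span
  refine ⟨s, le_antisymm (Submodule.span_le.2 fun x hx => ?_) ?_⟩
  · exact (hs ▸ Submodule.subset_span hx : x ∈ I.degreeLE N).2
  have key : ∀ (k : ℕ) (p : S[X]), p ∈ I → degree p < k →
      p ∈ Submodule.span S[X] (s : Set S[X]) := by
    intro k
    induction k with
    | zero =>
      intro p _ hp
      rw [degree_eq_bot.1 (Nat.WithBot.lt_zero_iff.1 hp)]
      exact zero_mem _
    | succ k ih =>
      intro p hp hk
      have hk' : degree p ≤ k := Order.le_of_lt_succ (by exact_mod_cast hk)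
      obtain hkN | hkN := le_or_gt k N
      · exact hD ⟨mem_degreeLE.2 (hk'.trans (by exact_mod_cast hkN)), hp⟩
      · have h1 : p.coeff k ∈ L N := by
          rw [hN k hkN.le]
          exact ⟨p, ⟨mem_degreeLE.2 hk', hp⟩, rfl⟩
        obtain ⟨q, hq, hqc⟩ := h1
        have hqc' : q.coeff N = p.coeff k := hqc
        have h2 : X ^ (k - N) * q ∈ Submodule.span S[X] (s : Set S[X]) :=
          Ideal.mul_mem_left _ _ (hD hq)
        rw [← sub_add_cancel p (X ^ (k - N) * q)]
        refine add_mem (ih _ (sub_mem hp (I.mul_mem_left _ hq.2)) ?_) h2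
        refine (degree_lt_iff_coeff_zero _ _).2 fun m hm => ?_
        obtain ⟨j, rfl⟩ : ∃ j, m = j + (k - N) := ⟨m - (k - N), by omega⟩
        rw [coeff_sub, coeff_X_pow_mul]
        obtain hj | hj := (show N ≤ j by omega).eq_or_lt
        · subst hj
          rw [hqc', show N + (k - N) = k by omega, sub_self]
        · rw [(degree_le_iff_coeff_zero _ _).1 (mem_degreeLE.1 hq.1) j (by exact_mod_cast hj),
            (degree_le_iff_coeff_zero _ _).1 hk' _ (by
              exact_mod_cast (by omega : k < j + (k - N))), sub_zero]
  exact fun p hp => key (p.natDegree + 1) p hp (degree_le_natDegree.trans_lt (by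
    exact_mod_cast Nat.lt_succ_self _))⟩

end Hilbert

section NoetherianTensor

variable (z : Type u) [CommRing z] (S : Type u) [Ring S] [Algebra z S]

theorem isNoetherianRing_tensor_algEquiv {c c' : Type*} [CommRing c] [Algebra z c] [CommRing c']
    [Algebra z c'] (f : c →ₐ[z] c') (hf : Function.Surjective f) [IsNoetherianRing (c ⊗[z] S)] :
    IsNoetherianRing (c' ⊗[z] S) :=
  isNoetherianRing_of_surjective _ _ (Algebra.TensorProduct.map f (AlgHom.id z S)).toRingHom
    (TensorProduct.map_surjective hf Function.surjective_id)

theorem isNoetherianRing_mvPolynomial_tensor [IsNoetherianRing S] (m : ℕ) :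
    IsNoetherianRing (MvPolynomial (Fin m) z ⊗[z] S) := by
  induction m with
  | zero =>
    exact isNoetherianRing_of_ringEquiv S ((Algebra.TensorProduct.lid z S).symm.trans
      (Algebra.TensorProduct.congr (MvPolynomial.isEmptyAlgEquiv z (Fin 0)).symm
        AlgEquiv.refl)).toRingEquiv
  | succ m ih =>
    have := isNoetherianRing_polynomial (MvPolynomial (Fin m) z ⊗[z] S)
    have : IsNoetherianRing (Polynomial (MvPolynomial (Fin m) z) ⊗[z] S) :=
      isNoetherianRing_of_ringEquiv (Polynomial (MvPolynomial (Fin m) z ⊗[z] S))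
        ((tensorPolynomialEquiv (RingEquiv.refl _)).symm.trans
          (tensorTowerEquiv z S (MvPolynomial (Fin m) z) (Polynomial (MvPolynomial (Fin m) z))))
    exact isNoetherianRing_tensor_algEquiv z S (MvPolynomial.finSuccEquiv z m).symm.toAlgHom
      (MvPolynomial.finSuccEquiv z m).symm.surjective

/-- The base change of a Noetherian algebra to a commutative algebra of finite type is
Noetherian. -/
theorem isNoetherianRing_tensor_of_finiteType [IsNoetherianRing S] (c : Type*) [CommRing c]
    [Algebra z c] [hc : Algebra.FiniteType z c] : IsNoetherianRing (c ⊗[z] S) := by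
  obtain ⟨m, f, hf⟩ := Algebra.FiniteType.iff_quotient_mvPolynomial''.1 hc
  have := isNoetherianRing_mvPolynomial_tensor z S m
  exact isNoetherianRing_tensor_algEquiv z S f hf

end NoetherianTensor

section Chain

attribute [local instance 50] baseModule baseModule_isScalarTower

variable {z : Type u} [CommRing z] {S : Type u} [Ring S] [Algebra z S]
  {X : CochainComplex (ModuleCat.{u} S) ℤ} {n a : ℤ} [X.IsStrictlyGE a]

include a in
theorem baseExtVanishing_self (h : ExtVanishing n (DerivedCategory.Q.obj X)) [IsNoetherianRing S] :
    BaseExtVanishing z X n z := fun _ _ σ => h.bc_of_epi σ (fun a => by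
      rw [← mul_one a, ← smul_eq_mul, TensorProduct.smul_tmul]) X a

include a in
theorem baseExtVanishing_mvPolynomial (h : ExtVanishing n (DerivedCategory.Q.obj X))
    [IsNoetherianRing S] (m : ℕ) : BaseExtVanishing z X (n + m) (MvPolynomial (Fin m) z) := by
  induction m with
  | zero =>
    rw [Nat.cast_zero, add_zero]
    exact baseExtVanishing_algEquiv (a := a) (MvPolynomial.isEmptyAlgEquiv z (Fin 0)).symm
      (baseExtVanishing_self (a := a) h)
  | succ m ih =>
    have := isNoetherianRing_mvPolynomial_tensor z S m
    rw [Nat.cast_succ, ← add_assoc]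
    exact baseExtVanishing_algEquiv (a := a) (MvPolynomial.finSuccEquiv z m).symm
      (BaseExtVanishing.polynomial (a := a) ih)

open IsLocalRing

include a in
/-- A surjection of regular local rings is a composition of quotients by nonzerodivisors, each of
which belongs to `m ∖ m²`. -/
theorem BaseExtVanishing.of_surjective_regularLocal [Module.Flat z S]
    (hX : ∀ i, Module.Flat z (X.X i)) (d : ℕ) : ∀ {R R' : Type u} [CommRing R] [Algebra z R]
    [CommRing R'] [Algebra z R'] [IsRegularLocalRing R] [IsRegularLocalRing R']
    (f : R →ₐ[z] R') (_ : Function.Surjective f) (_ : (maximalIdeal R).spanFinrank = d)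
    (_ : BaseExtVanishing z X n R), BaseExtVanishing z X n R' := by
  induction d using Nat.strong_induction_on with
  | _ d ih =>
    intro R R' _ _ _ _ _ _ f hf hd h
    by_cases hker : RingHom.ker f.toRingHom = ⊥
    · exact baseExtVanishing_algEquiv (a := a) (AlgEquiv.ofBijective f
        ⟨(RingHom.injective_iff_ker_eq_bot f.toRingHom).2 hker, hf⟩) h
    · obtain ⟨x, hx, hx', hfx⟩ := exists_mem_ker_notMem_sq f.toRingHom hf hker
      obtain ⟨hreg, hloc, hrank⟩ := isRegularLocalRing_quotient hx hx'
      have hx0 : x ≠ 0 := fun h0 => hx' (h0 ▸ zero_mem _)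
      refine ih _ (by omega) (Ideal.Quotient.liftₐ (Ideal.span {x}) f fun y hy => ?_) ?_ rfl
        (h.quotient (a := a) hX (mem_nonZeroDivisors_of_ne_zero hx0))
      · obtain ⟨w, rfl⟩ := Ideal.mem_span_singleton.1 hy
        rw [map_mul]
        exact (congrArg (· * f w) hfx).trans (zero_mul _)
      · exact Ideal.Quotient.lift_surjective_of_surjective _ _ hf

include a in
/-- Let `z'` be a regular algebra of finite type over the regular ring `z`. If `X` is a bounded
below complex of `z`-flat modules over the Noetherian flat `z`-algebra `S` that has finite injective
dimension, then so does its base change to `z'`. -/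
theorem exists_baseExtVanishing [IsRegularRing z] [Module.Flat z S] [IsNoetherianRing S]
    (hX : ∀ i, Module.Flat z (X.X i)) (h : ExtVanishing n (DerivedCategory.Q.obj X))
    (z' : Type u) [CommRing z'] [Algebra z z'] [IsRegularRing z'] [hz' : Algebra.FiniteType z z'] :
    ∃ n', BaseExtVanishing z X n' z' := by
  obtain ⟨m, f, hf⟩ := Algebra.FiniteType.iff_quotient_mvPolynomial''.1 hz'
  have hP := isNoetherianRing_mvPolynomial_tensor z S m
  have := isNoetherianRing_tensor_of_finiteType z S z'
  -- at a maximal ideal `M` with preimage `q` in `z[x₁, …, x_m]`, the base change passes through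
  -- `z[x₁, …, x_m]` and its localization at `q`
  refine ⟨n + m + 1, BaseExtVanishing.of_local (a := a) fun M hM => ?_⟩
  let q := M.comap f.toRingHom
  have h1 : BaseExtVanishing z X (n + m) (Localization.AtPrime q) := by
    have : Module.Flat (MvPolynomial (Fin m) z) (Localization.AtPrime q) :=
      IsLocalization.flat _ q.primeCompl
    exact BaseExtVanishing.of_epi (a := a) (c := MvPolynomial (Fin m) z)
      (tmul_one_eq_of_isLocalization q.primeCompl) (baseExtVanishing_mvPolynomial (a := a) h m)
  let g := Localization.localAlgHom q M f rfl
  refine BaseExtVanishing.of_surjective_regularLocal (a := a) hX _ g (fun y => ?_) rfl h1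
  obtain ⟨w, t, rfl⟩ := IsLocalization.exists_mk'_eq M.primeCompl y
  obtain ⟨p, rfl⟩ := hf w
  obtain ⟨r, hr⟩ := hf t
  have hrq : r ∈ q.primeCompl := fun hrq => t.2 (hr ▸ hrq)
  refine ⟨IsLocalization.mk' _ p ⟨r, hrq⟩, ?_⟩
  refine (Localization.localRingHom_mk' q M f.toRingHom rfl p ⟨r, hrq⟩).trans ?_
  congr 1
  exact Subtype.ext hr

end Chain

/-! ### Base change of dualizing complexes -/

theorem exists_ringKrullDim_le (k z : Type*) [Field k] [CommRing z] [Algebra k z]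
    [hz : Algebra.FiniteType k z] : ∃ D : ℕ, ringKrullDim z ≤ D := by
  obtain ⟨n, f, hf⟩ := Algebra.FiniteType.iff_quotient_mvPolynomial''.1 hz
  refine ⟨n, (ringKrullDim_le_of_surjective f.toRingHom hf).trans ?_⟩
  rw [MvPolynomial.ringKrullDim_of_isNoetherianRing, ringKrullDim_eq_zero_of_field]
  simp

section LeftDerived

variable {C D : Type (u + 1)} [Category.{u} C] [Category.{u} D] [Abelian C] [Abelian D]

/-- Left derived functors can be computed by any K-projective resolution. -/
theorem IsLeftDerived.nonempty_iso {F : C ⥤ D} [F.Additive] {X : DerivedCategory C}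
    {Y : DerivedCategory D} (h : IsLeftDerived F X Y) {P : CochainComplex C ℤ}
    [hP : P.IsKProjective] (e : DerivedCategory.Q.obj P ≅ X) :
    Nonempty (DerivedCategory.Q.obj ((F.mapHomologicalComplex (ComplexShape.up ℤ)).obj P) ≅ Y) := by
  obtain ⟨P', hP', ⟨e'⟩, ⟨e''⟩⟩ := h
  obtain ⟨w⟩ := nonempty_homotopyEquiv_of_isKProjective (e ≪≫ e'.symm)
  exact ⟨isoOfHomotopyEquiv (F.mapHomotopyEquiv w) ≪≫ e''⟩

end LeftDerived

section FlatModel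

attribute [local instance 50] baseModule baseModule_isScalarTower tensorModule

variable {z : Type u} [CommRing z] [IsRegularRing z] {D : ℕ} (hD : ringKrullDim z ≤ D)
  {S : Type u} [Ring S] [Algebra z S] [Module.Flat z S]

omit [Module.Flat z S] in
include hD in
/-- A complex with bounded below cohomology and flat terms over a regular ring of finite dimension
is quasi-isomorphic to one of its truncations, which has flat terms as well. -/
theorem exists_flat_truncation (K : CochainComplex (ModuleCat.{u} S) ℤ) {a : ℤ} [hK : K.IsGE a]
    [∀ i, Module.Flat z (K.X i)] :
    ∃ (a' : ℤ) (G : CochainComplex (ModuleCat.{u} S) ℤ) (f : K ⟶ G), QuasiIso f ∧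
      G.IsStrictlyGE a' ∧ (∀ b, K.IsStrictlyLE b → G.IsStrictlyLE b) ∧
      ∀ i, Module.Flat z (G.X i) := by
  have h1 : ∀ j ≤ a - 1, K.ExactAt j := fun j hj => K.exactAt_of_isGE a j (by omega)
  have : K.IsGE (a - 1 - D + 1) := K.isGE_of_ge _ a (by omega)
  refine ⟨a - 1 - D + 1, K.truncGE (a - 1 - D + 1), K.πTruncGE _, ?_, inferInstance, fun b hb => ?_,
    flat_truncGE hD K h1⟩
  · infer_instance
  · infer_instance

include hD in
/-- A bounded object of the derived category is represented by a bounded above complex of projective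
modules, and by a bounded complex of flat `z`-modules. -/
theorem exists_flat_model (R : DerivedCategory (ModuleCat.{u} S)) {a b : ℤ} [R.IsGE a]
    [R.IsLE b] :
    ∃ (a' b' : ℤ) (P G : CochainComplex (ModuleCat.{u} S) ℤ) (f : P ⟶ G), QuasiIso f ∧
      P.IsStrictlyLE b' ∧ (∀ i, Projective (P.X i)) ∧ Nonempty (DerivedCategory.Q.obj P ≅ R) ∧
      G.IsStrictlyGE a' ∧ G.IsStrictlyLE b' ∧ ∀ i, Module.Flat z (G.X i) := by
  obtain ⟨P, b', hb', hP, ⟨e⟩⟩ := hasLeftResolution_projective R (a := a) (b := b)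
  have hP' : ∀ i, Projective (P.X i) := hP
  have : ∀ i, Module.Flat z (P.X i) := fun i => flat_of_projective (P.X i)
  have : P.IsGE a := by
    rw [← DerivedCategory.isGE_Q_obj_iff]
    exact DerivedCategory.TStructure.t.isGE_of_iso e.symm a
  obtain ⟨a', G, f, hf, hG, hG', hG''⟩ := exists_flat_truncation hD P (a := a)
  exact ⟨a', b', P, G, f, hf, hb', hP, ⟨e⟩, hG, hG' b' hb', hG''⟩

end FlatModel

section Env

variable (z z' : Type u) [CommRing z] [CommRing z'] [Algebra z z'] (A : Type u) [Ring A]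
  [Algebra z A]

/-- The opposite of the base change, `(z' ⊗ A)^o ≃ z' ⊗ A^o`. -/
noncomputable def opBaseChange : (BaseChange z z' A)ᵐᵒᵖ ≃+* z' ⊗[z] Aᵐᵒᵖ :=
  ((Algebra.TensorProduct.opAlgEquiv z z' z' A).symm.trans
    (Algebra.TensorProduct.congr (AlgEquiv.toOpposite z' z').symm AlgEquiv.refl)).toRingEquiv

theorem opBaseChange_op_tmul (s : z') (a : A) :
    opBaseChange z z' A (MulOpposite.op (s ⊗ₜ a)) = s ⊗ₜ MulOpposite.op a := by
  simp [opBaseChange]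

/-- The additive map `A ⊗ A^o → A' ⊗ A'^o`. -/
noncomputable def envInclude : Env z A →+ Env z' (BaseChange z z' A) :=
  TensorProduct.liftAddHom
    (AddMonoidHom.mk' (fun a : A => AddMonoidHom.mk' (fun b : Aᵐᵒᵖ =>
      ((1 ⊗ₜ a : BaseChange z z' A) ⊗ₜ MulOpposite.op (1 ⊗ₜ b.unop : BaseChange z z' A) :
        Env z' (BaseChange z z' A)))
      fun b b' => by simp [TensorProduct.tmul_add])
      fun a a' => AddMonoidHom.ext fun b => by
        simp [TensorProduct.tmul_add, TensorProduct.add_tmul])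
    fun r a b => by
      change ((1 ⊗ₜ (r • a) : BaseChange z z' A) ⊗ₜ MulOpposite.op _ :
        Env z' (BaseChange z z' A)) = _ ⊗ₜ MulOpposite.op (1 ⊗ₜ (r • b.unop) : BaseChange z z' A)
      have h : ∀ x : A, (1 ⊗ₜ (r • x) : BaseChange z z' A) = algebraMap z z' r • (1 ⊗ₜ x) :=
        fun x => by rw [← TensorProduct.smul_tmul, TensorProduct.smul_tmul', smul_eq_mul, mul_one,
          Algebra.smul_def, mul_one]
      rw [h, h, MulOpposite.op_smul, TensorProduct.smul_tmul]

theorem envInclude_tmul (a : A) (b : Aᵐᵒᵖ) : envInclude z z' A (a ⊗ₜ b) =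
    (1 ⊗ₜ a : BaseChange z z' A) ⊗ₜ MulOpposite.op (1 ⊗ₜ b.unop : BaseChange z z' A) :=
  rfl

theorem envInclude_smul (r : z) (w : Env z A) :
    envInclude z z' A (r • w) = algebraMap z z' r • envInclude z z' A w := by
  induction w using TensorProduct.induction_on with
  | zero => simp
  | add x y hx hy => rw [smul_add, map_add, map_add, hx, hy, smul_add]
  | tmul a b =>
    rw [TensorProduct.smul_tmul', envInclude_tmul, envInclude_tmul, TensorProduct.smul_tmul']
    congr 1
    rw [← TensorProduct.smul_tmul, TensorProduct.smul_tmul', smul_eq_mul, mul_one,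
      Algebra.smul_def, mul_one]

/-- The inverse map is `s ⊗ w ↦ s • envInclude w`. -/
theorem envBaseChange_bijective : Function.Bijective (envBaseChange z z' A) := by
  let g : z' ⊗[z] Env z A →+ Env z' (BaseChange z z' A) := TensorProduct.liftAddHom
    (AddMonoidHom.mk' (fun s : z' =>
      (DistribSMul.toAddMonoidHom (Env z' (BaseChange z z' A)) s).comp (envInclude z z' A))
      fun s s' => AddMonoidHom.ext fun w => by
        change (s + s') • envInclude z z' A w = s • envInclude z z' A w + s' • envInclude z z' A w
        exact add_smul _ _ _)
    fun r s w => by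
      change (r • s) • envInclude z z' A w = s • envInclude z z' A (r • w)
      rw [envInclude_smul, Algebra.smul_def, mul_comm, mul_smul]
  have hg : ∀ s w, g (s ⊗ₜ w) = s • envInclude z z' A w := fun _ _ => rfl
  refine Function.bijective_iff_has_inverse.2 ⟨g, fun x => ?_, fun x => ?_⟩
  · induction x using TensorProduct.induction_on with
    | zero => simp
    | add x y hx hy => rw [map_add, map_add, hx, hy]
    | tmul x y =>
      induction x using TensorProduct.induction_on with
      | zero => simp
      | add x x' hx hx' => rw [TensorProduct.add_tmul, map_add, map_add, hx, hx']
      | tmul s a =>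
        induction y using MulOpposite.rec' with
        | h y =>
          induction y using TensorProduct.induction_on with
          | zero => simp
          | add y y' hy hy' =>
            rw [MulOpposite.op_add, TensorProduct.tmul_add, map_add, map_add, hy, hy']
          | tmul t b =>
            have h : ∀ (r : z') (x : A), (r ⊗ₜ x : BaseChange z z' A) = r • (1 ⊗ₜ x) :=
              fun r x => by rw [TensorProduct.smul_tmul', smul_eq_mul, mul_one]
            rw [envBaseChange_tmul, hg, envInclude_tmul, h s a, h t b, MulOpposite.op_smul,
              TensorProduct.tmul_smul, TensorProduct.smul_tmul', ← TensorProduct.smul_tmul',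
              ← TensorProduct.smul_tmul', smul_smul, mul_comm]
            rfl
  · induction x using TensorProduct.induction_on with
    | zero => simp
    | add x y hx hy => rw [map_add, map_add, hx, hy]
    | tmul s w =>
      rw [hg, map_smul]
      induction w using TensorProduct.induction_on with
      | zero => simp
      | add x y hx hy => rw [map_add, map_add, smul_add, hx, hy, TensorProduct.tmul_add]
      | tmul a b =>
        rw [envInclude_tmul, envBaseChange_tmul, TensorProduct.smul_tmul', smul_eq_mul, mul_one,
          mul_one]
        rfl

/-- The identification `A' ⊗_{z'} A'^o ≃ z' ⊗_z (A ⊗_z A^o)`. The functor `baseChange z z' A` on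
bimodules is the base change `bc` along it, by definition. -/
noncomputable def envEquiv : Env z' (BaseChange z z' A) ≃+* z' ⊗[z] Env z A :=
  RingEquiv.ofBijective (envBaseChange z z' A) (envBaseChange_bijective z z' A)

theorem envEquiv_symm_tmul (s : z') (a : A) (b : Aᵐᵒᵖ) :
    (envEquiv z z' A).symm (s ⊗ₜ (a ⊗ₜ b)) =
      (s ⊗ₜ a : BaseChange z z' A) ⊗ₜ MulOpposite.op (1 ⊗ₜ b.unop : BaseChange z z' A) := by
  rw [RingEquiv.symm_apply_eq]
  refine ((envBaseChange_tmul z z' A s 1 a b.unop).trans ?_).symm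
  rw [mul_one, MulOpposite.op_unop]

end Env

section OneSided

attribute [local instance 50] baseModule baseModule_isScalarTower tensorModule

variable {z : Type u} [CommRing z] [IsRegularRing z] {c E S E' S' : Type u} [CommRing c]
  [Algebra z c] [Ring E] [Ring S] [Ring E'] [Ring S'] [Algebra z E] [Algebra z S]
  {iS : S →ₐ[z] E} {iS' : S' →+* E'} {σE : E' ≃+* c ⊗[z] E} {σS : S' ≃+* c ⊗[z] S}
  (hS : ∀ a s, iS' (σS.symm (a ⊗ₜ s)) = σE.symm (a ⊗ₜ iS s)) [Module.Flat z S]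
  [IsNoetherianRing S] {G : CochainComplex (ModuleCat.{u} E) ℤ} {a b : ℤ}
  [G.IsStrictlyGE a] [hG : ∀ i, Module.Flat z (G.X i)]
  {R : DerivedCategory (ModuleCat.{u} E)} {R' : DerivedCategory (ModuleCat.{u} E')}
  (e : DerivedCategory.Q.obj G ≅ R) (e' : DerivedCategory.Q.obj ((bcComplex σE).obj G) ≅ R')

omit [IsRegularRing z] [Module.Flat z S] [IsNoetherianRing S] in
theorem flat_resComplex (i : ℤ) : Module.Flat z (((resComplex iS.toRingHom).obj G).X i) := by
  refine @Module.Flat.of_linearEquiv z (G.X i) _ _ _ _ _ _ (hG i)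
      { toFun := fun x => x
        invFun := fun x => x
        map_add' := fun _ _ => rfl
        map_smul' := fun r (x : G.X i) => congrArg (· • x) (iS.commutes r) }

include hS e e' a in
/-- Restriction to one side commutes with base change, so that `exists_baseExtVanishing` applies to
the restriction of `G`. -/
theorem hasFiniteInjectiveDimension_bc [IsRegularRing c] [Algebra.FiniteType z c]
    (h : HasFiniteInjectiveDimension
      ((ModuleCat.restrictScalars iS.toRingHom).mapDerivedCategory.obj R)) :
    HasFiniteInjectiveDimension
      ((ModuleCat.restrictScalars iS').mapDerivedCategory.obj R') := by
  obtain ⟨n, hn⟩ := h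
  obtain ⟨e₁⟩ := nonempty_restrictScalars_iso iS.toRingHom e
  obtain ⟨e₂⟩ := nonempty_restrictScalars_iso iS' e'
  have h1 : ExtVanishing n (DerivedCategory.Q.obj ((resComplex iS.toRingHom).obj G)) :=
    ExtVanishing.of_iso hn e₁.symm
  obtain ⟨n', hn'⟩ := exists_baseExtVanishing (a := a) flat_resComplex h1 c
  exact ⟨n', (hn' S' σS).of_iso (DerivedCategory.Q.mapIso (bcResIso hS G) ≪≫ e₂)⟩

include hS e e' a b in
theorem finite_homology_restrictScalars_bc [G.IsStrictlyLE b] {D : ℕ} (hD : ringKrullDim z ≤ D)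
    [IsNoetherianRing S']
    (h : ∀ n, Module.Finite S ((ModuleCat.restrictScalars iS.toRingHom).obj
      ((DerivedCategory.homologyFunctor _ n).obj R))) (n : ℤ) :
    Module.Finite S' ((ModuleCat.restrictScalars iS').obj
      ((DerivedCategory.homologyFunctor _ n).obj R')) := by
  have h1 := flat_resComplex (iS := iS) (G := G)
  have h2 := finite_homology_bc σS hD ((resComplex iS.toRingHom).obj G) (a := a) (b := b)
    (fun i => finite_of_iso
      (nonempty_homology_restrictScalars_iso iS.toRingHom e i).some.symm (h i)) n
  exact finite_of_iso ((DerivedCategory.homologyFunctor _ n).mapIso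
    (DerivedCategory.Q.mapIso (bcResIso hS G)) ≪≫
      (nonempty_homology_restrictScalars_iso iS' e' n).some) h2

end OneSided

section Dualizing

attribute [local instance 50] baseModule baseModule_isScalarTower tensorModule

variable {z z' : Type u} [CommRing z] [IsRegularRing z] [CommRing z'] [IsRegularRing z']
  [Algebra z z'] [Algebra.FiniteType z z'] {A : Type u} [Ring A] [Algebra z A] [Module.Flat z A]
  [IsNoetherianRing A] [IsNoetherianRing Aᵐᵒᵖ] {D : ℕ} (hD : ringKrullDim z ≤ D)

instance flat_op : Module.Flat z Aᵐᵒᵖ :=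
  Module.Flat.of_linearEquiv (MulOpposite.opLinearEquiv z).symm

include hD in
/-- The base change of a dualizing complex is a dualizing complex. -/
theorem IsDualizing.bc {G : CochainComplex (ModuleCat.{u} (Env z A)) ℤ} {a b : ℤ}
    [G.IsStrictlyGE a] [G.IsStrictlyLE b] [hG : ∀ i, Module.Flat z (G.X i)]
    {R : DerivedCategory (ModuleCat.{u} (Env z A))}
    {R' : DerivedCategory (ModuleCat.{u} (Env z' (BaseChange z z' A)))}
    (e : DerivedCategory.Q.obj G ≅ R)
    (e' : DerivedCategory.Q.obj ((bcComplex (envEquiv z z' A)).obj G) ≅ R')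
    (h : IsDualizing z A R) : IsDualizing z' (BaseChange z z' A) R' := by
  have hS : ∀ (s : z') (x : A), (Algebra.TensorProduct.includeLeft :
      BaseChange z z' A →ₐ[z'] Env z' (BaseChange z z' A)).toRingHom
        ((RingEquiv.refl (z' ⊗[z] A)).symm (s ⊗ₜ x)) =
      (envEquiv z z' A).symm (s ⊗ₜ (Algebra.TensorProduct.includeLeft : A →ₐ[z] Env z A) x) :=
    fun s x => (envEquiv_symm_tmul z z' A s x 1).symm
  have hB : ∀ (s : z') (x : Aᵐᵒᵖ), (Algebra.TensorProduct.includeRight :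
      (BaseChange z z' A)ᵐᵒᵖ →ₐ[z'] Env z' (BaseChange z z' A)).toRingHom
        ((opBaseChange z z' A).symm (s ⊗ₜ x)) =
      (envEquiv z z' A).symm (s ⊗ₜ (Algebra.TensorProduct.includeRight : Aᵐᵒᵖ →ₐ[z] Env z A) x) :=
    fun s x => by
      have h1 : (opBaseChange z z' A).symm (s ⊗ₜ x) = MulOpposite.op (s ⊗ₜ x.unop) := by
        rw [RingEquiv.symm_apply_eq, opBaseChange_op_tmul, MulOpposite.op_unop]
      rw [h1, Algebra.TensorProduct.includeRight_apply, envEquiv_symm_tmul]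
      change (1 ⊗ₜ[z'] MulOpposite.op (s ⊗ₜ x.unop) : Env z' (BaseChange z z' A)) = _
      have h2 : ∀ (r : z') (x : A), (r ⊗ₜ x : BaseChange z z' A) = r • (1 ⊗ₜ x) :=
        fun r x => by rw [TensorProduct.smul_tmul', smul_eq_mul, mul_one]
      rw [h2 s x.unop, h2 s 1, MulOpposite.op_smul, TensorProduct.tmul_smul,
        ← TensorProduct.smul_tmul']
      rfl
  have hA' : IsNoetherianRing (BaseChange z z' A) := isNoetherianRing_tensor_of_finiteType z A z'
  have hop : IsNoetherianRing (z' ⊗[z] Aᵐᵒᵖ) := isNoetherianRing_tensor_of_finiteType z Aᵐᵒᵖ z'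
  have hA'' : IsNoetherianRing (BaseChange z z' A)ᵐᵒᵖ :=
    isNoetherianRing_of_ringEquiv _ (opBaseChange z z' A).symm
  have hl := (hasDerivedEnd_left_iff e).2 ⟨h.ext_left, h.end_left⟩
  have hr := (hasDerivedEnd_right_iff e).2 ⟨h.ext_right, h.end_right⟩
  have hl' := (hasDerivedEnd_left_iff e').1 (HasDerivedEnd.bc hS hB _ _ hD G (a := a) (b := b)
    (fun i => finite_of_iso (nonempty_homology_restrictScalars_iso _ e i).some.symm
      (h.finite_left i)) hl)
  have hr' := (hasDerivedEnd_right_iff e').1 (HasDerivedEnd.bc hB hS _ _ hD G (a := a) (b := b)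
    (fun i => finite_of_iso (nonempty_homology_restrictScalars_iso _ e i).some.symm
      (h.finite_right i)) hr)
  exact {
    bounded := ⟨a, b, DerivedCategory.TStructure.t.isGE_of_iso e' a,
      DerivedCategory.TStructure.t.isLE_of_iso e' b⟩
    injective_left := hasFiniteInjectiveDimension_bc hS (a := a) e e' h.injective_left
    injective_right := hasFiniteInjectiveDimension_bc hB (a := a) e e' h.injective_right
    finite_left := finite_homology_restrictScalars_bc hS (a := a) (b := b) e e' hD h.finite_left
    finite_right := finite_homology_restrictScalars_bc hB (a := a) (b := b) e e' hD h.finite_right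
    end_left := hl'.2
    ext_left := hl'.1
    end_right := hr'.2
    ext_right := hr'.1 }

end Dualizing

/-! ### Total complexes of bounded above double complexes -/

section Columns

variable {U : Type u} [Ring U]

/-- The description of a complex `T` as the total complex of a double complex with columns `C i`:
the module in degree `n` is the direct sum of the `(C i).X (n - i)`, and the differential is the sum
of that of the columns, up to the signs `ε i`, and of a part that goes from each column to the
next one. -/
structure ColumnDecomposition (T : CochainComplex (ModuleCat.{u} U) ℤ)
    (C : ℤ → CochainComplex (ModuleCat.{u} U) ℤ) where
  /-- the inclusion of a summand -/
  ι (i n : ℤ) : (C i).X (n - i) →+ T.X n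
  /-- the projection to a summand -/
  π (i n : ℤ) : T.X n →+ (C i).X (n - i)
  /-- the signs in the differential -/
  ε : ℤ → ℤ
  ε_mul_ε (i : ℤ) : ε i * ε i = 1
  π_ι_self (i n : ℤ) (a : (C i).X (n - i)) : π i n (ι i n a) = a
  π_ι_of_ne (i i' n : ℤ) (h : i' ≠ i) (a : (C i').X (n - i')) : π i n (ι i' n a) = 0
  closure_eq_top (n : ℤ) : AddSubgroup.closure {x : T.X n | ∃ i a, ι i n a = x} = ⊤
  d_ι (i n : ℤ) (a : (C i).X (n - i)) : ∃ b, (T.d n (n + 1)).hom (ι i n a) =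
    ε i • ι i (n + 1) (((C i).d (n - i) (n + 1 - i)).hom a) + ι (i + 1) (n + 1) b

namespace ColumnDecomposition

variable {T T' : CochainComplex (ModuleCat.{u} U) ℤ}
    {C C' : ℤ → CochainComplex (ModuleCat.{u} U) ℤ} (δ : ColumnDecomposition T C)
    (δ' : ColumnDecomposition T' C')

/-- The elements of a total complex that are supported in the columns from the `m`-th on. -/
def fil (m n : ℤ) : AddSubgroup (T.X n) := AddSubgroup.closure {x | ∃ i, m ≤ i ∧ ∃ a, δ.ι i n a = x}

theorem ι_mem_fil {m i : ℤ} (n : ℤ) (h : m ≤ i) (a : (C i).X (n - i)) : δ.ι i n a ∈ δ.fil m n :=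
  AddSubgroup.subset_closure ⟨i, h, a, rfl⟩

theorem fil_anti {m m' : ℤ} (n : ℤ) (h : m ≤ m') : δ.fil m' n ≤ δ.fil m n :=
  AddSubgroup.closure_mono fun _ ⟨i, hi, a, ha⟩ => ⟨i, h.trans hi, a, ha⟩

theorem d_mem_fil {m n : ℤ} {x : T.X n} (hx : x ∈ δ.fil m n) :
    (T.d n (n + 1)).hom x ∈ δ.fil m (n + 1) := by
  induction hx using AddSubgroup.closure_induction with
  | mem x hx =>
    obtain ⟨i, hi, a, rfl⟩ := hx
    obtain ⟨b, hb⟩ := δ.d_ι i n a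
    rw [hb]
    exact add_mem (zsmul_mem (δ.ι_mem_fil _ hi _) _) (δ.ι_mem_fil _ (by omega) _)
  | zero => rw [map_zero]; exact zero_mem _
  | add x y _ _ hx hy => rw [map_add]; exact add_mem hx hy
  | neg x _ hx => rw [map_neg]; exact neg_mem hx

theorem π_of_mem_fil {m n : ℤ} {x : T.X n} (hx : x ∈ δ.fil (m + 1) n) : δ.π m n x = 0 := by
  induction hx using AddSubgroup.closure_induction with
  | mem x hx =>
    obtain ⟨i, hi, a, rfl⟩ := hx
    exact δ.π_ι_of_ne _ _ _ (by omega) _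
  | zero => rw [map_zero]
  | add x y _ _ hx hy => rw [map_add, hx, hy, add_zero]
  | neg x _ hx => rw [map_neg, hx, neg_zero]

theorem exists_eq_ι_add {m n : ℤ} {x : T.X n} (hx : x ∈ δ.fil m n) :
    ∃ a, ∃ y ∈ δ.fil (m + 1) n, x = δ.ι m n a + y := by
  induction hx using AddSubgroup.closure_induction with
  | mem x hx =>
    obtain ⟨i, hi, a, rfl⟩ := hx
    obtain rfl | hi := hi.eq_or_lt
    · exact ⟨a, 0, zero_mem _, (add_zero _).symm⟩
    · exact ⟨0, _, δ.ι_mem_fil n hi a, by rw [map_zero, zero_add]⟩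
  | zero => exact ⟨0, 0, zero_mem _, by rw [map_zero, zero_add]⟩
  | add x y _ _ hx hy =>
    obtain ⟨a, x', hx', rfl⟩ := hx
    obtain ⟨b, y', hy', rfl⟩ := hy
    exact ⟨a + b, _, add_mem hx' hy', by rw [map_add]; abel⟩
  | neg x _ hx =>
    obtain ⟨a, x', hx', rfl⟩ := hx
    exact ⟨-a, _, neg_mem hx', by rw [map_neg]; abel⟩

theorem exists_d_ι_eq (m n : ℤ) (a : (C m).X (n - m)) : ∃ y ∈ δ.fil (m + 1) (n + 1),
    (T.d n (n + 1)).hom (δ.ι m n a) =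
      δ.ι m (n + 1) (δ.ε m • ((C m).d (n - m) (n + 1 - m)).hom a) + y := by
  obtain ⟨b, hb⟩ := δ.d_ι m n a
  exact ⟨_, δ.ι_mem_fil _ le_rfl b, by rw [hb, map_zsmul]⟩

theorem π_ι_add {m n : ℤ} (a : (C m).X (n - m)) {x : T.X n} (hx : x ∈ δ.fil (m + 1) n) :
    δ.π m n (δ.ι m n a + x) = a := by
  rw [map_add, π_ι_self, π_of_mem_fil _ hx, add_zero]

theorem mem_fil {b n : ℤ} (hC : ∀ i, (C i).IsStrictlyLE b) (x : T.X n) : x ∈ δ.fil (n - b) n := by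
  have hx : x ∈ AddSubgroup.closure {x : T.X n | ∃ i a, δ.ι i n a = x} :=
    δ.closure_eq_top n ▸ AddSubgroup.mem_top x
  refine AddSubgroup.closure_le _ |>.2 ?_ hx
  rintro _ ⟨i, a, rfl⟩
  by_cases hi : n - b ≤ i
  · exact δ.ι_mem_fil n hi a
  · have := hC i
    have := ModuleCat.subsingleton_of_isZero ((C i).isZero_of_isStrictlyLE b (n - i) (by omega))
    rw [Subsingleton.elim a 0, map_zero]
    exact zero_mem _

theorem eq_zero_of_mem_fil {b m n : ℤ} (hC : ∀ i, b < i → ∀ j, Limits.IsZero ((C i).X j))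
    (hm : b < m) {x : T.X n} (hx : x ∈ δ.fil m n) : x = 0 := by
  rw [← AddSubgroup.mem_bot]
  refine AddSubgroup.closure_le _ |>.2 ?_ hx
  rintro _ ⟨i, hi, a, rfl⟩
  have := ModuleCat.subsingleton_of_isZero (hC i (by omega) (n - i))
  rw [Subsingleton.elim a 0, map_zero]
  exact zero_mem _

variable {δ δ'} {Φ : T ⟶ T'} {φ : ∀ i, C i ⟶ C' i}
  (hΦ : ∀ i n a, (Φ.f n).hom (δ.ι i n a) = δ'.ι i n (((φ i).f (n - i)).hom a))
  (hε : ∀ i, δ.ε i = δ'.ε i)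

include hΦ in
theorem map_mem_fil {m n : ℤ} {x : T.X n} (hx : x ∈ δ.fil m n) : (Φ.f n).hom x ∈ δ'.fil m n := by
  induction hx using AddSubgroup.closure_induction with
  | mem x hx =>
    obtain ⟨i, hi, a, rfl⟩ := hx
    rw [hΦ]
    exact δ'.ι_mem_fil _ hi _
  | zero => rw [map_zero]; exact zero_mem _
  | add x y _ _ hx hy => rw [map_add]; exact add_mem hx hy
  | neg x _ hx => rw [map_neg]; exact neg_mem hx

include hΦ hε in
/-- The acyclicity of the cone of `Φ`, shown one column after the other. -/
theorem exists_boundary {b : ℤ} (hφ : ∀ i, QuasiIso (φ i))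
    (hC : ∀ i, b < i → ∀ j, Limits.IsZero ((C i).X j))
    (hC' : ∀ i, b < i → ∀ j, Limits.IsZero ((C' i).X j)) (k : ℕ) : ∀ (l m n : ℤ), l + 1 = n →
      b < m + k → ∀ (x : T.X (n + 1)) (y : T'.X n), x ∈ δ.fil m (n + 1) → y ∈ δ'.fil m n →
      (T.d (n + 1) (n + 1 + 1)).hom x = 0 → (Φ.f (n + 1)).hom x = (T'.d n (n + 1)).hom y →
      ∃ (u : T.X n) (v : T'.X l), x = (T.d n (n + 1)).hom u ∧
        y = (Φ.f n).hom u + (T'.d l n).hom v := by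
  induction k with
  | zero =>
    intro l m n _ hm x y hx hy _ _
    refine ⟨0, 0, ?_, ?_⟩
    · rw [δ.eq_zero_of_mem_fil hC (by simpa using hm) hx, map_zero]
    · rw [δ'.eq_zero_of_mem_fil hC' (by simpa using hm) hy, map_zero, map_zero, add_zero]
  | succ k ih =>
    rintro l m _ rfl hm x y hx hy hdx hxy
    obtain ⟨a, x₁, hx₁, rfl⟩ := δ.exists_eq_ι_add hx
    obtain ⟨c, y₁, hy₁, rfl⟩ := δ'.exists_eq_ι_add hy
    obtain ⟨q₁, q₂⟩ := (quasiIso_iff_elements _).1 (hφ m)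
    have hε' := δ'.ε_mul_ε m
    have ha : ((C m).d (l + 1 + 1 - m) (l + 1 + 1 + 1 - m)).hom a = 0 := by
      obtain ⟨w, hw, hdw⟩ := δ.exists_d_ι_eq m _ a
      have h1 := δ.π_ι_add (δ.ε m • ((C m).d (l + 1 + 1 - m) (l + 1 + 1 + 1 - m)).hom a)
        (add_mem hw (δ.d_mem_fil hx₁))
      rw [← add_assoc (δ.ι m _ _) w, ← hdw, ← map_add, hdx, map_zero] at h1
      generalize ((C m).d (l + 1 + 1 - m) (l + 1 + 1 + 1 - m)).hom a = t at h1 ⊢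
      have h2 : (δ.ε m * δ.ε m) • t = t := by rw [δ.ε_mul_ε, one_smul]
      rw [← h2, mul_smul, ← h1, smul_zero]
    have hac : ((φ m).f _).hom a = δ'.ε m • ((C' m).d (l + 1 - m) (l + 1 + 1 - m)).hom c := by
      obtain ⟨w, hw, hdw⟩ := δ'.exists_d_ι_eq m _ c
      have h1 := δ'.π_ι_add (δ'.ε m • ((C' m).d (l + 1 - m) (l + 1 + 1 - m)).hom c)
        (add_mem hw (δ'.d_mem_fil hy₁))
      rw [← add_assoc (δ'.ι m _ _) w, ← hdw, ← map_add, ← hxy, map_add, hΦ,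
        δ'.π_ι_add _ (map_mem_fil hΦ hx₁)] at h1
      exact h1
    -- the leading terms `a`, `c` form a cocycle in the cone of `φ m`, which is acyclic;
    -- once they are removed, the remaining terms lie in the columns from `m + 1` on
    obtain ⟨u₀, hu₀⟩ := q₂ (l + 1 - m) (l + 1 + 1 - m) (l + 1 + 1 + 1 - m)
      (by omega) (by omega) a ha
      (δ'.ε m • c) (by rw [hac, map_zsmul])
    obtain ⟨u₁, w, hu₁, hw⟩ := q₁ (l - m) (l + 1 - m) (l + 1 + 1 - m) (by omega) (by omega)
      (c - δ'.ε m • ((φ m).f _).hom u₀) (by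
        rw [map_sub, map_zsmul, ← comm_apply, ← hu₀, hac, smul_smul, hε', one_smul, sub_self])
    obtain ⟨x₂, hx₂, hdx₂⟩ := δ.exists_d_ι_eq m (l + 1) (δ.ε m • u₀ + u₁)
    obtain ⟨y₂, hy₂, hdy₂⟩ := δ'.exists_d_ι_eq m l (δ'.ε m • w)
    have hd1 : (T.d (l + 1) (l + 1 + 1)).hom (δ.ι m (l + 1) (δ.ε m • u₀ + u₁)) =
        δ.ι m (l + 1 + 1) a + x₂ := by
      have h1 : δ.ε m • ((C m).d (l + 1 - m) (l + 1 + 1 - m)).hom (δ.ε m • u₀ + u₁) = a := by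
        rw [map_add, map_zsmul, hu₁, add_zero, smul_smul, δ.ε_mul_ε, one_smul, ← hu₀]
      rw [hdx₂, h1]
    have hd2 : (Φ.f (l + 1)).hom (δ.ι m (l + 1) (δ.ε m • u₀ + u₁)) +
        (T'.d l (l + 1)).hom (δ'.ι m l (δ'.ε m • w)) = δ'.ι m (l + 1) c + y₂ := by
      have h1 : ((φ m).f _).hom (δ.ε m • u₀ + u₁) +
          δ'.ε m • ((C' m).d (l - m) (l + 1 - m)).hom (δ'.ε m • w) = c := by
        rw [map_zsmul, smul_smul, hε', one_smul, map_add, map_zsmul,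
          hε, add_assoc (δ'.ε m • ((φ m).f _).hom u₀), ← hw, add_sub_cancel]
      rw [hΦ, hdy₂, ← add_assoc (δ'.ι m _ _), ← map_add, h1]
    generalize δ.ι m (l + 1) (δ.ε m • u₀ + u₁) = U₁ at hd1 hd2
    generalize δ'.ι m l (δ'.ε m • w) = V₁ at hd2
    obtain ⟨u, v, hu, hv⟩ := ih l (m + 1) (l + 1) rfl (by push_cast at hm; omega)
      (x₁ - x₂) (y₁ - y₂)
      (sub_mem hx₁ hx₂) (sub_mem hy₁ hy₂) (by
        have h1 := d_d_apply T (l + 1) (l + 1 + 1) (l + 1 + 1 + 1)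
          U₁
        rw [hd1] at h1
        have h2 : x₁ - x₂ = (δ.ι m (l + 1 + 1) a + x₁) - (δ.ι m (l + 1 + 1) a + x₂) := by abel
        rw [h2, map_sub, hdx, h1, sub_self]) (by
        have h1 : (Φ.f (l + 1 + 1)).hom (δ.ι m (l + 1 + 1) a + x₂) =
            (T'.d (l + 1) (l + 1 + 1)).hom (δ'.ι m (l + 1) c + y₂) := by
          rw [← hd1, ← hd2, map_add, d_d_apply, add_zero, comm_apply]
        have h2 : x₁ - x₂ = (δ.ι m (l + 1 + 1) a + x₁) - (δ.ι m (l + 1 + 1) a + x₂) := by abel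
        have h3 : y₁ - y₂ = (δ'.ι m (l + 1) c + y₁) - (δ'.ι m (l + 1) c + y₂) := by abel
        rw [h2, h3, map_sub, map_sub, h1, hxy])
    refine ⟨U₁ + u, V₁ + v, ?_, ?_⟩
    · rw [map_add, hd1, ← hu]
      abel
    · rw [map_add, map_add, add_add_add_comm, hd2, ← hv]
      abel

include hΦ hε in
/-- A morphism of bounded above double complexes that is a quasi-isomorphism on all columns is a
quasi-isomorphism on total complexes. -/
theorem quasiIso {b b' : ℤ} (hφ : ∀ i, QuasiIso (φ i)) (hC₁ : ∀ i, (C i).IsStrictlyLE b')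
    (hC₁' : ∀ i, (C' i).IsStrictlyLE b')
    (hC : ∀ i, b < i → ∀ j, Limits.IsZero ((C i).X j))
    (hC' : ∀ i, b < i → ∀ j, Limits.IsZero ((C' i).X j)) : QuasiIso Φ := by
  rw [quasiIso_iff_elements]
  have key : ∀ (l n : ℤ), l + 1 = n → ∀ (x : T.X (n + 1)) (y : T'.X n),
      (T.d (n + 1) (n + 1 + 1)).hom x = 0 → (Φ.f (n + 1)).hom x = (T'.d n (n + 1)).hom y →
      ∃ (u : T.X n) (v : T'.X l), x = (T.d n (n + 1)).hom u ∧
        y = (Φ.f n).hom u + (T'.d l n).hom v := fun l n hl x y h1 h2 =>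
    exists_boundary hΦ hε hφ hC hC' (b - (n - b') + 1).toNat l (n - b') n hl (by omega) x y
      (δ.fil_anti _ (by omega) (δ.mem_fil hC₁ x)) (δ'.mem_fil hC₁' y) h1 h2
  constructor
  · rintro l n _ hl rfl y hy
    obtain ⟨u, v, hu, hv⟩ := key l n hl 0 y (map_zero _) (by rw [map_zero, hy])
    exact ⟨u, v, hu.symm, hv⟩
  · rintro l _ _ rfl rfl x hx w hw
    obtain ⟨u, v, hu, hv⟩ := key (l - 1) l (by omega) x w hx hw
    exact ⟨u, hu⟩

end ColumnDecomposition

end Columns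

section MapBifunctor

open HomologicalComplex

variable {S T U : Type u} [Ring S] [Ring T] [Ring U]
  (F : ModuleCat.{u} S ⥤ ModuleCat.{u} T ⥤ ModuleCat.{u} U) [F.Additive] [∀ X, (F.obj X).Additive]
  (K : CochainComplex (ModuleCat.{u} S) ℤ) (L : CochainComplex (ModuleCat.{u} T) ℤ)

/-- The inclusion of a summand of a total complex. -/
noncomputable def totalι (i j n : ℤ) (h : i + j = n) :
    (F.obj (K.X i)).obj (L.X j) ⟶ (CochainComplex.mapBifunctor K L F).X n :=
  ιMapBifunctor K L F (ComplexShape.up ℤ) i j n h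

variable {F K L} in
theorem total_hom_ext {n : ℤ} {Y : ModuleCat.{u} U}
    {f g : (CochainComplex.mapBifunctor K L F).X n ⟶ Y}
    (h : ∀ i j h, totalι F K L i j n h ≫ f = totalι F K L i j n h ≫ g) : f = g :=
  mapBifunctor.hom_ext h

variable {F K L} in
theorem exists_totalDesc {n : ℤ} {Y : ModuleCat.{u} U}
    (f : ∀ i j (_ : i + j = n), (F.obj (K.X i)).obj (L.X j) ⟶ Y) :
    ∃ g : (CochainComplex.mapBifunctor K L F).X n ⟶ Y,
      ∀ i j h, totalι F K L i j n h ≫ g = f i j h :=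
  ⟨mapBifunctorDesc f, fun i j h =>
    ι_mapBifunctorDesc (K₁ := K) (K₂ := L) (F := F) (c := ComplexShape.up ℤ) f i j h⟩

/-- The differential of a total complex on a summand, with the sign `(-1)^i` on the second part. -/
theorem totalι_d (i j n : ℤ) (h : i + j = n) :
    totalι F K L i j n h ≫ (CochainComplex.mapBifunctor K L F).d n (n + 1) =
      (F.map (K.d i (i + 1))).app (L.X j) ≫ totalι F K L (i + 1) j (n + 1) (by omega) +
      i.negOnePow • ((F.obj (K.X i)).map (L.d j (j + 1)) ≫
        totalι F K L i (j + 1) (n + 1) (by omega)) := by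
  have h1 : totalι F K L i j n h ≫ mapBifunctor.D₁ K L F (ComplexShape.up ℤ) n (n + 1) = _ :=
    (mapBifunctor.ι_D₁ K L F (ComplexShape.up ℤ) n (n + 1) i j h).trans
    (mapBifunctor.d₁_eq K L F (ComplexShape.up ℤ) (i₁ := i) (i₁' := i + 1) rfl j (n + 1)
      (by change i + 1 + j = n + 1; omega))
  have h2 : totalι F K L i j n h ≫ mapBifunctor.D₂ K L F (ComplexShape.up ℤ) n (n + 1) = _ :=
    (mapBifunctor.ι_D₂ K L F (ComplexShape.up ℤ) n (n + 1) i j h).trans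
    (mapBifunctor.d₂_eq K L F (ComplexShape.up ℤ) i (i₂ := j) (i₂' := j + 1) rfl (n + 1)
      (by change i + (j + 1) = n + 1; omega))
  rw [mapBifunctor.d_eq, Preadditive.comp_add, h1, h2]
  congr 1
  exact one_smul _ _

variable {K L} in
theorem totalι_map {K' : CochainComplex (ModuleCat.{u} S) ℤ}
    {L' : CochainComplex (ModuleCat.{u} T) ℤ} (f : K ⟶ K') (g : L ⟶ L') (i j n : ℤ)
    (h : i + j = n) :
    totalι F K L i j n h ≫ (mapBifunctorMap f g F (ComplexShape.up ℤ)).f n =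
      (F.map (f.f i)).app (L.X j) ≫ (F.obj (K'.X i)).map (g.f j) ≫ totalι F K' L' i j n h :=
  ι_mapBifunctorMap _ _ _ _ _ _ _ _

/-- A total complex is generated, as a group, by the images of its summands. -/
theorem closure_totalι (n : ℤ) : AddSubgroup.closure {x : (CochainComplex.mapBifunctor K L F).X n |
    ∃ i j h a, (totalι F K L i j n h).hom a = x} = ⊤ := by
  set s := {x : (CochainComplex.mapBifunctor K L F).X n |
    ∃ i j h a, (totalι F K L i j n h).hom a = x} with hs
  have h1 : ModuleCat.ofHom (Submodule.span U s).mkQ = 0 := total_hom_ext fun i j h =>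
    ModuleCat.hom_ext (LinearMap.ext fun a => by
      change (Submodule.span U s).mkQ ((totalι F K L i j n h).hom a) = 0
      rw [Submodule.mkQ_apply, Submodule.Quotient.mk_eq_zero]
      exact Submodule.subset_span ⟨i, j, h, a, rfl⟩)
  rw [eq_top_iff]
  rintro x -
  have hx : x ∈ Submodule.span U s := by
    rw [← Submodule.Quotient.mk_eq_zero]
    exact congrArg (fun f => f.hom x) h1
  induction hx using Submodule.span_induction with
  | mem x hx => exact AddSubgroup.subset_closure hx
  | zero => exact zero_mem _
  | add x y _ _ hx hy => exact add_mem hx hy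
  | smul r x h0 hx =>
    clear h0
    induction hx using AddSubgroup.closure_induction with
    | mem x hx =>
      obtain ⟨i, j, h, a, rfl⟩ := hx
      rw [← map_smul]
      exact AddSubgroup.subset_closure ⟨i, j, h, _, rfl⟩
    | zero => rw [smul_zero]; exact zero_mem _
    | add x y _ _ hx hy => rw [smul_add]; exact add_mem hx hy
    | neg x _ hx => rw [smul_neg]; exact neg_mem hx

/-- The projection to a summand of a total complex. -/
theorem exists_totalπ (i j n : ℤ) (h : i + j = n) :
    ∃ p : (CochainComplex.mapBifunctor K L F).X n ⟶ (F.obj (K.X i)).obj (L.X j),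
      totalι F K L i j n h ≫ p = 𝟙 _ ∧
      ∀ i' j' h', i' ≠ i → totalι F K L i' j' n h' ≫ p = 0 := by
  obtain ⟨p, hp⟩ := exists_totalDesc (F := F) (K := K) (L := L) (n := n)
    (Y := (F.obj (K.X i)).obj (L.X j)) fun i' j' h' =>
      if e : i' = i then eqToHom (by subst e; congr; omega) else 0
  refine ⟨p, ?_, fun i' j' h' e => ?_⟩
  · rw [hp, dif_pos rfl, eqToHom_refl]
  · rw [hp, dif_neg e]

/-- The decomposition of the total complex of `F K L` into the complexes `F (K.X i) L`. -/
noncomputable def columnsRight : ColumnDecomposition (CochainComplex.mapBifunctor K L F)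
    (fun i => ((F.obj (K.X i)).mapHomologicalComplex (ComplexShape.up ℤ)).obj L) where
  ι i n := (totalι F K L i (n - i) n (by omega)).hom.toAddMonoidHom
  π i n := (exists_totalπ F K L i (n - i) n (by omega)).choose.hom.toAddMonoidHom
  ε i := i.negOnePow
  ε_mul_ε i := by rw [← Units.val_mul, Int.units_mul_self, Units.val_one]
  π_ι_self i n a := congrArg (fun f => f.hom a)
    (exists_totalπ F K L i (n - i) n (by omega)).choose_spec.1
  π_ι_of_ne i i' n h a := congrArg (fun f => f.hom a)
    ((exists_totalπ F K L i (n - i) n (by omega)).choose_spec.2 i' (n - i') (by omega) h)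
  closure_eq_top n := by
    rw [← closure_totalι]
    congr 1
    ext x
    constructor
    · rintro ⟨i, a, rfl⟩
      exact ⟨i, _, _, a, rfl⟩
    · rintro ⟨i, j, h, a, rfl⟩
      obtain rfl : j = n - i := by omega
      exact ⟨i, a, rfl⟩
  d_ι i n a := by
    have h1 := congrArg (fun f => f.hom a) (totalι_d F K L i (n - i) n (by omega))
    have h2 : ∀ j (h : i + 1 + j = n + 1) (b : (F.obj (K.X (i + 1))).obj (L.X j)),
      ∃ b', (totalι F K L (i + 1) j (n + 1) h).hom b =
        (totalι F K L (i + 1) (n + 1 - (i + 1)) (n + 1) (by omega)).hom b' := fun j h b => by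
        obtain rfl : j = n + 1 - (i + 1) := by omega
        exact ⟨b, rfl⟩
    obtain ⟨b, hb⟩ := h2 (n - i) (by omega) (((F.map (K.d i (i + 1))).app (L.X (n - i))).hom a)
    refine ⟨b, h1.trans ((add_comm _ _).trans (congrArg₂ _ ?_ hb))⟩
    have h3 : ∀ j (h : i + j = n + 1), n - i + 1 = j →
        ((i.negOnePow • ((F.obj (K.X i)).map (L.d (n - i) (n - i + 1)) ≫
          totalι F K L i (n - i + 1) (n + 1) (by omega))).hom a) =
        (i.negOnePow : ℤ) • (totalι F K L i j (n + 1) h).hom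
          (((F.obj (K.X i)).map (L.d (n - i) j)).hom a) := by
      rintro j h rfl
      rfl
    exact h3 (n + 1 - i) (by omega) (by omega)

/-- The decomposition of the total complex of `F K L` into the complexes `F K (L.X j)`. -/
noncomputable def columnsLeft [∀ X, (F.flip.obj X).Additive] :
    ColumnDecomposition (CochainComplex.mapBifunctor K L F)
    (fun j => ((F.flip.obj (L.X j)).mapHomologicalComplex (ComplexShape.up ℤ)).obj K) where
  ι j n := (totalι F K L (n - j) j n (by omega)).hom.toAddMonoidHom
  π j n := (exists_totalπ F K L (n - j) j n (by omega)).choose.hom.toAddMonoidHom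
  ε i := 1
  ε_mul_ε i := one_mul 1
  π_ι_self j n a := congrArg (fun f => f.hom a)
    (exists_totalπ F K L (n - j) j n (by omega)).choose_spec.1
  π_ι_of_ne j j' n h a := congrArg (fun f => f.hom a)
    ((exists_totalπ F K L (n - j) j n (by omega)).choose_spec.2 (n - j') j' (by omega) (by omega))
  closure_eq_top n := by
    rw [← closure_totalι]
    congr 1
    ext x
    constructor
    · rintro ⟨i, a, rfl⟩
      exact ⟨_, i, _, a, rfl⟩
    · rintro ⟨i, j, h, a, rfl⟩
      obtain rfl : i = n - j := by omega
      exact ⟨j, a, rfl⟩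
  d_ι j n a := by
    have h1 := congrArg (fun f => f.hom a) (totalι_d F K L (n - j) j n (by omega))
    have h2 : ∀ i (h : i + (j + 1) = n + 1) (b : (F.obj (K.X i)).obj (L.X (j + 1))),
      ∃ b', (totalι F K L i (j + 1) (n + 1) h).hom b =
        (totalι F K L (n + 1 - (j + 1)) (j + 1) (n + 1) (by omega)).hom b' := fun i h b => by
        obtain rfl : i = n + 1 - (j + 1) := by omega
        exact ⟨b, rfl⟩
    obtain ⟨b, hb⟩ := h2 (n - j) (by omega)
      ((n - j).negOnePow • ((F.obj (K.X (n - j))).map (L.d j (j + 1))).hom a)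
    refine ⟨b, h1.trans (congrArg₂ _ ?_ ((map_zsmul (totalι F K L (n - j) (j + 1) (n + 1) _).hom
      ((n - j).negOnePow : ℤ) _).symm.trans hb))⟩
    have h3 : ∀ i (h : i + j = n + 1), n - j + 1 = i →
        (((F.map (K.d (n - j) (n - j + 1))).app (L.X j) ≫
          totalι F K L (n - j + 1) j (n + 1) (by omega)).hom a) =
        (totalι F K L i j (n + 1) h).hom
          (((F.map (K.d (n - j) i)).app (L.X j)).hom a) := by
      rintro i h rfl
      rfl
    exact (h3 (n + 1 - j) (by omega) (by omega)).trans (one_smul ℤ _).symm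

variable {F K L}

theorem quasiIso_mapBifunctorMap_right {L' : CochainComplex (ModuleCat.{u} T) ℤ} (g : L ⟶ L')
    {b b' : ℤ} [K.IsStrictlyLE b] [L.IsStrictlyLE b'] [L'.IsStrictlyLE b']
    (hg : ∀ i, QuasiIso (((F.obj (K.X i)).mapHomologicalComplex (ComplexShape.up ℤ)).map g)) :
    QuasiIso (mapBifunctorMap (𝟙 K) g F (ComplexShape.up ℤ)) := by
  have hz : ∀ (L : CochainComplex (ModuleCat.{u} T) ℤ) (i : ℤ), b < i → ∀ j, Limits.IsZero
      ((((F.obj (K.X i)).mapHomologicalComplex (ComplexShape.up ℤ)).obj L).X j) := fun L i hi j =>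
    Functor.map_isZero (F.flip.obj (L.X j)) (K.isZero_of_isStrictlyLE b i hi)
  refine ColumnDecomposition.quasiIso (δ := columnsRight F K L) (δ' := columnsRight F K L')
    (φ := fun i => ((F.obj (K.X i)).mapHomologicalComplex (ComplexShape.up ℤ)).map g)
    (fun i n a => ?_) (fun _ => rfl) (b := b) (b' := b') hg (fun i => inferInstance)
    (fun i => inferInstance) (hz L) (hz L')
  have h1 := totalι_map F (𝟙 K) g i (n - i) n (by omega)
  rw [HomologicalComplex.id_f, CategoryTheory.Functor.map_id, NatTrans.id_app,
    Category.id_comp] at h1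
  exact congrArg (fun f => f.hom a) h1

theorem quasiIso_mapBifunctorMap_left [∀ X, (F.flip.obj X).Additive]
    {K' : CochainComplex (ModuleCat.{u} S) ℤ} (g : K ⟶ K')
    {b b' : ℤ} [K.IsStrictlyLE b] [K'.IsStrictlyLE b] [L.IsStrictlyLE b']
    (hg : ∀ j, QuasiIso (((F.flip.obj (L.X j)).mapHomologicalComplex (ComplexShape.up ℤ)).map g)) :
    QuasiIso (mapBifunctorMap g (𝟙 L) F (ComplexShape.up ℤ)) := by
  have hz : ∀ (K : CochainComplex (ModuleCat.{u} S) ℤ) (i : ℤ), b' < i → ∀ j, Limits.IsZero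
      ((((F.flip.obj (L.X i)).mapHomologicalComplex (ComplexShape.up ℤ)).obj K).X j) :=
    fun K i hi j => Functor.map_isZero (F.obj (K.X j)) (L.isZero_of_isStrictlyLE b' i hi)
  refine ColumnDecomposition.quasiIso (δ := columnsLeft F K L) (δ' := columnsLeft F K' L)
    (φ := fun j => ((F.flip.obj (L.X j)).mapHomologicalComplex (ComplexShape.up ℤ)).map g)
    (fun j n a => ?_) (fun _ => rfl) (b := b') (b' := b) hg (fun i => inferInstance)
    (fun i => inferInstance) (hz K) (hz K')
  have h1 := totalι_map F g (𝟙 L) (n - j) j n (by omega)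
  rw [HomologicalComplex.id_f, CategoryTheory.Functor.map_id, Category.id_comp] at h1
  exact congrArg (fun f => f.hom a) h1

/-- Total complexes are compatible with homotopy equivalences. -/
theorem nonempty_homotopyEquiv_mapBifunctor [∀ X, (F.flip.obj X).Additive]
    {K' : CochainComplex (ModuleCat.{u} S) ℤ} {L' : CochainComplex (ModuleCat.{u} T) ℤ}
    (f : HomotopyEquiv K K') (g : HomotopyEquiv L L') :
    Nonempty (HomotopyEquiv (CochainComplex.mapBifunctor K L F)
      (CochainComplex.mapBifunctor K' L' F)) := by
  have hid : ∀ (K : CochainComplex (ModuleCat.{u} S) ℤ) (L : CochainComplex (ModuleCat.{u} T) ℤ),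
      mapBifunctorMap (𝟙 K) (𝟙 L) F (ComplexShape.up ℤ) = 𝟙 _ := fun K L =>
    HomologicalComplex.hom_ext _ _ fun n => total_hom_ext fun i j h => by
      rw [totalι_map]
      simp
  have hcomp : ∀ {K₁ K₂ K₃ : CochainComplex (ModuleCat.{u} S) ℤ}
      {L₁ L₂ L₃ : CochainComplex (ModuleCat.{u} T) ℤ} (f : K₁ ⟶ K₂) (f' : K₂ ⟶ K₃) (g : L₁ ⟶ L₂)
      (g' : L₂ ⟶ L₃), mapBifunctorMap f g F (ComplexShape.up ℤ) ≫
        mapBifunctorMap f' g' F (ComplexShape.up ℤ) =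
        mapBifunctorMap (f ≫ f') (g ≫ g') F (ComplexShape.up ℤ) := fun f f' g g' =>
    HomologicalComplex.hom_ext _ _ fun n => total_hom_ext fun i j h => by
      rw [HomologicalComplex.comp_f, ← Category.assoc, totalι_map, Category.assoc, Category.assoc,
        totalι_map, totalι_map]
      simp
  have hh : ∀ {K₁ : CochainComplex (ModuleCat.{u} S) ℤ}
      {L₁ : CochainComplex (ModuleCat.{u} T) ℤ} {f : K₁ ⟶ K₁} {g : L₁ ⟶ L₁}
      (_ : Homotopy f (𝟙 _)) (_ : Homotopy g (𝟙 _)),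
      Nonempty (Homotopy (mapBifunctorMap f g F (ComplexShape.up ℤ)) (𝟙 _)) :=
    fun {K₁ L₁ f g} h₁ h₂ => ⟨((mapBifunctorMapHomotopy₁ h₁ g F _).trans
      (mapBifunctorMapHomotopy₂ (𝟙 K₁) h₂ F _)).trans (Homotopy.ofEq (hid K₁ L₁))⟩
  refine ⟨{ hom := mapBifunctorMap f.hom g.hom F _
            inv := mapBifunctorMap f.inv g.inv F _
            homotopyHomInvId := ?_
            homotopyInvHomId := ?_ }⟩
  · exact (Homotopy.ofEq (hcomp _ _ _ _)).trans
      (hh f.homotopyHomInvId g.homotopyHomInvId).some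
  · exact (Homotopy.ofEq (hcomp _ _ _ _)).trans
      (hh f.homotopyInvHomId g.homotopyInvHomId).some

theorem isStrictlyGE_mapBifunctor {a a' : ℤ} [K.IsStrictlyGE a] [L.IsStrictlyGE a'] :
    (CochainComplex.mapBifunctor K L F).IsStrictlyGE (a + a') := by
  rw [CochainComplex.isStrictlyGE_iff]
  refine fun n hn => (Limits.IsZero.iff_id_eq_zero _).2 (total_hom_ext fun i j h => ?_)
  have hz : Limits.IsZero ((F.obj (K.X i)).obj (L.X j)) := by
    by_cases hi : i < a
    · exact Functor.map_isZero (F.flip.obj (L.X j)) (K.isZero_of_isStrictlyGE a i hi)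
    · exact Functor.map_isZero (F.obj (K.X i)) (L.isZero_of_isStrictlyGE a' j (by omega))
  exact hz.eq_of_src _ _

end MapBifunctor

/-! ### Tensor products of complexes and base change -/

section TensorComplex

attribute [local instance 50] baseModule baseModule_isScalarTower tensorModule

variable (z : Type u) [CommRing z] (S T : Type u) [Ring S] [Ring T] [Algebra z S] [Algebra z T]

instance tensorFunctor_flip_obj_additive (N : ModuleCat.{u} T) :
    ((tensorFunctor z S T).flip.obj N).Additive where
  map_add {_ _ f f'} := congrArg (fun τ => τ.app N)
    ((tensorFunctor z S T).map_add (f := f) (g := f'))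

/-- The tensor product over `z` of complexes of modules over the `z`-algebras `S` and `T`. -/
noncomputable abbrev tensorComplex (K : CochainComplex (ModuleCat.{u} S) ℤ)
    (L : CochainComplex (ModuleCat.{u} T) ℤ) : CochainComplex (ModuleCat.{u} (S ⊗[z] T)) ℤ :=
  CochainComplex.mapBifunctor K L (tensorFunctor z S T)

variable {z S T}

theorem tensorFunctor_obj_quasiIso (X : ModuleCat.{u} S) [Module.Flat z X]
    {K L : CochainComplex (ModuleCat.{u} T) ℤ} (f : K ⟶ L) [hf : QuasiIso f] :
    QuasiIso ((((tensorFunctor z S T).obj X).mapHomologicalComplex (ComplexShape.up ℤ)).map f) := by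
  rw [quasiIso_iff_acyclic_mappingCone] at hf ⊢
  refine acyclic_of_iso (CochainComplex.mappingCone.mapHomologicalComplexIso f _) fun j => ?_
  have h1 := (exactAt_iff_function_exact _ (j - 1) j (j + 1) (by omega) rfl).1 (hf j)
  rw [exactAt_iff_function_exact _ (j - 1) j (j + 1) (by omega) rfl]
  exact Module.Flat.lTensor_exact (M := X)
    (f := ((CochainComplex.mappingCone f).d (j - 1) j).hom.restrictScalars z)
    (g := ((CochainComplex.mappingCone f).d j (j + 1)).hom.restrictScalars z) h1

theorem tensorFunctor_flip_obj_quasiIso (Y : ModuleCat.{u} T) [Module.Flat z Y]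
    {K L : CochainComplex (ModuleCat.{u} S) ℤ} (f : K ⟶ L) [hf : QuasiIso f] :
    QuasiIso ((((tensorFunctor z S T).flip.obj Y).mapHomologicalComplex (ComplexShape.up ℤ)).map
      f) := by
  rw [quasiIso_iff_acyclic_mappingCone] at hf ⊢
  refine acyclic_of_iso (CochainComplex.mappingCone.mapHomologicalComplexIso f _) fun j => ?_
  have h1 := (exactAt_iff_function_exact _ (j - 1) j (j + 1) (by omega) rfl).1 (hf j)
  rw [exactAt_iff_function_exact _ (j - 1) j (j + 1) (by omega) rfl]
  exact Module.Flat.rTensor_exact (M := Y)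
    (f := ((CochainComplex.mappingCone f).d (j - 1) j).hom.restrictScalars z)
    (g := ((CochainComplex.mappingCone f).d j (j + 1)).hom.restrictScalars z) h1

/-- The tensor product of bounded above complexes of flat modules preserves quasi-isomorphisms. -/
theorem nonempty_tensorComplex_iso {K K' : CochainComplex (ModuleCat.{u} S) ℤ}
    {L L' : CochainComplex (ModuleCat.{u} T) ℤ} (f : K ⟶ K') [QuasiIso f] (g : L ⟶ L') [QuasiIso g]
    {b b' : ℤ} [K.IsStrictlyLE b] [K'.IsStrictlyLE b] [L.IsStrictlyLE b'] [L'.IsStrictlyLE b']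
    [∀ i, Module.Flat z (K.X i)] [∀ i, Module.Flat z (L'.X i)] :
    Nonempty (DerivedCategory.Q.obj (tensorComplex z S T K L) ≅
      DerivedCategory.Q.obj (tensorComplex z S T K' L')) := by
  have h1 := quasiIso_mapBifunctorMap_right (F := tensorFunctor z S T) (K := K) g
    (b := b) (b' := b')
    fun i => tensorFunctor_obj_quasiIso (K.X i) g
  have h2 := quasiIso_mapBifunctorMap_left (F := tensorFunctor z S T) (L := L') f
    (b := b) (b' := b')
    fun i => tensorFunctor_flip_obj_quasiIso (L'.X i) f
  exact ⟨@asIso _ _ _ _ _ ((DerivedCategory.isIso_Q_map_iff_quasiIso _ _).2 h1) ≪≫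
    @asIso _ _ _ _ _ ((DerivedCategory.isIso_Q_map_iff_quasiIso _ _).2 h2)⟩

/-- The derived tensor product can be computed by any K-projective resolutions. -/
theorem IsDerivedTensor.nonempty_iso {X : DerivedCategory (ModuleCat.{u} S)}
    {Y : DerivedCategory (ModuleCat.{u} T)} {W : DerivedCategory (ModuleCat.{u} (S ⊗[z] T))}
    (h : IsDerivedTensor z X Y W) {P : CochainComplex (ModuleCat.{u} S) ℤ}
    {P' : CochainComplex (ModuleCat.{u} T) ℤ} [P.IsKProjective] [P'.IsKProjective]
    (e : DerivedCategory.Q.obj P ≅ X) (e' : DerivedCategory.Q.obj P' ≅ Y) :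
    Nonempty (DerivedCategory.Q.obj (tensorComplex z S T P P') ≅ W) := by
  obtain ⟨P₁, P₁', _, _, ⟨e₁⟩, ⟨e₁'⟩, ⟨e₂⟩⟩ := h
  obtain ⟨w⟩ := nonempty_homotopyEquiv_of_isKProjective (e ≪≫ e₁.symm)
  obtain ⟨w'⟩ := nonempty_homotopyEquiv_of_isKProjective (e' ≪≫ e₁'.symm)
  obtain ⟨w''⟩ := nonempty_homotopyEquiv_mapBifunctor (F := tensorFunctor z S T) w w'
  exact ⟨isoOfHomotopyEquiv w'' ≪≫ e₂⟩

theorem flat_of_tensor_equiv (M : ModuleCat.{u} S) (N : ModuleCat.{u} T) [Module.Flat z M]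
    [Module.Flat z N] (X : ModuleCat.{u} (S ⊗[z] T)) (e : (M ⊗[z] N) ≃+ X)
    (he : ∀ (s : S) m n, e ((s • m) ⊗ₜ n) = (s ⊗ₜ[z] (1 : T)) • e (m ⊗ₜ n)) : Module.Flat z X := by
  refine Module.Flat.of_linearEquiv (e.toLinearEquiv fun r x => ?_).symm
  induction x using TensorProduct.induction_on with
  | zero => rw [smul_zero, map_zero, smul_zero]
  | tmul m n =>
    rw [TensorProduct.smul_tmul', ← algebraMap_smul S r m, he, ← algebraMap_smul (S ⊗[z] T) r (e _),
      Algebra.TensorProduct.algebraMap_apply]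
  | add x y hx hy => rw [smul_add, map_add, map_add, hx, hy, smul_add]

omit [Algebra z S] [Algebra z T] in
/-- A term of a total complex is a retract of the direct sum of its summands. -/
theorem flat_mapBifunctor {U : Type u} [Ring U] [Algebra z U]
    (F : ModuleCat.{u} S ⥤ ModuleCat.{u} T ⥤ ModuleCat.{u} U) [F.Additive]
    [∀ X, (F.obj X).Additive] (K : CochainComplex (ModuleCat.{u} S) ℤ)
    (L : CochainComplex (ModuleCat.{u} T) ℤ)
    [hF : ∀ i j, Module.Flat z ((F.obj (K.X i)).obj (L.X j))] (n : ℤ) :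
    Module.Flat z ((CochainComplex.mapBifunctor K L F).X n) := by
  classical
  let X : ℤ → ModuleCat.{u} U := fun i => (F.obj (K.X i)).obj (L.X (n - i))
  obtain ⟨p, hp⟩ := exists_totalDesc (F := F) (K := K) (L := L) (n := n)
    (Y := ModuleCat.of U (DirectSum ℤ fun i => X i))
    fun i j h => eqToHom (by obtain rfl : j = n - i := by omega
                             rfl) ≫
      ModuleCat.ofHom (X := X i) (DirectSum.lof U ℤ (fun i => X i) i)
  let q : (DirectSum ℤ fun i => X i) →ₗ[U] (CochainComplex.mapBifunctor K L F).X n :=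
    DirectSum.toModule _ _ _ fun i => (totalι F K L i (n - i) n (by omega)).hom
  have hpq : p ≫ ModuleCat.ofHom q = 𝟙 _ := total_hom_ext fun i j h => by
    obtain rfl : j = n - i := by omega
    rw [← Category.assoc, hp, eqToHom_refl, Category.id_comp, Category.comp_id]
    exact ModuleCat.hom_ext (LinearMap.ext fun x =>
      DirectSum.toModule_lof U (M := fun i => X i) (φ := fun i =>
        (totalι F K L i (n - i) n (by omega)).hom) i x)
  have h2 : ∀ (r : z) (x : DirectSum ℤ fun i => X i), r • x = algebraMap z U r • x := fun r x =>
    DFinsupp.ext fun i => rfl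
  exact Module.Flat.of_retract
    { toFun := p.hom
      map_add' := map_add p.hom
      map_smul' := fun r x => by
        change p.hom (algebraMap z U r • x) = _
        rw [map_smul]
        exact (h2 r _).symm }
    { toFun := q
      map_add' := map_add q
      map_smul' := fun r x => by
        rw [h2, map_smul]
        rfl }
    (LinearMap.ext fun x => congrArg (fun f => f.hom x) hpq)

/-- Tensor products of complexes of flat modules have flat terms. -/
theorem flat_tensorComplex (K : CochainComplex (ModuleCat.{u} S) ℤ)
    (L : CochainComplex (ModuleCat.{u} T) ℤ) [∀ i, Module.Flat z (K.X i)]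
    [∀ i, Module.Flat z (L.X i)] (n : ℤ) :
    @Module.Flat z ((tensorComplex z S T K L).X n) _ _ (baseModule z _) :=
  @flat_mapBifunctor z _ S T _ _ (S ⊗[z] T) _ _ (tensorFunctor z S T) _ _ K L
    (fun i j => flat_of_tensor_equiv (z := z) (K.X i) (L.X j)
      (((tensorFunctor z S T).obj (K.X i)).obj (L.X j)) (AddEquiv.refl _) fun s m n => by
      refine ((tmul_smul_tensorMk (z := z) (X := K.X i) (M := L.X j) s 1 m n).trans ?_).symm
      rw [one_smul]
      rfl) n

end TensorComplex

section TensorBaseChange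

attribute [local instance 50] baseModule baseModule_isScalarTower tensorModule

section Equiv

variable (z c E : Type u) [CommRing z] [CommRing c] [Algebra z c] [Ring E] [Algebra z E]

/-- `c ⊗ (E ⊗ E)` is the tensor product over `c` of two copies of `c ⊗ E`. -/
noncomputable def tensorDistribEquiv :
    c ⊗[z] (E ⊗[z] E) ≃ₐ[c] (c ⊗[z] E) ⊗[c] (c ⊗[z] E) :=
  Algebra.TensorProduct.algEquivOfLinearEquivTensorProduct
    (TensorProduct.AlgebraTensorModule.distribBaseChange z c E E)
    (fun a₁ a₂ b₁ b₂ => by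
      induction b₁ using TensorProduct.induction_on with
      | zero => simp
      | add x y hx hy => simp only [add_mul, TensorProduct.tmul_add, map_add, hx, hy]
      | tmul s t =>
        induction b₂ using TensorProduct.induction_on with
        | zero => simp
        | add x y hx hy => simp only [mul_add, TensorProduct.tmul_add, map_add, hx, hy]
        | tmul s' t' => simp)
    (by simp [Algebra.TensorProduct.one_def])

end Equiv

variable {z c E E' : Type u} [CommRing z] [CommRing c] [Algebra z c] [Ring E] [Algebra z E]
  [Ring E'] [Algebra c E'] {σ : E' ≃+* c ⊗[z] E} (hσ : ∀ a, σ.symm (a ⊗ₜ 1) = algebraMap c E' a)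

include hσ in
theorem exists_tensor_equiv : ∃ δ : E' ⊗[c] E' ≃+* c ⊗[z] (E ⊗[z] E),
    ∀ a s t, δ.symm (a ⊗ₜ (s ⊗ₜ t)) = σ.symm (a ⊗ₜ s) ⊗ₜ[c] σ.symm (1 ⊗ₜ t) := by
  let σ' : c ⊗[z] E ≃ₐ[c] E' := AlgEquiv.ofRingEquiv (f := σ.symm) hσ
  refine ⟨((tensorDistribEquiv z c E).trans
    (Algebra.TensorProduct.congr σ' σ')).symm.toRingEquiv, fun a s t => ?_⟩
  change (Algebra.TensorProduct.congr σ' σ') (tensorDistribEquiv z c E (a ⊗ₜ (s ⊗ₜ t))) = _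
  rfl

include hσ in
theorem algebraMap_smul_bcMk {M : ModuleCat.{u} E} (r a : c) (m : M) :
    algebraMap c E' r • bcMk σ a m = bcMk σ (r * a) m := by
  rw [← hσ, symm_tmul_smul_bcMk, one_smul]

omit [Algebra c E'] in
theorem bc_addHom_ext {M : ModuleCat.{u} E} {Z : Type*} [AddCommGroup Z]
    {f g : (bc σ).obj M →+ Z} (h : ∀ a m, f (bcMk σ a m) = g (bcMk σ a m)) : f = g := by
  ext x
  induction x using bc_induction with
  | zero => rw [map_zero, map_zero]
  | mk a m => exact h a m
  | add x y hx hy => rw [map_add, map_add, hx, hy]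

variable {δ : E' ⊗[c] E' ≃+* c ⊗[z] (E ⊗[z] E)}
  (hδ : ∀ a s t, δ.symm (a ⊗ₜ (s ⊗ₜ t)) = σ.symm (a ⊗ₜ s) ⊗ₜ[c] σ.symm (1 ⊗ₜ t))
  (M N : ModuleCat.{u} E)

/-- The additive map `M ⊗_z N → (c ⊗ M) ⊗_c (c ⊗ N)`. -/
noncomputable def tensorToBc (σ : E' ≃+* c ⊗[z] E) (hσ : ∀ a, σ.symm (a ⊗ₜ 1) = algebraMap c E' a)
    (M N : ModuleCat.{u} E) : ((tensorFunctor z E E).obj M).obj N →+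
      ((tensorFunctor c E' E').obj ((bc σ).obj M)).obj ((bc σ).obj N) :=
  tensorLift (z := z)
    (AddMonoidHom.mk' (fun m => AddMonoidHom.mk' (fun n =>
      tensorMk (z := c) (bcMk σ 1 m) (bcMk σ 1 n))
      fun n n' => by rw [bcMk_add, tensorMk_add])
      fun m m' => AddMonoidHom.ext fun n => by
        change tensorMk (bcMk σ 1 (m + m')) _ = tensorMk _ _ + tensorMk _ _
        rw [bcMk_add, add_tensorMk])
    fun r m n => by
      change tensorMk (bcMk σ 1 (algebraMap z E r • m)) (bcMk σ 1 n) =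
        tensorMk (bcMk σ 1 m) (bcMk σ 1 (algebraMap z E r • n))
      rw [← algebraMap_bcMk, ← algebraMap_bcMk, ← algebraMap_smul_bcMk hσ,
        ← algebraMap_smul_bcMk hσ, algebraMap_smul_tensorMk]

include hδ in
theorem tensorToBc_smul (r : E ⊗[z] E) (x : ((tensorFunctor z E E).obj M).obj N) :
    tensorToBc σ hσ M N (r • x) = δ.symm (1 ⊗ₜ r) • tensorToBc σ hσ M N x := by
  induction r using TensorProduct.induction_on with
  | zero =>
    have h0 : (0 : E ⊗[z] E) • x = 0 := zero_smul _ x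
    rw [h0, TensorProduct.tmul_zero, map_zero, map_zero, zero_smul]
  | add r r' h h' =>
    have h0 : (r + r') • x = r • x + r' • x := add_smul r r' x
    rw [h0, TensorProduct.tmul_add, map_add, map_add, add_smul, h, h']
  | tmul s t =>
    rw [hδ]
    refine tensor_induction (p := fun x => tensorToBc σ hσ M N ((s ⊗ₜ[z] t) • x) =
      (σ.symm (1 ⊗ₜ s) ⊗ₜ[c] σ.symm (1 ⊗ₜ t)) • tensorToBc σ hσ M N x) x ?_ (fun m n => ?_)
        fun x y hx hy => ?_
    · rw [smul_zero, map_zero, smul_zero]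
    · rw [tmul_smul_tensorMk]
      change tensorMk (bcMk σ 1 (s • m)) (bcMk σ 1 (t • n)) = _ • tensorMk _ _
      rw [tmul_smul_tensorMk, symm_tmul_smul_bcMk, symm_tmul_smul_bcMk, mul_one]
    · rw [smul_add, map_add, map_add, hx, hy, smul_add]

/-- The comparison map `c ⊗ (M ⊗_z N) → (c ⊗ M) ⊗_c (c ⊗ N)`. -/
noncomputable def bcTensorHom :
    (bc δ).obj (((tensorFunctor z E E).obj M).obj N) ⟶
      ((tensorFunctor c E' E').obj ((bc σ).obj M)).obj ((bc σ).obj N) :=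
  bcLift δ (ModuleCat.ofHom
    (Y := (ModuleCat.restrictScalars (bcInclude δ)).obj
      (((tensorFunctor c E' E').obj ((bc σ).obj M)).obj ((bc σ).obj N)))
    { toFun := tensorToBc σ hσ M N
      map_add' := map_add (tensorToBc σ hσ M N)
      map_smul' := tensorToBc_smul hσ hδ M N })

theorem bcTensorHom_bcMk (a : c) (m : M) (n : N) : (bcTensorHom hσ hδ M N).hom
    (bcMk δ (M := ((tensorFunctor z E E).obj M).obj N) a (tensorMk m n)) =
      tensorMk (bcMk σ a m) (bcMk σ 1 n) := by
  refine (bcLift_bcMk δ _ _ _).trans ?_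
  let w : ((tensorFunctor c E' E').obj ((bc σ).obj M)).obj ((bc σ).obj N) :=
    tensorMk (bcMk σ 1 m) (bcMk σ 1 n)
  change δ.symm (a ⊗ₜ 1) • w = _
  rw [Algebra.TensorProduct.one_def, hδ, tmul_smul_tensorMk, symm_tmul_smul_bcMk,
    symm_tmul_smul_bcMk, mul_one, one_smul, mul_one, one_smul]

/-- The additive map `(c ⊗ M) ⊗_c (c ⊗ N) → c ⊗ (M ⊗_z N)`. -/
noncomputable def bcTensorInv (δ : E' ⊗[c] E' ≃+* c ⊗[z] (E ⊗[z] E)) :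
    ((tensorFunctor c E' E').obj ((bc σ).obj M)).obj ((bc σ).obj N) →+
      (bc δ).obj (((tensorFunctor z E E).obj M).obj N) :=
  let X := ((tensorFunctor z E E).obj M).obj N
  let H : c → M → (bc σ).obj N →+ (bc δ).obj X := fun a m =>
    tensorLift (z := z) (X := ModuleCat.of c c) (M := N)
      (AddMonoidHom.mk' (fun b : c => AddMonoidHom.mk' (fun n =>
        bcMk δ (M := X) (a * b) (tensorMk m n))
        fun n n' => by rw [tensorMk_add, bcMk_add])
        fun b b' => AddMonoidHom.ext fun n => by
          change bcMk δ (M := X) (a * (b + b')) _ = bcMk δ (M := X) _ _ + bcMk δ (M := X) _ _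
          rw [mul_add, add_bcMk])
      fun r b n => by
        change bcMk δ (M := X) (a * (algebraMap z c r * b)) _ = bcMk δ (M := X) (a * b) _
        rw [mul_left_comm, algebraMap_bcMk, ← algebraMap_smul_tensorMk,
          Algebra.TensorProduct.algebraMap_apply, tmul_smul_tensorMk, one_smul]
  have hH : ∀ a m b n, H a m (bcMk σ b n) = bcMk δ (M := X) (a * b) (tensorMk m n) :=
    fun a m b n => rfl
  let G : (bc σ).obj M →+ (bc σ).obj N →+ (bc δ).obj X :=
    tensorLift (z := z) (X := ModuleCat.of c c) (M := M)
      (AddMonoidHom.mk' (fun a : c => AddMonoidHom.mk' (fun m => H a m)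
        fun m m' => bc_addHom_ext fun b n => by
          rw [AddMonoidHom.add_apply, hH, hH, hH, add_tensorMk, bcMk_add])
        fun a a' => AddMonoidHom.ext fun m => bc_addHom_ext fun b n => by
          change H (a + a') m (bcMk σ b n) = H a m (bcMk σ b n) + H a' m (bcMk σ b n)
          rw [hH, hH, hH, add_mul, add_bcMk])
      fun r a m => bc_addHom_ext fun b n => by
        change H (algebraMap z c r * a) m (bcMk σ b n) = H a (algebraMap z E r • m) (bcMk σ b n)
        rw [hH, hH, mul_assoc, algebraMap_bcMk, Algebra.TensorProduct.algebraMap_apply,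
          tmul_smul_tensorMk, one_smul]
  have hG : ∀ a m b n, G (bcMk σ a m) (bcMk σ b n) = bcMk δ (M := X) (a * b) (tensorMk m n) :=
    fun a m b n => rfl
  tensorLift (z := c) G fun r x y => by
    induction x using bc_induction with
    | zero => rw [smul_zero, map_zero, AddMonoidHom.zero_apply, AddMonoidHom.zero_apply]
    | add x x' hx hx' => rw [smul_add, map_add, map_add, AddMonoidHom.add_apply,
        AddMonoidHom.add_apply, hx, hx']
    | mk a m =>
      induction y using bc_induction with
      | zero => rw [smul_zero, map_zero, map_zero]
      | add y y' hy hy' => rw [smul_add, map_add, map_add, hy, hy']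
      | mk b n =>
        rw [algebraMap_smul_bcMk hσ, algebraMap_smul_bcMk hσ, hG, hG]
        congr 1
        ring

theorem bcTensorInv_tensorMk (a b : c) (m : M) (n : N) : bcTensorInv hσ M N δ
    (tensorMk (bcMk σ a m) (bcMk σ b n)) =
      bcMk δ (M := ((tensorFunctor z E E).obj M).obj N) (a * b) (tensorMk m n) :=
  rfl

theorem bcTensorHom_bijective : Function.Bijective (bcTensorHom hσ hδ M N).hom := by
  refine Function.bijective_iff_has_inverse.2 ⟨bcTensorInv hσ M N δ, fun x => ?_, fun x => ?_⟩
  · induction x using bc_induction with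
    | zero => rw [map_zero, map_zero]
    | add x y hx hy => rw [map_add, map_add, hx, hy]
    | mk a w =>
      refine tensor_induction (p := fun w => bcTensorInv hσ M N δ ((bcTensorHom hσ hδ M N).hom
        (bcMk δ (M := ((tensorFunctor z E E).obj M).obj N) a w)) =
          bcMk δ (M := ((tensorFunctor z E E).obj M).obj N) a w) w ?_ (fun m n => ?_)
            fun x y hx hy => ?_
      · rw [bcMk_zero, map_zero, map_zero]
      · rw [bcTensorHom_bcMk, bcTensorInv_tensorMk, mul_one]
      · rw [bcMk_add, map_add, map_add, hx, hy]
  · refine tensor_induction (p := fun x => (bcTensorHom hσ hδ M N).hom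
      (bcTensorInv hσ M N δ x) = x) x ?_ (fun x y => ?_) fun x y hx hy => ?_
    · rw [map_zero, map_zero]
    · induction x using bc_induction with
      | zero => rw [zero_tensorMk, map_zero, map_zero]
      | add x x' hx hx' => rw [add_tensorMk, map_add, map_add, hx, hx']
      | mk a m =>
        induction y using bc_induction with
        | zero => rw [tensorMk_zero, map_zero, map_zero]
        | add y y' hy hy' => rw [tensorMk_add, map_add, map_add, hy, hy']
        | mk b n =>
          have h : bcMk σ (b * 1) n = algebraMap c E' b • bcMk σ 1 n :=
            (algebraMap_smul_bcMk hσ b 1 n).symm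
          rw [bcTensorInv_tensorMk, bcTensorHom_bcMk, mul_comm, ← algebraMap_smul_bcMk hσ,
            algebraMap_smul_tensorMk, ← h, mul_one]
    · rw [map_add, map_add, hx, hy]

end TensorBaseChange

section MapTotal

variable {S T U S' T' U' : Type u} [Ring S] [Ring T] [Ring U] [Ring S'] [Ring T'] [Ring U']
  {F : ModuleCat.{u} S ⥤ ModuleCat.{u} T ⥤ ModuleCat.{u} U} [F.Additive] [∀ X, (F.obj X).Additive]
  {F' : ModuleCat.{u} S' ⥤ ModuleCat.{u} T' ⥤ ModuleCat.{u} U'} [F'.Additive]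
  [∀ X, (F'.obj X).Additive] {B : ModuleCat.{u} U ⥤ ModuleCat.{u} U'} [B.Additive]
  {B' : ModuleCat.{u} U' ⥤ ModuleCat.{u} U} (adj : B ⊣ B')
  {K : CochainComplex (ModuleCat.{u} S) ℤ} {L : CochainComplex (ModuleCat.{u} T) ℤ}
  {K' : CochainComplex (ModuleCat.{u} S') ℤ} {L' : CochainComplex (ModuleCat.{u} T') ℤ}

include adj in
omit [B.Additive] in
theorem map_total_hom_ext {n : ℤ} {Y : ModuleCat.{u} U'}
    {f g : B.obj ((CochainComplex.mapBifunctor K L F).X n) ⟶ Y}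
    (h : ∀ i j hij, B.map (totalι F K L i j n hij) ≫ f = B.map (totalι F K L i j n hij) ≫ g) :
    f = g := by
  refine (adj.homEquiv _ _).injective (total_hom_ext fun i j hij => ?_)
  rw [← Adjunction.homEquiv_naturality_left, ← Adjunction.homEquiv_naturality_left, h]

include adj in
/-- An additive left adjoint commutes with the formation of total complexes. -/
theorem nonempty_mapBifunctor_iso_of_leftAdjoint
    (τ : ∀ i j, (F'.obj (K'.X i)).obj (L'.X j) ≅ B.obj ((F.obj (K.X i)).obj (L.X j)))
    (hl : ∀ i j, (F'.map (K'.d i (i + 1))).app (L'.X j) ≫ (τ (i + 1) j).hom =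
      (τ i j).hom ≫ B.map ((F.map (K.d i (i + 1))).app (L.X j)))
    (hr : ∀ i j, (F'.obj (K'.X i)).map (L'.d j (j + 1)) ≫ (τ i (j + 1)).hom =
      (τ i j).hom ≫ B.map ((F.obj (K.X i)).map (L.d j (j + 1)))) :
    Nonempty (CochainComplex.mapBifunctor K' L' F' ≅
      (B.mapHomologicalComplex (ComplexShape.up ℤ)).obj (CochainComplex.mapBifunctor K L F)) := by
  have h1 := fun n => exists_totalDesc (F := F') (K := K') (L := L') (n := n)
    (Y := B.obj ((CochainComplex.mapBifunctor K L F).X n))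
    fun i j h => (τ i j).hom ≫ B.map (totalι F K L i j n h)
  choose fwd hfwd using h1
  have h2 := fun n => exists_totalDesc (F := F) (K := K) (L := L) (n := n)
    (Y := B'.obj ((CochainComplex.mapBifunctor K' L' F').X n))
    fun i j h => adj.homEquiv _ _ ((τ i j).inv ≫ totalι F' K' L' i j n h)
  choose bwd₀ hbwd₀ using h2
  let bwd : ∀ n, B.obj ((CochainComplex.mapBifunctor K L F).X n) ⟶
      (CochainComplex.mapBifunctor K' L' F').X n :=
    fun n => (adj.homEquiv _ _).symm (bwd₀ n)
  have hbwd : ∀ n i j h, B.map (totalι F K L i j n h) ≫ bwd n =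
      (τ i j).inv ≫ totalι F' K' L' i j n h := fun n i j h => by
    rw [← Adjunction.homEquiv_naturality_left_symm, hbwd₀, Equiv.symm_apply_apply]
  have hid1 : ∀ n, fwd n ≫ bwd n = 𝟙 ((CochainComplex.mapBifunctor K' L' F').X n) := fun n =>
    total_hom_ext fun i j h => by
      rw [← Category.assoc, hfwd, Category.assoc, hbwd, Iso.hom_inv_id_assoc, Category.comp_id]
  have hid2 : ∀ n, bwd n ≫ fwd n = 𝟙 (B.obj ((CochainComplex.mapBifunctor K L F).X n)) := fun n =>
    map_total_hom_ext adj fun i j h => by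
      rw [← Category.assoc, hbwd, Category.assoc, hfwd, Iso.inv_hom_id_assoc, Category.comp_id]
  have hcomm : ∀ n, fwd n ≫ B.map ((CochainComplex.mapBifunctor K L F).d n (n + 1)) =
      (CochainComplex.mapBifunctor K' L' F').d n (n + 1) ≫ fwd (n + 1) := fun n => by
    refine total_hom_ext fun i j h => ?_
    rw [← Category.assoc, hfwd, Category.assoc, ← B.map_comp, totalι_d F K L i j n h,
      ← Category.assoc, totalι_d F' K' L' i j n h, Preadditive.add_comp, Category.assoc, hfwd,
      Linear.units_smul_comp, Category.assoc, hfwd, ← Category.assoc, hl,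
      ← Category.assoc _ _ (B.map _), hr,
      B.map_add, Functor.map_units_smul, B.map_comp, B.map_comp,
      Preadditive.comp_add, Linear.comp_units_smul, Category.assoc, Category.assoc]
  refine ⟨HomologicalComplex.Hom.isoOfComponents (fun n =>
    { hom := fwd n, inv := bwd n, hom_inv_id := hid1 n, inv_hom_id := hid2 n }) ?_⟩
  rintro n _ rfl
  exact hcomm n

end MapTotal

section TensorComplexBaseChange

attribute [local instance 50] baseModule baseModule_isScalarTower tensorModule

variable {z c E E' : Type u} [CommRing z] [CommRing c] [Algebra z c] [Ring E] [Algebra z E]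
  [Ring E'] [Algebra c E'] {σ : E' ≃+* c ⊗[z] E} (hσ : ∀ a, σ.symm (a ⊗ₜ 1) = algebraMap c E' a)
  {δ : E' ⊗[c] E' ≃+* c ⊗[z] (E ⊗[z] E)}
  (hδ : ∀ a s t, δ.symm (a ⊗ₜ (s ⊗ₜ t)) = σ.symm (a ⊗ₜ s) ⊗ₜ[c] σ.symm (1 ⊗ₜ t))

theorem bc_tensor_hom_ext {M N : ModuleCat.{u} E} {Y : ModuleCat.{u} (E' ⊗[c] E')}
    {f g : (bc δ).obj (((tensorFunctor z E E).obj M).obj N) ⟶ Y}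
    (h : ∀ m n, f.hom (bcMk δ (M := ((tensorFunctor z E E).obj M).obj N) 1 (tensorMk m n)) =
      g.hom (bcMk δ (M := ((tensorFunctor z E E).obj M).obj N) 1 (tensorMk m n))) : f = g :=
  bc_hom_ext δ fun w => by
    refine tensor_induction (p := fun w => f.hom (bcMk δ (M := ((tensorFunctor z E E).obj M).obj N)
      1 w) = g.hom (bcMk δ (M := ((tensorFunctor z E E).obj M).obj N) 1 w)) w ?_ h
        fun x y hx hy => ?_
    · rw [bcMk_zero, map_zero, map_zero]
    · rw [bcMk_add, map_add, map_add, hx, hy]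

theorem bcTensorHom_naturality_left {M M' : ModuleCat.{u} E} (f : M ⟶ M') (N : ModuleCat.{u} E) :
    bcTensorHom hσ hδ M N ≫ ((tensorFunctor c E' E').map ((bc σ).map f)).app ((bc σ).obj N) =
      (bc δ).map (((tensorFunctor z E E).map f).app N) ≫ bcTensorHom hσ hδ M' N :=
  bc_tensor_hom_ext fun m n => (congrArg (((tensorFunctor c E' E').map ((bc σ).map f)).app
    ((bc σ).obj N)).hom (bcTensorHom_bcMk hσ hδ M N 1 m n)).trans
      (bcTensorHom_bcMk hσ hδ M' N 1 (f.hom m) n).symm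

theorem bcTensorHom_naturality_right (M : ModuleCat.{u} E) {N N' : ModuleCat.{u} E} (f : N ⟶ N') :
    bcTensorHom hσ hδ M N ≫ ((tensorFunctor c E' E').obj ((bc σ).obj M)).map ((bc σ).map f) =
      (bc δ).map (((tensorFunctor z E E).obj M).map f) ≫ bcTensorHom hσ hδ M N' :=
  bc_tensor_hom_ext fun m n => (congrArg (((tensorFunctor c E' E').obj ((bc σ).obj M)).map
    ((bc σ).map f)).hom (bcTensorHom_bcMk hσ hδ M N 1 m n)).trans
      (bcTensorHom_bcMk hσ hδ M N' 1 m (f.hom n)).symm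

/-- The isomorphism `c ⊗ (M ⊗_z N) ≅ (c ⊗ M) ⊗_c (c ⊗ N)`. -/
noncomputable def bcTensorIso (M N : ModuleCat.{u} E) :
    (bc δ).obj (((tensorFunctor z E E).obj M).obj N) ≅
      ((tensorFunctor c E' E').obj ((bc σ).obj M)).obj ((bc σ).obj N) :=
  @asIso _ _ _ _ (bcTensorHom hσ hδ M N)
    ((ConcreteCategory.isIso_iff_bijective _).2 (bcTensorHom_bijective hσ hδ M N))

theorem bcTensorIso_inv_naturality_left {M M' : ModuleCat.{u} E} (f : M ⟶ M')
    (N : ModuleCat.{u} E) :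
    ((tensorFunctor c E' E').map ((bc σ).map f)).app ((bc σ).obj N) ≫
      (bcTensorIso hσ hδ M' N).inv =
      (bcTensorIso hσ hδ M N).inv ≫ (bc δ).map (((tensorFunctor z E E).map f).app N) := by
  rw [Iso.comp_inv_eq, Category.assoc, Iso.eq_inv_comp]
  exact bcTensorHom_naturality_left hσ hδ f N

theorem bcTensorIso_inv_naturality_right (M : ModuleCat.{u} E) {N N' : ModuleCat.{u} E}
    (f : N ⟶ N') :
    ((tensorFunctor c E' E').obj ((bc σ).obj M)).map ((bc σ).map f) ≫
      (bcTensorIso hσ hδ M N').inv =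
      (bcTensorIso hσ hδ M N).inv ≫ (bc δ).map (((tensorFunctor z E E).obj M).map f) := by
  rw [Iso.comp_inv_eq, Category.assoc, Iso.eq_inv_comp]
  exact bcTensorHom_naturality_right hσ hδ M f

variable (K L : CochainComplex (ModuleCat.{u} E) ℤ)

include hσ hδ in
/-- Base change commutes with tensor products of complexes. -/
theorem nonempty_bc_tensorComplex_iso :
    Nonempty (tensorComplex c E' E' ((bcComplex σ).obj K) ((bcComplex σ).obj L) ≅
      (bcComplex δ).obj (tensorComplex z E E K L)) :=
  nonempty_mapBifunctor_iso_of_leftAdjoint (bcAdj δ)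
    (fun i j => (bcTensorIso hσ hδ (K.X i) (L.X j)).symm)
    (fun i j => bcTensorIso_inv_naturality_left hσ hδ (K.d i (i + 1)) (L.X j))
    (fun i j => bcTensorIso_inv_naturality_right hσ hδ (K.X i) (L.d j (j + 1)))

end TensorComplexBaseChange

/-! ### The right derived functor of Hom of bimodules -/

section RestrictInjective

attribute [local instance 50] baseModule baseModule_isScalarTower tensorModule

variable {z : Type u} [CommRing z] {S T : Type u} [Ring S] [Ring T] [Algebra z S] [Algebra z T]

theorem tensorFunctor_map_app_injective {M N : ModuleCat.{u} S} (i : M ⟶ N)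
    (hi : Function.Injective i.hom) (Y : ModuleCat.{u} T) [Module.Flat z Y] :
    Function.Injective (((tensorFunctor z S T).map i).app Y).hom :=
  Module.Flat.rTensor_preserves_injective_linearMap (M := Y) (i.hom.restrictScalars z) hi

/-- The `S ⊗ T`-linear map `M ⊗ T → J` extending an `S`-linear map `M → J`. -/
noncomputable def tensorExtend {M : ModuleCat.{u} S} {J : ModuleCat.{u} (S ⊗[z] T)}
    (f : M ⟶ (ModuleCat.restrictScalars (Algebra.TensorProduct.includeLeft (R := z) (S := z)
      (A := S) (B := T)).toRingHom).obj J) :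
    ((tensorFunctor z S T).obj M).obj (ModuleCat.of T T) ⟶ J :=
  let f₀ : M →+ J := f.hom.toAddMonoidHom
  have hf₀ : ∀ (s : S) m, f₀ (s • m) = (s ⊗ₜ[z] (1 : T)) • f₀ m := fun s m => map_smul f.hom s m
  let g : ((tensorFunctor z S T).obj M).obj (ModuleCat.of T T) →+ J :=
    tensorLift (z := z) (X := M) (M := ModuleCat.of T T)
      { toFun := fun m =>
          { toFun := fun t : T => ((1 : S) ⊗ₜ[z] t) • f₀ m
            map_zero' := by rw [TensorProduct.tmul_zero, zero_smul]
            map_add' := fun t t' : T => by rw [TensorProduct.tmul_add, add_smul] }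
        map_zero' := AddMonoidHom.ext fun t => by
          change ((1 : S) ⊗ₜ[z] (t : T)) • f₀ 0 = 0
          rw [map_zero, smul_zero]
        map_add' := fun m m' => AddMonoidHom.ext fun t => by
          change ((1 : S) ⊗ₜ[z] (t : T)) • f₀ (m + m') = _
          rw [map_add, smul_add]
          rfl }
      fun r m (t : T) => by
        change ((1 : S) ⊗ₜ[z] t) • f₀ (algebraMap z S r • m) =
          ((1 : S) ⊗ₜ[z] (algebraMap z T r * t)) • f₀ m
        rw [hf₀, smul_smul, Algebra.TensorProduct.tmul_mul_tmul, one_mul, mul_one,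
          ← Algebra.smul_def, ← TensorProduct.smul_tmul, Algebra.algebraMap_eq_smul_one]
  have hg : ∀ m (t : T), g (tensorMk (M := ModuleCat.of T T) m t) =
    ((1 : S) ⊗ₜ[z] t) • f₀ m := fun _ _ => rfl
  ModuleCat.ofHom (X := ((tensorFunctor z S T).obj M).obj (ModuleCat.of T T)) (Y := J)
    { toFun := g
      map_add' := map_add g
      map_smul' := fun r x => by
        change g (r • x) = r • g x
        induction r using TensorProduct.induction_on with
        | zero => rw [zero_smul, zero_smul, map_zero]
        | add r r' h h' => rw [add_smul, add_smul, map_add, h, h']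
        | tmul s t =>
          refine tensor_induction (p := fun x => g ((s ⊗ₜ t : S ⊗[z] T) • x) =
            (s ⊗ₜ t : S ⊗[z] T) • g x) x ?_ (fun m (t' : T) => ?_) fun x y hx hy => ?_
          · rw [smul_zero, map_zero, smul_zero]
          · rw [tmul_smul_tensorMk]
            refine (hg (s • m) (t * t')).trans (Eq.trans ?_ (congrArg _ (hg m t')).symm)
            rw [hf₀, smul_smul, smul_smul]
            simp
          · rw [smul_add, map_add, map_add, smul_add, hx, hy] }

theorem tensorExtend_one {M : ModuleCat.{u} S} {J : ModuleCat.{u} (S ⊗[z] T)}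
    (f : M ⟶ (ModuleCat.restrictScalars (Algebra.TensorProduct.includeLeft (R := z) (S := z)
      (A := S) (B := T)).toRingHom).obj J) (m : M) :
    (tensorExtend f).hom (tensorMk (M := ModuleCat.of T T) m (1 : T)) = (f.hom m : J) :=
  one_smul (S ⊗[z] T) (f.hom m : J)

/-- Restriction of scalars from `S ⊗ T` to `S` preserves injective modules when `T` is flat, as its
left adjoint `M ↦ M ⊗ T` is then exact. -/
theorem injective_restrictScalars_includeLeft [hT : Module.Flat z T]
    (J : ModuleCat.{u} (S ⊗[z] T)) [Injective J] :
    Injective ((ModuleCat.restrictScalars (Algebra.TensorProduct.includeLeft (R := z) (S := z)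
      (A := S) (B := T)).toRingHom).obj J) where
  factors {M N} f i _ := by
    have : Mono (((tensorFunctor z S T).map i).app (ModuleCat.of T T)) :=
      (ModuleCat.mono_iff_injective _).2 (@tensorFunctor_map_app_injective z _ S T _ _ _ _ M N i
        ((ModuleCat.mono_iff_injective i).1 inferInstance) (ModuleCat.of T T) flat_self)
    obtain ⟨h, hh⟩ := Injective.factors (tensorExtend f)
      (((tensorFunctor z S T).map i).app (ModuleCat.of T T))
    have hadd : ∀ n : N, ∀ s : S, tensorMk (z := z) (M := ModuleCat.of T T) (s • n) (1 : T) =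
      (s ⊗ₜ[z] (1 : T)) • tensorMk (M := ModuleCat.of T T) n (1 : T) := fun n s => by
        rw [tmul_smul_tensorMk, one_smul]
    refine ⟨ModuleCat.ofHom (X := N) (Y := (ModuleCat.restrictScalars
      (Algebra.TensorProduct.includeLeft (R := z) (S := z) (A := S) (B := T)).toRingHom).obj J)
      { toFun := fun n => h.hom (tensorMk (M := ModuleCat.of T T) n (1 : T))
        map_add' := fun n n' => (congrArg h.hom (add_tensorMk _ _ _)).trans (map_add h.hom _ _)
        map_smul' := fun s n => (congrArg h.hom (hadd n s)).trans (map_smul h.hom _ _) }, ?_⟩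
    ext m
    exact (congrArg (fun f => f.hom (tensorMk (M := ModuleCat.of T T) m (1 : T))) hh).trans
      (tensorExtend_one f m)

end RestrictInjective

section RightDerived

variable {C D : Type (u + 1)} [Category.{u} C] [Category.{u} D] [Abelian C] [Abelian D]

/-- Right derived functors can be computed by any K-injective resolution. -/
theorem IsRightDerived.nonempty_iso {F : C ⥤ D} [F.Additive] {X : DerivedCategory C}
    {Y : DerivedCategory D} (h : IsRightDerived F X Y) {I : CochainComplex C ℤ}
    [hI : I.IsKInjective] (e : DerivedCategory.Q.obj I ≅ X) :
    Nonempty (DerivedCategory.Q.obj ((F.mapHomologicalComplex (ComplexShape.up ℤ)).obj I) ≅ Y) := by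
  obtain ⟨I', hI', ⟨e'⟩, ⟨e''⟩⟩ := h
  obtain ⟨w⟩ := nonempty_homotopyEquiv_of_isKInjective (e ≪≫ e'.symm)
  exact ⟨isoOfHomotopyEquiv (F.mapHomotopyEquiv w) ≪≫ e''⟩

end RightDerived

section HomFunctor

open CochainComplex CochainComplex.HomComplex

variable {z : Type u} [CommRing z] {S T U : Type u} [Ring S] [Ring T] [Ring U] [Algebra z S]
  [Algebra z T] [Algebra z U] (ω : S ⊗[z] T →ₐ[z] U) (N : Type u) [AddCommGroup N] [Module S N]

/-- The action of `S` on `U`-modules given by `S ⊗ T → U`. -/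
abbrev leftMap : S →ₐ[z] U := ω.comp Algebra.TensorProduct.includeLeft

/-- The action of `T` on `U`-modules given by `S ⊗ T → U`. -/
abbrev rightMap : T →ₐ[z] U := ω.comp Algebra.TensorProduct.includeRight

theorem commute_leftMap_rightMap (s : S) (t : T) : Commute (leftMap ω s) (rightMap ω t) := by
  have h : Commute (s ⊗ₜ[z] (1 : T)) ((1 : S) ⊗ₜ[z] t) := by
    simp [Commute, SemiconjBy]
  exact h.map ω

theorem injective_resComplex_leftMap [Module.Flat z T] (hω : Function.Bijective ω)
    (J : CochainComplex (ModuleCat.{u} U) ℤ) [hJ : ∀ i, Injective (J.X i)]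
    (i : ℤ) : Injective (((resComplex (leftMap ω).toRingHom).obj J).X i) := by
  have : Injective ((ModuleCat.restrictScalars ω.toRingHom).obj (J.X i)) :=
    ((ModuleCat.restrictScalarsEquivalenceOfRingEquiv
      (RingEquiv.ofBijective ω hω)).map_injective_iff (J.X i)).2 (hJ i)
  exact injective_restrictScalars_includeLeft
    ((ModuleCat.restrictScalars ω.toRingHom).obj (J.X i))

/-- The action of `T` on a complex of `U`-modules viewed as a complex of `S`-modules. -/
noncomputable abbrev rightAction (K : CochainComplex (ModuleCat.{u} U) ℤ) :
    T →+* End ((resComplex (leftMap ω).toRingHom).obj K) :=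
  commAction (leftMap ω).toRingHom (rightMap ω).toRingHom (commute_leftMap_rightMap ω) K

/-- A homomorphism from `N`, as a cochain on `N` in degree zero. -/
noncomputable def singleCochain (K : CochainComplex (ModuleCat.{u} U) ℤ) (n : ℤ)
    (φ : ModuleCat.of S N ⟶ ((resComplex (leftMap ω).toRingHom).obj K).X n) :
    (homComplex ((singleFunctor (ModuleCat.{u} S) 0).obj (ModuleCat.of S N))
      (rightAction ω K)).X n :=
  homComplexMk (rightAction ω K) (Cochain.fromSingleMk φ (zero_add n))

theorem singleCochain_add (K : CochainComplex (ModuleCat.{u} U) ℤ) (n : ℤ)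
    (φ ψ : ModuleCat.of S N ⟶ ((resComplex (leftMap ω).toRingHom).obj K).X n) :
    singleCochain ω N K n (φ + ψ) = singleCochain ω N K n φ + singleCochain ω N K n ψ :=
  Cochain.fromSingleMk_add φ ψ (zero_add n)

theorem singleCochain_smul (K : CochainComplex (ModuleCat.{u} U) ℤ) (n : ℤ) (t : T)
    (φ : ModuleCat.of S N ⟶ ((resComplex (leftMap ω).toRingHom).obj K).X n) :
    singleCochain ω N K n (φ ≫ (rightAction ω K t : _ ⟶ _).f n) = t • singleCochain ω N K n φ := by
  refine Eq.trans ?_ (homComplex_smul (rightAction ω K) t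
    (Cochain.fromSingleMk φ (zero_add n))).symm
  exact congrArg (homComplexMk _) (Cochain.fromSingleMk_postcomp _ _ _)

theorem singleCochain_d (K : CochainComplex (ModuleCat.{u} U) ℤ) (n m : ℤ)
    (φ : ModuleCat.of S N ⟶ ((resComplex (leftMap ω).toRingHom).obj K).X n) :
    ((homComplex ((singleFunctor (ModuleCat.{u} S) 0).obj (ModuleCat.of S N))
      (rightAction ω K)).d n m).hom (singleCochain ω N K n φ) =
    singleCochain ω N K m (φ ≫ ((resComplex (leftMap ω).toRingHom).obj K).d n m) :=
  congrArg (homComplexMk _) (Cochain.δ_fromSingleMk φ (zero_add n) m m (zero_add m))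

theorem singleCochain_bijective (K : CochainComplex (ModuleCat.{u} U) ℤ) (n : ℤ) :
    Function.Bijective (singleCochain ω N K n) :=
  (Cochain.fromSingleEquiv (zero_add n)).symm.bijective

/-- The complex of homomorphisms from `N` is the Hom complex from `N` placed in degree zero. -/
noncomputable def toHomComplex (K : CochainComplex (ModuleCat.{u} U) ℤ) :
    ((ModuleCat.restrictScalars ω.toRingHom ⋙ homFunctor z S T N).mapHomologicalComplex
      (ComplexShape.up ℤ)).obj K ⟶
      homComplex ((singleFunctor (ModuleCat.{u} S) 0).obj (ModuleCat.of S N))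
        (rightAction ω K) where
  f n := ModuleCat.ofHom (X := (ModuleCat.restrictScalars ω.toRingHom ⋙
      homFunctor z S T N).obj (K.X n))
    (Y := (homComplex ((singleFunctor (ModuleCat.{u} S) 0).obj (ModuleCat.of S N))
        (rightAction ω K)).X n)
    { toFun := fun φ => singleCochain ω N K n (ModuleCat.ofHom (X := N)
        (Y := ((resComplex (leftMap ω).toRingHom).obj K).X n) φ)
      map_add' := fun φ ψ => singleCochain_add ω N K n _ _
      map_smul' := fun t φ => singleCochain_smul ω N K n t _ }
  comm' i j _ := by
    ext φ
    exact singleCochain_d ω N K i j _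

instance isIso_toHomComplex (K : CochainComplex (ModuleCat.{u} U) ℤ) :
    IsIso (toHomComplex ω N K) := by
  have : ∀ n, IsIso ((toHomComplex ω N K).f n) := fun n =>
    (ConcreteCategory.isIso_iff_bijective _).2 ((singleCochain_bijective ω N K n).comp
      (ModuleCat.homEquiv (M := ModuleCat.of S N)
        (N := ((resComplex (leftMap ω).toRingHom).obj K).X n)).symm.bijective)
  exact HomologicalComplex.Hom.isIso_of_components _

/-- The functor `RHom_S(N, -)` on a bounded below complex of `U`-modules is computed by the Hom
complex from a K-projective resolution of `N`. -/
theorem isRightDerived_homFunctor_iff [Module.Flat z T] (hω : Function.Bijective ω)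
    {F : CochainComplex (ModuleCat.{u} S) ℤ} [F.IsKProjective]
    (q : F ⟶ (singleFunctor (ModuleCat.{u} S) 0).obj (ModuleCat.of S N)) [QuasiIso q]
    {K : CochainComplex (ModuleCat.{u} U) ℤ} (a : ℤ) [K.IsStrictlyGE a]
    {X : DerivedCategory (ModuleCat.{u} U)} {Y : DerivedCategory (ModuleCat.{u} T)}
    (e : DerivedCategory.Q.obj K ≅ X) :
    IsRightDerived (ModuleCat.restrictScalars ω.toRingHom ⋙ homFunctor z S T N) X Y ↔
      Nonempty (DerivedCategory.Q.obj (homComplex F (rightAction ω K)) ≅ Y) := by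
  obtain ⟨J, f, -, hf, hJ, hJ'⟩ := exists_injective_resolution K a
  have : J.IsKInjective := CochainComplex.isKInjective_of_injective J (a - 1)
  have hJS := injective_resComplex_leftMap ω hω J
  have : ((resComplex (leftMap ω).toRingHom).obj J).IsKInjective :=
    CochainComplex.isKInjective_of_injective _ (a - 1)
  have h1 := quasiIso_homComplexMapLeft (rightAction ω J) q
  have h2 := quasiIso_restrictScalars (leftMap ω).toRingHom f
  have h3 := quasiIso_homComplexMapRight (F := F) ((resComplex (leftMap ω).toRingHom).map f)
    (commAction_comm (leftMap ω).toRingHom (rightMap ω).toRingHom (commute_leftMap_rightMap ω) f)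
  have eJ : DerivedCategory.Q.obj J ≅ X :=
    (@asIso _ _ _ _ _ ((DerivedCategory.isIso_Q_map_iff_quasiIso _ f).2 hf)).symm ≪≫ e
  have eH : DerivedCategory.Q.obj (((ModuleCat.restrictScalars ω.toRingHom ⋙
      homFunctor z S T N).mapHomologicalComplex (ComplexShape.up ℤ)).obj J) ≅
      DerivedCategory.Q.obj (homComplex F (rightAction ω K)) :=
    DerivedCategory.Q.mapIso (asIso (toHomComplex ω N J)) ≪≫
      @asIso _ _ _ _ _ ((DerivedCategory.isIso_Q_map_iff_quasiIso _ _).2 h1) ≪≫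
      (@asIso _ _ _ _ _ ((DerivedCategory.isIso_Q_map_iff_quasiIso _ _).2 h3)).symm
  constructor
  · intro h
    obtain ⟨e'⟩ := h.nonempty_iso eJ
    exact ⟨eH.symm ≪≫ e'⟩
  · rintro ⟨e'⟩
    exact ⟨J, inferInstance, ⟨eJ⟩, ⟨eH ≪≫ e'⟩⟩

end HomFunctor

/-! ### Base change of rigid complexes -/

section RigidBaseChange

open CochainComplex CochainComplex.HomComplex

attribute [local instance 50] baseModule baseModule_isScalarTower tensorModule

variable {z c E E' : Type u} [CommRing z] [CommRing c] [Algebra z c] [Ring E] [Algebra z E]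
  [Ring E'] [Algebra c E'] {σ : E' ≃+* c ⊗[z] E} (hσ : ∀ a, σ.symm (a ⊗ₜ 1) = algebraMap c E' a)
  {δ : E' ⊗[c] E' ≃+* c ⊗[z] (E ⊗[z] E)}
  (hδ : ∀ a s t, δ.symm (a ⊗ₜ (s ⊗ₜ t)) = σ.symm (a ⊗ₜ s) ⊗ₜ[c] σ.symm (1 ⊗ₜ t))
  {ω : E ⊗[z] E →ₐ[z] E ⊗[z] E} {ω' : E' ⊗[c] E' →ₐ[c] E' ⊗[c] E'}
  (hS : ∀ a s, (leftMap ω').toRingHom (σ.symm (a ⊗ₜ s)) = δ.symm (a ⊗ₜ leftMap ω s))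
  (hB : ∀ a s, (rightMap ω').toRingHom (σ.symm (a ⊗ₜ s)) = δ.symm (a ⊗ₜ rightMap ω s))

theorem flat_single {S : Type u} [Ring S] [Algebra z S] (N : ModuleCat.{u} S) [Module.Flat z N]
    (i : ℤ) : Module.Flat z (((singleFunctor (ModuleCat.{u} S) 0).obj N).X i) := by
  by_cases hi : i = 0
  · subst hi
    exact Module.Flat.of_linearEquiv ((HomologicalComplex.singleObjXSelf (ComplexShape.up ℤ) 0
      N).toLinearEquiv.restrictScalars z)
  · have : Subsingleton (((singleFunctor (ModuleCat.{u} S) 0).obj N).X i) :=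
      ModuleCat.subsingleton_of_isZero (HomologicalComplex.isZero_single_obj_X
        (ComplexShape.up ℤ) 0 N i hi)
    infer_instance

include hσ in
theorem flat_of_base_change [Module.Flat z E] : Module.Flat c E' := by
  refine Module.Flat.of_linearEquiv (M := c ⊗[z] E) (σ.toAddEquiv.toLinearEquiv fun r x => ?_)
  change σ (r • x) = r • σ x
  rw [Algebra.smul_def, ← hσ, map_mul, σ.apply_symm_apply, Algebra.smul_def]
  rfl

include hS hB in
/-- Base change of `Hom` complexes from finitely generated free modules, for an action on a complex
of `E ⊗ E`-modules. -/
theorem nonempty_bc_homComplex_iso {F : CochainComplex (ModuleCat.{u} E) ℤ}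
    (K : CochainComplex (ModuleCat.{u} (E ⊗[z] E)) ℤ) {a b : ℤ} [F.IsStrictlyLE b]
    [K.IsStrictlyGE a] (hF : ∀ n, finiteFreeModules E (F.X n)) :
    Nonempty (DerivedCategory.Q.obj ((bcComplex σ).obj (homComplex F (rightAction ω K))) ≅
      DerivedCategory.Q.obj (homComplex ((bcComplex σ).obj F)
        (rightAction ω' ((bcComplex δ).obj K)))) := by
  have hFp : ∀ n, Projective (F.X n) := fun n => projective_of_finiteFree (hF n)
  have hFp' : ∀ n, Projective (((bcComplex σ).obj F).X n) := fun n =>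
    bc_map_projective σ (hFp n)
  have : ((bcComplex σ).obj F).IsKProjective := CochainComplex.isKProjective_of_projective _ b
  have h1 := isIso_bcHomComplex σ σ (isBaseChangeAction_conjEnd hS hB
    (commute_leftMap_rightMap ω) (commute_leftMap_rightMap ω') K)
    (isBaseLinear_commAction (commute_leftMap_rightMap ω) K) (a := a) (b := b) hF
  have h2 := quasiIso_homComplexMapRight (F := (bcComplex σ).obj F) (bcResIso hS K).hom
    (ρ := (conjEnd (bcResIso hS K)).comp (rightAction ω' ((bcComplex δ).obj K)))
    (ρ' := rightAction ω' ((bcComplex δ).obj K)) fun t => by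
      change ((bcResIso hS K).hom ≫ (rightAction ω' ((bcComplex δ).obj K) t : _ ⟶ _) ≫
        (bcResIso hS K).inv) ≫ _ = _
      rw [Category.assoc, Category.assoc, Iso.inv_hom_id, Category.comp_id]
  exact ⟨DerivedCategory.Q.mapIso (@asIso _ _ _ _ _ h1) ≪≫
    @asIso _ _ _ _ _ ((DerivedCategory.isIso_Q_map_iff_quasiIso _ _).2 h2)⟩

variable [IsRegularRing z] {D : ℕ} (hD : ringKrullDim z ≤ D) [Module.Flat z E]
  [IsNoetherianRing E] {N N' : Type u} [AddCommGroup N] [Module E N] [AddCommGroup N']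
  [Module E' N'] (ε : (bc σ).obj (ModuleCat.of E N) ≅ ModuleCat.of E' N')

include hσ hδ hS hB hD ε in
/-- The base change of an object `R` with `R ≅ RHom_E(N, R ⊗^L R)` has the same property. -/
theorem exists_rigid_bc (hω : Function.Bijective ω) (hω' : Function.Bijective ω')
    (hN : Module.Finite E N) (hN' : @Module.Flat z N _ _ (baseModule z (ModuleCat.of E N)))
    {P G : CochainComplex (ModuleCat.{u} E) ℤ} (f : P ⟶ G) [QuasiIso f] {a b : ℤ}
    [P.IsStrictlyLE b] [G.IsStrictlyLE b] [G.IsStrictlyGE a] [hP : ∀ i, Projective (P.X i)]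
    [hG : ∀ i, Module.Flat z (G.X i)] {R : DerivedCategory (ModuleCat.{u} E)}
    {R' : DerivedCategory (ModuleCat.{u} E')} (e : DerivedCategory.Q.obj P ≅ R)
    (e' : DerivedCategory.Q.obj ((bcComplex σ).obj P) ≅ R')
    (h : ∃ W, IsDerivedTensor z R R W ∧ IsRightDerived
      (ModuleCat.restrictScalars ω.toRingHom ⋙ homFunctor z E E N) W R) :
    ∃ W, IsDerivedTensor c R' R' W ∧ IsRightDerived
      (ModuleCat.restrictScalars ω'.toRingHom ⋙ homFunctor c E' E' N') W R' := by
  obtain ⟨W, hW, hR⟩ := h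
  have hE' : Module.Flat c E' := flat_of_base_change hσ
  have : P.IsKProjective := CochainComplex.isKProjective_of_projective P b
  have hPf : ∀ i, Module.Flat z (P.X i) := fun i => flat_of_projective (P.X i)
  obtain ⟨e₁⟩ := hW.nonempty_iso e e
  obtain ⟨e₂⟩ := nonempty_tensorComplex_iso (z := z) f f (b := b) (b' := b)
  have hT : (tensorComplex z E E G G).IsStrictlyGE (a + a) := isStrictlyGE_mapBifunctor
  have hTf := flat_tensorComplex (z := z) G G
  -- a resolution of `N` by finitely generated free modules
  obtain ⟨F, b', _, hF, ⟨eF⟩⟩ := hasLeftResolution_finiteFree_single (ModuleCat.of E N) hN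
  have hFp : ∀ n, Projective (F.X n) := fun n => projective_of_finiteFree (hF n)
  have : F.IsKProjective := CochainComplex.isKProjective_of_projective F b'
  have hFf : ∀ i, Module.Flat z (F.X i) := fun i => flat_of_projective (F.X i)
  obtain ⟨q, hq⟩ := exists_quasiIso_of_isKProjective (P := F)
    (L := (singleFunctor (ModuleCat.{u} E) 0).obj (ModuleCat.of E N)) eF
  -- `R` is represented by the Hom complex `H` from `F`
  obtain ⟨e₃⟩ := (isRightDerived_homFunctor_iff ω N hω q (a + a) (e₂.symm ≪≫ e₁)).1 hR
  have hHf : ∀ n, Module.Flat z ((homComplex F (rightAction ω (tensorComplex z E E G G))).X n) := by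
    have := flat_resComplex (iS := leftMap ω) (G := tensorComplex z E E G G)
    exact flat_homComplex_of_finiteFree (a := a + a) (b := b')
      (isBaseLinear_commAction (commute_leftMap_rightMap ω) _) hF
  obtain ⟨p, hp⟩ := exists_quasiIso_of_isKProjective (e ≪≫ e₃.symm)
  have hp' := bc_quasiIso σ hD p
  obtain ⟨e₄⟩ := nonempty_bc_homComplex_iso hS hB (tensorComplex z E E G G)
    (a := a + a) (b := b') hF
  have e₅ : DerivedCategory.Q.obj (homComplex ((bcComplex σ).obj F)
      (rightAction ω' ((bcComplex δ).obj (tensorComplex z E E G G)))) ≅ R' :=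
    e₄.symm ≪≫ (@asIso _ _ _ _ _ ((DerivedCategory.isIso_Q_map_iff_quasiIso _ _).2 hp')).symm ≪≫ e'
  -- the base change of the resolution of `N`
  have hNf := @flat_single z _ E _ _ (ModuleCat.of E N) hN'
  have hq₁ := bc_quasiIso σ hD q
  let e₈ : (bcComplex σ).obj ((singleFunctor (ModuleCat.{u} E) 0).obj (ModuleCat.of E N)) ≅
      (singleFunctor (ModuleCat.{u} E') 0).obj (ModuleCat.of E' N') :=
    (HomologicalComplex.singleMapHomologicalComplex (bc σ) (ComplexShape.up ℤ) 0).app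
      (ModuleCat.of E N) ≪≫ (singleFunctor (ModuleCat.{u} E') 0).mapIso ε
  let q' : (bcComplex σ).obj F ⟶ (singleFunctor (ModuleCat.{u} E') 0).obj (ModuleCat.of E' N') :=
    (bcComplex σ).map q ≫ e₈.hom
  have hq' : QuasiIso q' := by
    have : QuasiIso ((bcComplex σ).map q) := hq₁
    infer_instance
  have hFp' : ∀ n, Projective (((bcComplex σ).obj F).X n) := fun n =>
    bc_map_projective σ (hFp n)
  have : ((bcComplex σ).obj F).IsKProjective := CochainComplex.isKProjective_of_projective _ b'
  -- the base change of `R ⊗ R`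
  obtain ⟨e₆⟩ := nonempty_bc_tensorComplex_iso hσ hδ G G
  have hf' := bc_quasiIso σ hD f
  have hP' : ∀ n, Projective (((bcComplex σ).obj P).X n) := fun n =>
    bc_map_projective σ (hP n)
  have : ((bcComplex σ).obj P).IsKProjective := CochainComplex.isKProjective_of_projective _ b
  have hPf' : ∀ i, Module.Flat c (((bcComplex σ).obj P).X i) := fun i => flat_of_projective _
  have hGf' : ∀ i, Module.Flat c (((bcComplex σ).obj G).X i) := fun i => flat_bc_obj hσ (G.X i)
  obtain ⟨e₇⟩ := nonempty_tensorComplex_iso (z := c) ((bcComplex σ).map f) ((bcComplex σ).map f)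
    (b := b) (b' := b)
  exact ⟨_, ⟨(bcComplex σ).obj P, (bcComplex σ).obj P, inferInstance, inferInstance, ⟨e'⟩, ⟨e'⟩,
    ⟨Iso.refl _⟩⟩, (isRightDerived_homFunctor_iff ω' N' hω' q' (a + a)
      ((DerivedCategory.Q.mapIso e₆).symm ≪≫ e₇.symm)).2 ⟨e₅⟩⟩

end RigidBaseChange

section Rigid

attribute [local instance 50] baseModule baseModule_isScalarTower tensorModule

variable (z z' : Type u) [CommRing z] [CommRing z'] [Algebra z z'] (A : Type u) [Ring A]
  [Algebra z A]

/-- The map exchanging the outer and inner structures is an involution. -/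
theorem outerInner_bijective : Function.Bijective (outerInner z A) := by
  have h : (outerInner z A).comp (outerInner z A) = AlgHom.id z _ := by
    ext <;> simp [outerInner_tmul, Algebra.TensorProduct.one_def]
  exact Function.bijective_iff_has_inverse.2 ⟨outerInner z A, DFunLike.congr_fun h,
    DFunLike.congr_fun h⟩

theorem envEquiv_symm_tmul_one (s : z') :
    (envEquiv z z' A).symm (s ⊗ₜ 1) = algebraMap z' (Env z' (BaseChange z z' A)) s :=
  envEquiv_symm_tmul z z' A s 1 1

theorem finite_env : Module.Finite (Env z A) A :=
  Module.Finite.of_surjective (LinearMap.toSpanSingleton (Env z A) A 1) fun a =>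
    ⟨a ⊗ₜ 1, by simp [envModule_smul]⟩

theorem flat_env [Module.Flat z A] :
    @Module.Flat z A _ _ (baseModule z (ModuleCat.of (Env z A) A)) := by
  have h : (baseModule z (ModuleCat.of (Env z A) A) : Module z A) = Algebra.toModule :=
    Module.ext' _ _ fun r x => by
      change ((algebraMap z A r ⊗ₜ[z] (1 : Aᵐᵒᵖ) : Env z A) • x : A) = _
      rw [envModule_smul, MulOpposite.unop_one, mul_one, Algebra.smul_def]
  exact (congrArg (fun m : Module z A => @Module.Flat z A _ _ m) h).mpr inferInstance

theorem envEquiv_symm_tmul_smul (s t : z') (w : Env z A) (x : A) :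
    ((envEquiv z z' A).symm (s ⊗ₜ w) • (t ⊗ₜ x : BaseChange z z' A) : BaseChange z z' A) =
      (s * t) ⊗ₜ (w • x) := by
  induction w using TensorProduct.induction_on with
  | zero =>
    rw [TensorProduct.tmul_zero, map_zero]
    exact (zero_smul (Env z' (BaseChange z z' A)) (t ⊗ₜ x : BaseChange z z' A)).trans
      ((congrArg ((s * t) ⊗ₜ[z] ·) (zero_smul (Env z A) x)).trans
        (TensorProduct.tmul_zero _ _)).symm
  | add w w' h h' => rw [TensorProduct.tmul_add, map_add, add_smul, h, h', add_smul,
      TensorProduct.tmul_add]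
  | tmul a b =>
    rw [envEquiv_symm_tmul, envModule_smul, envModule_smul]
    simp

/-- The comparison map from the base change of the bimodule `A` to `A' = z' ⊗ A`. -/
noncomputable def bcSelfHom : (bc (envEquiv z z' A)).obj (ModuleCat.of (Env z A) A) ⟶
    ModuleCat.of (Env z' (BaseChange z z' A)) (BaseChange z z' A) :=
  bcLift (envEquiv z z' A) (ModuleCat.ofHom (X := A)
    (Y := (ModuleCat.restrictScalars (bcInclude (envEquiv z z' A))).obj
      (ModuleCat.of (Env z' (BaseChange z z' A)) (BaseChange z z' A)))
    { toFun := fun x : A => (1 ⊗ₜ x : BaseChange z z' A)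
      map_add' := fun x y => TensorProduct.tmul_add _ _ _
      map_smul' := fun w x => by
        refine ((envEquiv_symm_tmul_smul z z' A 1 1 w x).trans ?_).symm
        rw [one_mul] })

theorem bcSelfHom_bcMk (s : z') (x : A) : (bcSelfHom z z' A).hom (bcMk (envEquiv z z' A)
    (M := ModuleCat.of (Env z A) A) s x) = (s ⊗ₜ x : BaseChange z z' A) := by
  refine (bcLift_bcMk (envEquiv z z' A) _ s _).trans
    ((envEquiv_symm_tmul_smul z z' A s 1 1 x).trans ?_)
  rw [mul_one, one_smul]

theorem bcSelfHom_bijective : Function.Bijective (bcSelfHom z z' A).hom := by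
  let g : BaseChange z z' A →+ (bc (envEquiv z z' A)).obj (ModuleCat.of (Env z A) A) :=
    TensorProduct.liftAddHom
      { toFun := fun s =>
          { toFun := fun x => bcMk (envEquiv z z' A) (M := ModuleCat.of (Env z A) A) s x
            map_zero' := bcMk_zero (envEquiv z z' A) (M := ModuleCat.of (Env z A) A) s
            map_add' := bcMk_add (envEquiv z z' A) (M := ModuleCat.of (Env z A) A) s }
        map_zero' := AddMonoidHom.ext fun x =>
          zero_bcMk (envEquiv z z' A) (M := ModuleCat.of (Env z A) A) x
        map_add' := fun s s' => AddMonoidHom.ext fun x =>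
          add_bcMk (envEquiv z z' A) (M := ModuleCat.of (Env z A) A) s s' x }
      fun r s x => by
        change bcMk (envEquiv z z' A) (M := ModuleCat.of (Env z A) A) (r • s) x =
          bcMk (envEquiv z z' A) (M := ModuleCat.of (Env z A) A) s (r • x)
        rw [Algebra.smul_def]
        refine (algebraMap_bcMk (envEquiv z z' A) (M := ModuleCat.of (Env z A) A) r s x).trans
          (congrArg _ ?_)
        change ((algebraMap z A r ⊗ₜ[z] (1 : Aᵐᵒᵖ) : Env z A) • x : A) = _
        rw [envModule_smul, MulOpposite.unop_one, mul_one, Algebra.smul_def]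
  have hg : ∀ s x, g (s ⊗ₜ x) =
    bcMk (envEquiv z z' A) (M := ModuleCat.of (Env z A) A) s x := fun _ _ => rfl
  refine Function.bijective_iff_has_inverse.2 ⟨g, fun x => ?_, fun x => ?_⟩
  · induction x using bc_induction with
    | zero => rw [map_zero]; exact map_zero g
    | mk s x => exact congrArg g (bcSelfHom_bcMk z z' A s x)
    | add x y hx hy =>
      rw [map_add]
      exact (map_add g _ _).trans (congrArg₂ _ hx hy)
  · induction x using TensorProduct.induction_on with
    | zero => exact (congrArg _ (map_zero g)).trans (map_zero _)
    | tmul s x => exact bcSelfHom_bcMk z z' A s x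
    | add x y hx hy =>
      exact (congrArg _ (map_add g x y)).trans ((map_add _ _ _).trans (congrArg₂ _ hx hy))

section

/-- The outer structure, `a ⊗ b ↦ (a ⊗ 1) ⊗ (1 ⊗ b)`. -/
noncomputable abbrev outerMap : Env z A →ₐ[z] Env z A ⊗[z] Env z A :=
  leftMap (S := Env z A) (T := Env z A) (U := Env z A ⊗[z] Env z A) (outerInner z A)

/-- The inner structure, `a ⊗ b ↦ (1 ⊗ b) ⊗ (a ⊗ 1)`. -/
noncomputable abbrev innerMap : Env z A →ₐ[z] Env z A ⊗[z] Env z A :=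
  rightMap (S := Env z A) (T := Env z A) (U := Env z A ⊗[z] Env z A) (outerInner z A)

theorem outerMap_tmul (x : A) (y : Aᵐᵒᵖ) : outerMap z A (x ⊗ₜ y) =
    (x ⊗ₜ 1 : Env z A) ⊗ₜ[z] (1 ⊗ₜ y : Env z A) :=
  rfl

theorem innerMap_tmul (x : A) (y : Aᵐᵒᵖ) : innerMap z A (x ⊗ₜ y) =
    (1 ⊗ₜ y : Env z A) ⊗ₜ[z] (x ⊗ₜ 1 : Env z A) :=
  rfl

variable (t : z') (g : Env z A ⊗[z] Env z A →+
    Env z' (BaseChange z z' A) ⊗[z'] Env z' (BaseChange z z' A))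
  (hg : ∀ u v, g (u ⊗ₜ v) =
    (envEquiv z z' A).symm (t ⊗ₜ u) ⊗ₜ[z'] (envEquiv z z' A).symm (1 ⊗ₜ v))

include hg in
/-- The outer structure commutes with base change. -/
theorem outerMap_envEquiv_symm (w : Env z A) :
    outerMap z' (BaseChange z z' A) ((envEquiv z z' A).symm (t ⊗ₜ w)) = g (outerMap z A w) := by
  induction w using TensorProduct.induction_on with
  | zero => simp only [map_zero, TensorProduct.tmul_zero]
  | add w w' h h' => rw [TensorProduct.tmul_add, map_add, map_add, h, h', map_add, map_add]
  | tmul x y =>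
    rw [outerMap_tmul, hg, envEquiv_symm_tmul, envEquiv_symm_tmul, envEquiv_symm_tmul,
      outerMap_tmul]
    rfl

include hg in
/-- The inner structure commutes with base change. -/
theorem innerMap_envEquiv_symm (w : Env z A) :
    innerMap z' (BaseChange z z' A) ((envEquiv z z' A).symm (t ⊗ₜ w)) = g (innerMap z A w) := by
  induction w using TensorProduct.induction_on with
  | zero => simp only [map_zero, TensorProduct.tmul_zero]
  | add w w' h h' => rw [TensorProduct.tmul_add, map_add, map_add, h, h', map_add, map_add]
  | tmul x y =>
    have h2 : ∀ x : A, (t ⊗ₜ x : BaseChange z z' A) = t • (1 ⊗ₜ x) :=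
      fun x => by rw [TensorProduct.smul_tmul', smul_eq_mul, mul_one]
    have h3 : ∀ (p q : BaseChange z z' A) (r s : (BaseChange z z' A)ᵐᵒᵖ),
        (p ⊗ₜ[z'] r : Env z' (BaseChange z z' A)) ⊗ₜ[z']
          ((t • q) ⊗ₜ[z'] s : Env z' (BaseChange z z' A)) =
        ((t • p) ⊗ₜ[z'] r : Env z' (BaseChange z z' A)) ⊗ₜ[z']
          (q ⊗ₜ[z'] s : Env z' (BaseChange z z' A)) := fun p q r s => by
      rw [← TensorProduct.smul_tmul', ← TensorProduct.smul_tmul', TensorProduct.smul_tmul]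
    rw [innerMap_tmul, hg, envEquiv_symm_tmul, envEquiv_symm_tmul, envEquiv_symm_tmul,
      innerMap_tmul, h2 x, h2 1]
    exact h3 _ _ _ _

end

variable {z z' A}

variable [IsRegularRing z] {D : ℕ} (hD : ringKrullDim z ≤ D) [Module.Flat z A]
  [IsNoetherianRing (Env z A)]

include hD in
/-- The base change of a rigid complex is rigid. -/
theorem IsRigid.bc {P G : CochainComplex (ModuleCat.{u} (Env z A)) ℤ} (f : P ⟶ G) [QuasiIso f]
    (a b : ℤ) [P.IsStrictlyLE b] [G.IsStrictlyLE b] [G.IsStrictlyGE a]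
    [hP : ∀ i, Projective (P.X i)] [hG : ∀ i, Module.Flat z (G.X i)]
    {R : DerivedCategory (ModuleCat.{u} (Env z A))}
    {R' : DerivedCategory (ModuleCat.{u} (Env z' (BaseChange z z' A)))}
    (e : DerivedCategory.Q.obj P ≅ R)
    (e' : DerivedCategory.Q.obj ((bcComplex (envEquiv z z' A)).obj P) ≅ R')
    (h : IsRigid z A R) : IsRigid z' (BaseChange z z' A) R' := by
  obtain ⟨δ, hδ⟩ := exists_tensor_equiv (envEquiv_symm_tmul_one z z' A)
  let g : ∀ t : z', Env z A ⊗[z] Env z A →+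
      Env z' (BaseChange z z' A) ⊗[z'] Env z' (BaseChange z z' A) := fun t =>
    { toFun := fun v => δ.symm (t ⊗ₜ v)
      map_zero' := by rw [TensorProduct.tmul_zero, map_zero]
      map_add' := fun v v' => by rw [TensorProduct.tmul_add, map_add] }
  have hS := fun t => outerMap_envEquiv_symm z z' A t (g t) (hδ t)
  have hB := fun t => innerMap_envEquiv_symm z z' A t (g t) (hδ t)
  exact exists_rigid_bc (envEquiv_symm_tmul_one z z' A) hδ hS hB hD
    (@asIso _ _ _ _ (bcSelfHom z z' A)
      ((ConcreteCategory.isIso_iff_bijective _).2 (bcSelfHom_bijective z z' A)))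
    (outerInner_bijective z A) (outerInner_bijective z' (BaseChange z z' A)) (finite_env z A)
    (flat_env z A) f (a := a) (b := b) e e' h

end Rigid

end DualizingComplex

theorem mainTheorem10 {k : Type*} [Field k]
    {z : Type u} [CommRing z] [Algebra k z] [Algebra.FiniteType k z] [IsRegularRing z]
    {z' : Type u} [CommRing z'] [Algebra k z'] [Algebra.FiniteType k z'] [IsRegularRing z']
    [Algebra z z'] [IsScalarTower k z z']
    {A : Type u} [Ring A] [IsNoetherianRing A] [IsNoetherianRing Aᵐᵒᵖ]
    [Algebra z A] [Module.Flat z A]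
    (R : DerivedCategory (ModuleCat.{u} (DualizingComplex.Env z A)))
    (hR : DualizingComplex.IsDualizing z A R) :
    (∃ R' : DerivedCategory (ModuleCat.{u}
        (DualizingComplex.Env z' (DualizingComplex.BaseChange z z' A))),
      DualizingComplex.IsDerivedBaseChange z z' A R R') ∧
    ∀ R' : DerivedCategory (ModuleCat.{u}
        (DualizingComplex.Env z' (DualizingComplex.BaseChange z z' A))),
      DualizingComplex.IsDerivedBaseChange z z' A R R' →
        DualizingComplex.IsDualizing z' (DualizingComplex.BaseChange z z' A) R' ∧
        (IsNoetherianRing (DualizingComplex.Env z A) → DualizingComplex.IsRigid z A R →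
          DualizingComplex.IsRigid z' (DualizingComplex.BaseChange z z' A) R') := by
  obtain ⟨D, hD⟩ := DualizingComplex.exists_ringKrullDim_le k z
  have : Algebra.FiniteType z z' := Algebra.FiniteType.of_restrictScalars_finiteType k z z'
  obtain ⟨a, b, _, _⟩ := hR.bounded
  -- `P` is K-projective and defines the derived base change; `G` is bounded with flat terms
  obtain ⟨a', b', P, G, f, hf, _, hP, ⟨e⟩, _, _, hG⟩ :=
    DualizingComplex.exists_flat_model hD R (a := a) (b := b)
  have : P.IsKProjective := CochainComplex.isKProjective_of_projective P b'
  have hPf : ∀ i, @Module.Flat z (P.X i) _ _ (DualizingComplex.baseModule z (P.X i)) :=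
    fun i => DualizingComplex.flat_of_projective (P.X i)
  refine ⟨⟨_, P, inferInstance, ⟨e⟩, ⟨Iso.refl _⟩⟩, fun R' hR' => ?_⟩
  obtain ⟨e'⟩ := hR'.nonempty_iso e
  -- both `P` and `G` remain representatives after base change
  have hf' := DualizingComplex.bc_quasiIso (DualizingComplex.envEquiv z z' A) hD f
  refine ⟨DualizingComplex.IsDualizing.bc hD (a := a') (b := b')
    ((@asIso _ _ _ _ _ ((DerivedCategory.isIso_Q_map_iff_quasiIso _ f).2 hf)).symm ≪≫ e)
    ((@asIso _ _ _ _ _ ((DerivedCategory.isIso_Q_map_iff_quasiIso _ _).2 hf')).symm ≪≫ e') hR,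
    fun _ h => DualizingComplex.IsRigid.bc hD f a' b' e e' h⟩
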